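/- **Symmetry algebras.** All Hopf algebras are over $\mathbb C$; $X'$ denotes the flip of $X\in G\otimes G$, $\Delta'=(\Delta(\cdot))'$. A *ribbon Hopf-$*$-algebra* $G$ is a Hopf algebra with a $*$-operation such that $\epsilon(\xi^*)=\overline{\epsilon(\xi)}$, $S(\xi^*)=S(\xi)^*$, $\Delta(\xi^*)=\Delta(\xi)^*$ where $(\xi\otimes\eta)^*:=\eta^*\otimes\xi^*$, together with an invertible $R=\sum r^1\otimes r^2$ with $R\Delta(\xi)=\Delta'(\xi)R$, $(\Delta\otimes\mathrm{id})R=R_{13}R_{23}$, $(\mathrm{id}\otimes\Delta)R=R_{13}R_{12}$, $R^*=R^{-1}$, and a central invertible $v$ with $v^2=uS(u)$ for $u=\sum S(r^2)r^1$, $S(v)=v$, $\epsilon(v)=1$, $v^*=v^{-1}$, $\Delta(v)=(R'R)^{-1}(v\otimes v)$. Let $G_*$ be a semisimple ribbon Hopf-$*$-algebra each of whose irreducible representations is equivalent to a unitary one; let $\tau^I$ on $V^I=\mathbb C^{\dim I}$ be unitary representatives of the finitely many classes, $\tau^0=\epsilon$, and let $C^a[IJ|K]:V^I\otimes V^J\to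 V^K$ be bases of the intertwiners from $(\tau^I\otimes\tau^J)\circ\Delta$ to $\tau^K$. Put $v^I=\tau^I(v)$ and $d_I=\mathrm{Tr}\,\tau^I(S(u)v^{-1})$. Assume there are square roots $\kappa_I$ of $v^I$ such that $$C^a[IJ|K]\,(\tau^I\otimes\tau^J)(R')\,C^b[IJ|L]^*=\delta_{ab}\delta_{KL}\,\frac{\kappa_I\kappa_J}{\kappa_K}\,\mathrm{id}\qquad\text{(pos)}$$ and such that $\kappa_{\bar I}=\kappa_I$ for conjugate labels, i.e. the central element $\kappa_*\in G_*$ with $\tau^I(\kappa_*)=\kappa_I$ satisfies $S(\kappa_*)=\kappa_*$. **Lattice.** Let $\Gamma$ be a finite simple graph (e.g. that of a triangulation of an oriented surface) with, at every vertex $x$, a linear order $<$ on the oriented links pointing to $x$ (the ciliation). At every vertex let $\mathcal G_x$ be a ribbon Hopf-$*$-algebra twist equivalent to $G_*$: there is a $*$-isomorphism $\iota_x:\mathcal G_x\to G_*$ compatible with $\epsilon,S,v$, and a unitary ($F_x^*=F_x^{-1}$), counital 2-cocycle $F_x\in G_*\otimes G_*$, i.e. $(\Delta\otimes\mathrm{id})(F_x)(F_x\otimes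 1)=(\mathrm{id}\otimes\Delta)(F_x)(1\otimes F_x)$, with $(\iota_x\otimes\iota_x)\Delta_x(\xi)=F_x^{-1}\Delta(\iota_x\xi)F_x$ and $(\iota_x\otimes\iota_x)R_x=F_x'^{-1}RF_x$. Put $\mathcal G=\bigotimes_x\mathcal G_x$, $\tau^I_x=\tau^I\circ\iota_x$, $\bar\tau^I_x={}^t(\tau^I_x\circ S_x)$, $C^a_x[IJ|K]=C^a[IJ|K](\tau^I\otimes\tau^J)(F_x)$. For an oriented link $i$ from $x$ to $y$ ($-i$ is the reversed link) let $\tau^{I,i}$ be the representation of $\mathcal G$ that is $\bar\tau^I_x$ on $\mathcal G_x$, $\tau^I_y$ on $\mathcal G_y$ and trivial on the other factors, and $C^a[IJ|K]^i=C^a_y[IJ|K]\otimes{}^t(C^a_x[IJ|K]^*)$. Multi-indices are $\alpha=(\text{source index},\text{target index})$. *Lattice algebra* $\mathcal B$: the unital algebra generated by $\mathcal G$ (with its own relations) and elements $U^I_\alpha(i)$, with relations 1. $\xi\,U^I_\alpha(i)=\sum_\beta U^I_\beta(i)\,(\tau^{I,i}_{\beta\alpha}\otimes\mathrm{id})(\Delta(\xi))$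 for $\xi\in\mathcal G$; 2. $U^I_\alpha(i)U^J_\beta(i)=\sum_{K,a,\gamma}U^K_\gamma(i)\,C^a[IJ|K]^i_{\gamma,\alpha\beta}$ and $\sum_bU^I_{ab}(i)U^I_{bc}(-i)=\delta_{ac}$; 3. $U^I_\alpha(i)U^J_\beta(j)=\sum_{\gamma,\delta}U^J_\gamma(j)U^I_\delta(i)\,(\tau^{I,i}_{\delta\alpha}\otimes\tau^{J,j}_{\gamma\beta})(R)$ if $i,j$ have the same target and $i<j$, or if $i,j$ have no common endpoint. $\mathcal F$ is the unital algebra with unit $\Omega$ generated by $u^I_\alpha(i)$ subject to relations 2 and 3. $\mathcal A\subset\mathcal B$ consists of the elements of the subalgebra generated by all $U^I_\alpha(i)$ that commute with every $\xi\in\mathcal G$. **Theorem (scalar product).** (a) The following exist and are unique: the unital antilinear anti-homomorphism $\theta$ of $\mathcal B$ with $\theta(\xi)=\xi^*$ for $\xi\in\mathcal G_x$ and $\theta(U^I_\alpha(i))=\sum U^I_\gamma(-i)\,(\tau^{I,-i}_{\gamma\beta}\otimes\mathrm{id})(R^{-1})\,\eta^{I,i}_{\beta\alpha}$, where $\eta^{I,i}=e_x\otimes{}^t\tau^I_y(S_y(u_y))$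 and $\tau^{I,-i}$ acts on the index space $V^I_x\otimes V^I_y$; the linear functional $\omega:\mathcal B\to\mathbb C$ (multidimensional Haar functional) with $$\omega\bigl(U^{I_1}_{\alpha_1}(i_1)\cdots U^{I_n}_{\alpha_n}(i_n)\,\xi\bigr)=\epsilon(\xi)\,\delta_{I_1,0}\cdots\delta_{I_n,0}$$ whenever $n\ge0$, $\xi\in\mathcal G$ and every link occurs at most once and in only one orientation among $i_1,\dots,i_n$; and the representation $\pi$ of $\mathcal B$ on $\mathcal F$ with $\pi(U^I_\alpha(i))\psi=u^I_\alpha(i)\psi$, $\pi(\xi)(\psi_1\psi_2)=\sum\pi(\xi^1)\psi_1\,\pi(\xi^2)\psi_2$, $\pi(\xi)u^I_\alpha(i)=\sum_\beta u^I_\beta(i)\tau^{I,i}_{\beta\alpha}(\xi)$, $\pi(\xi)\Omega=\epsilon(\xi)\Omega$. (b) Let $B^*:=\kappa^{-1}\theta(B)\kappa$ with $\kappa=\bigotimes_x\iota_x^{-1}(\kappa_*)$. Then $\langle\psi_1|\psi_2\rangle:=\omega(\Psi_1^*\Psi_2)$ for $\psi_\nu=\pi(\Psi_\nu)\Omega$,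 $\Psi_\nu\in\mathcal B$, is a well-defined form on $\mathcal F$, and it is a scalar product (sesquilinear, hermitian and positive definite) if and only if $d_I>0$ for all $I$. (c) If $d_I>0$ for all $I$, then $\omega(A^*A)\ge0$ for all $A\in\mathcal A$. -/

import Mathlib

open scoped TensorProduct ComplexOrder Matrix

universe u

noncomputable section

namespace LatticeGauge

/-! ### Ribbon Hopf-*-algebras -/

section Hopf

variable (G : Type*) [Ring G] [HopfAlgebra ℂ G]

/-- The flip `ξ ⊗ η ↦ η ⊗ ξ` (written `R ↦ R'`, `Δ ↦ Δ'`). -/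
def flip : G ⊗[ℂ] G →ₗ[ℂ] G ⊗[ℂ] G := (TensorProduct.comm ℂ G G).toLinearMap

/-- The conjugation `(ξ ⊗ η)^* = η^* ⊗ ξ^*` on `G ⊗ G`. -/
def conj₂ [StarRing G] [StarModule ℂ G] (z : G ⊗[ℂ] G) : G ⊗[ℂ] G := flip G (star z)

/-- `X ↦ X₁₂`, `X ⊗ 1` in `G ⊗ (G ⊗ G)`. -/
def leg12 (X : G ⊗[ℂ] G) : G ⊗[ℂ] (G ⊗[ℂ] G) := TensorProduct.assoc ℂ G G G (X ⊗ₜ[ℂ] (1 : G))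

/-- `X ↦ X₂₃ = 1 ⊗ X`. -/
def leg23 (X : G ⊗[ℂ] G) : G ⊗[ℂ] (G ⊗[ℂ] G) := (1 : G) ⊗ₜ[ℂ] X

/-- `X ↦ X₁₃`: `ξ ⊗ η ↦ ξ ⊗ (1 ⊗ η)`. -/
def leg13 : G ⊗[ℂ] G →ₗ[ℂ] G ⊗[ℂ] (G ⊗[ℂ] G) :=
  LinearMap.lTensor G (TensorProduct.mk ℂ G G 1)

/-- `(Δ ⊗ id)`, with values in `G ⊗ (G ⊗ G)`. -/
def comulLeft : G ⊗[ℂ] G →ₗ[ℂ] G ⊗[ℂ] (G ⊗[ℂ] G) :=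
  (TensorProduct.assoc ℂ G G G).toLinearMap ∘ₗ LinearMap.rTensor G Coalgebra.comul

/-- `(id ⊗ Δ)`. -/
def comulRight : G ⊗[ℂ] G →ₗ[ℂ] G ⊗[ℂ] (G ⊗[ℂ] G) :=
  LinearMap.lTensor G Coalgebra.comul

variable {G}

/-- `(f ⊗ id) : G ⊗ G → G` for a linear functional `f` on `G`. -/
def slice (f : G →ₗ[ℂ] ℂ) : G ⊗[ℂ] G →ₗ[ℂ] G :=
  (TensorProduct.lid ℂ G).toLinearMap ∘ₗ LinearMap.rTensor G f

/-- `(f ⊗ g) : G ⊗ G → ℂ` for linear functionals `f, g` on `G`. -/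
def pair (f g : G →ₗ[ℂ] ℂ) : G ⊗[ℂ] G →ₗ[ℂ] ℂ :=
  LinearMap.mul' ℂ ℂ ∘ₗ TensorProduct.map f g

/-- The element `∑ S(r²) r¹` built from `R = ∑ r¹ ⊗ r²`. -/
def drinfeld (R : G ⊗[ℂ] G) : G :=
  LinearMap.mul' ℂ G
    (TensorProduct.map (HopfAlgebra.antipode ℂ (A := G)) LinearMap.id (flip G R))

end Hopf

/-- A ribbon Hopf-*-algebra: a Hopf algebra over `ℂ` with a `*`-operation for which the coproduct
is a `*`-homomorphism with respect to `(ξ ⊗ η)^* = η^* ⊗ ξ^*`, a unitary `R`-matrix and a ribbon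
element. -/
class RibbonHopfStarAlgebra (G : Type*) [Ring G] [HopfAlgebra ℂ G] [StarRing G]
    [StarModule ℂ G] where
  counit_star : ∀ ξ : G, Coalgebra.counit (R := ℂ) (star ξ) = star (Coalgebra.counit (R := ℂ) ξ)
  comul_star : ∀ ξ : G,
    Coalgebra.comul (R := ℂ) (star ξ) = conj₂ G (Coalgebra.comul (R := ℂ) ξ)
  antipode_star : ∀ ξ : G,
    HopfAlgebra.antipode ℂ (star ξ) = star (HopfAlgebra.antipode ℂ ξ)
  /-- The `R`-matrix. -/
  R : (G ⊗[ℂ] G)ˣ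
  R_comul : ∀ ξ : G,
    (R : G ⊗[ℂ] G) * Coalgebra.comul (R := ℂ) ξ = flip G (Coalgebra.comul (R := ℂ) ξ) * R
  comulLeft_R : comulLeft G R = leg13 G R * leg23 G R
  comulRight_R : comulRight G R = leg13 G R * leg12 G R
  R_star : conj₂ G (R : G ⊗[ℂ] G) = ((R⁻¹ : (G ⊗[ℂ] G)ˣ) : G ⊗[ℂ] G)
  /-- The ribbon element. -/
  v : Gˣ
  v_central : ∀ ξ : G, (v : G) * ξ = ξ * v
  v_sq : (v : G) ^ 2 = drinfeld (R : G ⊗[ℂ] G) * HopfAlgebra.antipode ℂ (drinfeld (R : G ⊗[ℂ] G))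
  antipode_v : HopfAlgebra.antipode ℂ (v : G) = v
  counit_v : Coalgebra.counit (R := ℂ) (v : G) = 1
  v_star : star (v : G) = ((v⁻¹ : Gˣ) : G)
  comul_v : flip G (R : G ⊗[ℂ] G) * R * Coalgebra.comul (R := ℂ) (v : G)
    = (v : G) ⊗ₜ[ℂ] (v : G)

section Elements

variable (G : Type*) [Ring G] [HopfAlgebra ℂ G] [StarRing G] [StarModule ℂ G]
  [RibbonHopfStarAlgebra G]

/-- The `R`-matrix `R ∈ G ⊗ G`. -/
def Rm : G ⊗[ℂ] G := ((RibbonHopfStarAlgebra.R : (G ⊗[ℂ] G)ˣ) : G ⊗[ℂ] G)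

/-- `R⁻¹`. -/
def RmInv : G ⊗[ℂ] G := (((RibbonHopfStarAlgebra.R : (G ⊗[ℂ] G)ˣ)⁻¹ : (G ⊗[ℂ] G)ˣ) : G ⊗[ℂ] G)

/-- `u = ∑ S(r²) r¹`. -/
def uElt : G := drinfeld (Rm G)

/-- The ribbon element `v`. -/
def rib : G := ((RibbonHopfStarAlgebra.v : Gˣ) : G)

/-- `v⁻¹`. -/
def ribInv : G := (((RibbonHopfStarAlgebra.v : Gˣ)⁻¹ : Gˣ) : G)

end Elements

/-- Twist equivalence of `G` with `H`: a `*`-isomorphism `ι : G → H` preserving counit, antipode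
and ribbon element and intertwining coproducts and `R`-matrices up to a unitary twist
`F ∈ H ⊗ H`, i.e. `Δ_G = F⁻¹ Δ_H F` and `R_G = F'⁻¹ R_H F`.  As usual for twists between
coassociative coproducts, `F` is a normalized 2-cocycle. -/
structure TwistEquiv (G H : Type*)
    [Ring G] [HopfAlgebra ℂ G] [StarRing G] [StarModule ℂ G] [RibbonHopfStarAlgebra G]
    [Ring H] [HopfAlgebra ℂ H] [StarRing H] [StarModule ℂ H] [RibbonHopfStarAlgebra H] where
  /-- The `*`-isomorphism. -/
  iso : G ≃⋆ₐ[ℂ] H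
  /-- The twist element. -/
  F : (H ⊗[ℂ] H)ˣ
  counit_iso : ∀ ξ : G, Coalgebra.counit (R := ℂ) (iso ξ) = Coalgebra.counit (R := ℂ) ξ
  antipode_iso : ∀ ξ : G, iso (HopfAlgebra.antipode ℂ ξ) = HopfAlgebra.antipode ℂ (iso ξ)
  comul_iso : ∀ ξ : G,
    (F : H ⊗[ℂ] H) * TensorProduct.map iso.toAlgEquiv.toLinearMap iso.toAlgEquiv.toLinearMap
        (Coalgebra.comul (R := ℂ) ξ)
      = Coalgebra.comul (R := ℂ) (iso ξ) * F
  R_iso : flip H (F : H ⊗[ℂ] H)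
        * TensorProduct.map iso.toAlgEquiv.toLinearMap iso.toAlgEquiv.toLinearMap (Rm G)
      = Rm H * F
  rib_iso : iso (rib G) = rib H
  F_star : conj₂ H (F : H ⊗[ℂ] H) = ((F⁻¹ : (H ⊗[ℂ] H)ˣ) : H ⊗[ℂ] H)
  F_counit_left : TensorProduct.lid ℂ H (LinearMap.rTensor H Coalgebra.counit (F : H ⊗[ℂ] H)) = 1
  F_counit_right : TensorProduct.rid ℂ H (LinearMap.lTensor H Coalgebra.counit (F : H ⊗[ℂ] H)) = 1
  F_cocycle : comulLeft H F * leg12 H F = comulRight H F * leg23 H F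

/-! ### Representations of the symmetry algebra -/

/-- A complete system of representatives `τ^J` of the irreducible representations, one in each
equivalence class, realized as unitary matrix representations on `V^J = ℂ^{dim J}` (with the
standard scalar product).  The label `triv` (written `0`) is the class of the counit. -/
structure IrrepSystem (G : Type u) [Ring G] [HopfAlgebra ℂ G] [StarRing G] [StarModule ℂ G]
    (Lab : Type*) where
  dim : Lab → ℕ
  τ : ∀ J, G →⋆ₐ[ℂ] Matrix (Fin (dim J)) (Fin (dim J)) ℂ
  dim_pos : ∀ J, 0 < dim J
  irreducible : ∀ (J) (W : Submodule ℂ (Fin (dim J) → ℂ)),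
    (∀ (ξ : G), ∀ w ∈ W, τ J ξ *ᵥ w ∈ W) → W = ⊥ ∨ W = ⊤
  /-- Every simple module is equivalent to exactly one `τ^J`. -/
  complete : ∀ (M : Type u) [AddCommGroup M] [Module G M] [IsSimpleModule G M],
    ∃! J, ∃ e : M ≃+ (Fin (dim J) → ℂ), ∀ (ξ : G) (m : M), e (ξ • m) = τ J ξ *ᵥ e m
  triv : Lab
  dim_triv : dim triv = 1
  τ_triv : ∀ ξ : G, τ triv ξ = (Coalgebra.counit (R := ℂ) ξ) • 1

namespace IrrepSystem

variable {G : Type u} [Ring G] [HopfAlgebra ℂ G] [StarRing G] [StarModule ℂ G] {Lab : Type*}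

/-- The matrix element `ξ ↦ τ^J_{ab}(ξ)`. -/
def entry (V : IrrepSystem G Lab) (J : Lab) (a b : Fin (V.dim J)) : G →ₗ[ℂ] ℂ where
  toFun ξ := V.τ J ξ a b
  map_add' ξ η := by simp
  map_smul' c ξ := by simp

/-- `(τ^I ⊗ τ^J)(z)` for `z ∈ G ⊗ G`, as a matrix on `V^I ⊗ V^J`. -/
def tens (V : IrrepSystem G Lab) (I J : Lab) (z : G ⊗[ℂ] G) :
    Matrix (Fin (V.dim I) × Fin (V.dim J)) (Fin (V.dim I) × Fin (V.dim J)) ℂ :=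
  Matrix.of fun p q => pair (V.entry I p.1 q.1) (V.entry J p.2 q.2) z

/-- The quantum dimension `d_J = Tr τ^J(S(u) v⁻¹)`. -/
def qdim [RibbonHopfStarAlgebra G] (V : IrrepSystem G Lab) (J : Lab) : ℂ :=
  (V.τ J (HopfAlgebra.antipode ℂ (uElt G) * ribInv G)).trace

end IrrepSystem

/-- Clebsch-Gordan maps `C^a[IJ|K] : V^I ⊗ V^J → V^K`, `a = 1, …, N^{IJ}_K`: for all `I, J, K` a
basis of the space of intertwiners from `τ^I ⊠ τ^J = (τ^I ⊗ τ^J) ∘ Δ` to `τ^K`. -/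
structure ClebschGordan {G : Type u} [Ring G] [HopfAlgebra ℂ G] [StarRing G] [StarModule ℂ G]
    {Lab : Type*} (V : IrrepSystem G Lab) where
  N : Lab → Lab → Lab → ℕ
  C : ∀ I J K, Fin (N I J K) → Matrix (Fin (V.dim K)) (Fin (V.dim I) × Fin (V.dim J)) ℂ
  intertwine : ∀ I J K a (ξ : G),
    C I J K a * V.tens I J (Coalgebra.comul (R := ℂ) ξ) = V.τ K ξ * C I J K a
  linearIndependent : ∀ I J K, LinearIndependent ℂ (C I J K)
  span : ∀ I J K (T : Matrix (Fin (V.dim K)) (Fin (V.dim I) × Fin (V.dim J)) ℂ),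
    (∀ ξ : G, T * V.tens I J (Coalgebra.comul (R := ℂ) ξ) = V.τ K ξ * T) →
      T ∈ Submodule.span ℂ (Set.range (C I J K))

/-- The normalization
`C^a[IJ|K] (τ^I ⊗ τ^J)(R') C^b[IJ|L]^* = δ_{ab} δ_{KL} κ_I κ_J / κ_K`. -/
def ClebschGordan.IsNormalized {G : Type u} [Ring G] [HopfAlgebra ℂ G] [StarRing G]
    [StarModule ℂ G] [RibbonHopfStarAlgebra G] {Lab : Type*} {V : IrrepSystem G Lab}
    (c : ClebschGordan V) (κ : Lab → ℂ) : Prop :=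
  (∀ I J K a b, c.C I J K a * V.tens I J (flip G (Rm G)) * (c.C I J K b)ᴴ
      = (if a = b then κ I * κ J / κ K else 0) • (1 : Matrix _ _ ℂ)) ∧
  (∀ I J K L a b, K ≠ L →
    c.C I J K a * V.tens I J (flip G (Rm G)) * (c.C I J L b)ᴴ = 0)

/-! ### The lattice -/

/-- The data of a lattice gauge theory on a ciliated graph `Γ`: a symmetry algebra `𝒢 x` at every
vertex, all twist equivalent to `Gs`, representatives of the irreducible representations of `Gs`
and Clebsch-Gordan maps, and a linear order (given by the cilium) on the set `L_x` of oriented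
links `i` with target `t(i) = x`.  Oriented links are darts `i` of `Γ`, from `i.fst = t(-i)` to
`i.snd = t(i)`, with `-i = i.symm`. -/
structure GaugeData {X : Type*} (Γ : SimpleGraph X) (Gs : Type u)
    [Ring Gs] [HopfAlgebra ℂ Gs] [StarRing Gs] [StarModule ℂ Gs] [RibbonHopfStarAlgebra Gs]
    (𝒢 : X → Type*)
    [∀ x, Ring (𝒢 x)] [∀ x, HopfAlgebra ℂ (𝒢 x)] [∀ x, StarRing (𝒢 x)]
    [∀ x, StarModule ℂ (𝒢 x)] [∀ x, RibbonHopfStarAlgebra (𝒢 x)]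
    (Lab : Type*) where
  V : IrrepSystem Gs Lab
  cg : ClebschGordan V
  twist : ∀ x, TwistEquiv (𝒢 x) Gs
  order : ∀ x, LinearOrder {i : Γ.Dart // i.snd = x}

namespace GaugeData

section

variable {X : Type*} {Γ : SimpleGraph X} {Gs : Type u}
    [Ring Gs] [HopfAlgebra ℂ Gs] [StarRing Gs] [StarModule ℂ Gs] [RibbonHopfStarAlgebra Gs]
    {𝒢 : X → Type*}
    [∀ x, Ring (𝒢 x)] [∀ x, HopfAlgebra ℂ (𝒢 x)] [∀ x, StarRing (𝒢 x)]
    [∀ x, StarModule ℂ (𝒢 x)] [∀ x, RibbonHopfStarAlgebra (𝒢 x)]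
    {Lab : Type*} (D : GaugeData Γ Gs 𝒢 Lab)

/-- The index set of a basis of `V^I`. -/
abbrev Idx (I : Lab) : Type := Fin (D.V.dim I)

/-- Matrix elements of `τ^I_x = τ^I ∘ ι_x`. -/
def rep (x : X) (I : Lab) (a b : D.Idx I) : 𝒢 x →ₗ[ℂ] ℂ :=
  D.V.entry I a b ∘ₗ (D.twist x).iso.toAlgEquiv.toLinearMap

/-- Matrix elements of the contragradient representation `ξ ↦ ᵗτ^I_x(S_x(ξ))`. -/
def repBar (x : X) (I : Lab) (a b : D.Idx I) : 𝒢 x →ₗ[ℂ] ℂ :=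
  D.rep x I b a ∘ₗ HopfAlgebra.antipode ℂ (A := 𝒢 x)

/-- `C^m_x[IJ|K] = C^m[IJ|K] (τ^I ⊗ τ^J)(F_x)`, an intertwiner from
`(τ^I_x ⊗ τ^J_x) ∘ Δ_x` to `τ^K_x`. -/
def siteCG (x : X) (I J K : Lab) (m : Fin (D.cg.N I J K)) :
    Matrix (D.Idx K) (D.Idx I × D.Idx J) ℂ :=
  D.cg.C I J K m * D.V.tens I J ((D.twist x).F : Gs ⊗[ℂ] Gs)

/-- Matrix elements of `C^m[IJ|K]^i = C^m_y[IJ|K] ⊗ ᵗ(C^m_x[IJ|K]^*)` for a link `i` from `x` to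
`y`.  Indices of `V^I_x ⊗ V^I_y` are pairs (source index, target index). -/
def linkCG (i : Γ.Dart) (I J K : Lab) (m : Fin (D.cg.N I J K))
    (γ : D.Idx K × D.Idx K) (α : D.Idx I × D.Idx I) (β : D.Idx J × D.Idx J) : ℂ :=
  D.siteCG i.snd I J K m γ.2 (α.2, β.2) * ((D.siteCG i.fst I J K m)ᴴ)ᵀ γ.1 (α.1, β.1)

/-- `η^I_x = τ^I_x(S_x(u_x))`. -/
def eta (x : X) (I : Lab) : Matrix (D.Idx I) (D.Idx I) ℂ :=
  Matrix.of fun a b => D.rep x I a b (HopfAlgebra.antipode ℂ (uElt (𝒢 x)))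

/-- The relations among the matrix elements `U^I_{ab}(i)` of a quantum lattice connection, where
`a` is the index at the source of `i` and `b` the index at the target: functoriality on the links
and braid relations. -/
inductive LinkRel [Fintype Lab] {A : Type*} [Ring A] [Algebra ℂ A]
    (U : ∀ (I : Lab), Γ.Dart → D.Idx I → D.Idx I → A) : A → A → Prop
  /-- `U^I_α(i) U^J_β(i) = ∑ U^K_γ(i) C^m[IJ|K]^i_{γ,αβ}`. -/
  | ope (I J : Lab) (i : Γ.Dart) (a b : D.Idx I) (c d : D.Idx J) :
      LinkRel U (U I i a b * U J i c d)
        (∑ K, ∑ m : Fin (D.cg.N I J K), ∑ e : D.Idx K, ∑ f : D.Idx K,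
          D.linkCG i I J K m (e, f) (a, b) (c, d) • U K i e f)
  /-- `U^I(i) U^I(-i) = 1` as matrices (for both orientations of every link). -/
  | inv (I : Lab) (i : Γ.Dart) (a c : D.Idx I) :
      LinkRel U (∑ b, U I i a b * U I i.symm b c) (if a = c then 1 else 0)
  /-- `U^I_α(i) U^J_β(j) = U^J_γ(j) U^I_δ(i) (τ^{I,i}_{δα} ⊗ τ^{J,j}_{γβ})(R)` for `i < j` with
  the same target; only `R_x` at this target contributes. -/
  | braid (I J : Lab) (i j : Γ.Dart) (h : i.snd = j.snd)
      (hlt : (D.order j.snd).lt ⟨i, h⟩ ⟨j, rfl⟩)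
      (a b : D.Idx I) (c d : D.Idx J) :
      LinkRel U (U I i a b * U J j c d)
        (∑ b' : D.Idx I, ∑ d' : D.Idx J,
          pair (D.rep j.snd I b' b) (D.rep j.snd J d' d) (Rm (𝒢 j.snd)) •
            (U J j c d' * U I i a b'))
  /-- Matrix elements on links without common endpoints commute. -/
  | comm (I J : Lab) (i j : Γ.Dart) (h₁ : i.fst ≠ j.fst) (h₂ : i.fst ≠ j.snd)
      (h₃ : i.snd ≠ j.fst) (h₄ : i.snd ≠ j.snd)
      (a b : D.Idx I) (c d : D.Idx J) :
      LinkRel U (U I i a b * U J j c d) (U J j c d * U I i a b)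

/-- Labels of the generators `U^I_{ab}(i)`. -/
structure Coord where
  I : Lab
  i : Γ.Dart
  a : D.Idx I
  b : D.Idx I

/-! #### The algebra `ℱ` of functions on the space of lattice connections -/

/-- The unital algebra `ℱ` generated by the coordinate functions `u^I_{ab}(i)`. -/
abbrev FunAlg [Fintype Lab] : Type _ :=
  RingQuot (D.LinkRel fun I i a b => FreeAlgebra.ι ℂ (Coord.mk I i a b : D.Coord))

/-- The coordinate function `u^I_{ab}(i)`. -/
def coord [Fintype Lab] (I : Lab) (i : Γ.Dart) (a b : D.Idx I) : D.FunAlg :=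
  RingQuot.mkAlgHom ℂ _ (FreeAlgebra.ι ℂ (Coord.mk I i a b : D.Coord))

/-! #### The lattice algebra `ℬ` -/

/-- The underlying algebra of the full gauge symmetry `𝒢 = ⨂_x 𝒢_x`. -/
abbrev Sym (_ : GaugeData Γ Gs 𝒢 Lab) : Type _ := ⨂[ℂ] x, 𝒢 x

/-- The counit `ε = ⨂_x ε_x` of `𝒢`. -/
def symCounit [Fintype X] : D.Sym →ₗ[ℂ] ℂ :=
  PiTensorProduct.lift
    ((MultilinearMap.mkPiAlgebra ℂ X ℂ).compLinearMap fun x => Coalgebra.counit (A := 𝒢 x))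

/-- The embedding `𝒢_x → 𝒢`. -/
def loc [DecidableEq X] (x : X) : 𝒢 x →ₐ[ℂ] D.Sym := PiTensorProduct.singleAlgHom x

variable [Fintype Lab] [DecidableEq X]

/-- Generators of `ℬ`: the `U^I_{ab}(i)` and the elements of `𝒢`. -/
abbrev Gen : Type _ := D.Coord ⊕ D.Sym

/-- Free generator `U^I_{ab}(i)`. -/
def genU (I : Lab) (i : Γ.Dart) (a b : D.Idx I) : FreeAlgebra ℂ D.Gen :=
  FreeAlgebra.ι ℂ (Sum.inl (Coord.mk I i a b))

/-- Free generator `ξ ∈ 𝒢`. -/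
def genG (ξ : D.Sym) : FreeAlgebra ℂ D.Gen := FreeAlgebra.ι ℂ (Sum.inr ξ)

/-- The defining relations of `ℬ`.  Covariance
`ξ U^I_α(i) = U^I_β(i) (τ^{I,i}_{βα} ⊗ id)(Δ(ξ))` is imposed for `ξ` in the local algebras `𝒢_x`,
which generate `𝒢`; here `τ^{I,i}` is `τ^I_y` at the target `y` of `i` (acting on the second
index), the contragradient of `τ^I_x` at the source `x` (acting on the first index), and trivial
at all other vertices. -/
inductive LatticeRel : FreeAlgebra ℂ D.Gen → FreeAlgebra ℂ D.Gen → Prop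
  | sym_one : LatticeRel (D.genG 1) 1
  | sym_add (ξ η : D.Sym) : LatticeRel (D.genG (ξ + η)) (D.genG ξ + D.genG η)
  | sym_smul (c : ℂ) (ξ : D.Sym) : LatticeRel (D.genG (c • ξ)) (c • D.genG ξ)
  | sym_mul (ξ η : D.Sym) : LatticeRel (D.genG (ξ * η)) (D.genG ξ * D.genG η)
  | cov_target (I : Lab) (i : Γ.Dart) (a b : D.Idx I) (ξ : 𝒢 i.snd) :
      LatticeRel (D.genG (D.loc i.snd ξ) * D.genU I i a b)
        (∑ c, D.genU I i a c *
          D.genG (D.loc i.snd (slice (D.rep i.snd I c b) (Coalgebra.comul (R := ℂ) ξ))))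
  | cov_source (I : Lab) (i : Γ.Dart) (a b : D.Idx I) (ξ : 𝒢 i.fst) :
      LatticeRel (D.genG (D.loc i.fst ξ) * D.genU I i a b)
        (∑ c, D.genU I i c b *
          D.genG (D.loc i.fst (slice (D.repBar i.fst I c a) (Coalgebra.comul (R := ℂ) ξ))))
  | cov_other (I : Lab) (i : Γ.Dart) (a b : D.Idx I) (z : X) (h₁ : z ≠ i.fst) (h₂ : z ≠ i.snd)
      (ξ : 𝒢 z) :
      LatticeRel (D.genG (D.loc z ξ) * D.genU I i a b) (D.genU I i a b * D.genG (D.loc z ξ))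
  | link {f g : FreeAlgebra ℂ D.Gen} (h : D.LinkRel D.genU f g) : LatticeRel f g

/-- The lattice algebra `ℬ`. -/
abbrev Lattice : Type _ := RingQuot D.LatticeRel

/-- The element `U^I_{ab}(i)` of `ℬ`. -/
def U (I : Lab) (i : Γ.Dart) (a b : D.Idx I) : D.Lattice :=
  RingQuot.mkAlgHom ℂ D.LatticeRel (D.genU I i a b)

/-- The canonical homomorphism `𝒢 → ℬ`. -/
def sym : D.Sym →ₐ[ℂ] D.Lattice :=
  AlgHom.ofLinearMap
    { toFun := fun ξ => RingQuot.mkAlgHom ℂ D.LatticeRel (D.genG ξ)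
      map_add' := fun ξ η => by
        rw [← map_add]; exact RingQuot.mkAlgHom_rel ℂ (LatticeRel.sym_add ξ η)
      map_smul' := fun c ξ => by
        rw [RingHom.id_apply, ← map_smul]
        exact RingQuot.mkAlgHom_rel ℂ (LatticeRel.sym_smul c ξ) }
    (by rw [← map_one (RingQuot.mkAlgHom ℂ D.LatticeRel)]
        exact RingQuot.mkAlgHom_rel ℂ LatticeRel.sym_one)
    (fun ξ η => by
      change RingQuot.mkAlgHom ℂ D.LatticeRel (D.genG (ξ * η)) = 
        RingQuot.mkAlgHom ℂ D.LatticeRel (D.genG ξ) * RingQuot.mkAlgHom ℂ D.LatticeRel (D.genG η)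
      rw [← map_mul]; exact RingQuot.mkAlgHom_rel ℂ (LatticeRel.sym_mul ξ η))

/-- The algebra `𝒜` of observables: the elements of the subalgebra `⟨U^I_{ab}(i)⟩ ⊂ ℬ` that
commute with all `ξ ∈ 𝒢`. -/
def observables : Subalgebra ℂ D.Lattice :=
  Algebra.adjoin ℂ {B | ∃ I i a b, B = D.U I i a b} ⊓ Subalgebra.centralizer ℂ (Set.range D.sym)

/-! #### The `*`-operation on `ℬ` -/

/-- `θ` is the antilinear anti-homomorphism of `ℬ` with `θ(ξ) = ξ^*` on `𝒢` and
`θ(U^I_α(i)) = U^I_γ(-i) (τ^{I,-i}_{γβ} ⊗ id)(R⁻¹) η^{I,i}_{βα}`, where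
`η^{I,i} = e_x ⊗ ᵗη^I_y` for a link `i` from `x` to `y`.  Since `R` is the product of the local
`R`-matrices, `R_x` and `R_y` contribute; `b` is the index at `x`, `c, c'` are indices at `y`. -/
structure IsTheta (θ : D.Lattice →ₛₗ[starRingEnd ℂ] D.Lattice) : Prop where
  map_one : θ 1 = 1
  map_mul : ∀ A B, θ (A * B) = θ B * θ A
  map_sym : ∀ (x : X) (ξ : 𝒢 x), θ (D.sym (D.loc x ξ)) = D.sym (D.loc x (star ξ))
  map_U : ∀ (I : Lab) (i : Γ.Dart) (a d : D.Idx I),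
    θ (D.U I i a d) = ∑ b, ∑ c, ∑ c',
      (D.eta i.snd I)ᵀ c' d •
        (D.U I i.symm c b *
          D.sym (D.loc i.fst (slice (D.rep i.fst I b a) (RmInv (𝒢 i.fst)))) *
          D.sym (D.loc i.snd (slice (D.repBar i.snd I c c') (RmInv (𝒢 i.snd)))))

/-- `κ_x = ι_x⁻¹(κ_*)`. -/
def siteκ (κs : Gsˣ) (x : X) : (𝒢 x)ˣ :=
  Units.map ((D.twist x).iso.symm : Gs →* 𝒢 x) κs

/-- `B^* = (σ_κ ∘ θ)(B) = κ⁻¹ θ(B) κ`, with `κ = ⨂_x κ_x ∈ 𝒢`. -/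
def adj (κs : Gsˣ) (θ : D.Lattice →ₛₗ[starRingEnd ℂ] D.Lattice) (B : D.Lattice) : D.Lattice :=
  D.sym (PiTensorProduct.tprod ℂ fun x => (((D.siteκ κs x)⁻¹ : (𝒢 x)ˣ) : 𝒢 x)) * θ B *
    D.sym (PiTensorProduct.tprod ℂ fun x => ((D.siteκ κs x : (𝒢 x)ˣ) : 𝒢 x))

/-! #### The multidimensional Haar functional and the regular representation -/

variable [Fintype X]

open Classical in
/-- `ω(U^{I₁}_{α₁}(i₁) ⋯ U^{Iₙ}_{αₙ}(iₙ) ξ) = ε(ξ) δ_{I₁,0} ⋯ δ_{Iₙ,0}` whenever each link appears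
at most once and only in one orientation among `i₁, …, iₙ` (`n ≥ 0`). -/
def IsHaar (ω : D.Lattice →ₗ[ℂ] ℂ) : Prop :=
  ∀ (l : List D.Coord) (ξ : D.Sym), (l.map fun p => p.i.edge).Nodup →
    ω ((l.map fun p => D.U p.I p.i p.a p.b).prod * D.sym ξ)
      = D.symCounit ξ * (if ∀ p ∈ l, p.I = D.V.triv then 1 else 0)

/-- The linear map `ξ ↦ π(ξ) ψ` on `𝒢_x`. -/
def act (π : D.Lattice →ₐ[ℂ] Module.End ℂ D.FunAlg) (x : X) (ψ : D.FunAlg) :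
    𝒢 x →ₗ[ℂ] D.FunAlg :=
  LinearMap.applyₗ ψ ∘ₗ π.toLinearMap ∘ₗ D.sym.toLinearMap ∘ₗ (D.loc x).toLinearMap

/-- `π` is the representation of `ℬ` on `ℱ` in which the `U^I_{ab}(i)` act by multiplication and
the gauge transformations act as generalized derivations; the unit `1` of `ℱ` is the state `Ω`. -/
structure IsRegularRep (π : D.Lattice →ₐ[ℂ] Module.End ℂ D.FunAlg) : Prop where
  map_U : ∀ (I : Lab) (i : Γ.Dart) (a b : D.Idx I) (ψ : D.FunAlg),
    π (D.U I i a b) ψ = D.coord I i a b * ψ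
  /-- `π(ξ)(ψ₁ ψ₂) = ∑ π(ξ¹)ψ₁ π(ξ²)ψ₂`. -/
  sym_mul : ∀ (x : X) (ξ : 𝒢 x) (ψ₁ ψ₂ : D.FunAlg),
    π (D.sym (D.loc x ξ)) (ψ₁ * ψ₂) =
      LinearMap.mul' ℂ D.FunAlg
        (TensorProduct.map (D.act π x ψ₁) (D.act π x ψ₂) (Coalgebra.comul (R := ℂ) ξ))
  /-- `π(ξ) u^I_α(i) = u^I_β(i) τ^{I,i}_{βα}(ξ)`. -/
  sym_coord_target : ∀ (I : Lab) (i : Γ.Dart) (a b : D.Idx I) (ξ : 𝒢 i.snd),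
    π (D.sym (D.loc i.snd ξ)) (D.coord I i a b) =
      ∑ c, D.rep i.snd I c b ξ • D.coord I i a c
  sym_coord_source : ∀ (I : Lab) (i : Γ.Dart) (a b : D.Idx I) (ξ : 𝒢 i.fst),
    π (D.sym (D.loc i.fst ξ)) (D.coord I i a b) =
      ∑ c, D.repBar i.fst I c a ξ • D.coord I i c b
  sym_coord_other : ∀ (I : Lab) (i : Γ.Dart) (a b : D.Idx I) (z : X),
    z ≠ i.fst → z ≠ i.snd → ∀ ξ : 𝒢 z,
    π (D.sym (D.loc z ξ)) (D.coord I i a b) =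
      Coalgebra.counit (R := ℂ) ξ • D.coord I i a b
  sym_one : ∀ ξ : D.Sym, π (D.sym ξ) 1 = D.symCounit ξ • (1 : D.FunAlg)

/-- `⟨ψ₁|ψ₂⟩ = ω(Ψ₁^* Ψ₂)` whenever `Ψ_ν ∈ ℬ` generates `ψ_ν = π(Ψ_ν)Ω`. -/
def IsStateForm (κs : Gsˣ) (θ : D.Lattice →ₛₗ[starRingEnd ℂ] D.Lattice)
    (ω : D.Lattice →ₗ[ℂ] ℂ) (π : D.Lattice →ₐ[ℂ] Module.End ℂ D.FunAlg)
    (form : D.FunAlg → D.FunAlg → ℂ) : Prop :=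
  ∀ Ψ₁ Ψ₂ : D.Lattice, form (π Ψ₁ 1) (π Ψ₂ 1) = ω (D.adj κs θ Ψ₁ * Ψ₂)

end

end GaugeData

/-- A scalar product on a complex vector space: antilinear in the first and linear in the second
argument, hermitian and positive definite. -/
structure IsScalarProduct {E : Type*} [AddCommGroup E] [Module ℂ E] (form : E → E → ℂ) :
    Prop where
  add_right : ∀ ψ φ χ, form ψ (φ + χ) = form ψ φ + form ψ χ
  smul_right : ∀ (c : ℂ) (ψ φ), form ψ (c • φ) = c * form ψ φ
  conj_symm : ∀ ψ φ, star (form ψ φ) = form φ ψ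
  pos : ∀ ψ, ψ ≠ 0 → 0 < form ψ ψ

end LatticeGauge

end

open LatticeGauge

open LatticeGauge

set_option linter.unusedSectionVars false
set_option linter.unusedSimpArgs false

noncomputable section

namespace LatticeGauge

/-! ### Quasi-triangular Hopf algebras -/

section HopfFacts

open HopfAlgebra Coalgebra

variable {G : Type*} [Ring G] [HopfAlgebra ℂ G]

variable (G) in
/-- The antipode as a linear map. -/
abbrev SA : G →ₗ[ℂ] G := HopfAlgebra.antipode ℂ (A := G)

variable (G) in
/-- The flip as an algebra homomorphism. -/
def flipA : G ⊗[ℂ] G →ₐ[ℂ] G ⊗[ℂ] G := (Algebra.TensorProduct.comm ℂ G G).toAlgHom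

variable (G) in
/-- The coproduct as an algebra homomorphism. -/
abbrev comulA : G →ₐ[ℂ] G ⊗[ℂ] G := Bialgebra.comulAlgHom ℂ G

variable (G) in
/-- `X ↦ X₁₂` as an algebra homomorphism. -/
def leg12A : G ⊗[ℂ] G →ₐ[ℂ] G ⊗[ℂ] (G ⊗[ℂ] G) :=
  (Algebra.TensorProduct.assoc ℂ ℂ ℂ G G G).toAlgHom.comp
    (Algebra.TensorProduct.includeLeft : G ⊗[ℂ] G →ₐ[ℂ] (G ⊗[ℂ] G) ⊗[ℂ] G)

variable (G) in
/-- `X ↦ X₂₃` as an algebra homomorphism. -/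
def leg23A : G ⊗[ℂ] G →ₐ[ℂ] G ⊗[ℂ] (G ⊗[ℂ] G) := Algebra.TensorProduct.includeRight

variable (G) in
/-- `X ↦ X₁₃` as an algebra homomorphism. -/
def leg13A : G ⊗[ℂ] G →ₐ[ℂ] G ⊗[ℂ] (G ⊗[ℂ] G) :=
  Algebra.TensorProduct.map (AlgHom.id ℂ G) Algebra.TensorProduct.includeRight

variable (G) in
/-- `Δ ⊗ id` as an algebra homomorphism. -/
def comulLeftA : G ⊗[ℂ] G →ₐ[ℂ] G ⊗[ℂ] (G ⊗[ℂ] G) :=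
  (Algebra.TensorProduct.assoc ℂ ℂ ℂ G G G).toAlgHom.comp
    (Algebra.TensorProduct.map (comulA G) (AlgHom.id ℂ G))

variable (G) in
/-- `id ⊗ Δ` as an algebra homomorphism. -/
def comulRightA : G ⊗[ℂ] G →ₐ[ℂ] G ⊗[ℂ] (G ⊗[ℂ] G) :=
  Algebra.TensorProduct.map (AlgHom.id ℂ G) (comulA G)

@[simp] lemma flipA_tmul (a b : G) : flipA G (a ⊗ₜ b) = b ⊗ₜ a := rfl
@[simp] lemma leg12A_tmul (a b : G) : leg12A G (a ⊗ₜ b) = a ⊗ₜ (b ⊗ₜ 1) := rfl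
@[simp] lemma leg23A_apply (X : G ⊗[ℂ] G) : leg23A G X = 1 ⊗ₜ X := rfl
@[simp] lemma leg13A_tmul (a b : G) : leg13A G (a ⊗ₜ b) = a ⊗ₜ (1 ⊗ₜ b) := rfl
@[simp] lemma comulRightA_tmul (a b : G) :
    comulRightA G (a ⊗ₜ b) = a ⊗ₜ Coalgebra.comul (R := ℂ) b := rfl
lemma comulLeftA_tmul (a b : G) :
    comulLeftA G (a ⊗ₜ b) = TensorProduct.assoc ℂ G G G (Coalgebra.comul (R := ℂ) a ⊗ₜ b) := rfl

lemma flip_eq (X : G ⊗[ℂ] G) : flip G X = flipA G X := rfl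
lemma leg12_eq (X : G ⊗[ℂ] G) : leg12 G X = leg12A G X := rfl
lemma leg23_eq (X : G ⊗[ℂ] G) : leg23 G X = leg23A G X := rfl
lemma leg13_eq (X : G ⊗[ℂ] G) : leg13 G X = leg13A G X := by
  induction X using TensorProduct.induction_on with
  | zero => simp
  | tmul a b => rfl
  | add a b ha hb => simp [ha, hb]
lemma comulLeft_eq (X : G ⊗[ℂ] G) : comulLeft G X = comulLeftA G X := by
  induction X using TensorProduct.induction_on with
  | zero => simp
  | tmul a b => rfl
  | add a b ha hb => simp [ha, hb]
lemma comulRight_eq (X : G ⊗[ℂ] G) : comulRight G X = comulRightA G X := by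
  induction X using TensorProduct.induction_on with
  | zero => simp
  | tmul a b => rfl
  | add a b ha hb => simp [ha, hb]

@[simp] lemma flipA_flipA (X : G ⊗[ℂ] G) : flipA G (flipA G X) = X := by
  induction X using TensorProduct.induction_on with
  | zero => simp
  | tmul a b => rfl
  | add a b ha hb => simp [ha, hb]

lemma comulLeftA_comul (ξ : G) : comulLeftA G (comulA G ξ) = comulRightA G (comulA G ξ) := by
  rw [← comulLeft_eq, ← comulRight_eq]
  exact Coalgebra.coassoc_apply ξ

lemma antipode_mul' (a b : G) : SA G (a * b) = SA G b * SA G a :=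
  HopfAlgebra.antipode_mul_antidistrib a b

/-- The map `S ⊗ S` after the flip. -/
def flipSS : G ⊗[ℂ] G →ₗ[ℂ] G ⊗[ℂ] G := TensorProduct.map (SA G) (SA G) ∘ₗ flip G

@[simp] lemma flipSS_tmul (a b : G) : flipSS (a ⊗ₜ[ℂ] b) = SA G b ⊗ₜ SA G a := rfl

/-- `Δ(S(ξ)) = S(ξ²) ⊗ S(ξ¹)`. -/
lemma comul_antipode (ξ : G) : comulA G (SA G ξ) = flipSS (comulA G ξ) := by
  let i1 : G →ₐ[ℂ] G ⊗[ℂ] G := Algebra.TensorProduct.includeLeft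
  let i2 : G →ₐ[ℂ] G ⊗[ℂ] G := Algebra.TensorProduct.includeRight
  have key : ∀ j : G →ₐ[ℂ] G ⊗[ℂ] G, WithConv.toConv (j.toLinearMap ∘ₗ SA G) *
      WithConv.toConv j.toLinearMap = 1 := by
    intro j
    have h := congrArg (fun f : WithConv (G →ₗ[ℂ] G) => WithConv.toConv (j.toLinearMap ∘ₗ f.ofConv))
      (LinearMap.antipode_mul_id (R := ℂ) (C := G))
    simp only [LinearMap.algHom_comp_convMul_distrib] at h
    rw [WithConv.toConv_ofConv] at h
    refine h.trans ?_
    apply WithConv.ext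
    ext x
    simp [LinearMap.convOne_def]
  have hδ : WithConv.toConv (comulA G).toLinearMap =
      WithConv.toConv i1.toLinearMap * WithConv.toConv i2.toLinearMap := by
    apply WithConv.ext
    ext x
    have : ∀ X : G ⊗[ℂ] G, X = LinearMap.mul' ℂ (G ⊗[ℂ] G)
        (TensorProduct.map i1.toLinearMap i2.toLinearMap X) := by
      intro X
      induction X using TensorProduct.induction_on with
      | zero => simp
      | add a b ha hb => rw [map_add, map_add, ← ha, ← hb]
      | tmul a b => simp [i1, i2]
    exact this _
  have hG : WithConv.toConv (flipSS ∘ₗ (comulA G).toLinearMap) =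
      WithConv.toConv (i2.toLinearMap ∘ₗ SA G) * WithConv.toConv (i1.toLinearMap ∘ₗ SA G) := by
    apply WithConv.ext
    ext x
    have : ∀ X : G ⊗[ℂ] G, flipSS X = LinearMap.mul' ℂ (G ⊗[ℂ] G)
        (TensorProduct.map (i2.toLinearMap ∘ₗ SA G) (i1.toLinearMap ∘ₗ SA G) X) := by
      intro X
      induction X using TensorProduct.induction_on with
      | zero => simp
      | add a b ha hb => rw [map_add, map_add, map_add, ← ha, ← hb]
      | tmul a b => simp [i1, i2]
    exact this _
  have hL : WithConv.toConv (flipSS ∘ₗ (comulA G).toLinearMap) *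
      WithConv.toConv (comulA G).toLinearMap = 1 := by
    rw [hδ, hG, mul_assoc, ← mul_assoc _ _ (WithConv.toConv i2.toLinearMap), key i1, one_mul,
      key i2]
  have hR : WithConv.toConv (comulA G).toLinearMap *
      WithConv.toConv ((comulA G).toLinearMap ∘ₗ SA G) = 1 := LinearMap.comul_right_inv
  have := left_inv_eq_right_inv hL hR
  exact (congrArg (fun f => f.ofConv ξ) this).symm

variable (G) in
/-- `ε ⊗ id` as an algebra homomorphism. -/
def counitLeftA : G ⊗[ℂ] G →ₐ[ℂ] G :=
  (Algebra.TensorProduct.lid ℂ G).toAlgHom.comp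
    (Algebra.TensorProduct.map (Bialgebra.counitAlgHom ℂ G) (AlgHom.id ℂ G))

variable (G) in
/-- `id ⊗ ε` as an algebra homomorphism. -/
def counitRightA : G ⊗[ℂ] G →ₐ[ℂ] G :=
  (Algebra.TensorProduct.rid ℂ ℂ G).toAlgHom.comp
    (Algebra.TensorProduct.map (AlgHom.id ℂ G) (Bialgebra.counitAlgHom ℂ G))

@[simp] lemma counitLeftA_tmul (a b : G) : counitLeftA G (a ⊗ₜ b) = counit (R := ℂ) a • b := rfl
@[simp] lemma counitRightA_tmul (a b : G) : counitRightA G (a ⊗ₜ b) = counit (R := ℂ) b • a := rfl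

@[simp] lemma counitLeftA_comul (ξ : G) : counitLeftA G (comul (R := ℂ) ξ) = ξ := by
  have h := congrArg (TensorProduct.lid ℂ G) (Coalgebra.rTensor_counit_comul (R := ℂ) ξ)
  have : ∀ X : G ⊗[ℂ] G, counitLeftA G X = TensorProduct.lid ℂ G (counit.rTensor G X) := by
    intro X
    induction X using TensorProduct.induction_on with
    | zero => simp
    | add a b ha hb => simp [ha, hb]
    | tmul a b => simp
  rw [this, h]; simp

@[simp] lemma counitRightA_comul (ξ : G) : counitRightA G (comul (R := ℂ) ξ) = ξ := by
  have h := congrArg (TensorProduct.rid ℂ G) (Coalgebra.lTensor_counit_comul (R := ℂ) ξ)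
  have : ∀ X : G ⊗[ℂ] G, counitRightA G X = TensorProduct.rid ℂ G (counit.lTensor G X) := by
    intro X
    induction X using TensorProduct.induction_on with
    | zero => simp
    | add a b ha hb => simp [ha, hb]
    | tmul a b => simp
  rw [this, h]; simp

lemma counitLeftA_flipA (X : G ⊗[ℂ] G) : counitLeftA G (flipA G X) = counitRightA G X := by
  induction X using TensorProduct.induction_on with
  | zero => simp
  | add a b ha hb => simp [ha, hb]
  | tmul a b => simp

lemma counitRightA_flipA (X : G ⊗[ℂ] G) : counitRightA G (flipA G X) = counitLeftA G X := by
  induction X using TensorProduct.induction_on with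
  | zero => simp
  | add a b ha hb => simp [ha, hb]
  | tmul a b => simp

/-- `m(id ⊗ S)Δ = ε`. -/
lemma mul_id_antipode_comul (ξ : G) :
    LinearMap.mul' ℂ G (TensorProduct.map LinearMap.id (SA G) (comul (R := ℂ) ξ)) =
      algebraMap ℂ G (counit (R := ℂ) ξ) :=
  HopfAlgebra.mul_antipode_lTensor_comul_apply ξ

lemma mul_antipode_id_comul (ξ : G) :
    LinearMap.mul' ℂ G (TensorProduct.map (SA G) LinearMap.id (comul (R := ℂ) ξ)) =
      algebraMap ℂ G (counit (R := ℂ) ξ) :=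
  HopfAlgebra.mul_antipode_rTensor_comul_apply ξ

end HopfFacts

section QuasiTriangular

open HopfAlgebra Coalgebra

variable {G : Type*} [Ring G] [HopfAlgebra ℂ G] [StarRing G] [StarModule ℂ G]
  [RibbonHopfStarAlgebra G]

@[simp] lemma Rm_mul_RmInv : Rm G * RmInv G = 1 :=
  (RibbonHopfStarAlgebra.R : (G ⊗[ℂ] G)ˣ).mul_inv
@[simp] lemma RmInv_mul_Rm : RmInv G * Rm G = 1 :=
  (RibbonHopfStarAlgebra.R : (G ⊗[ℂ] G)ˣ).inv_mul
@[simp] lemma rib_mul_ribInv : rib G * ribInv G = 1 :=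
  (RibbonHopfStarAlgebra.v : Gˣ).mul_inv
@[simp] lemma ribInv_mul_rib : ribInv G * rib G = 1 :=
  (RibbonHopfStarAlgebra.v : Gˣ).inv_mul

lemma Rm_comul (ξ : G) : Rm G * comulA G ξ = flipA G (comulA G ξ) * Rm G :=
  RibbonHopfStarAlgebra.R_comul ξ

lemma comulLeftA_Rm : comulLeftA G (Rm G) = leg13A G (Rm G) * leg23A G (Rm G) := by
  rw [← comulLeft_eq, ← leg13_eq, ← leg23_eq]; exact RibbonHopfStarAlgebra.comulLeft_R

lemma comulRightA_Rm : comulRightA G (Rm G) = leg13A G (Rm G) * leg12A G (Rm G) := by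
  rw [← comulRight_eq, ← leg13_eq, ← leg12_eq]; exact RibbonHopfStarAlgebra.comulRight_R

lemma RmInv_unique {X : G ⊗[ℂ] G} (h : X * Rm G = 1) : X = RmInv G := by
  calc X = X * (Rm G * RmInv G) := by simp
    _ = RmInv G := by rw [← mul_assoc, h, one_mul]

lemma comulRightA_RmInv : comulRightA G (RmInv G) = leg12A G (RmInv G) * leg13A G (RmInv G) := by
  have h1 : comulRightA G (RmInv G) * comulRightA G (Rm G) = 1 := by rw [← map_mul]; simp
  have h2 : comulRightA G (Rm G) * (leg12A G (RmInv G) * leg13A G (RmInv G)) = 1 := by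
    rw [comulRightA_Rm, mul_assoc, ← mul_assoc (leg12A G _), ← map_mul, Rm_mul_RmInv, map_one,
      one_mul, ← map_mul, Rm_mul_RmInv, map_one]
  exact left_inv_eq_right_inv h1 h2

@[simp] lemma counitLeftA_Rm : counitLeftA G (Rm G) = 1 := by
  let ε3 : G ⊗[ℂ] (G ⊗[ℂ] G) →ₐ[ℂ] G :=
    (counitLeftA G).comp
      ((Algebra.TensorProduct.map (AlgHom.id ℂ G) (counitLeftA G)))
  have h1 : ∀ X : G ⊗[ℂ] G, ε3 (comulLeftA G X) = counitLeftA G X := by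
    intro X
    induction X using TensorProduct.induction_on with
    | zero => simp
    | add a b ha hb => simp [ha, hb]
    | tmul a b =>
      have : ∀ Y : G ⊗[ℂ] G, ε3 (TensorProduct.assoc ℂ G G G (Y ⊗ₜ b)) =
          counit (R := ℂ) (counitLeftA G Y) • b := by
        intro Y
        induction Y using TensorProduct.induction_on with
        | zero => simp
        | add a b ha hb => simp [ha, hb, TensorProduct.add_tmul, add_smul]
        | tmul c d => simp [ε3, mul_smul, smul_comm (counit (R := ℂ) c)]
      rw [comulLeftA_tmul, this]; simp
  have h2 : ∀ X : G ⊗[ℂ] G, ε3 (leg13A G X) = counitLeftA G X := by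
    intro X
    induction X using TensorProduct.induction_on with
    | zero => simp
    | add a b ha hb => simp [ha, hb]
    | tmul a b => simp [ε3]
  have h3 : ∀ X : G ⊗[ℂ] G, ε3 (leg23A G X) = counitLeftA G X := by
    intro X; simp [ε3]
  have h := congrArg ε3 (comulLeftA_Rm (G := G))
  rw [map_mul, h1, h2, h3] at h
  have hu : counitLeftA G (RmInv G) * counitLeftA G (Rm G) = 1 := by rw [← map_mul]; simp
  calc counitLeftA G (Rm G) = counitLeftA G (RmInv G) * (counitLeftA G (Rm G) *
        counitLeftA G (Rm G)) := by rw [← mul_assoc, hu, one_mul]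
    _ = 1 := by rw [← h, hu]

@[simp] lemma counitRightA_Rm : counitRightA G (Rm G) = 1 := by
  let ε3 : G ⊗[ℂ] (G ⊗[ℂ] G) →ₐ[ℂ] G :=
    (counitRightA G).comp
      ((Algebra.TensorProduct.map (AlgHom.id ℂ G) (counitRightA G)))
  have h1 : ∀ X : G ⊗[ℂ] G, ε3 (comulRightA G X) = counitRightA G X := by
    intro X
    induction X using TensorProduct.induction_on with
    | zero => simp
    | add a b ha hb => simp [ha, hb]
    | tmul a b => simp [ε3]
  have h2 : ∀ X : G ⊗[ℂ] G, ε3 (leg13A G X) = counitRightA G X := by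
    intro X
    induction X using TensorProduct.induction_on with
    | zero => simp
    | add a b ha hb => simp [ha, hb]
    | tmul a b => simp [ε3]
  have h3 : ∀ X : G ⊗[ℂ] G, ε3 (leg12A G X) = counitRightA G X := by
    intro X
    induction X using TensorProduct.induction_on with
    | zero => simp
    | add a b ha hb => simp [ha, hb]
    | tmul a b => simp [ε3]
  have h := congrArg ε3 (comulRightA_Rm (G := G))
  rw [map_mul, h1, h2, h3] at h
  have hu : counitRightA G (RmInv G) * counitRightA G (Rm G) = 1 := by rw [← map_mul]; simp
  calc counitRightA G (Rm G) = counitRightA G (RmInv G) * (counitRightA G (Rm G) *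
        counitRightA G (Rm G)) := by rw [← mul_assoc, hu, one_mul]
    _ = 1 := by rw [← h, hu]

@[simp] lemma counitRightA_RmInv : counitRightA G (RmInv G) = 1 := by
  have : counitRightA G (RmInv G) * counitRightA G (Rm G) = 1 := by rw [← map_mul]; simp
  simpa using this

/-- `(S ⊗ id)R = R⁻¹`. -/
lemma antipode_left_Rm : TensorProduct.map (SA G) LinearMap.id (Rm G) = RmInv G := by
  apply RmInv_unique
  let f : G ⊗[ℂ] (G ⊗[ℂ] G) →ₗ[ℂ] G ⊗[ℂ] G :=
    TensorProduct.map (LinearMap.mul' ℂ G ∘ₗ TensorProduct.map (SA G) LinearMap.id) LinearMap.id ∘ₗ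
      (TensorProduct.assoc ℂ G G G).symm.toLinearMap
  have hf : ∀ a b c : G, f (a ⊗ₜ (b ⊗ₜ c)) = (SA G a * b) ⊗ₜ c := fun _ _ _ => rfl
  have h1 : ∀ X : G ⊗[ℂ] G, f (comulLeftA G X) = 1 ⊗ₜ counitLeftA G X := by
    intro X
    induction X using TensorProduct.induction_on with
    | zero => simp
    | add a b ha hb => simp [ha, hb, TensorProduct.tmul_add]
    | tmul a b =>
      rw [comulLeftA_tmul]
      have : f ((TensorProduct.assoc ℂ G G G) (comul (R := ℂ) a ⊗ₜ[ℂ] b)) =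
        (LinearMap.mul' ℂ G (TensorProduct.map (SA G) LinearMap.id (comul (R := ℂ) a))) ⊗ₜ b := by
        simp [f]
      rw [this, mul_antipode_id_comul, Algebra.algebraMap_eq_smul_one, counitLeftA_tmul,
        TensorProduct.smul_tmul]
  have h2 : ∀ X Y : G ⊗[ℂ] G, f (leg13A G X * leg23A G Y) =
      TensorProduct.map (SA G) LinearMap.id X * Y := by
    intro X Y
    induction X using TensorProduct.induction_on with
    | zero => simp
    | add a b ha hb => simp only [map_add, add_mul, ha, hb]
    | tmul a b =>
      induction Y using TensorProduct.induction_on with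
      | zero => simp
      | add c d hc hd => simp only [map_add, mul_add, hc, hd]
      | tmul c d => simp [hf]
  have h := congrArg f (comulLeftA_Rm (G := G))
  rw [h1, h2, counitLeftA_Rm] at h
  exact h.symm

/-- `(id ⊗ S)R⁻¹ = R`. -/
lemma antipode_right_RmInv : TensorProduct.map LinearMap.id (SA G) (RmInv G) = Rm G := by
  let f : G ⊗[ℂ] (G ⊗[ℂ] G) →ₗ[ℂ] G ⊗[ℂ] G :=
    TensorProduct.map LinearMap.id (LinearMap.mul' ℂ G ∘ₗ TensorProduct.map LinearMap.id (SA G))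
  have hf : ∀ a b c : G, f (a ⊗ₜ (b ⊗ₜ c)) = a ⊗ₜ (b * SA G c) := fun _ _ _ => rfl
  have h1 : ∀ X : G ⊗[ℂ] G, f (comulRightA G X) = counitRightA G X ⊗ₜ 1 := by
    intro X
    induction X using TensorProduct.induction_on with
    | zero => simp
    | add a b ha hb => simp [ha, hb, TensorProduct.add_tmul]
    | tmul a b =>
      rw [comulRightA_tmul]
      have : f (a ⊗ₜ comul (R := ℂ) b) =
        a ⊗ₜ (LinearMap.mul' ℂ G (TensorProduct.map LinearMap.id (SA G) (comul (R := ℂ) b))) := by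
        simp [f]
      rw [this, mul_id_antipode_comul, Algebra.algebraMap_eq_smul_one, counitRightA_tmul,
        TensorProduct.smul_tmul]
  have h2 : ∀ X Y : G ⊗[ℂ] G, f (leg12A G X * leg13A G Y) =
      X * TensorProduct.map LinearMap.id (SA G) Y := by
    intro X Y
    induction X using TensorProduct.induction_on with
    | zero => simp
    | add a b ha hb => simp only [map_add, add_mul, ha, hb]
    | tmul a b =>
      induction Y using TensorProduct.induction_on with
      | zero => simp
      | add c d hc hd => simp only [map_add, mul_add, hc, hd]
      | tmul c d => simp [hf]
  have h := congrArg f (comulRightA_RmInv (G := G))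
  rw [h1, h2, counitRightA_RmInv] at h
  calc TensorProduct.map LinearMap.id (SA G) (RmInv G)
      = Rm G * (RmInv G * TensorProduct.map LinearMap.id (SA G) (RmInv G)) := by
        rw [← mul_assoc, Rm_mul_RmInv, one_mul]
    _ = Rm G := by rw [← h]; exact mul_one _

/-- `(S ⊗ S)R = R`. -/
lemma antipode_antipode_Rm : TensorProduct.map (SA G) (SA G) (Rm G) = Rm G := by
  conv_rhs => rw [← antipode_right_RmInv, ← antipode_left_Rm, ← LinearMap.comp_apply,
    ← TensorProduct.map_comp]
  simp

/-- `u = m(S ⊗ id)(flip R)` on general tensors. -/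
lemma drinfeld_tmul (a b : G) : drinfeld (a ⊗ₜ[ℂ] b) = SA G b * a := rfl

/-- `S²(ξ) u = u ξ`. -/
lemma antipode_sq_mul_uElt (ξ : G) : SA G (SA G ξ) * uElt G = uElt G * ξ := by
  let m := LinearMap.mul' ℂ G
  let L : G ⊗[ℂ] (G ⊗[ℂ] G) →ₗ[ℂ] G := m ∘ₗ
    TensorProduct.map (m ∘ₗ TensorProduct.map (SA G ∘ₗ SA G) (SA G) ∘ₗ flip G) LinearMap.id ∘ₗ
      (TensorProduct.comm ℂ _ _).toLinearMap
  have hL : ∀ a b c : G, L (a ⊗ₜ (b ⊗ₜ c)) = SA G (SA G c) * SA G b * a := fun _ _ _ => rfl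
  let dr : G ⊗[ℂ] G →ₗ[ℂ] G := m ∘ₗ TensorProduct.map (SA G) LinearMap.id ∘ₗ flip G
  have hdr : ∀ a b : G, dr (a ⊗ₜ b) = SA G b * a := fun _ _ => rfl
  have hu : uElt G = dr (Rm G) := rfl
  have h1 : ∀ X R : G ⊗[ℂ] G, L (leg12A G R * comulRightA G X) = dr R * counitRightA G X := by
    intro X R
    induction X using TensorProduct.induction_on with
    | zero => simp
    | add a b ha hb => simp only [map_add, mul_add, ha, hb]
    | tmul a b =>
      have : ∀ Y : G ⊗[ℂ] G, L (leg12A G R * a ⊗ₜ Y) =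
          SA G (m (TensorProduct.map LinearMap.id (SA G) Y)) * dr R * a := by
        intro Y
        induction Y using TensorProduct.induction_on with
        | zero => simp
        | add c d hc hd => simp only [map_add, TensorProduct.tmul_add, mul_add, add_mul, hc, hd]
        | tmul c d =>
          induction R using TensorProduct.induction_on with
          | zero => simp
          | add c d hc hd => simp only [map_add, mul_add, add_mul, hc, hd]
          | tmul p q => simp [hL, hdr, m, antipode_mul', mul_assoc]
      rw [comulRightA_tmul, this, mul_id_antipode_comul, counitRightA_tmul,
        Algebra.algebraMap_eq_smul_one]
      simp
  have h2 : ∀ X R : G ⊗[ℂ] G, L (TensorProduct.assoc ℂ G G G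
      (TensorProduct.map (flip G ∘ₗ (comulA G).toLinearMap) LinearMap.id X) * leg12A G R) =
      SA G (SA G (counitLeftA G X)) * dr R := by
    intro X R
    induction X using TensorProduct.induction_on with
    | zero => simp
    | add a b ha hb => simp only [map_add, add_mul, ha, hb]
    | tmul a b =>
      have h3 : ∀ Y : G ⊗[ℂ] G, ∀ p q : G,
          L (TensorProduct.assoc ℂ G G G (flip G Y ⊗ₜ b) * leg12A G (p ⊗ₜ q)) =
          SA G (SA G b) * (SA G q * m (TensorProduct.map (SA G) LinearMap.id Y) * p) := by
        intro Y p q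
        induction Y using TensorProduct.induction_on with
        | zero => simp
        | add c d hc hd => simp only [map_add, TensorProduct.add_tmul, mul_add, add_mul, hc, hd]
        | tmul c d => simp [flip, hL, m, antipode_mul', mul_assoc]
      induction R using TensorProduct.induction_on with
      | zero => simp
      | add c d hc hd => simp only [map_add, mul_add, hc, hd]
      | tmul p q =>
        have := h3 (comul (R := ℂ) a) p q
        rw [mul_antipode_id_comul, Algebra.algebraMap_eq_smul_one] at this
        simp only [TensorProduct.map_tmul, LinearMap.comp_apply, LinearMap.id_apply]
        refine this.trans ?_
        simp [hdr]
  have h3 : ∀ X : G ⊗[ℂ] G, leg12A G (Rm G) * comulLeftA G X = TensorProduct.assoc ℂ G G G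
      (TensorProduct.map (flip G ∘ₗ (comulA G).toLinearMap) LinearMap.id X) *
        leg12A G (Rm G) := by
    intro X
    induction X using TensorProduct.induction_on with
    | zero => simp
    | add a b ha hb => simp only [map_add, mul_add, add_mul, ha, hb]
    | tmul a b =>
      have e1 : ∀ Y Z : G ⊗[ℂ] G, leg12A G Z * TensorProduct.assoc ℂ G G G (Y ⊗ₜ b) =
          TensorProduct.assoc ℂ G G G ((Z * Y) ⊗ₜ b) := by
        intro Y Z
        exact (map_mul (Algebra.TensorProduct.assoc ℂ ℂ ℂ G G G) (Z ⊗ₜ 1) (Y ⊗ₜ b)).symm.trans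
          (by simp [Algebra.TensorProduct.tmul_mul_tmul]; rfl)
      have e2 : ∀ Y Z : G ⊗[ℂ] G, TensorProduct.assoc ℂ G G G (Y ⊗ₜ b) * leg12A G Z =
          TensorProduct.assoc ℂ G G G ((Y * Z) ⊗ₜ b) := by
        intro Y Z
        exact (map_mul (Algebra.TensorProduct.assoc ℂ ℂ ℂ G G G) (Y ⊗ₜ b) (Z ⊗ₜ 1)).symm.trans
          (by simp [Algebra.TensorProduct.tmul_mul_tmul]; rfl)
      rw [comulLeftA_tmul, e1]
      refine Eq.trans ?_ (e2 _ _).symm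
      exact congrArg (fun z => TensorProduct.assoc ℂ G G G (z ⊗ₜ b)) (Rm_comul a)
  have := congrArg L (h3 (comulA G ξ))
  rw [h2, comulLeftA_comul, h1] at this
  simp only [Bialgebra.comulAlgHom_apply, counitRightA_comul, counitLeftA_comul] at this
  rw [hu, this]

/-- `S(u) = ∑ r¹ S(r²)`. -/
lemma antipode_uElt : SA G (uElt G) =
    LinearMap.mul' ℂ G (TensorProduct.map LinearMap.id (SA G) (Rm G)) := by
  have h : ∀ X : G ⊗[ℂ] G, SA G (drinfeld X) =
      LinearMap.mul' ℂ G (TensorProduct.map LinearMap.id (SA G)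
        (TensorProduct.map (SA G) (SA G) X)) := by
    intro X
    induction X using TensorProduct.induction_on with
    | zero => simp [drinfeld]
    | add a b ha hb =>
      have : drinfeld (a + b) = drinfeld a + drinfeld b := by simp [drinfeld]
      rw [this, map_add, ha, hb]; simp only [map_add]
    | tmul a b => simp [drinfeld_tmul, antipode_mul']
  rw [uElt, h, antipode_antipode_Rm]

/-- `∑ S(r̄²) u r̄¹ = 1` for `R⁻¹ = ∑ r̄¹ ⊗ r̄²`. -/
lemma antipode_conj_uElt : (LinearMap.mul' ℂ G ∘ₗ
    TensorProduct.map (SA G) (LinearMap.mulLeft ℂ (uElt G)) ∘ₗ flip G) (RmInv G) = 1 := by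
  have e : ∀ a b : G ⊗[ℂ] G, drinfeld (a + b) = drinfeld a + drinfeld b := by simp [drinfeld]
  have h' : ∀ (X : G ⊗[ℂ] G) (p q : G), SA G q * (drinfeld X * p) = drinfeld (X * p ⊗ₜ q) := by
    intro X p q
    induction X using TensorProduct.induction_on with
    | zero => simp [drinfeld]
    | add a b ha hb => rw [e, add_mul, mul_add, ha, hb, add_mul, e]
    | tmul a b => simp [drinfeld_tmul, antipode_mul', mul_assoc]
  have h : ∀ X Y : G ⊗[ℂ] G, (LinearMap.mul' ℂ G ∘ₗ
    TensorProduct.map (SA G) (LinearMap.mulLeft ℂ (drinfeld X)) ∘ₗ flip G) Y =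
      drinfeld (X * Y) := by
    intro X Y
    induction Y using TensorProduct.induction_on with
    | zero => simp [drinfeld]
    | add c d hc hd => rw [map_add, mul_add, e, hc, hd]
    | tmul c d => exact h' X c d
  rw [uElt, h, Rm_mul_RmInv]
  simp [drinfeld, Algebra.TensorProduct.one_def, flip]

/-- The Yang-Baxter equation. -/
lemma yang_baxter : leg12A G (Rm G) * leg13A G (Rm G) * leg23A G (Rm G) =
    leg23A G (Rm G) * leg13A G (Rm G) * leg12A G (Rm G) := by
  have h : ∀ X : G ⊗[ℂ] G, leg23A G (Rm G) * comulRightA G X =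
      TensorProduct.map LinearMap.id (flip G) (comulRightA G X) * leg23A G (Rm G) := by
    intro X
    induction X using TensorProduct.induction_on with
    | zero => simp
    | add a b ha hb => simp only [map_add, mul_add, add_mul, ha, hb]
    | tmul a b =>
      have := Rm_comul b
      simp only [Bialgebra.comulAlgHom_apply] at this
      simp [this, flip_eq]
  have h1 : ∀ X Y : G ⊗[ℂ] G, TensorProduct.map LinearMap.id (flip G)
      (leg13A G X * leg12A G Y) = leg12A G X * leg13A G Y := by
    intro X Y
    induction X using TensorProduct.induction_on with
    | zero => simp
    | add a b ha hb => simp only [map_add, add_mul, ha, hb]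
    | tmul a b =>
      induction Y using TensorProduct.induction_on with
      | zero => simp
      | add c d hc hd => simp only [map_add, mul_add, hc, hd]
      | tmul c d => simp [flip]
  have := h (Rm G)
  rw [comulRightA_Rm, h1] at this
  rw [← this, mul_assoc]

/-- `R'` is a 2-cocycle. -/
lemma flip_Rm_cocycle : comulLeftA G (flipA G (Rm G)) * leg12A G (flipA G (Rm G)) =
    comulRightA G (flipA G (Rm G)) * leg23A G (flipA G (Rm G)) := by
  let swp : G ⊗[ℂ] (G ⊗[ℂ] G) →ₐ[ℂ] G ⊗[ℂ] (G ⊗[ℂ] G) :=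
    (Algebra.TensorProduct.assoc ℂ ℂ ℂ G G G).toAlgHom.comp
      (Algebra.TensorProduct.comm ℂ G (G ⊗[ℂ] G)).toAlgHom
  let swp' : G ⊗[ℂ] (G ⊗[ℂ] G) →ₐ[ℂ] G ⊗[ℂ] (G ⊗[ℂ] G) :=
    (Algebra.TensorProduct.comm ℂ (G ⊗[ℂ] G) G).toAlgHom.comp
      (Algebra.TensorProduct.assoc ℂ ℂ ℂ G G G).symm.toAlgHom
  have hs : ∀ a b c : G, swp (a ⊗ₜ (b ⊗ₜ c)) = b ⊗ₜ (c ⊗ₜ a) := fun _ _ _ => rfl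
  have hs' : ∀ a b c : G, swp' (a ⊗ₜ (b ⊗ₜ c)) = c ⊗ₜ (a ⊗ₜ b) := fun _ _ _ => rfl
  have l1 : ∀ X : G ⊗[ℂ] G, comulLeftA G (flipA G X) = swp (comulRightA G X) := by
    intro X
    induction X using TensorProduct.induction_on with
    | zero => simp
    | add a b ha hb => simp only [map_add, ha, hb]
    | tmul a b => rfl
  have l2 : ∀ X : G ⊗[ℂ] G, comulRightA G (flipA G X) = swp' (comulLeftA G X) := by
    intro X
    induction X using TensorProduct.induction_on with
    | zero => simp
    | add a b ha hb => simp only [map_add, ha, hb]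
    | tmul a b =>
      simp only [flipA_tmul, comulRightA_tmul, comulLeftA_tmul]
      have : ∀ Y : G ⊗[ℂ] G, swp' (TensorProduct.assoc ℂ G G G (Y ⊗ₜ b)) = b ⊗ₜ Y := by
        intro Y
        induction Y using TensorProduct.induction_on with
        | zero => simp
        | add c d hc hd => simp only [map_add, TensorProduct.add_tmul, TensorProduct.tmul_add, hc, hd]
        | tmul c d => rfl
      rw [this]
  have leg : ∀ X : G ⊗[ℂ] G, swp (leg12A G X) = leg13A G (flipA G X) ∧
      swp (leg13A G X) = leg23A G (flipA G X) ∧ swp' (leg23A G X) = leg13A G (flipA G X) ∧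
      swp' (leg13A G X) = leg12A G (flipA G X) := by
    intro X
    induction X using TensorProduct.induction_on with
    | zero => simp
    | add a b ha hb => simp only [map_add, ha, hb, and_self]
    | tmul a b => exact ⟨rfl, rfl, rfl, rfl⟩
  let rv : G ⊗[ℂ] (G ⊗[ℂ] G) →ₐ[ℂ] G ⊗[ℂ] (G ⊗[ℂ] G) :=
    (Algebra.TensorProduct.map (AlgHom.id ℂ G) (flipA G)).comp swp'
  have lrv : ∀ X : G ⊗[ℂ] G, rv (leg12A G X) = leg23A G (flipA G X) ∧
      rv (leg13A G X) = leg13A G (flipA G X) ∧ rv (leg23A G X) = leg12A G (flipA G X) := by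
    intro X
    induction X using TensorProduct.induction_on with
    | zero => simp
    | add a b ha hb => simp only [map_add, ha, hb, and_self]
    | tmul a b => exact ⟨rfl, rfl, rfl⟩
  have yb := congrArg rv (yang_baxter (G := G))
  simp only [map_mul, lrv] at yb
  rw [l1, l2, comulLeftA_Rm, comulRightA_Rm, map_mul, map_mul, (leg _).1, (leg _).2.1,
    (leg _).2.2.1, (leg _).2.2.2, yb]

/-- `∑ r¹ S(u) ⊗ r² = ∑ S(u) S(r̄¹) ⊗ r̄²`. -/
lemma Rm_mul_antipode_uElt : Rm G * (SA G (uElt G) ⊗ₜ[ℂ] (1 : G)) =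
    (SA G (uElt G) ⊗ₜ[ℂ] (1 : G)) * TensorProduct.map (SA G) LinearMap.id (RmInv G) := by
  have h0 : ∀ ξ : G, SA G ξ * SA G (uElt G) = SA G (uElt G) * SA G (SA G (SA G ξ)) := by
    intro ξ
    rw [← antipode_mul', ← antipode_mul', antipode_sq_mul_uElt]
  have h : ∀ X : G ⊗[ℂ] G, TensorProduct.map (SA G) (SA G) X * (SA G (uElt G) ⊗ₜ[ℂ] (1 : G)) =
      (SA G (uElt G) ⊗ₜ[ℂ] (1 : G)) * TensorProduct.map (SA G ∘ₗ SA G) LinearMap.id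
        (TensorProduct.map (SA G) (SA G) X) := by
    intro X
    induction X using TensorProduct.induction_on with
    | zero => simp
    | add a b ha hb => simp only [map_add, mul_add, add_mul, ha, hb]
    | tmul a b => simp [h0]
  have h2 := h (Rm G)
  rw [antipode_antipode_Rm] at h2
  rw [h2, ← antipode_left_Rm, ← LinearMap.comp_apply, ← TensorProduct.map_comp]
  simp

lemma rib_comm (ξ : G) : rib G * ξ = ξ * rib G := RibbonHopfStarAlgebra.v_central ξ

lemma rib_sq : rib G * rib G = uElt G * SA G (uElt G) := by
  rw [← sq]; exact RibbonHopfStarAlgebra.v_sq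

lemma comul_rib : flipA G (Rm G) * Rm G * comulA G (rib G) = rib G ⊗ₜ[ℂ] rib G :=
  RibbonHopfStarAlgebra.comul_v

end QuasiTriangular

/-! ### Matrices over a noncommutative algebra -/

section MatrixTools

variable {T : Type*} [Ring T] [Algebra ℂ T]
variable {l m n k : Type*} [Fintype l] [DecidableEq l] [Fintype m] [DecidableEq m] [Fintype n]
  [DecidableEq n] [Fintype k] [DecidableEq k]

variable (T) in
/-- A complex matrix as a matrix over `T`. -/
def cm (M : Matrix m n ℂ) : Matrix m n T := M.map (algebraMap ℂ T)

variable (T n) in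
/-- `cm` as an algebra homomorphism. -/
def cmA : Matrix n n ℂ →ₐ[ℂ] Matrix n n T := (Algebra.ofId ℂ T).mapMatrix

variable (T n) in
/-- Scalar matrices. -/
def sc : T →ₐ[ℂ] Matrix n n T where
  toRingHom := Matrix.scalar n
  commutes' _ := rfl

@[simp] lemma cm_apply (M : Matrix m n ℂ) (i : m) (j : n) :
    cm T M i j = algebraMap ℂ T (M i j) := rfl
lemma cm_mul (M : Matrix l m ℂ) (N : Matrix m n ℂ) : cm T (M * N) = cm T M * cm T N :=
  Matrix.map_mul
@[simp] lemma cm_one : cm T (1 : Matrix n n ℂ) = 1 := map_one (cmA T n)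
@[simp] lemma cm_zero : cm T (0 : Matrix m n ℂ) = 0 := by ext; simp
lemma cm_add (M N : Matrix m n ℂ) : cm T (M + N) = cm T M + cm T N := by ext; simp
lemma cm_smul (c : ℂ) (M : Matrix m n ℂ) : cm T (c • M) = c • cm T M := by
  ext; simp [Algebra.smul_def]
lemma cm_sum {ι : Type*} (s : Finset ι) (M : ι → Matrix m n ℂ) :
    cm T (∑ i ∈ s, M i) = ∑ i ∈ s, cm T (M i) := by
  ext a b; simp [Matrix.sum_apply]
lemma sc_apply (t : T) (a b : n) : sc T n t a b = if a = b then t else 0 := by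
  show Matrix.diagonal (fun _ => t) a b = _
  simp [Matrix.diagonal_apply]
lemma sc_mul_apply (t : T) (M : Matrix m n T) (a : m) (b : n) : (sc T m t * M) a b = t * M a b := by
  change (Matrix.diagonal (fun _ => t) * M : Matrix m n T) a b = _
  simp
lemma mul_sc_apply (t : T) (M : Matrix m n T) (a : m) (b : n) : (M * sc T n t) a b = M a b * t := by
  change (M * Matrix.diagonal (fun _ => t) : Matrix m n T) a b = _
  simp
lemma sc_mul_cm (t : T) (M : Matrix m n ℂ) : sc T m t * cm T M = cm T M * sc T n t := by
  ext a b
  rw [sc_mul_apply, mul_sc_apply, cm_apply, (Algebra.commutes _ _)]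
lemma cm_mul_apply (M : Matrix l m ℂ) (N : Matrix m n T) (a : l) (b : n) :
    (cm T M * N) a b = ∑ c, M a c • N c b := by
  simp [Matrix.mul_apply, Algebra.smul_def]
lemma mul_cm_apply (M : Matrix l m T) (N : Matrix m n ℂ) (a : l) (b : n) :
    (M * cm T N) a b = ∑ c, N c b • M a c := by
  simp only [Matrix.mul_apply, Algebra.smul_def, cm_apply]
  exact Finset.sum_congr rfl fun c _ => (Algebra.commutes _ _).symm

variable (T m n) in
/-- `M ↦ M ⊗ 1`. -/
def e1 : Matrix m m T →ₐ[ℂ] Matrix (m × n) (m × n) T :=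
  AlgHom.ofLinearMap
    { toFun := fun M => Matrix.of fun p q => if p.2 = q.2 then M p.1 q.1 else 0
      map_add' := fun M N => by ext p q; by_cases h : p.2 = q.2 <;> simp [h]
      map_smul' := fun c M => by ext p q; by_cases h : p.2 = q.2 <;> simp [h] }
    (by ext ⟨a, b⟩ ⟨c, d⟩; by_cases h : b = d <;> simp [h, Matrix.one_apply])
    (fun M N => by
      ext ⟨a, b⟩ ⟨c, d⟩
      by_cases h : b = d <;> simp [h, Matrix.mul_apply, Fintype.sum_prod_type])

variable (T m n) in
/-- `N ↦ 1 ⊗ N`. -/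
def e2 : Matrix n n T →ₐ[ℂ] Matrix (m × n) (m × n) T :=
  AlgHom.ofLinearMap
    { toFun := fun M => Matrix.of fun p q => if p.1 = q.1 then M p.2 q.2 else 0
      map_add' := fun M N => by ext p q; by_cases h : p.1 = q.1 <;> simp [h]
      map_smul' := fun c M => by ext p q; by_cases h : p.1 = q.1 <;> simp [h] }
    (by ext ⟨a, b⟩ ⟨c, d⟩; by_cases h : a = c <;> simp [h, Matrix.one_apply])
    (fun M N => by
      ext ⟨a, b⟩ ⟨c, d⟩
      by_cases h : a = c <;> simp [h, Matrix.mul_apply, Fintype.sum_prod_type])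

lemma e1_apply (M : Matrix m m T) (p q : m × n) :
    e1 T m n M p q = if p.2 = q.2 then M p.1 q.1 else 0 := rfl
lemma e2_apply (M : Matrix n n T) (p q : m × n) :
    e2 T m n M p q = if p.1 = q.1 then M p.2 q.2 else 0 := rfl

lemma e1_mul_e2_apply (M : Matrix m m T) (N : Matrix n n T) (p q : m × n) :
    (e1 T m n M * e2 T m n N) p q = M p.1 q.1 * N p.2 q.2 := by
  simp [Matrix.mul_apply, Fintype.sum_prod_type, e1_apply, e2_apply]

lemma e2_mul_e1_apply (M : Matrix m m T) (N : Matrix n n T) (p q : m × n) :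
    (e2 T m n N * e1 T m n M) p q = N p.2 q.2 * M p.1 q.1 := by
  simp [Matrix.mul_apply, Fintype.sum_prod_type, e1_apply, e2_apply]

lemma e1_e2_comm {M : Matrix m m T} {N : Matrix n n T}
    (h : ∀ a b c d, M a b * N c d = N c d * M a b) :
    e1 T m n M * e2 T m n N = e2 T m n N * e1 T m n M := by
  ext p q
  rw [e1_mul_e2_apply, e2_mul_e1_apply, h]

lemma e1_cm_comm (M : Matrix m m ℂ) (N : Matrix n n T) :
    e1 T m n (cm T M) * e2 T m n N = e2 T m n N * e1 T m n (cm T M) :=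
  e1_e2_comm fun _ _ _ _ => Algebra.commutes _ _

@[simp] lemma e1_sc (t : T) : e1 T m n (sc T m t) = sc T (m × n) t := by
  ext ⟨a, b⟩ ⟨c, d⟩
  by_cases h : b = d <;> simp [e1_apply, sc_apply, h]

@[simp] lemma e2_sc (t : T) : e2 T m n (sc T n t) = sc T (m × n) t := by
  ext ⟨a, b⟩ ⟨c, d⟩
  by_cases h : a = c <;> simp [e2_apply, sc_apply, h]

lemma e1_cm (M : Matrix m m ℂ) : e1 T m n (cm T M) = cm T (e1 ℂ m n M) := by
  ext p q
  by_cases h : p.2 = q.2 <;> simp [e1_apply, h]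

lemma e2_cm (M : Matrix n n ℂ) : e2 T m n (cm T M) = cm T (e2 ℂ m n M) := by
  ext p q
  by_cases h : p.1 = q.1 <;> simp [e2_apply, h]

variable (T m n) in
/-- Exchange of the two tensor factors. -/
def sw : Matrix (m × n) (m × n) T →ₐ[ℂ] Matrix (n × m) (n × m) T :=
  (Matrix.reindexAlgEquiv ℂ T (Equiv.prodComm m n)).toAlgHom

lemma sw_apply (M : Matrix (m × n) (m × n) T) (p q : n × m) :
    sw T m n M p q = M p.swap q.swap := rfl
@[simp] lemma sw_sw (M : Matrix (m × n) (m × n) T) : sw T n m (sw T m n M) = M := rfl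
@[simp] lemma sw_e1 (M : Matrix m m T) : sw T m n (e1 T m n M) = e2 T n m M := rfl
@[simp] lemma sw_e2 (M : Matrix n n T) : sw T m n (e2 T m n M) = e1 T n m M := rfl
@[simp] lemma sw_cm (M : Matrix (m × n) (m × n) ℂ) : sw T m n (cm T M) = cm T (sw ℂ m n M) := rfl

variable {G : Type*} [Ring G] [HopfAlgebra ℂ G]

/-- Matrix elements of a representation. -/
def ent (τ : G →ₐ[ℂ] Matrix n n ℂ) (a b : n) : G →ₗ[ℂ] ℂ :=
  (Matrix.entryLinearMap ℂ ℂ a b) ∘ₗ τ.toLinearMap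

@[simp] lemma ent_apply (τ : G →ₐ[ℂ] Matrix n n ℂ) (a b : n) (ξ : G) : ent τ a b ξ = τ ξ a b := rfl

/-- `(τ₁ ⊗ τ₂)(z)` as a matrix. -/
def tens2 (τ₁ : G →ₐ[ℂ] Matrix m m ℂ) (τ₂ : G →ₐ[ℂ] Matrix n n ℂ) :
    G ⊗[ℂ] G →ₐ[ℂ] Matrix (m × n) (m × n) ℂ :=
  Algebra.TensorProduct.lift ((e1 ℂ m n).comp τ₁) ((e2 ℂ m n).comp τ₂)
    fun _ _ => e1_e2_comm fun _ _ _ _ => mul_comm _ _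

lemma tens2_tmul (τ₁ : G →ₐ[ℂ] Matrix m m ℂ) (τ₂ : G →ₐ[ℂ] Matrix n n ℂ) (a b : G) :
    tens2 τ₁ τ₂ (a ⊗ₜ b) = e1 ℂ m n (τ₁ a) * e2 ℂ m n (τ₂ b) := by
  exact Algebra.TensorProduct.lift_tmul _ _ _ _ _

lemma tens2_apply (τ₁ : G →ₐ[ℂ] Matrix m m ℂ) (τ₂ : G →ₐ[ℂ] Matrix n n ℂ) (z : G ⊗[ℂ] G)
    (p q : m × n) : tens2 τ₁ τ₂ z p q = pair (ent τ₁ p.1 q.1) (ent τ₂ p.2 q.2) z := by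
  induction z using TensorProduct.induction_on with
  | zero => simp
  | add a b ha hb => simp [ha, hb]
  | tmul a b => rw [tens2_tmul, e1_mul_e2_apply]; rfl

lemma sw_tens2 (τ₁ : G →ₐ[ℂ] Matrix m m ℂ) (τ₂ : G →ₐ[ℂ] Matrix n n ℂ) (z : G ⊗[ℂ] G) :
    sw ℂ m n (tens2 τ₁ τ₂ z) = tens2 τ₂ τ₁ (flipA G z) := by
  induction z using TensorProduct.induction_on with
  | zero => simp
  | add a b ha hb => simp [ha, hb]
  | tmul a b =>
    rw [tens2_tmul, flipA_tmul, tens2_tmul, map_mul, sw_e1, sw_e2]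
    exact (e1_e2_comm fun _ _ _ _ => mul_comm _ _).symm

lemma e1_conjTranspose (M : Matrix m m ℂ) : (e1 ℂ m n M)ᴴ = e1 ℂ m n Mᴴ := by
  ext p q
  by_cases h : q.2 = p.2
  · simp [e1_apply, Matrix.conjTranspose_apply, h]
  · simp [e1_apply, Matrix.conjTranspose_apply, h, Ne.symm h]

lemma e2_conjTranspose (M : Matrix n n ℂ) : (e2 ℂ m n M)ᴴ = e2 ℂ m n Mᴴ := by
  ext p q
  by_cases h : q.1 = p.1
  · simp [e2_apply, Matrix.conjTranspose_apply, h]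
  · simp [e2_apply, Matrix.conjTranspose_apply, h, Ne.symm h]

lemma tens2_conjTranspose [StarRing G] [StarModule ℂ G] (τ₁ : G →ₐ[ℂ] Matrix m m ℂ)
    (τ₂ : G →ₐ[ℂ] Matrix n n ℂ) (h₁ : ∀ ξ, τ₁ (star ξ) = (τ₁ ξ)ᴴ)
    (h₂ : ∀ ξ, τ₂ (star ξ) = (τ₂ ξ)ᴴ) (z : G ⊗[ℂ] G) :
    (tens2 τ₁ τ₂ z)ᴴ = tens2 τ₁ τ₂ (star z) := by
  induction z using TensorProduct.induction_on with
  | zero => simp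
  | add a b ha hb => simp [ha, hb]
  | tmul a b =>
    rw [TensorProduct.star_tmul, tens2_tmul, tens2_tmul, Matrix.conjTranspose_mul,
      e1_conjTranspose, e2_conjTranspose, h₁, h₂]
    exact (e1_e2_comm fun _ _ _ _ => mul_comm _ _).symm

/-- `(τ ⊗ h)(z)` as a matrix over `T`. -/
def Phi (τ : G →ₐ[ℂ] Matrix n n ℂ) (h : G →ₐ[ℂ] T) : G ⊗[ℂ] G →ₐ[ℂ] Matrix n n T :=
  Algebra.TensorProduct.lift ((cmA T n).comp τ) ((sc T n).comp h)
    fun _ _ => (sc_mul_cm _ _).symm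

lemma Phi_tmul (τ : G →ₐ[ℂ] Matrix n n ℂ) (h : G →ₐ[ℂ] T) (a b : G) :
    Phi τ h (a ⊗ₜ b) = cm T (τ a) * sc T n (h b) := by
  exact Algebra.TensorProduct.lift_tmul _ _ _ _ _

lemma Phi_apply (τ : G →ₐ[ℂ] Matrix n n ℂ) (h : G →ₐ[ℂ] T) (z : G ⊗[ℂ] G) (a b : n) :
    Phi τ h z a b = h (slice (ent τ a b) z) := by
  induction z using TensorProduct.induction_on with
  | zero => simp
  | add a b ha hb => simp [ha, hb]
  | tmul x y =>
    rw [Phi_tmul, mul_sc_apply, cm_apply]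
    simp [slice, Algebra.smul_def]

/-- `(τ₁ ⊗ τ₂ ⊗ h)(z)` as a matrix over `T`. -/
def Phi3 (τ₁ : G →ₐ[ℂ] Matrix m m ℂ) (τ₂ : G →ₐ[ℂ] Matrix n n ℂ) (h : G →ₐ[ℂ] T) :
    G ⊗[ℂ] (G ⊗[ℂ] G) →ₐ[ℂ] Matrix (m × n) (m × n) T :=
  Algebra.TensorProduct.lift ((e1 T m n).comp ((cmA T m).comp τ₁)) ((e2 T m n).comp (Phi τ₂ h))
    fun _ _ => e1_cm_comm _ _

variable (τ₁ : G →ₐ[ℂ] Matrix m m ℂ) (τ₂ : G →ₐ[ℂ] Matrix n n ℂ) (h : G →ₐ[ℂ] T)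

lemma Phi3_tmul (a : G) (z : G ⊗[ℂ] G) :
    Phi3 τ₁ τ₂ h (a ⊗ₜ z) = e1 T m n (cm T (τ₁ a)) * e2 T m n (Phi τ₂ h z) := by
  exact Algebra.TensorProduct.lift_tmul _ _ _ _ _

lemma Phi3_leg12 (X : G ⊗[ℂ] G) : Phi3 τ₁ τ₂ h (leg12A G X) = cm T (tens2 τ₁ τ₂ X) := by
  induction X using TensorProduct.induction_on with
  | zero => simp
  | add a b ha hb => simp [ha, hb, cm_add]
  | tmul a b => rw [leg12A_tmul, Phi3_tmul, tens2_tmul, cm_mul, Phi_tmul]; simp [e1_cm, e2_cm]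

lemma Phi3_leg13 (X : G ⊗[ℂ] G) : Phi3 τ₁ τ₂ h (leg13A G X) = e1 T m n (Phi τ₁ h X) := by
  induction X using TensorProduct.induction_on with
  | zero => simp
  | add a b ha hb => simp [ha, hb]
  | tmul a b => rw [leg13A_tmul, Phi3_tmul, Phi_tmul, Phi_tmul]; simp

lemma Phi3_leg23 (X : G ⊗[ℂ] G) : Phi3 τ₁ τ₂ h (leg23A G X) = e2 T m n (Phi τ₂ h X) := by
  rw [leg23A_apply, Phi3_tmul]; simp

lemma Phi3_assoc_tmul (Y : G ⊗[ℂ] G) (b : G) :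
    Phi3 τ₁ τ₂ h (TensorProduct.assoc ℂ G G G (Y ⊗ₜ b)) =
      cm T (tens2 τ₁ τ₂ Y) * sc T (m × n) (h b) := by
  induction Y using TensorProduct.induction_on with
  | zero => simp
  | add a b ha hb => simp [ha, hb, cm_add, add_mul, TensorProduct.add_tmul]
  | tmul a c =>
    rw [TensorProduct.assoc_tmul, Phi3_tmul, tens2_tmul, cm_mul, Phi_tmul, map_mul, e2_sc]
    simp [e1_cm, e2_cm, mul_assoc]

lemma Phi3_comulLeft_tmul (a b : G) : Phi3 τ₁ τ₂ h (comulLeftA G (a ⊗ₜ b)) =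
    cm T (tens2 τ₁ τ₂ (comulA G a)) * sc T (m × n) (h b) := by
  rw [comulLeftA_tmul, Phi3_assoc_tmul]; rfl

/-- `C (τ₁ ⊗ τ₂ ⊗ h)((Δ ⊗ id)X) = (τ₃ ⊗ h)(X) C` for an intertwiner `C`. -/
lemma cm_mul_Phi3_comulLeft (τ₃ : G →ₐ[ℂ] Matrix k k ℂ) (C : Matrix k (m × n) ℂ)
    (hC : ∀ ξ, C * tens2 τ₁ τ₂ (comulA G ξ) = τ₃ ξ * C) (X : G ⊗[ℂ] G) :
    cm T C * Phi3 τ₁ τ₂ h (comulLeftA G X) = Phi τ₃ h X * cm T C := by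
  induction X using TensorProduct.induction_on with
  | zero => simp
  | add a b ha hb => simp [ha, hb, Matrix.mul_add, Matrix.add_mul]
  | tmul a b =>
    rw [Phi3_comulLeft_tmul, Phi_tmul, ← Matrix.mul_assoc, ← cm_mul, hC, cm_mul, Matrix.mul_assoc,
      ← sc_mul_cm, Matrix.mul_assoc]

/-- `(τ₁ ⊗ τ₂ ⊗ h)((Δ' ⊗ id)X) C = C (τ₃ ⊗ h)(X)`, in the form with exchanged factors. -/
lemma Phi3_comulLeft_mul_cm (τ₃ : G →ₐ[ℂ] Matrix k k ℂ) (C : Matrix (m × n) k ℂ)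
    (hC : ∀ ξ, tens2 τ₁ τ₂ (flipA G (comulA G ξ)) * C = C * τ₃ ξ) (X : G ⊗[ℂ] G) :
    sw T n m (Phi3 τ₂ τ₁ h (comulLeftA G X)) * cm T C = cm T C * Phi τ₃ h X := by
  induction X using TensorProduct.induction_on with
  | zero => simp
  | add a b ha hb => simp [ha, hb, Matrix.mul_add, Matrix.add_mul]
  | tmul a b =>
    have : sw T n m (sc T (n × m) (h b)) = sc T (m × n) (h b) := by
      rw [← e1_sc, sw_e1, e2_sc]
    rw [Phi3_comulLeft_tmul, Phi_tmul, map_mul, sw_cm, sw_tens2, this, Matrix.mul_assoc, sc_mul_cm,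
      ← Matrix.mul_assoc, ← cm_mul, hC, cm_mul, Matrix.mul_assoc]

variable {τ₁ τ₂ h}

/-- If `(τ₂ ⊗ h)(Δη) U = U h(η)` then `(τ₁ ⊗ τ₂ ⊗ h)((id ⊗ Δ)X) U₂ = U₂ (τ₁ ⊗ h)(X)₁`. -/
lemma Phi3_comulRight_mul_e2 {U : Matrix n n T}
    (hU : ∀ η, Phi τ₂ h (comulA G η) * U = U * sc T n (h η)) (X : G ⊗[ℂ] G) :
    Phi3 τ₁ τ₂ h (comulRightA G X) * e2 T m n U = e2 T m n U * e1 T m n (Phi τ₁ h X) := by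
  induction X using TensorProduct.induction_on with
  | zero => simp
  | add a b ha hb => simp [ha, hb, mul_add, add_mul]
  | tmul a b =>
    have := hU b
    rw [Bialgebra.comulAlgHom_apply] at this
    rw [comulRightA_tmul, Phi3_tmul, mul_assoc, ← map_mul, this, Phi_tmul, map_mul, map_mul,
      ← mul_assoc, e1_cm_comm]
    simp [mul_assoc]

/-- If `h(η) U = U (τ₂ ⊗ h)(Δη)` then `(τ₁ ⊗ h)(X)₁ U₂ = U₂ (τ₁ ⊗ τ₂ ⊗ h)((id ⊗ Δ)X)`. -/
lemma e1_Phi_mul_e2 {U : Matrix n n T}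
    (hU : ∀ η, sc T n (h η) * U = U * Phi τ₂ h (comulA G η)) (X : G ⊗[ℂ] G) :
    e1 T m n (Phi τ₁ h X) * e2 T m n U = e2 T m n U * Phi3 τ₁ τ₂ h (comulRightA G X) := by
  induction X using TensorProduct.induction_on with
  | zero => simp
  | add a b ha hb => simp [ha, hb, mul_add, add_mul]
  | tmul a b =>
    have := hU b
    rw [Bialgebra.comulAlgHom_apply] at this
    rw [comulRightA_tmul, Phi3_tmul, Phi_tmul, map_mul, mul_assoc, e1_sc, ← e2_sc (m := m),
      ← map_mul, this, map_mul, ← mul_assoc, e1_cm_comm, mul_assoc]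

end MatrixTools

/-! ### The irreducible representations of the symmetry algebra -/

section MatrixUnits

variable {G : Type u} [Ring G] [HopfAlgebra ℂ G] [StarRing G] [StarModule ℂ G] {Lab : Type*}
  (V : IrrepSystem G Lab)

namespace IrrepSystem

/-- `τ^J` as an algebra homomorphism. -/
def rho (J : Lab) : G →ₐ[ℂ] Matrix (Fin (V.dim J)) (Fin (V.dim J)) ℂ := (V.τ J).toAlgHom

@[simp] lemma rho_apply (J : Lab) (ξ : G) : V.rho J ξ = V.τ J ξ := rfl

lemma rho_star (J : Lab) (ξ : G) : V.rho J (star ξ) = (V.rho J ξ)ᴴ := map_star (V.τ J) ξ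

lemma tens_eq (I J : Lab) (z : G ⊗[ℂ] G) : V.tens I J z = tens2 (V.rho I) (V.rho J) z := by
  ext p q
  rw [tens2_apply]
  rfl

instance (J : Lab) : Nonempty (Fin (V.dim J)) := ⟨⟨0, V.dim_pos J⟩⟩

/-- The direct sum of all irreducible representations. -/
def Sum (V : IrrepSystem G Lab) : Type _ := ∀ J, Fin (V.dim J) → ℂ

instance : AddCommGroup V.Sum := inferInstanceAs (AddCommGroup (∀ J, Fin (V.dim J) → ℂ))

instance : Module G V.Sum where
  smul ξ w := fun J => V.τ J ξ *ᵥ w J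
  one_smul w := by funext J; change V.τ J 1 *ᵥ w J = _; simp
  mul_smul ξ η w := by
    funext J; change V.τ J (ξ * η) *ᵥ w J = V.τ J ξ *ᵥ (V.τ J η *ᵥ w J); simp
  smul_zero ξ := by funext J; exact Matrix.mulVec_zero _
  smul_add ξ v w := by funext J; exact Matrix.mulVec_add _ _ _
  add_smul ξ η w := by
    funext J; change V.τ J (ξ + η) *ᵥ w J = V.τ J ξ *ᵥ w J + V.τ J η *ᵥ w J
    simp [Matrix.add_mulVec]
  zero_smul w := by funext J; change V.τ J 0 *ᵥ w J = 0; simp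

lemma smul_sum_apply (ξ : G) (w : V.Sum) (J : Lab) : (ξ • w) J = V.τ J ξ *ᵥ w J := rfl

lemma range_eq {J K : Lab} (M : Matrix (Fin (V.dim J)) (Fin (V.dim K)) ℂ)
    (h : ∀ ξ, V.τ J ξ * M = M * V.τ K ξ) (hM : M ≠ 0) :
    Function.Bijective M.mulVecLin := by
  constructor
  · rw [← LinearMap.ker_eq_bot]
    refine (V.irreducible K (LinearMap.ker M.mulVecLin) fun ξ w hw => ?_).resolve_right fun ht => ?_
    · rw [LinearMap.mem_ker, Matrix.mulVecLin_apply] at hw ⊢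
      rw [Matrix.mulVec_mulVec, ← h, ← Matrix.mulVec_mulVec, hw, Matrix.mulVec_zero]
    · apply hM
      rw [LinearMap.ker_eq_top] at ht
      ext a b
      have := congrFun (LinearMap.congr_fun ht (Pi.single b 1)) a
      simpa using this
  · rw [← LinearMap.range_eq_top]
    refine (V.irreducible J (LinearMap.range M.mulVecLin) fun ξ w hw => ?_).resolve_left
      fun ht => ?_
    · obtain ⟨z, rfl⟩ := hw
      refine ⟨V.τ K ξ *ᵥ z, ?_⟩
      simp only [Matrix.mulVecLin_apply, Matrix.mulVec_mulVec, h]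
    · apply hM
      rw [LinearMap.range_eq_bot] at ht
      ext a b
      have := congrFun (LinearMap.congr_fun ht (Pi.single b 1)) a
      simpa using this

/-- The space `V^J` in the universe of `G`, as a `G`-module. -/
def Lift (V : IrrepSystem G Lab) (J : Lab) : Type u := ULift.{u} (Fin (V.dim J) → ℂ)

instance (J : Lab) : AddCommGroup (V.Lift J) :=
  inferInstanceAs (AddCommGroup (ULift.{u} (Fin (V.dim J) → ℂ)))

instance (J : Lab) : Module G (V.Lift J) where
  smul ξ w := ⟨V.τ J ξ *ᵥ w.down⟩
  one_smul w := by apply ULift.down_injective; change V.τ J 1 *ᵥ w.down = _; simp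
  mul_smul ξ η w := by
    apply ULift.down_injective
    change V.τ J (ξ * η) *ᵥ w.down = V.τ J ξ *ᵥ (V.τ J η *ᵥ w.down); simp
  smul_zero ξ := by apply ULift.down_injective; exact Matrix.mulVec_zero (V.τ J ξ)
  smul_add ξ v w := by
    apply ULift.down_injective; exact Matrix.mulVec_add (V.τ J ξ) v.down w.down
  add_smul ξ η w := by
    apply ULift.down_injective
    change V.τ J (ξ + η) *ᵥ w.down = V.τ J ξ *ᵥ w.down + V.τ J η *ᵥ w.down
    simp [Matrix.add_mulVec]
  zero_smul w := by apply ULift.down_injective; change V.τ J 0 *ᵥ w.down = 0; simp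

lemma lift_smul_down (J : Lab) (ξ : G) (w : V.Lift J) : (ξ • w).down = V.τ J ξ *ᵥ w.down := rfl

instance (J : Lab) : IsSimpleModule G (V.Lift J) := by
  have hnt : Nontrivial (V.Lift J) :=
    inferInstanceAs (Nontrivial (ULift.{u} (Fin (V.dim J) → ℂ)))
  refine isSimpleModule_iff _ _ |>.mpr ⟨fun W => ?_⟩
  let W' : Submodule ℂ (Fin (V.dim J) → ℂ) :=
    { carrier := {w | (ULift.up w : V.Lift J) ∈ W}
      add_mem' := fun {a b} ha hb => W.add_mem ha hb
      zero_mem' := W.zero_mem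
      smul_mem' := fun c w hw => by
        have := W.smul_mem (algebraMap ℂ G c) hw
        have e : (algebraMap ℂ G c) • (show V.Lift J from ULift.up w) = ULift.up (c • w) := by
          apply ULift.down_injective
          rw [lift_smul_down]
          change (V.rho J) (algebraMap ℂ G c) *ᵥ w = c • w
          rw [AlgHom.commutes, Algebra.algebraMap_eq_smul_one, Matrix.smul_mulVec,
            Matrix.one_mulVec]
        rw [e] at this
        exact this }
  rcases V.irreducible J W' fun ξ w hw => W.smul_mem ξ hw with h | h
  · left
    rw [eq_bot_iff]
    intro w hw
    have : w.down ∈ W' := hw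
    rw [h, Submodule.mem_bot] at this
    rw [Submodule.mem_bot]
    exact ULift.down_injective this
  · right
    rw [eq_top_iff]
    intro w _
    have : w.down ∈ W' := h ▸ Submodule.mem_top
    exact this

lemma intertwiner_eq_zero {J K : Lab} (hJK : J ≠ K)
    (M : Matrix (Fin (V.dim J)) (Fin (V.dim K)) ℂ) (h : ∀ ξ, V.τ J ξ * M = M * V.τ K ξ) :
    M = 0 := by
  by_contra hM
  have hb := V.range_eq M h hM
  let e := LinearEquiv.ofBijective M.mulVecLin hb
  obtain ⟨L, _, hL⟩ := V.complete (V.Lift J)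
  have h1 := hL J ⟨⟨Equiv.ulift, fun _ _ => rfl⟩, fun ξ m => rfl⟩
  have h2 := hL K ⟨AddEquiv.trans ⟨Equiv.ulift, fun _ _ => rfl⟩ e.symm.toAddEquiv, fun ξ m => by
    change e.symm (V.τ J ξ *ᵥ m.down) = V.τ K ξ *ᵥ e.symm m.down
    apply e.injective
    rw [LinearEquiv.apply_symm_apply]
    change _ = M *ᵥ _
    rw [Matrix.mulVec_mulVec, ← h, ← Matrix.mulVec_mulVec]
    congr 1
    exact (e.apply_symm_apply m.down).symm⟩
  exact hJK (h1.trans h2.symm)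

lemma intertwiner_eq_smul {J : Lab} (M : Matrix (Fin (V.dim J)) (Fin (V.dim J)) ℂ)
    (h : ∀ ξ, V.τ J ξ * M = M * V.τ J ξ) : ∃ c : ℂ, M = c • 1 := by
  obtain ⟨c, hc⟩ := Module.End.exists_eigenvalue (K := ℂ) M.mulVecLin
  refine ⟨c, ?_⟩
  have := (V.irreducible J (Module.End.eigenspace M.mulVecLin c) fun ξ w hw => ?_).resolve_left hc
  · ext a b
    have hb : (Pi.single b 1 : Fin (V.dim J) → ℂ) ∈ Module.End.eigenspace M.mulVecLin c :=
      this ▸ Submodule.mem_top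
    rw [Module.End.mem_eigenspace_iff] at hb
    have := congrFun hb a
    rw [Matrix.mulVecLin_apply, Matrix.mulVec_single_one] at this
    simpa [Matrix.one_apply, Pi.single_apply] using this
  · rw [Module.End.mem_eigenspace_iff, Matrix.mulVecLin_apply] at hw ⊢
    rw [Matrix.mulVec_mulVec, ← h, ← Matrix.mulVec_mulVec, hw, Matrix.mulVec_smul]

section

variable [IsSemisimpleRing G]

lemma eq_zero_of_forall_rep (ξ : G) (h : ∀ J, V.τ J ξ = 0) : ξ = 0 := by
  have h1 : (1 : G) ∈ (⨆ S : {S : Submodule G G // IsSimpleModule G S}, (S : Submodule G G)) := by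
    have := IsSemisimpleModule.sSup_simples_eq_top G G
    rw [sSup_eq_iSup'] at this
    have e : (⨆ S : {S : Submodule G G // IsSimpleModule G S}, (S : Submodule G G)) = ⊤ := this
    rw [e]; exact Submodule.mem_top
  have key : ∀ x ∈ (⨆ S : {S : Submodule G G // IsSimpleModule G S}, (S : Submodule G G)),
      ξ * x = 0 := by
    intro x hx
    induction hx using Submodule.iSup_induction' with
    | mem S x hx =>
      have := S.2
      obtain ⟨J, ⟨e, he⟩, _⟩ := V.complete S.1
      have h2 : e (ξ • (⟨x, hx⟩ : S.1)) = 0 := by rw [he, h, Matrix.zero_mulVec]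
      have h3 : ξ • (⟨x, hx⟩ : S.1) = 0 := by rw [← e.map_zero] at h2; exact e.injective h2
      exact congrArg Subtype.val h3
    | zero => exact mul_zero _
    | add x y _ _ hx hy => rw [mul_add, hx, hy, add_zero]
  simpa using key 1 h1

variable [Fintype Lab]

lemma exists_rep (B : ∀ J, Matrix (Fin (V.dim J)) (Fin (V.dim J)) ℂ) :
    ∃ ξ : G, ∀ J, V.τ J ξ = B J := by
  classical
  let sg : ∀ J, (Fin (V.dim J) → ℂ) → V.Sum := fun J w => Pi.single J w
  have hsg : ∀ (J : Lab) (ξ : G) (w : Fin (V.dim J) → ℂ), ξ • sg J w = sg J (V.τ J ξ *ᵥ w) := by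
    intro J ξ w
    funext K
    rw [smul_sum_apply]
    by_cases hK : K = J
    · subst hK; simp [sg]
    · simp [sg, hK]
  have comm : ∀ (φ : Module.End G V.Sum) (w : V.Sum) , ∀ J, ∃ c : ℂ, ∀ w, φ w J = c • w J := by
    intro φ _ J
    have hc : ∀ (c : ℂ) (w : V.Sum), φ ((algebraMap ℂ G c) • w) = (algebraMap ℂ G c) • φ w :=
      fun c w => map_smul φ _ w
    have alg : ∀ (c : ℂ) (w : V.Sum), ((algebraMap ℂ G c) • w) = fun K => c • w K := by
      intro c w
      funext K
      rw [smul_sum_apply]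
      change (V.rho K) (algebraMap ℂ G c) *ᵥ w K = c • w K
      rw [AlgHom.commutes, Algebra.algebraMap_eq_smul_one, Matrix.smul_mulVec, Matrix.one_mulVec]
    let M : ∀ K, Matrix (Fin (V.dim J)) (Fin (V.dim K)) ℂ :=
      fun K => LinearMap.toMatrix'
        { toFun := fun w => φ (sg K w) J
          map_add' := fun v w => by
            have : sg K (v + w) = sg K v + sg K w := Pi.single_add _ _ _
            rw [this, map_add]; rfl
          map_smul' := fun c w => by
            have : sg K (c • w) = algebraMap ℂ G c • sg K w := by
              rw [alg]; funext L
              by_cases hL : L = K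
              · subst hL; simp [sg]
              · simp [sg, hL]
            rw [this, hc, alg]; rfl }
    have hM : ∀ K w, φ (sg K w) J = M K *ᵥ w := by
      intro K w
      simp only [M, LinearMap.toMatrix'_mulVec]
      rfl
    have hint : ∀ K ξ, V.τ J ξ * M K = M K * V.τ K ξ := by
      intro K ξ
      apply Matrix.ext_of_mulVec_single
      intro b
      rw [← Matrix.mulVec_mulVec, ← Matrix.mulVec_mulVec, ← hM, ← hM, ← hsg, map_smul,
        smul_sum_apply]
    obtain ⟨c, hcJ⟩ := V.intertwiner_eq_smul (M J) (hint J)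
    refine ⟨c, fun w => ?_⟩
    have hw : w = ∑ K, sg K (w K) := (Finset.univ_sum_single w).symm
    have : φ w = ∑ K, φ (sg K (w K)) := by conv_lhs => rw [hw, map_sum]
    have h2 : φ w J = ∑ K, φ (sg K (w K)) J := by rw [this]; exact Finset.sum_apply _ _ _
    rw [h2, Finset.sum_eq_single J]
    · rw [hM, hcJ, Matrix.smul_mulVec, Matrix.one_mulVec]
    · intro K _ hK
      rw [hM, V.intertwiner_eq_zero (Ne.symm hK) (M K) (hint K), Matrix.zero_mulVec]
    · simp
  let f : Module.End (Module.End G V.Sum) V.Sum :=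
    { toFun := fun w J => B J *ᵥ w J
      map_add' := fun v w => by funext J; exact Matrix.mulVec_add _ _ _
      map_smul' := fun φ w => by
        funext J
        obtain ⟨c, hc⟩ := comm φ w J
        change B J *ᵥ (φ w) J = φ (fun J => B J *ᵥ w J) J
        rw [hc]
        exact (Matrix.mulVec_smul _ _ _).trans (hc (show V.Sum from fun J => B J *ᵥ w J)).symm }
  obtain ⟨ξ, hξ⟩ := jacobson_density f
    (Finset.univ.image fun p : (Σ J, Fin (V.dim J)) => sg p.1 (Pi.single p.2 1))
  refine ⟨ξ, fun J => Matrix.ext_of_mulVec_single fun b => ?_⟩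
  have := hξ (sg J (Pi.single b 1)) (Finset.mem_image.mpr ⟨⟨J, b⟩, Finset.mem_univ _, rfl⟩)
  rw [hsg] at this
  have := congrFun this J
  change B J *ᵥ (Pi.single J (Pi.single b 1) : ∀ J, Fin (V.dim J) → ℂ) J =
    (Pi.single J (V.τ J ξ *ᵥ Pi.single b 1) : ∀ J, Fin (V.dim J) → ℂ) J at this
  rw [Pi.single_eq_same, Pi.single_eq_same] at this
  exact this.symm

open Classical in
/-- Matrix units of `G`. -/
def E (I : Lab) (a b : Fin (V.dim I)) : G :=
  (V.exists_rep (Pi.single I (Matrix.single a b 1))).choose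

lemma rep_E (I : Lab) (a b : Fin (V.dim I)) : V.τ I (V.E I a b) = Matrix.single a b 1 := by
  classical
  have : V.τ I (V.E I a b) = _ := (V.exists_rep (Pi.single I (Matrix.single a b 1))).choose_spec I
  rwa [Pi.single_eq_same] at this

lemma rep_E_ne {I J : Lab} (h : J ≠ I) (a b : Fin (V.dim I)) : V.τ J (V.E I a b) = 0 := by
  classical
  have : V.τ J (V.E I a b) = _ := (V.exists_rep (Pi.single I (Matrix.single a b 1))).choose_spec J
  rwa [Pi.single_eq_of_ne h] at this

lemma eq_of_forall_rep {ξ η : G} (h : ∀ J, V.τ J ξ = V.τ J η) : ξ = η := by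
  rw [← sub_eq_zero]
  exact V.eq_zero_of_forall_rep _ fun J => by rw [map_sub, h, sub_self]

lemma sum_E (ξ : G) : ξ = ∑ I, ∑ a, ∑ b, V.τ I ξ a b • V.E I a b := by
  classical
  apply V.eq_of_forall_rep
  intro J
  simp only [map_sum, map_smul]
  rw [Finset.sum_eq_single J]
  · simp only [rep_E]
    conv_lhs => rw [Matrix.matrix_eq_sum_single (V.τ J ξ)]
    simp [Matrix.smul_single]
  · intro I _ hI
    simp [V.rep_E_ne hI.symm]
  · simp

lemma E_mul_E (I : Lab) (a b c d : Fin (V.dim I)) :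
    V.E I a b * V.E I c d = if b = c then V.E I a d else 0 := by
  apply V.eq_of_forall_rep
  intro J
  by_cases h : J = I
  · subst h
    by_cases hbc : b = c
    · subst hbc; simp [rep_E]
    · simp [rep_E, hbc]
  · by_cases hbc : b = c <;> simp [V.rep_E_ne h, hbc]

lemma E_mul_E_ne {I J : Lab} (h : I ≠ J) (a b : Fin (V.dim I)) (c d : Fin (V.dim J)) :
    V.E I a b * V.E J c d = 0 := by
  apply V.eq_of_forall_rep
  intro K
  by_cases hK : K = I
  · subst hK; simp [V.rep_E_ne h]
  · simp [V.rep_E_ne hK]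

lemma E_mul (I : Lab) (a b : Fin (V.dim I)) (ξ : G) :
    V.E I a b * ξ = ∑ c, V.τ I ξ b c • V.E I a c := by
  apply V.eq_of_forall_rep
  intro J
  by_cases h : J = I
  · subst h
    ext i j
    simp [rep_E, Matrix.sum_apply, Matrix.single_apply, Matrix.mul_apply]
    by_cases hi : a = i <;> simp [hi]
  · simp [V.rep_E_ne h]

/-- Every family of matrices on the `V^I ⊗ V^J` comes from `G ⊗ G`. -/
lemma exists_tens (B : ∀ I J, Matrix (Fin (V.dim I) × Fin (V.dim J)) (Fin (V.dim I) × Fin (V.dim J)) ℂ) :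
    ∃ X : G ⊗[ℂ] G, ∀ I J, tens2 (V.rho I) (V.rho J) X = B I J := by
  classical
  refine ⟨∑ I, ∑ J, ∑ p : Fin (V.dim I) × Fin (V.dim J), ∑ q : Fin (V.dim I) × Fin (V.dim J),
    B I J p q • (V.E I p.1 q.1 ⊗ₜ V.E J p.2 q.2), fun I J => ?_⟩
  ext p q
  simp only [map_sum, map_smul, tens2_tmul, rho_apply]
  rw [Finset.sum_eq_single I, Finset.sum_eq_single J]
  · simp only [rep_E, Matrix.sum_apply, Matrix.smul_apply, e1_mul_e2_apply]
    rw [Finset.sum_eq_single p, Finset.sum_eq_single q]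
    · simp
    · rintro q' _ hq
      by_cases h1 : q'.1 = q.1
      · have h2 : q'.2 ≠ q.2 := fun h => hq (Prod.ext h1 h)
        simp [Matrix.single_apply, h2]
      · simp [Matrix.single_apply, h1]
    · simp
    · rintro p' _ hp
      refine Finset.sum_eq_zero fun q' _ => ?_
      by_cases h1 : p'.1 = p.1
      · have h2 : p'.2 ≠ p.2 := fun h => hp (Prod.ext h1 h)
        simp [Matrix.single_apply, h2]
      · simp [Matrix.single_apply, h1]
    · simp
  · intro K _ hK
    simp [V.rep_E_ne hK.symm]
  · simp
  · intro K _ hK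
    simp [V.rep_E_ne hK.symm]
  · simp

/-- Elements of `G ⊗ G` are determined by the matrices `(τ^I ⊗ τ^J)(X)`. -/
lemma eq_of_forall_tens {X Y : G ⊗[ℂ] G}
    (h : ∀ I J, tens2 (V.rho I) (V.rho J) X = tens2 (V.rho I) (V.rho J) Y) : X = Y := by
  have key : ∀ X : G ⊗[ℂ] G, X = ∑ I, ∑ a, ∑ b, ∑ J, ∑ c, ∑ d,
      tens2 (V.rho I) (V.rho J) X (a, c) (b, d) • (V.E I a b ⊗ₜ[ℂ] V.E J c d) := by
    intro X
    induction X using TensorProduct.induction_on with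
    | zero => simp
    | add x y hx hy =>
      conv_lhs => rw [hx, hy]
      simp only [map_add, Matrix.add_apply, add_smul, Finset.sum_add_distrib]
    | tmul x y =>
      conv_lhs => rw [V.sum_E x, V.sum_E y]
      simp only [TensorProduct.sum_tmul]
      simp only [TensorProduct.tmul_sum, tens2_tmul, e1_mul_e2_apply,
        rho_apply, TensorProduct.smul_tmul_smul]
  rw [key X, key Y]
  simp only [h]

end

end IrrepSystem

end MatrixUnits

/-! ### Clebsch-Gordan maps and positivity of the unitarized `R`-matrix -/

section Intertwiners

open scoped MatrixOrder

/-- A square root `k` of the ribbon element for which the unitarized `R`-matrix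
`(k ⊗ k)⁻¹ R Δ(k)` is of the form `X^* X` with invertible `X`. -/
structure PositiveRoot (G : Type*) [Ring G] [HopfAlgebra ℂ G] [StarRing G] [StarModule ℂ G]
    [RibbonHopfStarAlgebra G] (k : Gˣ) : Prop where
  comm : ∀ ξ : G, (k : G) * ξ = ξ * k
  sq : (k : G) * k = rib G
  antipode : SA G (k : G) = k
  counit : Coalgebra.counit (R := ℂ) (k : G) = 1
  star_eq : star (k : G) = ((k⁻¹ : Gˣ) : G)
  factor : ∃ X : (G ⊗[ℂ] G)ˣ, Rm G * comulA G (k : G) =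
    ((k : G) ⊗ₜ[ℂ] (k : G)) * (star (X : G ⊗[ℂ] G) * X)

lemma star_Rm {G : Type*} [Ring G] [HopfAlgebra ℂ G] [StarRing G] [StarModule ℂ G]
    [RibbonHopfStarAlgebra G] : star (Rm G) = flipA G (RmInv G) := by
  have : flipA G (star (Rm G)) = RmInv G := RibbonHopfStarAlgebra.R_star
  rw [← this, flipA_flipA]

lemma star_comulA {G : Type*} [Ring G] [HopfAlgebra ℂ G] [StarRing G] [StarModule ℂ G]
    [RibbonHopfStarAlgebra G] (ξ : G) : star (comulA G ξ) = flipA G (comulA G (star ξ)) := by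
  have : comulA G (star ξ) = flipA G (star (comulA G ξ)) := RibbonHopfStarAlgebra.comul_star ξ
  rw [this, flipA_flipA]

variable {G : Type u} [Ring G] [HopfAlgebra ℂ G] [StarRing G] [StarModule ℂ G]
  [RibbonHopfStarAlgebra G] [IsSemisimpleRing G] {Lab : Type*} [Fintype Lab]
  {V : IrrepSystem G Lab} (c : ClebschGordan V)

namespace ClebschGordan

lemma intertwine' (I J K : Lab) (m : Fin (c.N I J K)) (ξ : G) :
    c.C I J K m * tens2 (V.rho I) (V.rho J) (comulA G ξ) = V.rho K ξ * c.C I J K m := by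
  have := c.intertwine I J K m ξ
  rwa [V.tens_eq] at this

lemma eq_zero_of_forall_mulVec {I J : Lab} (w : Fin (V.dim I) × Fin (V.dim J) → ℂ)
    (h : ∀ K m, c.C I J K m *ᵥ w = 0) : w = 0 := by
  by_contra hw
  let D : G →ₐ[ℂ] Matrix (Fin (V.dim I) × Fin (V.dim J)) (Fin (V.dim I) × Fin (V.dim J)) ℂ :=
    (tens2 (V.rho I) (V.rho J)).comp (comulA G)
  obtain ⟨K, a, b, hne⟩ : ∃ K a b, D (V.E K a b) *ᵥ w ≠ 0 := by
    by_contra hall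
    push Not at hall
    apply hw
    calc w = D 1 *ᵥ w := by rw [map_one, Matrix.one_mulVec]
      _ = 0 := by
        rw [V.sum_E 1]
        simp only [map_sum, map_smul, Matrix.sum_mulVec, Matrix.smul_mulVec, hall]
        simp
  obtain ⟨p, hp⟩ := Function.ne_iff.mp hne
  let S : Matrix (Fin (V.dim K)) (Fin (V.dim I) × Fin (V.dim J)) ℂ :=
    Matrix.of fun b q => D (V.E K a b) p q
  have hS : ∀ ξ : G, S * V.tens I J (Coalgebra.comul (R := ℂ) ξ) = V.τ K ξ * S := by
    intro ξ
    ext b q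
    rw [V.tens_eq]
    change ∑ r, D (V.E K a b) p r * (D ξ) r q = _
    rw [← Matrix.mul_apply, ← map_mul, V.E_mul]
    simp only [map_sum, map_smul, Matrix.sum_apply, Matrix.smul_apply, Matrix.mul_apply]
    rfl
  have hspan := c.span I J K S hS
  have h0 : ∀ M ∈ Submodule.span ℂ (Set.range (c.C I J K)), M *ᵥ w = 0 := by
    intro M hM
    induction hM using Submodule.span_induction with
    | mem x hx => obtain ⟨m, rfl⟩ := hx; exact h K m
    | zero => simp
    | add x y _ _ hx hy => rw [Matrix.add_mulVec, hx, hy, add_zero]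
    | smul t x _ hx => rw [Matrix.smul_mulVec, hx, smul_zero]
  exact hp (congrFun (h0 S hspan) b)

variable {c} {κ : Lab → ℂ} (hpos : c.IsNormalized κ)

include hpos in
lemma sum_conjTranspose_mul (hκ : ∀ I, κ I ≠ 0) (I J : Lab) :
    ∑ K, ∑ m, (κ I * κ J / κ K)⁻¹ • ((c.C I J K m)ᴴ * c.C I J K m) =
      tens2 (V.rho I) (V.rho J) (flipA G (RmInv G)) := by
  set Q := ∑ K, ∑ m, (κ I * κ J / κ K)⁻¹ • ((c.C I J K m)ᴴ * c.C I J K m) with hQ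
  have h1 : tens2 (V.rho I) (V.rho J) (flipA G (Rm G)) * Q = 1 := by
    have hC : ∀ K m, c.C I J K m * (tens2 (V.rho I) (V.rho J) (flipA G (Rm G)) * Q) =
        c.C I J K m := by
      intro K m
      rw [hQ, Matrix.mul_sum, Matrix.mul_sum, Finset.sum_eq_single K]
      · rw [Matrix.mul_sum, Matrix.mul_sum, Finset.sum_eq_single m]
        · have := hpos.1 I J K m m
          rw [if_pos rfl, V.tens_eq] at this
          rw [Matrix.mul_smul, Matrix.mul_smul, ← Matrix.mul_assoc, ← Matrix.mul_assoc]
          rw [← flip_eq, this, Matrix.smul_mul, Matrix.one_mul, smul_smul, inv_mul_cancel₀,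
            one_smul]
          exact div_ne_zero (mul_ne_zero (hκ I) (hκ J)) (hκ K)
        · intro m' _ hm
          have := hpos.1 I J K m m'
          rw [if_neg hm.symm, V.tens_eq, zero_smul] at this
          rw [Matrix.mul_smul, Matrix.mul_smul, ← Matrix.mul_assoc, ← Matrix.mul_assoc,
            ← flip_eq, this, Matrix.zero_mul, smul_zero]
        · simp
      · intro L _ hL
        rw [Matrix.mul_sum, Matrix.mul_sum]
        refine Finset.sum_eq_zero fun m' _ => ?_
        have := hpos.2 I J K L m m' hL.symm
        rw [V.tens_eq] at this
        rw [Matrix.mul_smul, Matrix.mul_smul, ← Matrix.mul_assoc, ← Matrix.mul_assoc,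
            ← flip_eq, this, Matrix.zero_mul, smul_zero]
      · simp
    apply Matrix.ext_of_mulVec_single
    intro p
    rw [← sub_eq_zero, ← Matrix.sub_mulVec]
    refine c.eq_zero_of_forall_mulVec _ fun K m => ?_
    rw [Matrix.mulVec_mulVec, Matrix.mul_sub, hC, Matrix.mul_one, sub_self, Matrix.zero_mulVec]
  have h2 : tens2 (V.rho I) (V.rho J) (flipA G (RmInv G)) *
      tens2 (V.rho I) (V.rho J) (flipA G (Rm G)) = 1 := by
    rw [← map_mul, ← map_mul]; simp
  calc Q = tens2 (V.rho I) (V.rho J) (flipA G (RmInv G)) *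
      tens2 (V.rho I) (V.rho J) (flipA G (Rm G)) * Q := by rw [h2, Matrix.one_mul]
    _ = _ := by rw [Matrix.mul_assoc, h1, Matrix.mul_one]

include hpos in
/-- `∑_m C^m[IJ|K]^* τ^K(ξ) C^m[IJ|K] = (κ_I κ_J / κ_K) (τ^I ⊗ τ^J)(R'⁻¹ Δ(ξ))` for `ξ` in the
block of `K`. -/
lemma sum_conjTranspose_mul_rep_mul (hκ : ∀ I, κ I ≠ 0) (I J K : Lab) (ξ : G)
    (hξ : ∀ L, L ≠ K → V.τ L ξ = 0) :
    ∑ m, (c.C I J K m)ᴴ * V.τ K ξ * c.C I J K m =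
      (κ I * κ J / κ K) •
        tens2 (V.rho I) (V.rho J) (flipA G (RmInv G) * comulA G ξ) := by
  rw [map_mul, ← sum_conjTranspose_mul hpos hκ, Finset.sum_mul, Finset.smul_sum,
    Finset.sum_eq_single K]
  · rw [Finset.sum_mul, Finset.smul_sum]
    refine Finset.sum_congr rfl fun m _ => ?_
    rw [Matrix.smul_mul, smul_smul, mul_inv_cancel₀
      (div_ne_zero (mul_ne_zero (hκ I) (hκ J)) (hκ K)), one_smul, Matrix.mul_assoc _ (c.C I J K m),
      intertwine', Matrix.mul_assoc]
    rfl
  · intro L _ hL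
    rw [Finset.sum_mul]
    rw [Finset.sum_eq_zero, smul_zero]
    intro m _
    rw [Matrix.smul_mul, Matrix.mul_assoc, intertwine', V.rho_apply, hξ L hL, Matrix.zero_mul,
      Matrix.mul_zero, smul_zero]
  · simp

section Root

variable (c)
variable {κs : Gˣ} (hκ_sq : ∀ I, V.τ I (rib G) = (κ I ^ 2) • (1 : Matrix _ _ ℂ))
  (hκs : ∀ I, V.τ I (κs : G) = κ I • (1 : Matrix _ _ ℂ))
  (hκ_conj : HopfAlgebra.antipode ℂ (κs : G) = κs)

include hκs in
lemma kappa_ne_zero (I : Lab) : κ I ≠ 0 := by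
  intro h
  have h1 : V.τ I (κs : G) * V.τ I ((κs⁻¹ : Gˣ) : G) = 1 := by rw [← map_mul]; simp
  rw [hκs, h, zero_smul, Matrix.zero_mul] at h1
  exact zero_ne_one h1

include hκs in
lemma rep_kappa_inv (I : Lab) : V.τ I ((κs⁻¹ : Gˣ) : G) = (κ I)⁻¹ • (1 : Matrix _ _ ℂ) := by
  have h1 : V.τ I (κs : G) * V.τ I ((κs⁻¹ : Gˣ) : G) = 1 := by rw [← map_mul]; simp
  rw [hκs, Matrix.smul_mul, Matrix.one_mul] at h1
  rw [← h1, smul_smul, inv_mul_cancel₀ (kappa_ne_zero hκs I), one_smul]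

include hκ_sq in
lemma kappa_star (I : Lab) : star (κ I) * κ I = 1 := by
  have h1 : V.τ I (star (rib G)) * V.τ I (rib G) = 1 := by
    rw [← map_mul]
    have : star (rib G) = ribInv G := RibbonHopfStarAlgebra.v_star
    rw [this, ribInv_mul_rib, map_one]
  rw [map_star, hκ_sq, star_smul, star_one, Matrix.smul_mul, Matrix.one_mul, smul_smul] at h1
  have h2 := congrFun (congrFun h1 ⟨0, V.dim_pos I⟩) ⟨0, V.dim_pos I⟩
  simp only [Matrix.smul_apply, Matrix.one_apply_eq, smul_eq_mul, mul_one] at h2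
  have h3 : (star (κ I) * κ I) = ((‖κ I‖ ^ 2 : ℝ) : ℂ) := by
    have := Complex.conj_mul' (κ I)
    simpa using this
  rw [star_pow, ← mul_pow, h3] at h2
  rw [h3]
  have h4 : (‖κ I‖ ^ 2) ^ 2 = 1 := by exact_mod_cast h2
  have h5 : ‖κ I‖ ^ 2 = 1 := by
    have h0 : (0:ℝ) ≤ ‖κ I‖ ^ 2 := by positivity
    nlinarith
  rw [h5]; simp

include hκ_sq hκs hpos in
lemma kappa_triv : κ V.triv = 1 := by
  have hsub : Subsingleton (Fin (V.dim V.triv)) := by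
    rw [V.dim_triv]; infer_instance
  let o : Fin (V.dim V.triv) := ⟨0, V.dim_pos _⟩
  have htens : ∀ z : G ⊗[ℂ] G, tens2 (V.rho V.triv) (V.rho V.triv) z =
      Coalgebra.counit (R := ℂ) (counitLeftA G z) • 1 := by
    intro z
    induction z using TensorProduct.induction_on with
    | zero => simp
    | add x y hx hy => simp [hx, hy, add_smul]
    | tmul x y => simp [tens2_tmul, V.τ_triv, smul_smul, mul_comm]
  obtain ⟨K, m, hne⟩ : ∃ K m, c.C V.triv V.triv K m ≠ 0 := by
    by_contra hall
    push Not at hall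
    have := c.eq_zero_of_forall_mulVec (fun _ => (1 : ℂ)) fun K m => by
      rw [hall, Matrix.zero_mulVec]
    exact one_ne_zero (congrFun this (o, o))
  have hK : K = V.triv := by
    by_contra hK
    apply hne
    have h1 : ∀ ξ : G, V.rho K ξ * c.C V.triv V.triv K m =
        Coalgebra.counit (R := ℂ) ξ • c.C V.triv V.triv K m := by
      intro ξ
      rw [← intertwine', htens]
      simp
    have h2 : V.rho K (∑ a, V.E K a a) = 1 := by
      rw [map_sum]
      simp only [V.rho_apply, V.rep_E]
      ext i j
      rw [Matrix.sum_apply]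
      simp only [Matrix.single_apply, Matrix.one_apply]
      by_cases hij : i = j
      · subst hij; rw [if_pos rfl, Finset.sum_eq_single i] <;> simp
      · rw [if_neg hij, Finset.sum_eq_zero]; intro k _; rw [if_neg]; rintro ⟨rfl, rfl⟩; exact hij rfl
    have h3 : Coalgebra.counit (R := ℂ) (∑ a, V.E K a a) = 0 := by
      have := V.τ_triv (∑ a, V.E K a a)
      rw [map_sum, Finset.sum_eq_zero fun a _ => V.rep_E_ne (Ne.symm hK) a a] at this
      have h := congrFun (congrFun this o) o
      simpa using h.symm
    have h4 := h1 (∑ a, V.E K a a)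
    rwa [h2, h3, zero_smul, Matrix.one_mul] at h4
  subst hK
  have h1 := hpos.1 V.triv V.triv V.triv m m
  rw [if_pos rfl, V.tens_eq, flip_eq, htens, counitLeftA_flipA, counitRightA_Rm] at h1
  have hk0 := kappa_ne_zero hκs V.triv
  rw [mul_div_assoc, div_self hk0, mul_one, Bialgebra.counit_one, one_smul, Matrix.mul_one] at h1
  have h2 := congrFun (congrFun h1 o) o
  simp only [Matrix.mul_apply, Matrix.conjTranspose_apply, Matrix.smul_apply, Matrix.one_apply_eq,
    smul_eq_mul, mul_one] at h2
  have h3 : (0 : ℂ) ≤ κ V.triv := by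
    rw [← h2]
    exact Finset.sum_nonneg fun p _ => mul_star_self_nonneg _
  have h4 := kappa_star hκ_sq V.triv
  have h5 : star (κ V.triv) = κ V.triv := (IsSelfAdjoint.of_nonneg h3).star_eq
  rw [h5] at h4
  rcases mul_self_eq_one_iff.mp h4 with h | h
  · exact h
  · rw [h] at h3
    exfalso
    have : (0:ℝ) ≤ (-1 : ℂ).re := (Complex.le_def.mp h3).1
    norm_num at this

include hκ_sq hκs hκ_conj hpos in
/-- The normalization of the Clebsch-Gordan maps makes the unitarized `R`-matrix positive. -/
theorem positiveRoot : PositiveRoot G κs where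
  comm ξ := V.eq_of_forall_rep fun J => by simp [hκs]
  sq := V.eq_of_forall_rep fun J => by simp [hκs, hκ_sq, smul_smul, sq]
  antipode := hκ_conj
  counit := by
    have h := V.τ_triv (κs : G)
    rw [hκs, kappa_triv c hpos hκ_sq hκs] at h
    have h2 := congrFun (congrFun h ⟨0, V.dim_pos _⟩) ⟨0, V.dim_pos _⟩
    simpa using h2.symm
  star_eq := V.eq_of_forall_rep fun J => by
    rw [map_star, hκs, rep_kappa_inv hκs, star_smul, star_one]
    congr 1
    exact eq_inv_of_mul_eq_one_left (kappa_star hκ_sq J)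
  factor := by
    classical
    have hκ := fun I => kappa_ne_zero hκs I
    have hcomm : ∀ ξ : G, (κs : G) * ξ = ξ * κs := fun ξ =>
      V.eq_of_forall_rep fun J => by simp [hκs]
    have hrib : (κs : G) * κs = rib G := V.eq_of_forall_rep fun J => by
      simp [hκs, hκ_sq, smul_smul, sq]
    set P : G ⊗[ℂ] G := ((κs : G) ⊗ₜ[ℂ] (κs : G)) * (flipA G (RmInv G) *
      comulA G ((κs⁻¹ : Gˣ) : G)) with hP
    have hPt : ∀ I J, tens2 (V.rho I) (V.rho J) P = ∑ K, ∑ m, (c.C I J K m)ᴴ * c.C I J K m := by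
      intro I J
      rw [hP, map_mul, map_mul, tens2_tmul, V.rho_apply, V.rho_apply, hκs, hκs, map_smul, map_smul,
        map_one, map_one, ← sum_conjTranspose_mul hpos hκ]
      simp only [Matrix.smul_mul, Matrix.mul_smul, Matrix.one_mul, smul_smul, Finset.sum_mul,
        Finset.smul_sum, Matrix.mul_assoc, intertwine', V.rho_apply, rep_kappa_inv hκs]
      refine Finset.sum_congr rfl fun K _ => Finset.sum_congr rfl fun m _ => ?_
      have h1 := hκ I; have h2 := hκ J; have h3 := hκ K
      rw [show κ J * κ I * ((κ I * κ J / κ K)⁻¹ * (κ K)⁻¹) = 1 by field_simp, one_smul]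
    have hB : ∀ I J, ∃ B : Matrix (Fin (V.dim I) × Fin (V.dim J)) (Fin (V.dim I) × Fin (V.dim J)) ℂ,
        tens2 (V.rho I) (V.rho J) P = Bᴴ * B ∧ IsUnit B := by
      intro I J
      have hps : (tens2 (V.rho I) (V.rho J) P).PosSemidef := by
        rw [hPt]
        exact Matrix.posSemidef_sum _ fun K _ => Matrix.posSemidef_sum _ fun m _ =>
          Matrix.posSemidef_conjTranspose_mul_self _
      obtain ⟨B, hB⟩ := CStarAlgebra.nonneg_iff_eq_star_mul_self.mp hps.nonneg
      refine ⟨B, hB, ?_⟩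
      rw [Matrix.isUnit_iff_isUnit_det, isUnit_iff_ne_zero]
      intro hdet
      obtain ⟨w, hw, hw0⟩ := Matrix.exists_mulVec_eq_zero_iff.mpr hdet
      apply hw
      have h0 : tens2 (V.rho I) (V.rho J) P *ᵥ w = 0 := by
        rw [hB, ← Matrix.mulVec_mulVec, hw0, Matrix.mulVec_zero]
      have h1 : ∑ K, ∑ m, star (c.C I J K m *ᵥ w) ⬝ᵥ (c.C I J K m *ᵥ w) = 0 := by
        have := congrArg (fun z => star w ⬝ᵥ z) h0
        rw [hPt] at this
        simp only [Matrix.sum_mulVec, dotProduct_zero] at this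
        rw [← this]
        simp only [dotProduct_sum]
        refine Finset.sum_congr rfl fun K _ => Finset.sum_congr rfl fun m _ => ?_
        rw [Matrix.star_mulVec, ← Matrix.dotProduct_mulVec, Matrix.mulVec_mulVec]
      refine c.eq_zero_of_forall_mulVec w fun K m => ?_
      have h2 := (Finset.sum_eq_zero_iff_of_nonneg fun K _ => Finset.sum_nonneg fun m _ =>
        dotProduct_star_self_nonneg (c.C I J K m *ᵥ w)).mp h1 K (Finset.mem_univ _)
      have h3 := (Finset.sum_eq_zero_iff_of_nonneg fun m _ =>
        dotProduct_star_self_nonneg (c.C I J K m *ᵥ w)).mp h2 m (Finset.mem_univ _)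
      exact dotProduct_star_self_eq_zero.mp h3
    choose B hB1 hB2 using hB
    obtain ⟨X, hX⟩ := V.exists_tens B
    obtain ⟨Y, hY⟩ := V.exists_tens fun I J => (B I J)⁻¹
    have hXY : X * Y = 1 := V.eq_of_forall_tens fun I J => by
      rw [map_mul, hX, hY, map_one, Matrix.mul_nonsing_inv _
        ((Matrix.isUnit_iff_isUnit_det _).mp (hB2 I J))]
    have hYX : Y * X = 1 := V.eq_of_forall_tens fun I J => by
      rw [map_mul, hX, hY, map_one, Matrix.nonsing_inv_mul _
        ((Matrix.isUnit_iff_isUnit_det _).mp (hB2 I J))]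
    refine ⟨⟨X, Y, hXY, hYX⟩, ?_⟩
    have hXP : Star.star X * X = P := V.eq_of_forall_tens fun I J => by
      rw [map_mul, ← tens2_conjTranspose _ _ (V.rho_star I) (V.rho_star J), hX, hB1]
    change _ = _ * (Star.star X * X)
    have hc : ∀ z : G ⊗[ℂ] G, (rib G ⊗ₜ[ℂ] rib G) * z = z * (rib G ⊗ₜ[ℂ] rib G) := by
      intro z
      induction z using TensorProduct.induction_on with
      | zero => simp
      | add x y hx hy => rw [mul_add, add_mul, hx, hy]
      | tmul x y => simp [rib_comm]
    have h1 : comulA G (κs : G) * comulA G ((κs⁻¹ : Gˣ) : G) = 1 := by rw [← map_mul]; simp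
    have h2 : flipA G (RmInv G) * flipA G (Rm G) = 1 := by rw [← map_mul]; simp
    rw [hXP, hP, ← mul_assoc, Algebra.TensorProduct.tmul_mul_tmul, hrib, ← mul_assoc, hc,
      ← comul_rib, ← hrib, map_mul]
    calc Rm G * comulA G (κs : G) = (flipA G (RmInv G) * flipA G (Rm G)) * Rm G *
          comulA G (κs : G) * (comulA G (κs : G) * comulA G ((κs⁻¹ : Gˣ) : G)) := by
          rw [h1, h2, one_mul, mul_one]
      _ = _ := by simp only [mul_assoc]

end Root

end ClebschGordan

end Intertwiners

/-! ### Quantum dimensions -/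

section QuantumDimension

variable {G : Type*} [Ring G] [HopfAlgebra ℂ G]

variable (G) in
/-- `a ⊗ b ↦ a S(b)`. -/
def mulIdSA : G ⊗[ℂ] G →ₗ[ℂ] G :=
  LinearMap.mul' ℂ G ∘ₗ TensorProduct.map LinearMap.id (SA G)

@[simp] lemma mulIdSA_tmul (a b : G) : mulIdSA G (a ⊗ₜ b) = a * SA G b := rfl

lemma mulIdSA_comul_mul (z : G ⊗[ℂ] G) (ξ : G) : mulIdSA G (z * comulA G ξ) =
    Coalgebra.counit (R := ℂ) ξ • mulIdSA G z := by
  induction z using TensorProduct.induction_on with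
  | zero => simp
  | add a b ha hb => rw [add_mul, map_add, ha, hb, map_add, smul_add]
  | tmul a b =>
    have : ∀ w : G ⊗[ℂ] G, mulIdSA G (a ⊗ₜ b * w) = a * mulIdSA G w * SA G b := by
      intro w
      induction w using TensorProduct.induction_on with
      | zero => simp
      | add c d hc hd => rw [mul_add, map_add, hc, hd, map_add, mul_add, add_mul]
      | tmul c d =>
        rw [Algebra.TensorProduct.tmul_mul_tmul, mulIdSA_tmul, mulIdSA_tmul, antipode_mul']
        simp only [mul_assoc]
    rw [this]
    have h : mulIdSA G (comulA G ξ) = algebraMap ℂ G (Coalgebra.counit (R := ℂ) ξ) :=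
      HopfAlgebra.mul_antipode_lTensor_comul_apply ξ
    rw [h, ← Algebra.commutes, mul_assoc, ← Algebra.smul_def, mulIdSA_tmul]

/-- The contragradient representation `ξ ↦ ᵗρ(S(ξ))`. -/
def contra {n : Type*} [Fintype n] [DecidableEq n] (ρ : G →ₐ[ℂ] Matrix n n ℂ) :
    G →ₐ[ℂ] Matrix n n ℂ :=
  AlgHom.ofLinearMap ((Matrix.transposeLinearEquiv n n ℂ ℂ).toLinearMap ∘ₗ ρ.toLinearMap ∘ₗ SA G)
    (by simp [HopfAlgebra.antipode_one])
    (fun a b => by simp [antipode_mul'])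

lemma contra_apply {n : Type*} [Fintype n] [DecidableEq n] (ρ : G →ₐ[ℂ] Matrix n n ℂ) (ξ : G) :
    contra ρ ξ = (ρ (SA G ξ))ᵀ := rfl

variable [StarRing G] [StarModule ℂ G] [RibbonHopfStarAlgebra G]

lemma contra_star {n : Type*} [Fintype n] [DecidableEq n] (ρ : G →ₐ[ℂ] Matrix n n ℂ)
    (h : ∀ ξ, ρ (star ξ) = (ρ ξ)ᴴ) (ξ : G) : contra ρ (star ξ) = (contra ρ ξ)ᴴ := by
  rw [contra_apply, contra_apply, RibbonHopfStarAlgebra.antipode_star, h]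
  rfl

@[simp] lemma antipode_rib : SA G (rib G) = rib G := RibbonHopfStarAlgebra.antipode_v

@[simp] lemma antipode_ribInv : SA G (ribInv G) = ribInv G := by
  have h : SA G (ribInv G) * rib G = 1 := by
    calc SA G (ribInv G) * rib G = SA G (rib G * ribInv G) := by rw [antipode_mul', antipode_rib]
      _ = 1 := by rw [rib_mul_ribInv, HopfAlgebra.antipode_one]
  calc SA G (ribInv G) = SA G (ribInv G) * (rib G * ribInv G) := by rw [rib_mul_ribInv, mul_one]
    _ = ribInv G := by rw [← mul_assoc, h, one_mul]

lemma ribInv_comm (ξ : G) : ribInv G * ξ = ξ * ribInv G := by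
  calc ribInv G * ξ = ribInv G * ξ * (rib G * ribInv G) := by rw [rib_mul_ribInv, mul_one]
    _ = ribInv G * rib G * ξ * ribInv G := by simp only [mul_assoc, ← mul_assoc ξ, ← rib_comm ξ]
    _ = ξ * ribInv G := by rw [ribInv_mul_rib, one_mul]

lemma uElt_mul_inv : uElt G * (SA G (uElt G) * (ribInv G * ribInv G)) = 1 := by
  rw [← mul_assoc, ← rib_sq]
  calc rib G * rib G * (ribInv G * ribInv G) = rib G * (rib G * ribInv G) * ribInv G := by
        simp only [mul_assoc]
    _ = 1 := by simp

lemma antipode_antipode_uElt : SA G (SA G (uElt G)) = uElt G := by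
  have h := antipode_sq_mul_uElt (uElt G)
  calc SA G (SA G (uElt G)) = SA G (SA G (uElt G)) * (uElt G *
        (SA G (uElt G) * (ribInv G * ribInv G))) := by rw [uElt_mul_inv, mul_one]
    _ = uElt G := by rw [← mul_assoc, h, mul_assoc, uElt_mul_inv, mul_one]

open scoped MatrixOrder in
lemma PositiveRoot.trace_pos {k : Gˣ} (hk : PositiveRoot G k) {n : Type*} [Fintype n]
    [DecidableEq n] [Nonempty n] (ρ : G →ₐ[ℂ] Matrix n n ℂ) (hρ : ∀ ξ, ρ (star ξ) = (ρ ξ)ᴴ) :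
    0 < (ρ (SA G (uElt G) * ribInv G)).trace := by
  obtain ⟨X, hX⟩ := hk.factor
  set Z := star (X : G ⊗[ℂ] G) * X with hZ
  have hM : mulIdSA G Z = SA G (uElt G) * ribInv G := by
    have h1 : ∀ z : G ⊗[ℂ] G, mulIdSA G (((k : G) ⊗ₜ[ℂ] (k : G)) * z) = rib G * mulIdSA G z := by
      intro z
      induction z using TensorProduct.induction_on with
      | zero => simp
      | add a b ha hb => rw [mul_add, map_add, ha, hb, map_add, mul_add]
      | tmul a b =>
        rw [Algebra.TensorProduct.tmul_mul_tmul, mulIdSA_tmul, mulIdSA_tmul, antipode_mul',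
          hk.antipode, ← hk.sq, ← hk.comm]
        simp only [mul_assoc, ← mul_assoc a, ← hk.comm a]
    have h2 := h1 Z
    rw [← hX, mulIdSA_comul_mul, hk.counit, one_smul] at h2
    have h3 : mulIdSA G (Rm G) = SA G (uElt G) := antipode_uElt.symm
    rw [← ribInv_comm, ← h3, h2, ← mul_assoc, ribInv_mul_rib, one_mul]
  let w : n × n → ℂ := fun p => if p.1 = p.2 then 1 else 0
  have hw : ∀ z : G ⊗[ℂ] G, star w ⬝ᵥ (tens2 ρ (contra ρ) z *ᵥ w) = (ρ (mulIdSA G z)).trace := by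
    intro z
    induction z using TensorProduct.induction_on with
    | zero => simp
    | add a b ha hb => simp [Matrix.add_mulVec, ha, hb]
    | tmul a b =>
      rw [tens2_tmul, mulIdSA_tmul, map_mul, Matrix.trace]
      simp only [dotProduct, Matrix.mulVec, e1_mul_e2_apply, Fintype.sum_prod_type, w,
        Pi.star_apply, contra_apply, Matrix.transpose_apply, mul_ite, mul_one, mul_zero,
        Finset.sum_ite_eq, Finset.mem_univ, if_true, Matrix.diag_apply]
      simp only [Matrix.mul_apply]
      refine Finset.sum_congr rfl fun p _ => ?_
      rw [Finset.sum_eq_single p]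
      · simp
      · intro q _ hq; simp [hq.symm]
      · simp
  rw [← hM, ← hw, hZ, map_mul, ← tens2_conjTranspose _ _ hρ (contra_star ρ hρ),
    ← Matrix.mulVec_mulVec, Matrix.dotProduct_mulVec, ← Matrix.star_mulVec]
  refine Matrix.dotProduct_star_self_pos_iff.mpr fun h0 => ?_
  have hinv : tens2 ρ (contra ρ) ((X⁻¹ : (G ⊗[ℂ] G)ˣ) : G ⊗[ℂ] G) *
      tens2 ρ (contra ρ) (X : G ⊗[ℂ] G) = 1 := by rw [← map_mul]; simp
  have hw0 : w = 0 := by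
    rw [← Matrix.one_mulVec w, ← hinv, ← Matrix.mulVec_mulVec, h0, Matrix.mulVec_zero]
  obtain ⟨a⟩ := ‹Nonempty n›
  have := congrFun hw0 (a, a)
  simp [w] at this

lemma PositiveRoot.trace_pos' {k : Gˣ} (hk : PositiveRoot G k) {n : Type*} [Fintype n]
    [DecidableEq n] [Nonempty n] (ρ : G →ₐ[ℂ] Matrix n n ℂ) (hρ : ∀ ξ, ρ (star ξ) = (ρ ξ)ᴴ) :
    0 < (ρ (uElt G * ribInv G)).trace := by
  have := hk.trace_pos (contra ρ) (contra_star ρ hρ)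
  rwa [contra_apply, Matrix.trace_transpose, antipode_mul', antipode_antipode_uElt,
    antipode_ribInv, ribInv_comm] at this

end QuantumDimension

/-! ### The symmetry algebras at the sites -/

namespace GaugeData

variable {X : Type*} {Γ : SimpleGraph X} {Gs : Type u}
    [Ring Gs] [HopfAlgebra ℂ Gs] [StarRing Gs] [StarModule ℂ Gs] [RibbonHopfStarAlgebra Gs]
    {𝒢 : X → Type*}
    [∀ x, Ring (𝒢 x)] [∀ x, HopfAlgebra ℂ (𝒢 x)] [∀ x, StarRing (𝒢 x)]
    [∀ x, StarModule ℂ (𝒢 x)] [∀ x, RibbonHopfStarAlgebra (𝒢 x)]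
    {Lab : Type*} (D : GaugeData Γ Gs 𝒢 Lab)

section Sites

/-- `τ^I_x` as an algebra homomorphism. -/
def siteRho (x : X) (I : Lab) : 𝒢 x →ₐ[ℂ] Matrix (D.Idx I) (D.Idx I) ℂ :=
  (D.V.rho I).comp (D.twist x).iso.toAlgEquiv.toAlgHom

lemma siteRho_apply (x : X) (I : Lab) (ξ : 𝒢 x) :
    D.siteRho x I ξ = D.V.rho I ((D.twist x).iso ξ) := rfl

lemma siteRho_star (x : X) (I : Lab) (ξ : 𝒢 x) : D.siteRho x I (star ξ) = (D.siteRho x I ξ)ᴴ := by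
  rw [siteRho_apply, siteRho_apply, map_star, D.V.rho_star]

/-- `ι_x ⊗ ι_x`. -/
def iso₂ (x : X) : 𝒢 x ⊗[ℂ] 𝒢 x ≃ₐ[ℂ] Gs ⊗[ℂ] Gs :=
  Algebra.TensorProduct.congr (D.twist x).iso.toAlgEquiv (D.twist x).iso.toAlgEquiv

@[simp] lemma iso₂_tmul (x : X) (a b : 𝒢 x) :
    D.iso₂ x (a ⊗ₜ b) = (D.twist x).iso a ⊗ₜ (D.twist x).iso b := rfl

lemma iso₂_flipA (x : X) (z : 𝒢 x ⊗[ℂ] 𝒢 x) : D.iso₂ x (flipA _ z) = flipA _ (D.iso₂ x z) := by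
  induction z using TensorProduct.induction_on with
  | zero => simp
  | add a b ha hb => simp [ha, hb]
  | tmul a b => rfl

lemma iso₂_star (x : X) (z : 𝒢 x ⊗[ℂ] 𝒢 x) : D.iso₂ x (star z) = star (D.iso₂ x z) := by
  induction z using TensorProduct.induction_on with
  | zero => simp
  | add a b ha hb => simp [ha, hb]
  | tmul a b => simp [map_star]

/-- The twist `F_x`. -/
def F (x : X) : Gs ⊗[ℂ] Gs := ((D.twist x).F : Gs ⊗[ℂ] Gs)

/-- `F_x⁻¹`. -/
def Finv (x : X) : Gs ⊗[ℂ] Gs := (((D.twist x).F⁻¹ : (Gs ⊗[ℂ] Gs)ˣ) : Gs ⊗[ℂ] Gs)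

@[simp] lemma F_mul_Finv (x : X) : D.F x * D.Finv x = 1 := (D.twist x).F.mul_inv
@[simp] lemma Finv_mul_F (x : X) : D.Finv x * D.F x = 1 := (D.twist x).F.inv_mul
@[simp] lemma Finv_mul_F_assoc (x : X) (z) : D.Finv x * (D.F x * z) = z := by
  rw [← mul_assoc, Finv_mul_F, one_mul]
@[simp] lemma F_mul_Finv_assoc (x : X) (z) : D.F x * (D.Finv x * z) = z := by
  rw [← mul_assoc, F_mul_Finv, one_mul]

lemma F_mul_comul (x : X) (ξ : 𝒢 x) :
    D.F x * D.iso₂ x (comulA _ ξ) = comulA Gs ((D.twist x).iso ξ) * D.F x :=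
  (D.twist x).comul_iso ξ

lemma iso₂_comul (x : X) (ξ : 𝒢 x) :
    D.iso₂ x (comulA _ ξ) = D.Finv x * comulA Gs ((D.twist x).iso ξ) * D.F x := by
  rw [mul_assoc, ← F_mul_comul, Finv_mul_F_assoc]

lemma flipA_F_mul_Rm (x : X) : flipA _ (D.F x) * D.iso₂ x (Rm _) = Rm Gs * D.F x :=
  (D.twist x).R_iso

@[simp] lemma flipA_Finv_mul (x : X) : flipA Gs (D.Finv x) * flipA Gs (D.F x) = 1 := by
  rw [← map_mul, Finv_mul_F, map_one]
@[simp] lemma flipA_F_mul (x : X) : flipA Gs (D.F x) * flipA Gs (D.Finv x) = 1 := by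
  rw [← map_mul, F_mul_Finv, map_one]

lemma iso₂_Rm (x : X) : D.iso₂ x (Rm _) = flipA _ (D.Finv x) * Rm Gs * D.F x := by
  rw [mul_assoc, ← flipA_F_mul_Rm, ← mul_assoc, flipA_Finv_mul, one_mul]

lemma star_F (x : X) : star (D.F x) = flipA Gs (D.Finv x) := by
  have : flipA Gs (star (D.F x)) = D.Finv x := (D.twist x).F_star
  rw [← this, flipA_flipA]

/-- `(τ^I_x ⊗ τ^J_x)(z)`. -/
abbrev siteTens (x : X) (I J : Lab) : 𝒢 x ⊗[ℂ] 𝒢 x →ₐ[ℂ]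
    Matrix (D.Idx I × D.Idx J) (D.Idx I × D.Idx J) ℂ :=
  tens2 (D.siteRho x I) (D.siteRho x J)

/-- `(τ^I ⊗ τ^J)(z)`. -/
abbrev gsTens (I J : Lab) : Gs ⊗[ℂ] Gs →ₐ[ℂ]
    Matrix (D.Idx I × D.Idx J) (D.Idx I × D.Idx J) ℂ :=
  tens2 (D.V.rho I) (D.V.rho J)

lemma siteTens_eq (x : X) (I J : Lab) (z : 𝒢 x ⊗[ℂ] 𝒢 x) :
    D.siteTens x I J z = D.gsTens I J (D.iso₂ x z) := by
  induction z using TensorProduct.induction_on with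
  | zero => simp
  | add a b ha hb => rw [map_add, ha, hb, map_add, map_add]
  | tmul a b => rw [iso₂_tmul, tens2_tmul, tens2_tmul]; rfl

lemma siteCG_eq (x : X) (I J K : Lab) (m : Fin (D.cg.N I J K)) :
    D.siteCG x I J K m = D.cg.C I J K m * D.gsTens I J (D.F x) := by
  rw [siteCG, D.V.tens_eq]; rfl

lemma siteCG_conjTranspose (x : X) (I J K : Lab) (m : Fin (D.cg.N I J K)) :
    (D.siteCG x I J K m)ᴴ = D.gsTens I J (flipA _ (D.Finv x)) * (D.cg.C I J K m)ᴴ := by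
  rw [siteCG_eq, Matrix.conjTranspose_mul, tens2_conjTranspose _ _ (D.V.rho_star I)
    (D.V.rho_star J), star_F]

variable [IsSemisimpleRing Gs] [Fintype Lab]

lemma siteCG_mul_comul (x : X) (I J K : Lab) (m : Fin (D.cg.N I J K)) (ξ : 𝒢 x) :
    D.siteCG x I J K m * D.siteTens x I J (comulA _ ξ) = D.siteRho x K ξ * D.siteCG x I J K m := by
  rw [siteCG_eq, siteTens_eq, Matrix.mul_assoc, ← map_mul, F_mul_comul, map_mul,
    ← Matrix.mul_assoc, D.cg.intertwine', siteRho_apply, Matrix.mul_assoc]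

lemma flip_comul_mul_siteCG (x : X) (I J K : Lab) (m : Fin (D.cg.N I J K)) (ξ : 𝒢 x) :
    D.siteTens x I J (flipA _ (comulA _ ξ)) * (D.siteCG x I J K m)ᴴ =
      (D.siteCG x I J K m)ᴴ * D.siteRho x K ξ := by
  have h := congrArg Matrix.conjTranspose (D.siteCG_mul_comul x I J K m (star ξ))
  rw [Matrix.conjTranspose_mul, Matrix.conjTranspose_mul, tens2_conjTranspose _ _
    (D.siteRho_star x I) (D.siteRho_star x J), star_comulA, star_star, ← siteRho_star,
    star_star] at h
  exact h

end Sites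

end GaugeData

namespace GaugeData

variable {X : Type*} {Γ : SimpleGraph X} {Gs : Type u}
    [Ring Gs] [HopfAlgebra ℂ Gs] [StarRing Gs] [StarModule ℂ Gs] [RibbonHopfStarAlgebra Gs]
    {𝒢 : X → Type*}
    [∀ x, Ring (𝒢 x)] [∀ x, HopfAlgebra ℂ (𝒢 x)] [∀ x, StarRing (𝒢 x)]
    [∀ x, StarModule ℂ (𝒢 x)] [∀ x, RibbonHopfStarAlgebra (𝒢 x)]
    {Lab : Type*} (D : GaugeData Γ Gs 𝒢 Lab)

/-- Square roots `κ_I` of `v^I` with the positivity property, combined into `κ_*`. -/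
structure HasRoots (κ : Lab → ℂ) (κs : Gsˣ) : Prop where
  sq : ∀ I, D.V.τ I (rib Gs) = (κ I ^ 2) • (1 : Matrix _ _ ℂ)
  rep : ∀ I, D.V.τ I (κs : Gs) = κ I • (1 : Matrix _ _ ℂ)
  antipode : HopfAlgebra.antipode ℂ (κs : Gs) = κs
  pos : D.cg.IsNormalized κ

variable [IsSemisimpleRing Gs] [Fintype Lab]

section SiteRoots

variable {D} {κ : Lab → ℂ} {κs : Gsˣ} (H : D.HasRoots κ κs)
include H

lemma HasRoots.ne_zero (I : Lab) : κ I ≠ 0 := ClebschGordan.kappa_ne_zero H.rep I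

lemma HasRoots.positiveRoot : PositiveRoot Gs κs :=
  ClebschGordan.positiveRoot D.cg H.pos H.sq H.rep H.antipode

lemma HasRoots.triv : κ D.V.triv = 1 := ClebschGordan.kappa_triv D.cg H.pos H.sq H.rep

omit [IsSemisimpleRing Gs] [Fintype Lab] H in
lemma iso_siteκ (x : X) : (D.twist x).iso ((D.siteκ κs x : (𝒢 x)ˣ) : 𝒢 x) = κs :=
  (D.twist x).iso.apply_symm_apply _

omit [IsSemisimpleRing Gs] [Fintype Lab] H in
lemma iso_siteκ_inv (x : X) : (D.twist x).iso (((D.siteκ κs x)⁻¹ : (𝒢 x)ˣ) : 𝒢 x) =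
    ((κs⁻¹ : Gsˣ) : Gs) := by
  have : (D.siteκ κs x)⁻¹ = D.siteκ κs⁻¹ x := by rw [siteκ, siteκ, map_inv]
  rw [this, iso_siteκ]

/-- The root at the site `x` has the same positivity property. -/
theorem HasRoots.site (x : X) : PositiveRoot (𝒢 x) (D.siteκ κs x) := by
  have P := H.positiveRoot
  have inj : Function.Injective (D.twist x).iso := (D.twist x).iso.injective
  refine ⟨fun ξ => inj ?_, inj ?_, inj ?_, ?_, inj ?_, ?_⟩
  · rw [map_mul, map_mul, iso_siteκ, P.comm]
  · rw [map_mul, iso_siteκ, P.sq]; exact (D.twist x).rib_iso.symm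
  · rw [(D.twist x).antipode_iso, iso_siteκ]; exact P.antipode
  · rw [← (D.twist x).counit_iso, iso_siteκ]; exact P.counit
  · rw [map_star, iso_siteκ, iso_siteκ_inv]; exact P.star_eq
  · obtain ⟨Z, hZ⟩ := P.factor
    refine ⟨Units.map (D.iso₂ x).symm.toAlgHom.toRingHom.toMonoidHom (Z * (D.twist x).F),
      (D.iso₂ x).injective ?_⟩
    have e : ∀ z, D.iso₂ x ((D.iso₂ x).symm z) = z := (D.iso₂ x).apply_symm_apply
    change _ = D.iso₂ x (_ * (star ((D.iso₂ x).symm (Z * D.F x)) * (D.iso₂ x).symm (Z * D.F x)))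
    rw [map_mul, map_mul, map_mul, iso₂_star, e, star_mul, star_F, iso₂_tmul, iso_siteκ,
      iso₂_Rm, iso₂_comul, iso_siteκ]
    have hc : ∀ z : Gs ⊗[ℂ] Gs, ((κs : Gs) ⊗ₜ[ℂ] (κs : Gs)) * z =
        z * ((κs : Gs) ⊗ₜ[ℂ] (κs : Gs)) := by
      intro z
      induction z using TensorProduct.induction_on with
      | zero => simp
      | add x y hx hy => rw [mul_add, add_mul, hx, hy]
      | tmul x y => simp [P.comm]
    calc _ = flipA Gs (D.Finv x) * (Rm Gs * comulA Gs (κs : Gs)) * D.F x := by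
          simp only [mul_assoc, F_mul_Finv_assoc]
      _ = _ := by rw [hZ]; simp only [← mul_assoc, hc (flipA Gs (D.Finv x))]

end SiteRoots

@[simp] lemma _root_.LatticeGauge.sw_sc {T m n : Type*} [Ring T] [Algebra ℂ T] [Fintype m]
    [DecidableEq m] [Fintype n] [DecidableEq n] (t : T) :
    sw T m n (sc T (m × n) t) = sc T (n × m) t := by
  ext p q
  rw [sw_apply, sc_apply, sc_apply]
  simp only [Prod.swap_inj]

/-! ### Operator products in terms of the coproduct -/

section OperatorProducts

variable {T : Type*} [Ring T] [Algebra ℂ T]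

/-- `∑ (τ^I ⊗ τ^J)(Δ(E^K_{ab})) Y^K_{ab}`. -/
def dup (Y : ∀ K, Matrix (D.Idx K) (D.Idx K) T) (I J : Lab) :
    Matrix (D.Idx I × D.Idx J) (D.Idx I × D.Idx J) T :=
  ∑ K, ∑ a, ∑ b, cm T (D.gsTens I J (comulA Gs (D.V.E K a b))) * sc T _ (Y K a b)

variable {D}

lemma dup_mul (Y Z : ∀ K, Matrix (D.Idx K) (D.Idx K) T) (I J : Lab) :
    D.dup Y I J * D.dup Z I J = D.dup (fun K => Y K * Z K) I J := by
  simp only [dup, Finset.sum_mul]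
  refine Finset.sum_congr rfl fun K _ => ?_
  refine Finset.sum_congr rfl fun a _ => ?_
  have h : ∀ b, cm T (D.gsTens I J (comulA Gs (D.V.E K a b))) * sc T _ (Y K a b) *
      (∑ L, ∑ c, ∑ d, cm T (D.gsTens I J (comulA Gs (D.V.E L c d))) * sc T _ (Z L c d)) =
      ∑ d, cm T (D.gsTens I J (comulA Gs (D.V.E K a d))) * sc T _ (Y K a b * Z K b d) := by
    intro b
    have key : ∀ L c d, cm T (D.gsTens I J (comulA Gs (D.V.E K a b))) * sc T _ (Y K a b) *
        (cm T (D.gsTens I J (comulA Gs (D.V.E L c d))) * sc T _ (Z L c d)) =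
        cm T (D.gsTens I J (comulA Gs (D.V.E K a b * D.V.E L c d))) *
          sc T _ (Y K a b * Z L c d) := by
      intro L c d
      rw [mul_assoc, ← mul_assoc (sc T _ _), sc_mul_cm, map_mul, map_mul, cm_mul, map_mul]
      simp only [mul_assoc]
    rw [Finset.mul_sum, Finset.sum_eq_single K]
    · rw [Finset.mul_sum, Finset.sum_eq_single b]
      · rw [Finset.mul_sum]
        exact Finset.sum_congr rfl fun d _ => by rw [key, D.V.E_mul_E, if_pos rfl]
      · intro c _ hc
        rw [Finset.mul_sum]
        exact Finset.sum_eq_zero fun d _ => by rw [key, D.V.E_mul_E, if_neg hc.symm]; simp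
      · simp
    · intro L _ hL
      rw [Finset.mul_sum]
      refine Finset.sum_eq_zero fun c _ => ?_
      rw [Finset.mul_sum]
      exact Finset.sum_eq_zero fun d _ => by rw [key, D.V.E_mul_E_ne hL.symm]; simp
    · simp
  simp only [h]
  rw [Finset.sum_comm]
  refine Finset.sum_congr rfl fun d _ => ?_
  rw [← Finset.mul_sum, ← map_sum, ← Matrix.mul_apply]

/-- `dup` of a family of scalar matrices coming from `ξ ∈ G_*`. -/
lemma dup_rep (ξ : Gs) (I J : Lab) : D.dup (fun K => cm T (D.V.rho K ξ)) I J =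
    cm T (D.gsTens I J (comulA Gs ξ)) := by
  conv_rhs => rw [D.V.sum_E ξ]
  simp only [dup, map_sum, map_smul, cm_sum, cm_smul]
  refine Finset.sum_congr rfl fun K _ => Finset.sum_congr rfl fun a _ =>
    Finset.sum_congr rfl fun b _ => ?_
  rw [cm_apply, D.V.rho_apply, AlgHom.commutes, ← Algebra.commutes, Algebra.smul_def]

@[simp] lemma dup_one (I J : Lab) : D.dup (fun K => (1 : Matrix _ _ T)) I J = 1 := by
  have := dup_rep (D := D) (T := T) 1 I J
  simpa using this

lemma rep_mul_dup (ξ : Gs) (Y : ∀ K, Matrix (D.Idx K) (D.Idx K) T) (I J : Lab) :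
    cm T (D.gsTens I J (comulA Gs ξ)) * D.dup Y I J =
      D.dup (fun K => cm T (D.V.rho K ξ) * Y K) I J := by
  rw [← dup_rep, dup_mul]

lemma Rm_mul_dup (Y : ∀ K, Matrix (D.Idx K) (D.Idx K) T) (I J : Lab) :
    cm T (D.gsTens I J (Rm Gs)) * D.dup Y I J =
      sw T _ _ (D.dup Y J I) * cm T (D.gsTens I J (Rm Gs)) := by
  simp only [dup, map_sum, Finset.mul_sum, Finset.sum_mul, map_mul, sw_cm, sw_tens2]
  refine Finset.sum_congr rfl fun K _ => Finset.sum_congr rfl fun a _ =>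
    Finset.sum_congr rfl fun b _ => ?_
  rw [← mul_assoc, ← cm_mul, ← map_mul, Rm_comul, map_mul, cm_mul, mul_assoc, ← sc_mul_cm,
    ← mul_assoc, sw_sc]

lemma sum_cm_mul_sc {k : Type*} [Fintype k] [DecidableEq k] (M : Matrix k k T) :
    M = ∑ a, ∑ b, cm T (Matrix.single a b (1 : ℂ)) * sc T k (M a b) := by
  ext i j
  simp only [Matrix.sum_apply, mul_sc_apply, cm_apply, Matrix.single_apply]
  rw [Finset.sum_eq_single i, Finset.sum_eq_single j]
  · simp
  · intro b _ hb; simp [hb]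
  · simp
  · intro a _ ha; exact Finset.sum_eq_zero fun b _ => by simp [ha]
  · simp

variable (D) in
/-- `J_x = (R' F_x')⁻¹`. -/
def cotwist (x : X) : Gs ⊗[ℂ] Gs := flipA Gs (D.Finv x) * flipA Gs (RmInv Gs)

variable (D) in
/-- `R' F_x'`. -/
def cotwistInv (x : X) : Gs ⊗[ℂ] Gs := flipA Gs (Rm Gs) * flipA Gs (D.F x)

@[simp] lemma cotwist_mul_inv (x : X) : D.cotwist x * D.cotwistInv x = 1 := by
  rw [cotwist, cotwistInv, mul_assoc, ← mul_assoc (flipA Gs (RmInv Gs)), ← map_mul, RmInv_mul_Rm,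
    map_one, one_mul, flipA_Finv_mul]

@[simp] lemma cotwistInv_mul (x : X) : D.cotwistInv x * D.cotwist x = 1 := by
  rw [cotwist, cotwistInv, mul_assoc, ← mul_assoc (flipA Gs (D.F x)), flipA_F_mul, one_mul,
    ← map_mul, Rm_mul_RmInv, map_one]

variable (D) in
/-- The operator product expansion of matrices `U^I` transforming under `𝒢_x` (first index) and
`𝒢_y` (second index). -/
def IsOpe (x y : X) (U : ∀ I, Matrix (D.Idx I) (D.Idx I) T) : Prop :=
  ∀ I J, e1 T _ _ (U I) * e2 T _ _ (U J) =
    ∑ K, ∑ m, cm T (D.siteCG x I J K m)ᴴ * U K * cm T (D.siteCG y I J K m)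

variable {κ : Lab → ℂ} {κs : Gsˣ} (H : D.HasRoots κ κs)
include H

lemma sum_siteCG (x y : X) (I J K : Lab) (Y : Matrix (D.Idx K) (D.Idx K) T) :
    ∑ m, cm T (D.siteCG x I J K m)ᴴ * Y * cm T (D.siteCG y I J K m) =
      (κ I * κ J / κ K) • (cm T (D.gsTens I J (D.cotwist x)) *
        (∑ a, ∑ b, cm T (D.gsTens I J (comulA Gs (D.V.E K a b))) * sc T _ (Y a b)) *
        cm T (D.gsTens I J (D.F y))) := by
  have h1 : ∀ a b, ∑ m, (D.siteCG x I J K m)ᴴ * Matrix.single a b (1 : ℂ) * D.siteCG y I J K m =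
      (κ I * κ J / κ K) • (D.gsTens I J (D.cotwist x) * D.gsTens I J (comulA Gs (D.V.E K a b)) *
        D.gsTens I J (D.F y)) := by
    intro a b
    have := ClebschGordan.sum_conjTranspose_mul_rep_mul H.pos H.ne_zero I J K (D.V.E K a b)
      fun L hL => D.V.rep_E_ne hL a b
    rw [D.V.rep_E] at this
    simp only [siteCG_conjTranspose]
    simp only [siteCG_eq, cotwist]
    calc _ = D.gsTens I J (flipA Gs (D.Finv x)) *
          (∑ m, (D.cg.C I J K m)ᴴ * Matrix.single a b (1 : ℂ) * D.cg.C I J K m) *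
          D.gsTens I J (D.F y) := by
          simp only [Matrix.mul_sum, Matrix.sum_mul, Matrix.mul_assoc]
      _ = _ := by
          rw [this]
          simp only [map_mul, Matrix.mul_smul, Matrix.smul_mul, Matrix.mul_assoc]
  calc _ = ∑ a, ∑ b, cm T (∑ m, (D.siteCG x I J K m)ᴴ * Matrix.single a b (1 : ℂ) *
        D.siteCG y I J K m) * sc T _ (Y a b) := by
        simp only [cm_sum, cm_mul, Finset.sum_mul]
        rw [Finset.sum_congr rfl fun a _ => Finset.sum_comm, Finset.sum_comm]
        refine Finset.sum_congr rfl fun m _ => ?_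
        conv_lhs => rw [sum_cm_mul_sc Y]
        simp only [Finset.mul_sum, Finset.sum_mul, Matrix.mul_sum, Matrix.sum_mul]
        refine Finset.sum_congr rfl fun a _ => Finset.sum_congr rfl fun b _ => ?_
        simp only [Matrix.mul_assoc, sc_mul_cm]
    _ = _ := by
        simp only [h1, cm_smul, cm_mul, Finset.smul_sum, Finset.mul_sum, Finset.sum_mul]
        refine Finset.sum_congr rfl fun a _ => Finset.sum_congr rfl fun b _ => ?_
        simp only [mul_assoc, smul_mul_assoc, mul_smul_comm, sc_mul_cm]

/-- The operator product expansion in terms of the coproduct. -/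
theorem isOpe_iff (x y : X) (U : ∀ I, Matrix (D.Idx I) (D.Idx I) T) :
    D.IsOpe x y U ↔ ∀ I J, e1 T _ _ (U I) * e2 T _ _ (U J) =
      (κ I * κ J) • (cm T (D.gsTens I J (D.cotwist x)) * D.dup (fun K => (κ K)⁻¹ • U K) I J *
        cm T (D.gsTens I J (D.F y))) := by
  refine forall_congr' fun I => forall_congr' fun J => ?_
  simp only [sum_siteCG H]
  suffices h : ∑ K, (κ I * κ J / κ K) • (cm T (D.gsTens I J (D.cotwist x)) *
        (∑ a, ∑ b, cm T (D.gsTens I J (comulA Gs (D.V.E K a b))) * sc T _ (U K a b)) *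
        cm T (D.gsTens I J (D.F y))) = (κ I * κ J) • (cm T (D.gsTens I J (D.cotwist x)) *
        D.dup (fun K => (κ K)⁻¹ • U K) I J * cm T (D.gsTens I J (D.F y))) by rw [h]
  simp only [dup, Finset.mul_sum, Finset.sum_mul, Finset.smul_sum]
  refine Finset.sum_congr rfl fun K _ => Finset.sum_congr rfl fun a _ =>
    Finset.sum_congr rfl fun b _ => ?_
  rw [Matrix.smul_apply, map_smul, mul_smul_comm, mul_smul_comm, smul_mul_assoc, smul_smul,
    div_eq_mul_inv]

end OperatorProducts

end GaugeData

namespace GaugeData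

variable {X : Type*} {Γ : SimpleGraph X} {Gs : Type u}
    [Ring Gs] [HopfAlgebra ℂ Gs] [StarRing Gs] [StarModule ℂ Gs] [RibbonHopfStarAlgebra Gs]
    {𝒢 : X → Type*}
    [∀ x, Ring (𝒢 x)] [∀ x, HopfAlgebra ℂ (𝒢 x)] [∀ x, StarRing (𝒢 x)]
    [∀ x, StarModule ℂ (𝒢 x)] [∀ x, RibbonHopfStarAlgebra (𝒢 x)]
    {Lab : Type*} {D : GaugeData Γ Gs 𝒢 Lab}
    [IsSemisimpleRing Gs] [Fintype Lab]
    {T : Type*} [Ring T] [Algebra ℂ T]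
    {κ : Lab → ℂ} {κs : Gsˣ}

section Consequences

variable (H : D.HasRoots κ κs) {x y : X} {U V : ∀ I, Matrix (D.Idx I) (D.Idx I) T}
include H

lemma IsOpe.eq (hU : D.IsOpe x y U) (I J : Lab) : e1 T _ _ (U I) * e2 T _ _ (U J) =
      (κ I * κ J) • (cm T (D.gsTens I J (D.cotwist x)) * D.dup (fun K => (κ K)⁻¹ • U K) I J *
        cm T (D.gsTens I J (D.F y))) := (isOpe_iff H x y U).mp hU I J

lemma IsOpe.eq_flip (hU : D.IsOpe x y U) (I J : Lab) : e2 T _ _ (U J) * e1 T _ _ (U I) =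
      (κ I * κ J) • (cm T (D.gsTens I J (flipA _ (D.cotwist x))) *
        sw T _ _ (D.dup (fun K => (κ K)⁻¹ • U K) J I) *
        cm T (D.gsTens I J (flipA _ (D.F y)))) := by
  have := congrArg (sw T _ _) (hU.eq H J I)
  rw [map_mul, sw_e1, sw_e2, map_smul, map_mul, map_mul, sw_cm, sw_cm, sw_tens2, sw_tens2] at this
  rw [this, mul_comm (κ I)]

/-- `R_x' U₁ U₂ = U₂ U₁ R_y`. -/
lemma IsOpe.exchange (hU : D.IsOpe x y U) (I J : Lab) :
    cm T (D.siteTens x I J (flipA _ (Rm _))) * (e1 T _ _ (U I) * e2 T _ _ (U J)) =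
      e2 T _ _ (U J) * e1 T _ _ (U I) * cm T (D.siteTens y I J (Rm _)) := by
  rw [hU.eq H, hU.eq_flip H, siteTens_eq, siteTens_eq, iso₂_flipA, mul_smul_comm, smul_mul_assoc]
  congr 1
  have h1 : D.iso₂ x (Rm _) * flipA _ (D.cotwist x) = flipA _ (D.Finv x) := by
    rw [iso₂_Rm, cotwist, map_mul, flipA_flipA, flipA_flipA]
    calc _ = flipA _ (D.Finv x) * (Rm Gs * (D.F x * D.Finv x) * RmInv Gs) := by
          simp only [mul_assoc]
      _ = _ := by simp
  have h1' : flipA _ (D.iso₂ x (Rm _)) * D.cotwist x = D.Finv x := by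
    have := congrArg (flipA Gs) h1
    rwa [map_mul, flipA_flipA, flipA_flipA] at this
  have h2 : flipA _ (D.cotwist x) * Rm Gs = D.Finv x := by
    rw [cotwist, map_mul, flipA_flipA, flipA_flipA, mul_assoc, RmInv_mul_Rm, mul_one]
  rw [← mul_assoc, ← mul_assoc, ← cm_mul, ← map_mul, h1', mul_assoc (_ * _) (cm T _) (cm T _),
    ← cm_mul, ← map_mul, flipA_F_mul_Rm, map_mul, cm_mul, ← mul_assoc, mul_assoc _ (sw T _ _ _),
    ← Rm_mul_dup, ← mul_assoc, ← cm_mul, ← map_mul, h2]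

lemma smul_gsTens_flip_RmInv (I J : Lab) :
    (κ I * κ J * (κ I * κ J)) • D.gsTens I J (flipA _ (RmInv Gs)) =
      D.gsTens I J (Rm Gs * comulA Gs (rib Gs)) := by
  have h : flipA _ (RmInv Gs) * (rib Gs ⊗ₜ[ℂ] rib Gs) = Rm Gs * comulA Gs (rib Gs) := by
    rw [← comul_rib, mul_assoc (flipA Gs _), ← mul_assoc (flipA Gs _), ← map_mul, RmInv_mul_Rm,
      map_one, one_mul]
  rw [← h, map_mul, tens2_tmul, D.V.rho_apply, D.V.rho_apply, H.sq, H.sq, map_smul, map_smul,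
    map_one, map_one, smul_mul_smul_comm, mul_one, mul_smul_comm, mul_one]
  congr 1; ring

/-- The inverse matrices satisfy the operator product expansion of the reversed link. -/
lemma IsOpe.inv (hU : D.IsOpe x y U) (hVU : ∀ I, V I * U I = 1) (hUV : ∀ I, U I * V I = 1) :
    D.IsOpe y x V := by
  rw [isOpe_iff H]
  intro I J
  set W := (κ I * κ J) • (cm T (D.gsTens I J (D.cotwist y)) * D.dup (fun K => (κ K)⁻¹ • V K) I J *
        cm T (D.gsTens I J (D.F x))) with hW
  have h1 : e2 T _ _ (U J) * e1 T _ _ (U I) * W = 1 := by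
    have h2 : flipA Gs (D.F y) * D.cotwist y = flipA _ (RmInv Gs) := by
      rw [cotwist, ← mul_assoc, flipA_F_mul, one_mul]
    have h3 : flipA Gs (D.cotwist x) * Rm Gs = D.Finv x := by
      rw [cotwist, map_mul, flipA_flipA, flipA_flipA, mul_assoc, RmInv_mul_Rm, mul_one]
    have h4 : (κ I * κ J * (κ I * κ J)) • (sw T _ _ (D.dup (fun K => (κ K)⁻¹ • U K) J I) *
        (cm T (D.gsTens I J (flipA _ (RmInv Gs))) * D.dup (fun K => (κ K)⁻¹ • V K) I J)) =
        cm T (D.gsTens I J (Rm Gs)) := by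
      rw [← mul_smul_comm, ← smul_mul_assoc, ← cm_smul, smul_gsTens_flip_RmInv H, map_mul, cm_mul,
        mul_assoc (cm T _), rep_mul_dup, ← mul_assoc, ← Rm_mul_dup, mul_assoc, dup_mul]
      have h5 : (fun K => (κ K)⁻¹ • U K * (cm T (D.V.rho K (rib Gs)) * (κ K)⁻¹ • V K)) =
          fun K => (1 : Matrix (D.Idx K) (D.Idx K) T) := by
        funext K
        have := H.ne_zero K
        rw [D.V.rho_apply, H.sq, cm_smul, cm_one, smul_mul_smul_comm, one_mul, smul_mul_smul_comm,
          hUV, show (κ K)⁻¹ * (κ K ^ 2 * (κ K)⁻¹) = 1 by field_simp, one_smul]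
      rw [h5, dup_one, mul_one]
    rw [hU.eq_flip H, hW, smul_mul_smul_comm]
    calc _ = cm T (D.gsTens I J (flipA _ (D.cotwist x))) * ((κ I * κ J * (κ I * κ J)) •
          (sw T _ _ (D.dup (fun K => (κ K)⁻¹ • U K) J I) *
          (cm T (D.gsTens I J (flipA _ (D.F y) * D.cotwist y)) *
            D.dup (fun K => (κ K)⁻¹ • V K) I J))) * cm T (D.gsTens I J (D.F x)) := by
          simp only [map_mul, cm_mul, mul_smul_comm, smul_mul_assoc, mul_assoc]
      _ = 1 := by
          rw [h2, h4, ← cm_mul, ← map_mul, h3, ← cm_mul, ← map_mul, Finv_mul_F, map_one, cm_one]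
  calc e1 T _ _ (V I) * e2 T _ _ (V J) = e1 T _ _ (V I) * e2 T _ _ (V J) *
        (e2 T _ _ (U J) * e1 T _ _ (U I) * W) := by rw [h1, mul_one]
    _ = e1 T _ _ (V I) * (e2 T _ _ (V J) * e2 T _ _ (U J)) * e1 T _ _ (U I) * W := by
        simp only [mul_assoc]
    _ = W := by rw [← map_mul, hVU, map_one, mul_one, ← map_mul, hVU, map_one, one_mul]

omit H [IsSemisimpleRing Gs] [Fintype Lab] in
lemma idx_triv_eq (a b : D.Idx D.V.triv) : a = b := by
  have : Subsingleton (Fin (D.V.dim D.V.triv)) := by rw [D.V.dim_triv]; infer_instance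
  exact Subsingleton.elim a b

omit H in
lemma counit_E (K : Lab) (a b : D.Idx K) [Decidable (K = D.V.triv)] :
    Coalgebra.counit (R := ℂ) (D.V.E K a b) = if K = D.V.triv then 1 else 0 := by
  let o : D.Idx D.V.triv := ⟨0, D.V.dim_pos _⟩
  have h := congrFun (congrFun (D.V.τ_triv (D.V.E K a b)) o) o
  simp only [Matrix.smul_apply, Matrix.one_apply_eq, smul_eq_mul, mul_one] at h
  rw [← h]
  split_ifs with hK
  · subst hK
    rw [D.V.rep_E, idx_triv_eq a o, idx_triv_eq b o]; simp
  · rw [D.V.rep_E_ne (Ne.symm hK)]; rfl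

omit H [IsSemisimpleRing Gs] [Fintype Lab] in
lemma gsTens_triv (z : Gs ⊗[ℂ] Gs) : D.gsTens D.V.triv D.V.triv z =
    Coalgebra.counit (R := ℂ) (counitLeftA Gs z) • 1 := by
  induction z using TensorProduct.induction_on with
  | zero => simp
  | add x y hx hy => rw [map_add, hx, hy, map_add, map_add, add_smul]
  | tmul x y => simp [tens2_tmul, D.V.τ_triv, smul_smul, mul_comm]

omit H [IsSemisimpleRing Gs] [Fintype Lab] in
@[simp] lemma counitLeftA_F (x : X) : counitLeftA Gs (D.F x) = 1 := (D.twist x).F_counit_left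

omit H [IsSemisimpleRing Gs] [Fintype Lab] in
@[simp] lemma counitRightA_F (x : X) : counitRightA Gs (D.F x) = 1 := (D.twist x).F_counit_right

omit H [IsSemisimpleRing Gs] [Fintype Lab] in
@[simp] lemma counitRightA_Finv (x : X) : counitRightA Gs (D.Finv x) = 1 := by
  have : counitRightA Gs (D.F x * D.Finv x) = 1 := by rw [F_mul_Finv, map_one]
  rwa [map_mul, counitRightA_F, one_mul] at this

/-- The matrix of the trivial representation is the unit. -/
lemma IsOpe.triv_eq_one (hU : D.IsOpe x y U) (hVU : V D.V.triv * U D.V.triv = 1) :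
    U D.V.triv = 1 := by
  classical
  let o : D.Idx D.V.triv := ⟨0, D.V.dim_pos _⟩
  have h := congrFun (congrFun (hU.eq H D.V.triv D.V.triv) (o, o)) (o, o)
  rw [e1_mul_e2_apply, gsTens_triv, gsTens_triv, cotwist, map_mul, counitLeftA_flipA,
    counitLeftA_flipA, counitRightA_Finv, counitRightA_RmInv, counitLeftA_F, H.triv, mul_one,
    mul_one, one_smul, Bialgebra.counit_one, one_smul, cm_one, one_mul, mul_one] at h
  have h2 : D.dup (fun K => (κ K)⁻¹ • U K) D.V.triv D.V.triv (o, o) (o, o) = U D.V.triv o o := by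
    have hval : ∀ K a b, (cm T (D.gsTens D.V.triv D.V.triv (comulA Gs (D.V.E K a b))) *
        sc T (D.Idx D.V.triv × D.Idx D.V.triv) (((κ K)⁻¹ • U K) a b)) (o, o) (o, o) =
        if K = D.V.triv then ((κ K)⁻¹ • U K) a b else 0 := by
      intro K a b
      rw [mul_sc_apply, gsTens_triv, Bialgebra.comulAlgHom_apply, counitLeftA_comul, counit_E, cm_smul, cm_one,
        Matrix.smul_apply, Matrix.one_apply_eq]
      split_ifs <;> simp
    simp only [dup, Matrix.sum_apply, hval]
    rw [Finset.sum_eq_single D.V.triv]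
    · rw [Finset.sum_eq_single o, Finset.sum_eq_single o]
      · simp [H.triv]
      · intro b _ hb; exact absurd (idx_triv_eq b o) hb
      · simp
      · intro b _ hb; exact absurd (idx_triv_eq b o) hb
      · simp
    · intro K _ hK; simp [hK]
    · simp
  rw [h2] at h
  have h3 : U D.V.triv * U D.V.triv = U D.V.triv := by
    ext a b
    rw [idx_triv_eq a o, idx_triv_eq b o, Matrix.mul_apply, Finset.sum_eq_single o]
    · exact h
    · intro b _ hb; exact absurd (idx_triv_eq b o) hb
    · simp
  calc U D.V.triv = V D.V.triv * U D.V.triv * U D.V.triv := by rw [hVU, one_mul]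
    _ = 1 := by rw [mul_assoc, h3, hVU]

end Consequences

/-! ### Matrix form of the relations on the lattice -/

/-- Matrices over `T` satisfying the relations of a quantum lattice connection. -/
structure IsConnection (D : GaugeData Γ Gs 𝒢 Lab)
    (U : ∀ (I : Lab) (_ : Γ.Dart), Matrix (D.Idx I) (D.Idx I) T) : Prop where
  ope : ∀ i : Γ.Dart, D.IsOpe i.fst i.snd fun I => U I i
  inv : ∀ I (i : Γ.Dart), U I i * U I i.symm = 1
  braid : ∀ (I J) (i j : Γ.Dart) (h : i.snd = j.snd)
    (_ : (D.order j.snd).lt ⟨i, h⟩ ⟨j, rfl⟩),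
    e1 T _ _ (U I i) * e2 T _ _ (U J j) =
      e2 T _ _ (U J j) * e1 T _ _ (U I i) * cm T (D.siteTens j.snd I J (Rm _))
  comm : ∀ (I J) (i j : Γ.Dart) (_ : i.fst ≠ j.fst) (_ : i.fst ≠ j.snd)
    (_ : i.snd ≠ j.fst) (_ : i.snd ≠ j.snd),
    e1 T _ _ (U I i) * e2 T _ _ (U J j) = e2 T _ _ (U J j) * e1 T _ _ (U I i)

section Presentation

variable {A : Type*} [Ring A] [Algebra ℂ A] (φ : A →ₐ[ℂ] T)
  (U : ∀ (I : Lab), Γ.Dart → D.Idx I → D.Idx I → A)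

lemma ope_entry (W : ∀ I, Matrix (D.Idx I) (D.Idx I) T) (i : Γ.Dart) (I J : Lab)
    (a b : D.Idx I) (c d : D.Idx J) :
    (∑ K, ∑ m, cm T (D.siteCG i.fst I J K m)ᴴ * W K * cm T (D.siteCG i.snd I J K m)) (a, c) (b, d) =
      ∑ K, ∑ m : Fin (D.cg.N I J K), ∑ e : D.Idx K, ∑ f : D.Idx K,
          D.linkCG i I J K m (e, f) (a, b) (c, d) • W K e f := by
  simp only [Matrix.sum_apply]
  refine Finset.sum_congr rfl fun K _ => Finset.sum_congr rfl fun m _ => ?_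
  rw [mul_cm_apply, Finset.sum_comm]
  refine Finset.sum_congr rfl fun f _ => ?_
  rw [cm_mul_apply, Finset.smul_sum]
  refine Finset.sum_congr rfl fun e _ => ?_
  rw [smul_smul, linkCG]
  rfl

lemma braid_entry {m n : Type*} [Fintype m] [DecidableEq m] [Fintype n] [DecidableEq n]
    (P : Matrix m m T) (Q : Matrix n n T) (M : Matrix (m × n) (m × n) ℂ) (p q : m × n) :
    (e2 T m n Q * e1 T m n P * cm T M) p q =
      ∑ b, ∑ d, M (b, d) q • (Q p.2 d * P p.1 b) := by
  rw [mul_cm_apply, Fintype.sum_prod_type]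
  simp only [e2_mul_e1_apply]

/-- A matrix family satisfying the relations gives a homomorphism respecting `LinkRel`. -/
lemma IsConnection.map_eq
    (hU : D.IsConnection fun I i => Matrix.of fun a b => φ (U I i a b)) {f g : A}
    (h : D.LinkRel U f g) : φ f = φ g := by
  cases h with
  | ope I J i a b c d =>
    have := congrFun (congrFun (hU.ope i I J) (a, c)) (b, d)
    rw [e1_mul_e2_apply, ope_entry] at this
    simp only [map_mul, map_sum, map_smul]
    exact this
  | inv I i a c =>
    have := congrFun (congrFun (hU.inv I i) a) c
    rw [Matrix.mul_apply] at this
    simp only [map_mul, map_sum]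
    rw [Matrix.one_apply] at this
    refine this.trans ?_
    split_ifs <;> simp
  | braid I J i j h hlt a b c d =>
    have := congrFun (congrFun (hU.braid I J i j h hlt) (a, c)) (b, d)
    rw [e1_mul_e2_apply, braid_entry] at this
    simp only [tens2_apply] at this
    simp only [map_mul, map_sum, map_smul]
    exact this
  | comm I J i j h₁ h₂ h₃ h₄ a b c d =>
    have := congrFun (congrFun (hU.comm I J i j h₁ h₂ h₃ h₄) (a, c)) (b, d)
    rw [e1_mul_e2_apply, e2_mul_e1_apply] at this
    rw [map_mul, map_mul]
    exact this

/-- A homomorphism respecting `LinkRel` gives a matrix family satisfying the relations. -/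
lemma isConnection_of (h : ∀ {f g : A}, D.LinkRel U f g → φ f = φ g) :
    D.IsConnection fun I i => Matrix.of fun a b => φ (U I i a b) where
  ope i I J := by
    ext ⟨a, c⟩ ⟨b, d⟩
    have := h (LinkRel.ope I J i a b c d)
    simp only [map_mul, map_sum, map_smul] at this
    rw [e1_mul_e2_apply, ope_entry]
    exact this
  inv I i := by
    ext a c
    have := h (LinkRel.inv I i a c)
    simp only [map_mul, map_sum] at this
    rw [Matrix.mul_apply, Matrix.one_apply]
    refine Eq.trans this ?_
    split_ifs <;> simp
  braid I J i j h' hlt := by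
    ext ⟨a, c⟩ ⟨b, d⟩
    have := h (LinkRel.braid I J i j h' hlt a b c d)
    simp only [map_mul, map_sum, map_smul] at this
    rw [e1_mul_e2_apply, braid_entry]
    simp only [tens2_apply]
    exact this
  comm I J i j h₁ h₂ h₃ h₄ := by
    ext ⟨a, c⟩ ⟨b, d⟩
    have := h (LinkRel.comm I J i j h₁ h₂ h₃ h₄ a b c d)
    simp only [map_mul] at this
    rw [e1_mul_e2_apply, e2_mul_e1_apply]
    exact this

end Presentation

end GaugeData

/-! ### The dual of a Hopf algebra with twisted product -/

section TwistedDual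

variable {G : Type*} [Ring G] [HopfAlgebra ℂ G]

variable (G) in
/-- `a ⊗ b ⊗ c ↦ a S(b) c`. -/
def mulMidSA : G ⊗[ℂ] (G ⊗[ℂ] G) →ₗ[ℂ] G :=
  LinearMap.mul' ℂ G ∘ₗ TensorProduct.map LinearMap.id
    (LinearMap.mul' ℂ G ∘ₗ TensorProduct.map (SA G) LinearMap.id)

@[simp] lemma mulMidSA_tmul (a b c : G) : mulMidSA G (a ⊗ₜ (b ⊗ₜ c)) = a * (SA G b * c) := rfl

variable (G) in
/-- `a ⊗ b ↦ S(a) b`. -/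
def mulSAId : G ⊗[ℂ] G →ₗ[ℂ] G :=
  LinearMap.mul' ℂ G ∘ₗ TensorProduct.map (SA G) LinearMap.id

@[simp] lemma mulSAId_tmul (a b : G) : mulSAId G (a ⊗ₜ b) = SA G a * b := rfl

/-- A normalized invertible 2-cocycle `F` with inverse `F'`. -/
structure IsTwist (F Fi : G ⊗[ℂ] G) : Prop where
  mul_inv : F * Fi = 1
  inv_mul : Fi * F = 1
  cocycle : comulLeftA G F * leg12A G F = comulRightA G F * leg23A G F
  counit_left : counitLeftA G F = 1
  counit_right : counitRightA G F = 1

lemma IsTwist.inv_cocycle {F Fi : G ⊗[ℂ] G} (h : IsTwist F Fi) :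
    leg12A G Fi * comulLeftA G Fi = leg23A G Fi * comulRightA G Fi := by
  have h1 : leg12A G Fi * comulLeftA G Fi * (comulLeftA G F * leg12A G F) = 1 := by
    rw [mul_assoc, ← mul_assoc (comulLeftA G Fi), ← map_mul, h.inv_mul, map_one, one_mul, ← map_mul,
      h.inv_mul, map_one]
  have h2 : comulLeftA G F * leg12A G F * (leg23A G Fi * comulRightA G Fi) = 1 := by
    rw [h.cocycle, mul_assoc, ← mul_assoc (leg23A G F), ← map_mul, h.mul_inv, map_one, one_mul,
      ← map_mul, h.mul_inv, map_one]
  exact left_inv_eq_right_inv h1 h2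

lemma IsTwist.counit_left_inv {F Fi : G ⊗[ℂ] G} (h : IsTwist F Fi) : counitLeftA G Fi = 1 := by
  have := congrArg (counitLeftA G) h.mul_inv
  rwa [map_mul, h.counit_left, one_mul, map_one] at this

lemma IsTwist.counit_right_inv {F Fi : G ⊗[ℂ] G} (h : IsTwist F Fi) : counitRightA G Fi = 1 := by
  have := congrArg (counitRightA G) h.mul_inv
  rwa [map_mul, h.counit_right, one_mul, map_one] at this

/-- `∑ f̄¹ S(f̄²) S(f¹) f² = 1`. -/
lemma IsTwist.mulIdSA_mul_mulSAId {F Fi : G ⊗[ℂ] G} (h : IsTwist F Fi) :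
    mulIdSA G Fi * mulSAId G F = 1 := by
  have h1 : comulRightA G Fi * comulLeftA G F = leg23A G F * leg12A G Fi := by
    calc _ = comulRightA G Fi * (comulLeftA G F * leg12A G F) * leg12A G Fi := by
          rw [mul_assoc, mul_assoc, ← map_mul, h.mul_inv, map_one, mul_one]
      _ = _ := by
          rw [h.cocycle, ← mul_assoc, ← map_mul, h.inv_mul, map_one, one_mul]
  have h2 : ∀ X Y : G ⊗[ℂ] G, mulMidSA G (leg23A G X * leg12A G Y) =
      mulIdSA G Y * mulSAId G X := by
    intro X Y
    induction X using TensorProduct.induction_on with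
    | zero => simp
    | add a b ha hb => simp only [map_add, add_mul, mul_add, ha, hb]
    | tmul a b =>
      induction Y using TensorProduct.induction_on with
      | zero => simp
      | add a b ha hb => simp only [map_add, add_mul, mul_add, ha, hb]
      | tmul c d => simp [leg23A_apply, antipode_mul', mul_assoc]
  have h3 : ∀ X Y : G ⊗[ℂ] G, mulMidSA G (comulRightA G X * comulLeftA G Y) =
      counitRightA G X * counitLeftA G Y := by
    intro X Y
    induction X using TensorProduct.induction_on with
    | zero => simp
    | add a b ha hb => simp only [map_add, add_mul, ha, hb]
    | tmul a b =>
      induction Y using TensorProduct.induction_on with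
      | zero => simp
      | add a b ha hb => simp only [map_add, mul_add, ha, hb]
      | tmul c d =>
        have key : ∀ Z W : G ⊗[ℂ] G, mulMidSA G ((a ⊗ₜ[ℂ] Z) *
            TensorProduct.assoc ℂ G G G (W ⊗ₜ d)) = a * (mulIdSA G W * (mulSAId G Z * d)) := by
          intro Z W
          induction Z using TensorProduct.induction_on with
          | zero => simp
          | add z w hz hw => simp only [TensorProduct.tmul_add, map_add, add_mul, mul_add, hz, hw]
          | tmul z w =>
            induction W using TensorProduct.induction_on with
            | zero => simp
            | add p q hp hq =>
              simp only [TensorProduct.add_tmul, map_add, add_mul, mul_add, hp, hq]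
            | tmul p q => simp [antipode_mul', mul_assoc]
        have e1 : mulIdSA G (Coalgebra.comul (R := ℂ) c) = algebraMap ℂ G _ :=
          HopfAlgebra.mul_antipode_lTensor_comul_apply c
        have e2 : mulSAId G (Coalgebra.comul (R := ℂ) b) = algebraMap ℂ G _ :=
          HopfAlgebra.mul_antipode_rTensor_comul_apply b
        rw [comulLeftA_tmul, comulRightA_tmul]
        refine (key _ _).trans ?_
        rw [e1, e2, ← Algebra.smul_def, ← Algebra.smul_def, counitRightA_tmul, counitLeftA_tmul]
        simp
  rw [← h2, ← h1, h3, h.counit_right_inv, h.counit_left, one_mul]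

variable {F Fi K Ki : G ⊗[ℂ] G}

variable (Ki F) in
/-- The operator of left multiplication by `g` in the dual of `G` with the product
`(g · f)(ξ) = (g ⊗ f)(K⁻¹ Δ(ξ) F)`, in transposed form. -/
def lop : (G →ₗ[ℂ] ℂ) →ₗ[ℂ] (Module.End ℂ G)ᵐᵒᵖ where
  toFun g := MulOpposite.op (slice g ∘ₗ LinearMap.mulLeft ℂ Ki ∘ₗ LinearMap.mulRight ℂ F ∘ₗ
    (comulA G).toLinearMap)
  map_add' g h := by
    rw [← MulOpposite.op_add]; congr 1; ext ξ; simp [slice, LinearMap.rTensor_add]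
  map_smul' c g := by
    rw [RingHom.id_apply, ← MulOpposite.op_smul]; congr 1; ext ξ
    simp [slice, LinearMap.rTensor_smul]

lemma unop_lop_apply (g : G →ₗ[ℂ] ℂ) (ξ : G) :
    (lop F Ki g).unop ξ = slice g (Ki * (comulA G ξ * F)) := rfl

variable (Ki F) in
/-- The twisted product of functionals. -/
def conv (g f : G →ₗ[ℂ] ℂ) : G →ₗ[ℂ] ℂ :=
  pair g f ∘ₗ LinearMap.mulLeft ℂ Ki ∘ₗ LinearMap.mulRight ℂ F ∘ₗ (comulA G).toLinearMap

lemma conv_apply (g f : G →ₗ[ℂ] ℂ) (ξ : G) :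
    conv F Ki g f ξ = pair g f (Ki * (comulA G ξ * F)) := rfl

@[simp] lemma slice_tmul (g : G →ₗ[ℂ] ℂ) (a b : G) : slice g (a ⊗ₜ[ℂ] b) = g a • b := rfl
@[simp] lemma pair_tmul (g f : G →ₗ[ℂ] ℂ) (a b : G) : pair g f (a ⊗ₜ[ℂ] b) = g a * f b := rfl

lemma lop_mul (hF : IsTwist F Fi) (hK : IsTwist K Ki) (g f : G →ₗ[ℂ] ℂ) :
    lop F Ki g * lop F Ki f = lop F Ki (conv F Ki g f) := by
  apply MulOpposite.unop_injective
  ext ξ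
  rw [MulOpposite.unop_mul]
  change (lop F Ki f).unop ((lop F Ki g).unop ξ) = _
  rw [unop_lop_apply, unop_lop_apply, unop_lop_apply]
  let sl : G ⊗[ℂ] (G ⊗[ℂ] G) →ₗ[ℂ] G :=
    (TensorProduct.lid ℂ G).toLinearMap ∘ₗ TensorProduct.map g (slice f)
  have hsl : ∀ a w, sl (a ⊗ₜ w) = g a • slice f w := fun _ _ => rfl
  have h1 : ∀ z : G ⊗[ℂ] G, slice f (Ki * (comulA G (slice g z) * F)) =
      sl (leg23A G Ki * (comulRightA G z * leg23A G F)) := by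
    intro z
    induction z using TensorProduct.induction_on with
    | zero => simp
    | add a b ha hb => simp only [map_add, add_mul, mul_add, ha, hb]
    | tmul a b =>
      rw [slice_tmul, map_smul, smul_mul_assoc, mul_smul_comm, map_smul, leg23A_apply, leg23A_apply,
        comulRightA_tmul, Algebra.TensorProduct.tmul_mul_tmul, Algebra.TensorProduct.tmul_mul_tmul,
        hsl, one_mul, mul_one]
      rfl
  have h2 : ∀ z : G ⊗[ℂ] G, sl (leg12A G Ki * (comulLeftA G z * leg12A G F)) =
      slice (conv F Ki g f) z := by
    intro z
    induction z using TensorProduct.induction_on with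
    | zero => simp
    | add a b ha hb => simp only [map_add, add_mul, mul_add, ha, hb]
    | tmul a b =>
      have e : ∀ X Y Z : G ⊗[ℂ] G, sl (leg12A G X * (TensorProduct.assoc ℂ G G G (Y ⊗ₜ b) *
          leg12A G Z)) = pair g f (X * (Y * Z)) • b := by
        intro X Y Z
        have e1 : ∀ W : G ⊗[ℂ] G, sl (TensorProduct.assoc ℂ G G G (W ⊗ₜ b)) = pair g f W • b := by
          intro W
          induction W using TensorProduct.induction_on with
          | zero => simp
          | add p q hp hq => simp only [TensorProduct.add_tmul, map_add, add_smul, hp, hq]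
          | tmul p q => simp [hsl, smul_smul]
        rw [← e1]
        congr 1
        have e2 : ∀ W : G ⊗[ℂ] G, ∀ c, TensorProduct.assoc ℂ G G G (W ⊗ₜ c) =
          (Algebra.TensorProduct.assoc ℂ ℂ ℂ G G G) (W ⊗ₜ c) := fun _ _ => rfl
        have e3 : ∀ W : G ⊗[ℂ] G, leg12A G W = (Algebra.TensorProduct.assoc ℂ ℂ ℂ G G G)
          (W ⊗ₜ 1) := fun _ => rfl
        rw [e2, e2, e3, e3, ← map_mul, ← map_mul, Algebra.TensorProduct.tmul_mul_tmul,
          Algebra.TensorProduct.tmul_mul_tmul, one_mul, mul_one]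
      rw [comulLeftA_tmul, e]
      rfl
  rw [h1, ← h2]
  congr 1
  simp only [map_mul]
  calc _ = leg23A G Ki * comulRightA G Ki * comulRightA G (comulA G ξ) *
        (comulRightA G F * leg23A G F) := by simp only [mul_assoc]
    _ = leg12A G Ki * comulLeftA G Ki * comulLeftA G (comulA G ξ) *
        (comulLeftA G F * leg12A G F) := by
        rw [hF.cocycle, hK.inv_cocycle, comulLeftA_comul]
    _ = _ := by simp only [mul_assoc]

lemma lop_counit (hF : IsTwist F Fi) (hK : IsTwist K Ki) :
    lop F Ki (Coalgebra.counit (R := ℂ) (A := G)) = 1 := by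
  apply MulOpposite.unop_injective
  ext ξ
  rw [unop_lop_apply]
  change counitLeftA G _ = ξ
  rw [map_mul, map_mul, hF.counit_left, hK.counit_left_inv, Bialgebra.comulAlgHom_apply,
    counitLeftA_comul, one_mul, mul_one]

variable {n : Type*} [Fintype n] [DecidableEq n] (τ : G →ₐ[ℂ] Matrix n n ℂ)

variable (F Ki) in
/-- The matrix of operators given by the matrix elements of `τ`. -/
def lopMat : Matrix n n (Module.End ℂ G)ᵐᵒᵖ := Matrix.of fun a b => lop F Ki (ent τ a b)

variable (F Fi K Ki) in
/-- The matrix of operators given by the matrix elements of the contragradient of `τ`. -/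
def lopInv : Matrix n n (Module.End ℂ G)ᵐᵒᵖ := Matrix.of fun a b => lop F Ki
  (ent τ a b ∘ₗ LinearMap.mulLeft ℂ (mulIdSA G Fi) ∘ₗ LinearMap.mulRight ℂ (mulSAId G K) ∘ₗ SA G)

lemma sum_lop_mul (hF : IsTwist F Fi) (hK : IsTwist K Ki) (g f : n → G →ₗ[ℂ] ℂ) (c : ℂ)
    (h : ∀ ξ : G, ∑ b, pair (g b) (f b) (Ki * (comulA G ξ * F)) =
      c * Coalgebra.counit (R := ℂ) ξ) :
    ∑ b, lop F Ki (g b) * lop F Ki (f b) = c • 1 := by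
  rw [← lop_counit hF hK, ← map_smul]
  simp only [lop_mul hF hK]
  rw [← map_sum]
  congr 1
  ext ξ
  simp only [LinearMap.sum_apply, conv_apply, h]
  rfl

lemma mulIdSA_tmul_mul (a b : G) (z : G ⊗[ℂ] G) :
    mulIdSA G (a ⊗ₜ b * z) = a * mulIdSA G z * SA G b := by
  induction z using TensorProduct.induction_on with
  | zero => simp
  | add c d hc hd => rw [mul_add, map_add, hc, hd, map_add, mul_add, add_mul]
  | tmul c d => simp [antipode_mul', mul_assoc]

lemma mulSAId_mul_tmul (a b : G) (z : G ⊗[ℂ] G) :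
    mulSAId G (z * a ⊗ₜ b) = SA G a * mulSAId G z * b := by
  induction z using TensorProduct.induction_on with
  | zero => simp
  | add c d hc hd => rw [add_mul, map_add, hc, hd, map_add, mul_add, add_mul]
  | tmul c d => simp [antipode_mul', mul_assoc]

lemma mulSAId_comul_mul (ξ : G) (z : G ⊗[ℂ] G) : mulSAId G (comulA G ξ * z) =
    Coalgebra.counit (R := ℂ) ξ • mulSAId G z := by
  induction z using TensorProduct.induction_on with
  | zero => simp
  | add a b ha hb => rw [mul_add, map_add, ha, hb, map_add, smul_add]
  | tmul a b =>
    have h : mulSAId G (comulA G ξ) = algebraMap ℂ G (Coalgebra.counit (R := ℂ) ξ) :=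
      HopfAlgebra.mul_antipode_rTensor_comul_apply ξ
    rw [mulSAId_mul_tmul, h, ← Algebra.commutes, mul_assoc, ← Algebra.smul_def, mulSAId_tmul]

/-- The contragradient matrix is a right inverse. -/
lemma lopMat_mul_lopInv (hF : IsTwist F Fi) (hK : IsTwist K Ki) :
    lopMat F Ki τ * lopInv F Fi K Ki τ = 1 := by
  ext a c
  rw [Matrix.mul_apply]
  refine (sum_lop_mul hF hK (fun b => ent τ a b) _ ((1 : Matrix n n ℂ) a c) fun ξ => ?_).trans ?_
  · have h1 : ∀ z : G ⊗[ℂ] G, ∑ b, pair (ent τ a b) (ent τ b c ∘ₗ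
        LinearMap.mulLeft ℂ (mulIdSA G Fi) ∘ₗ LinearMap.mulRight ℂ (mulSAId G K) ∘ₗ SA G) z =
        τ (mulIdSA G (z * Fi) * mulSAId G K) a c := by
      intro z
      induction z using TensorProduct.induction_on with
      | zero => simp
      | add p q hp hq =>
        simp only [map_add, Finset.sum_add_distrib, hp, hq, Matrix.add_apply, add_mul]
      | tmul p q =>
        rw [mulIdSA_tmul_mul, mul_assoc, mul_assoc, map_mul, Matrix.mul_apply]
        rfl
    rw [h1, mul_assoc, mul_assoc, hF.mul_inv, mul_one, mulIdSA_comul_mul, smul_mul_assoc,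
      hK.mulIdSA_mul_mulSAId, map_smul, map_one, Matrix.smul_apply, smul_eq_mul, mul_comm]
  · rw [Matrix.one_apply, Matrix.one_apply]
    split_ifs <;> simp

/-- The contragradient matrix is a left inverse. -/
lemma lopInv_mul_lopMat (hF : IsTwist F Fi) (hK : IsTwist K Ki) :
    lopInv F Fi K Ki τ * lopMat F Ki τ = 1 := by
  ext a c
  rw [Matrix.mul_apply]
  refine (sum_lop_mul hF hK _ (fun b => ent τ b c) ((1 : Matrix n n ℂ) a c) fun ξ => ?_).trans ?_
  · have h1 : ∀ z : G ⊗[ℂ] G, ∑ b, pair (ent τ a b ∘ₗ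
        LinearMap.mulLeft ℂ (mulIdSA G Fi) ∘ₗ LinearMap.mulRight ℂ (mulSAId G K) ∘ₗ SA G)
        (ent τ b c) z = τ (mulIdSA G Fi * mulSAId G (K * z)) a c := by
      intro z
      induction z using TensorProduct.induction_on with
      | zero => simp
      | add p q hp hq =>
        simp only [map_add, Finset.sum_add_distrib, hp, hq, Matrix.add_apply, mul_add]
      | tmul p q =>
        rw [mulSAId_mul_tmul, ← mul_assoc, map_mul, Matrix.mul_apply]
        rfl
    rw [h1, ← mul_assoc K, hK.mul_inv, one_mul, mulSAId_comul_mul, mul_smul_comm,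
      hF.mulIdSA_mul_mulSAId, map_smul, map_one, Matrix.smul_apply, smul_eq_mul, mul_comm]
  · rw [Matrix.one_apply, Matrix.one_apply]
    split_ifs <;> simp

variable (G) in
/-- Right translations as operators on the dual. -/
def rop : G →ₐ[ℂ] (Module.End ℂ G)ᵐᵒᵖ :=
  AlgHom.ofLinearMap
    { toFun := fun a => MulOpposite.op (LinearMap.mulRight ℂ a)
      map_add' := fun a b => by
        rw [← MulOpposite.op_add]; congr 1; ext ξ; simp [mul_add]
      map_smul' := fun c a => by
        rw [RingHom.id_apply, ← MulOpposite.op_smul]; congr 1; ext ξ; simp }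
    (by apply MulOpposite.unop_injective; ext ξ; simp)
    (fun a b => by
      apply MulOpposite.unop_injective; ext ξ
      simp [mul_assoc])

variable (G) in
/-- Left translations, composed with the antipode, as operators on the dual. -/
def slop : G →ₐ[ℂ] (Module.End ℂ G)ᵐᵒᵖ :=
  AlgHom.ofLinearMap
    { toFun := fun a => MulOpposite.op (LinearMap.mulLeft ℂ (SA G a))
      map_add' := fun a b => by
        rw [← MulOpposite.op_add]; congr 1; ext ξ; simp [add_mul]
      map_smul' := fun c a => by
        rw [RingHom.id_apply, ← MulOpposite.op_smul]; congr 1; ext ξ; simp }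
    (by apply MulOpposite.unop_injective; ext ξ; simp [HopfAlgebra.antipode_one])
    (fun a b => by
      apply MulOpposite.unop_injective; ext ξ
      simp [mul_assoc, antipode_mul'])

lemma slice_ent_mul (a b : n) (w z : G ⊗[ℂ] G) :
    slice (ent τ a b) (w * z) = ∑ c, slice (ent τ a c) w * slice (ent τ c b) z := by
  induction w using TensorProduct.induction_on with
  | zero => simp
  | add a b ha hb => simp only [add_mul, map_add, Finset.sum_add_distrib, ha, hb]
  | tmul a b =>
    induction z using TensorProduct.induction_on with
    | zero => simp
    | add c d hc hd => simp only [mul_add, map_add, Finset.sum_add_distrib, hc, hd]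
    | tmul c d =>
      simp only [Algebra.TensorProduct.tmul_mul_tmul, slice_tmul, ent_apply, map_mul,
        Matrix.mul_apply, Finset.sum_smul, smul_mul_smul_comm]

/-- `ρ(a) U = U ((τ ⊗ ρ)(F⁻¹ Δ(a) F))` for right translations `ρ`. -/
lemma rop_mul_lop (hF : IsTwist F Fi) (a : G) :
    sc _ n (rop G a) * lopMat F Ki τ =
      lopMat F Ki τ * Phi τ (rop G) (Fi * comulA G a * F) := by
  ext p q
  rw [sc_mul_apply, Matrix.mul_apply]
  apply MulOpposite.unop_injective
  ext ξ
  rw [MulOpposite.unop_mul, Finset.unop_sum, LinearMap.sum_apply]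
  change slice (ent τ p q) (Ki * (comulA G (ξ * a) * F)) = _
  rw [map_mul (comulA G), show Ki * (comulA G ξ * comulA G a * F) =
    Ki * (comulA G ξ * F) * (Fi * comulA G a * F) by
      simp only [mul_assoc]; rw [← mul_assoc F Fi, hF.mul_inv, one_mul], slice_ent_mul]
  refine Finset.sum_congr rfl fun r _ => ?_
  rw [Phi_apply]
  rfl

variable (K Ki) in
/-- `a ⊗ b ↦ (a ⊗ 1) K⁻¹ Δ(S(b)) K`. -/
def galois : G ⊗[ℂ] G →ₗ[ℂ] G ⊗[ℂ] G :=
  LinearMap.mul' ℂ (G ⊗[ℂ] G) ∘ₗ TensorProduct.map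
    (Algebra.TensorProduct.includeLeft : G →ₐ[ℂ] G ⊗[ℂ] G).toLinearMap
    (LinearMap.mulLeft ℂ Ki ∘ₗ LinearMap.mulRight ℂ K ∘ₗ (comulA G).toLinearMap ∘ₗ SA G)

lemma galois_tmul (a b : G) :
    galois K Ki (a ⊗ₜ b) = a ⊗ₜ 1 * (Ki * (comulA G (SA G b) * K)) := rfl

/-- `((τ ⊗ σ)(w)) U = U σ(a)` for left translations `σ`. -/
lemma Phi_slop_mul_lop (hK : IsTwist K Ki) (a : G) (w : G ⊗[ℂ] G)
    (hw : galois K Ki w = 1 ⊗ₜ SA G a) :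
    Phi τ (slop G) w * lopMat F Ki τ = lopMat F Ki τ * sc _ n (slop G a) := by
  ext p q
  rw [mul_sc_apply, Matrix.mul_apply]
  apply MulOpposite.unop_injective
  ext ξ
  rw [MulOpposite.unop_mul, Finset.unop_sum, LinearMap.sum_apply]
  have h1 : ∀ w : G ⊗[ℂ] G, ∑ c, (Phi τ (slop G) w p c * lopMat F Ki τ c q).unop ξ =
      slice (ent τ p q) (galois K Ki w * (Ki * (comulA G ξ * F))) := by
    intro w
    induction w using TensorProduct.induction_on with
    | zero => simp
    | add a b ha hb =>
      simp only [map_add, add_mul, Matrix.add_apply, MulOpposite.unop_add, LinearMap.add_apply,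
        Finset.sum_add_distrib, ha, hb]
    | tmul a b =>
      rw [galois_tmul, mul_assoc, slice_ent_mul]
      refine Finset.sum_congr rfl fun c _ => ?_
      rw [Phi_apply, slice_tmul, slice_tmul, map_smul, smul_mul_assoc, smul_mul_assoc, one_mul]
      change ent τ p c a • slice (ent τ c q) (Ki * (comulA G (SA G b * ξ) * F)) = _
      rw [map_mul (comulA G)]
      congr 2
      simp only [mul_assoc]
      rw [← mul_assoc K Ki, hK.mul_inv, one_mul]
  rw [h1, hw]
  change _ = SA G a * slice (ent τ p q) (Ki * (comulA G ξ * F))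
  generalize Ki * (comulA G ξ * F) = z
  induction z using TensorProduct.induction_on with
  | zero => simp
  | add c d hc hd => simp only [mul_add, map_add, hc, hd]
  | tmul c d => simp

end TwistedDual

/-! ### The algebra of a single link -/

namespace GaugeData

variable {X : Type*} {Γ : SimpleGraph X} {Gs : Type u}
    [Ring Gs] [HopfAlgebra ℂ Gs] [StarRing Gs] [StarModule ℂ Gs] [RibbonHopfStarAlgebra Gs]
    {𝒢 : X → Type*}
    [∀ x, Ring (𝒢 x)] [∀ x, HopfAlgebra ℂ (𝒢 x)] [∀ x, StarRing (𝒢 x)]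
    [∀ x, StarModule ℂ (𝒢 x)] [∀ x, RibbonHopfStarAlgebra (𝒢 x)]
    {Lab : Type*} (D : GaugeData Γ Gs 𝒢 Lab) [IsSemisimpleRing Gs] [Fintype Lab]

lemma isTwist_F (x : X) : IsTwist (D.F x) (D.Finv x) where
  mul_inv := D.F_mul_Finv x
  inv_mul := D.Finv_mul_F x
  cocycle := by
    have := (D.twist x).F_cocycle
    rwa [comulLeft_eq, comulRight_eq, leg12_eq, leg23_eq] at this
  counit_left := (D.twist x).F_counit_left
  counit_right := (D.twist x).F_counit_right

/-- `ι_x ⊗ ι_x ⊗ ι_x`. -/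
def iso₃ (x : X) : 𝒢 x ⊗[ℂ] (𝒢 x ⊗[ℂ] 𝒢 x) →ₐ[ℂ] Gs ⊗[ℂ] (Gs ⊗[ℂ] Gs) :=
  Algebra.TensorProduct.map (D.twist x).iso.toAlgEquiv.toAlgHom (D.iso₂ x).toAlgHom

lemma iso₃_leg12 (x : X) (z : 𝒢 x ⊗[ℂ] 𝒢 x) :
    D.iso₃ x (leg12A _ z) = leg12A _ (D.iso₂ x z) := by
  induction z using TensorProduct.induction_on with
  | zero => simp
  | add a b ha hb => simp only [map_add, ha, hb]
  | tmul a b =>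
    change (D.twist x).iso a ⊗ₜ[ℂ] ((D.twist x).iso b ⊗ₜ[ℂ] (D.twist x).iso 1) = _
    rw [map_one]; rfl

lemma iso₃_leg23 (x : X) (z : 𝒢 x ⊗[ℂ] 𝒢 x) :
    D.iso₃ x (leg23A _ z) = leg23A _ (D.iso₂ x z) := by
  change (D.twist x).iso 1 ⊗ₜ[ℂ] D.iso₂ x z = _
  rw [map_one]; rfl

lemma comulRight_iso₂_mul (x : X) (z : 𝒢 x ⊗[ℂ] 𝒢 x) :
    comulRightA _ (D.iso₂ x z) * leg23A _ (D.F x) =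
      leg23A _ (D.F x) * D.iso₃ x (comulRightA _ z) := by
  induction z using TensorProduct.induction_on with
  | zero => simp
  | add a b ha hb => simp only [map_add, add_mul, mul_add, ha, hb]
  | tmul a b =>
    rw [iso₂_tmul]
    change ((D.twist x).iso a ⊗ₜ[ℂ] comulA Gs ((D.twist x).iso b)) * (1 ⊗ₜ[ℂ] D.F x) =
      (1 ⊗ₜ[ℂ] D.F x) * ((D.twist x).iso a ⊗ₜ[ℂ] D.iso₂ x (comulA _ b))
    rw [Algebra.TensorProduct.tmul_mul_tmul, Algebra.TensorProduct.tmul_mul_tmul, F_mul_comul,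
      one_mul, mul_one]

lemma comulLeft_iso₂_mul (x : X) (z : 𝒢 x ⊗[ℂ] 𝒢 x) :
    comulLeftA _ (D.iso₂ x z) * leg12A _ (D.F x) =
      leg12A _ (D.F x) * D.iso₃ x (comulLeftA _ z) := by
  induction z using TensorProduct.induction_on with
  | zero => simp
  | add a b ha hb => simp only [map_add, add_mul, mul_add, ha, hb]
  | tmul a b =>
    have e1 : ∀ z : 𝒢 x ⊗[ℂ] 𝒢 x, D.iso₃ x (TensorProduct.assoc ℂ _ _ _ (z ⊗ₜ b)) =
        Algebra.TensorProduct.assoc ℂ ℂ ℂ _ _ _ (D.iso₂ x z ⊗ₜ (D.twist x).iso b) := by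
      intro z
      induction z using TensorProduct.induction_on with
      | zero => simp
      | add a b ha hb => simp only [map_add, TensorProduct.add_tmul, ha, hb]
      | tmul a b => rfl
    rw [iso₂_tmul]
    change Algebra.TensorProduct.assoc ℂ ℂ ℂ _ _ _
        (comulA Gs ((D.twist x).iso a) ⊗ₜ[ℂ] (D.twist x).iso b) *
        Algebra.TensorProduct.assoc ℂ ℂ ℂ _ _ _ (D.F x ⊗ₜ[ℂ] 1) =
      Algebra.TensorProduct.assoc ℂ ℂ ℂ _ _ _ (D.F x ⊗ₜ[ℂ] 1) *
        D.iso₃ x (TensorProduct.assoc ℂ _ _ _ (comulA _ a ⊗ₜ b))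
    rw [e1, ← map_mul, ← map_mul, Algebra.TensorProduct.tmul_mul_tmul,
      Algebra.TensorProduct.tmul_mul_tmul, F_mul_comul, one_mul, mul_one]

lemma cotwistInv_eq (x : X) : D.cotwistInv x = D.F x * D.iso₂ x (flipA _ (Rm _)) := by
  rw [iso₂_flipA, iso₂_Rm, cotwistInv, map_mul, map_mul, flipA_flipA, ← mul_assoc, ← mul_assoc,
    F_mul_Finv, one_mul]

lemma isTwist_cotwist (x : X) : IsTwist (D.cotwistInv x) (D.cotwist x) where
  mul_inv := cotwistInv_mul x
  inv_mul := cotwist_mul_inv x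
  cocycle := by
    rw [cotwistInv_eq]
    simp only [map_mul]
    calc _ = comulLeftA Gs (D.F x) * (comulLeftA Gs (D.iso₂ x (flipA _ (Rm _))) *
          leg12A Gs (D.F x)) * leg12A Gs (D.iso₂ x (flipA _ (Rm _))) := by simp only [mul_assoc]
      _ = comulRightA Gs (D.F x) * (comulRightA Gs (D.iso₂ x (flipA _ (Rm _))) *
          leg23A Gs (D.F x)) * leg23A Gs (D.iso₂ x (flipA _ (Rm _))) := by
          rw [comulLeft_iso₂_mul, comulRight_iso₂_mul, ← iso₃_leg12, ← iso₃_leg23, ← mul_assoc,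
            ← mul_assoc, (D.isTwist_F x).cocycle, mul_assoc _ (D.iso₃ x _), mul_assoc _ (D.iso₃ x _),
            ← map_mul, ← map_mul, flip_Rm_cocycle]
      _ = _ := by simp only [mul_assoc]
  counit_left := by
    rw [cotwistInv, map_mul, counitLeftA_flipA, counitLeftA_flipA, counitRightA_Rm, one_mul]
    exact (D.twist x).F_counit_right
  counit_right := by
    rw [cotwistInv, map_mul, counitRightA_flipA, counitRightA_flipA, counitLeftA_Rm, one_mul]
    exact (D.twist x).F_counit_left

lemma galois_iso₂_comul (x : X) (η : 𝒢 x) :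
    galois (D.cotwistInv x) (D.cotwist x) (D.iso₂ x (comulA _ η)) =
      1 ⊗ₜ SA Gs ((D.twist x).iso η) := by
  let f : 𝒢 x ⊗[ℂ] (𝒢 x ⊗[ℂ] 𝒢 x) →ₗ[ℂ] 𝒢 x ⊗[ℂ] 𝒢 x :=
    TensorProduct.map (mulIdSA _) (SA _) ∘ₗ (TensorProduct.assoc ℂ _ _ _).symm.toLinearMap
  have hf : ∀ a b c, f (a ⊗ₜ (b ⊗ₜ c)) = (a * SA _ b) ⊗ₜ SA _ c := fun _ _ _ => rfl
  have hS : ∀ b : 𝒢 x, D.cotwist x * (comulA Gs (SA Gs ((D.twist x).iso b)) * D.cotwistInv x) =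
      D.iso₂ x (TensorProduct.map (SA _) (SA _) (comulA _ b)) := by
    intro b
    have e1 : ∀ z : 𝒢 x ⊗[ℂ] 𝒢 x, TensorProduct.map (SA _) (SA _) z = flipA _ (flipSS z) := by
      intro z
      induction z using TensorProduct.induction_on with
      | zero => simp
      | add a b ha hb => simp only [map_add, ha, hb]
      | tmul a b => rfl
    rw [e1, ← comul_antipode, iso₂_flipA, iso₂_comul, (D.twist x).antipode_iso, cotwist, cotwistInv,
      map_mul, map_mul]
    have e2 := congrArg (flipA Gs) (Rm_comul (SA Gs ((D.twist x).iso b)))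
    rw [map_mul, map_mul, flipA_flipA] at e2
    calc _ = flipA Gs (D.Finv x) * flipA Gs (RmInv Gs) * (comulA Gs (SA Gs ((D.twist x).iso b)) *
          flipA Gs (Rm Gs)) * flipA Gs (D.F x) := by simp only [mul_assoc]
      _ = flipA Gs (D.Finv x) * (flipA Gs (RmInv Gs) * flipA Gs (Rm Gs)) *
          flipA Gs (comulA Gs (SA Gs ((D.twist x).iso b))) * flipA Gs (D.F x) := by
          rw [← e2]; simp only [mul_assoc]
      _ = _ := by rw [← map_mul (flipA Gs) (RmInv Gs), RmInv_mul_Rm, map_one, mul_one]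
  have h1 : ∀ z : 𝒢 x ⊗[ℂ] 𝒢 x, galois (D.cotwistInv x) (D.cotwist x) (D.iso₂ x z) =
      D.iso₂ x (f (comulRightA _ z)) := by
    intro z
    induction z using TensorProduct.induction_on with
    | zero => simp
    | add a b ha hb => simp only [map_add, ha, hb]
    | tmul a b =>
      have e : ∀ w : 𝒢 x ⊗[ℂ] 𝒢 x, D.iso₂ x (f (a ⊗ₜ w)) = (D.twist x).iso a ⊗ₜ[ℂ] 1 *
          D.iso₂ x (TensorProduct.map (SA _) (SA _) w) := by
        intro w
        induction w using TensorProduct.induction_on with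
        | zero => simp
        | add a b ha hb => simp only [TensorProduct.tmul_add, map_add, mul_add, ha, hb]
        | tmul c d => simp [hf]
      rw [iso₂_tmul, galois_tmul, hS, comulRightA_tmul, e]
      rfl
  have h2 : ∀ z : 𝒢 x ⊗[ℂ] 𝒢 x, f (comulLeftA _ z) = 1 ⊗ₜ SA _ (counitLeftA _ z) := by
    intro z
    induction z using TensorProduct.induction_on with
    | zero => simp
    | add a b ha hb => simp only [map_add, TensorProduct.tmul_add, ha, hb]
    | tmul a b =>
      have e : ∀ w : 𝒢 x ⊗[ℂ] 𝒢 x, f (TensorProduct.assoc ℂ _ _ _ (w ⊗ₜ b)) =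
          mulIdSA _ w ⊗ₜ SA _ b := by
        intro w
        induction w using TensorProduct.induction_on with
        | zero => simp
        | add a b ha hb => simp only [TensorProduct.add_tmul, map_add, ha, hb]
        | tmul c d => simp [hf]
      have e1 : mulIdSA (𝒢 x) (Coalgebra.comul (R := ℂ) a) = algebraMap ℂ _ _ :=
        HopfAlgebra.mul_antipode_lTensor_comul_apply a
      rw [comulLeftA_tmul, e, e1, counitLeftA_tmul, map_smul, Algebra.algebraMap_eq_smul_one,
        TensorProduct.smul_tmul]
  rw [h1, ← comulLeftA_comul, h2, Bialgebra.comulAlgHom_apply, counitLeftA_comul, iso₂_tmul,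
    map_one, (D.twist x).antipode_iso]

end GaugeData

/-! ### The Haar integral of `G_*` -/

namespace IrrepSystem

variable {G : Type u} [Ring G] [HopfAlgebra ℂ G] [StarRing G] [StarModule ℂ G] {Lab : Type*}
  [IsSemisimpleRing G] [Fintype Lab] (V : IrrepSystem G Lab)

/-- The normalized two-sided integral of `G`. -/
def haar : G := V.E V.triv ⟨0, V.dim_pos _⟩ ⟨0, V.dim_pos _⟩

lemma triv_subsingleton : Subsingleton (Fin (V.dim V.triv)) := by
  rw [V.dim_triv]; infer_instance

lemma rep_haar : V.τ V.triv V.haar = 1 := by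
  have := V.triv_subsingleton
  rw [haar, V.rep_E]
  ext a b
  rw [Subsingleton.elim a ⟨0, V.dim_pos _⟩, Subsingleton.elim b ⟨0, V.dim_pos _⟩]
  simp

lemma rep_haar_of_ne {I : Lab} (h : I ≠ V.triv) : V.τ I V.haar = 0 := V.rep_E_ne h _ _

lemma counit_haar : Coalgebra.counit (R := ℂ) V.haar = 1 := by
  have h := congrFun (congrFun ((V.τ_triv V.haar).symm.trans V.rep_haar) ⟨0, V.dim_pos _⟩)
    ⟨0, V.dim_pos _⟩
  simpa using h

lemma mul_haar (ξ : G) : ξ * V.haar = Coalgebra.counit (R := ℂ) ξ • V.haar := by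
  refine V.eq_of_forall_rep fun J => ?_
  by_cases hJ : J = V.triv
  · subst hJ; rw [map_mul, map_smul, V.rep_haar, V.τ_triv, mul_one]
  · rw [map_mul, map_smul, V.rep_haar_of_ne hJ, mul_zero, smul_zero]

lemma haar_mul (ξ : G) : V.haar * ξ = Coalgebra.counit (R := ℂ) ξ • V.haar := by
  refine V.eq_of_forall_rep fun J => ?_
  by_cases hJ : J = V.triv
  · subst hJ; rw [map_mul, map_smul, V.rep_haar, V.τ_triv, one_mul]
  · rw [map_mul, map_smul, V.rep_haar_of_ne hJ, zero_mul, smul_zero]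

lemma antipode_haar [RibbonHopfStarAlgebra G] : SA G V.haar = V.haar := by
  have h1 : SA G (SA G V.haar) = V.haar := by
    have h := antipode_sq_mul_uElt V.haar
    rw [mul_haar, ← haar_mul] at h
    calc _ = SA G (SA G V.haar) * (uElt G * (SA G (uElt G) * (ribInv G * ribInv G))) := by
          rw [uElt_mul_inv, mul_one]
      _ = V.haar := by rw [← mul_assoc, h, mul_assoc, uElt_mul_inv, mul_one]
  have h2 := congrArg (SA G) (V.haar_mul (SA G V.haar))
  rw [antipode_mul', h1, map_smul, haar_mul] at h2
  simpa [HopfAlgebra.counit_antipode, counit_haar] using h2.symm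

end IrrepSystem

section ConjOp

/-- The opposite algebra with the conjugate scalar multiplication. -/
def ConjOp (A : Type*) : Type _ := Aᵐᵒᵖ

variable {A : Type*} [Ring A] [Algebra ℂ A]

instance : Ring (ConjOp A) := inferInstanceAs (Ring Aᵐᵒᵖ)

instance : Algebra ℂ (ConjOp A) :=
  RingHom.toAlgebra' (((algebraMap ℂ Aᵐᵒᵖ).comp (starRingEnd ℂ) : ℂ →+* Aᵐᵒᵖ) : ℂ →+* ConjOp A)
    fun c x => Algebra.commutes (R := ℂ) (A := Aᵐᵒᵖ) (starRingEnd ℂ c) x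

namespace ConjOp

/-- The element of the algebra underlying an element of the conjugate opposite algebra. -/
def out : ConjOp A →+ A := (MulOpposite.opAddEquiv (α := A)).symm.toAddMonoidHom

/-- An element of the algebra as an element of the conjugate opposite algebra. -/
def of : A →+ ConjOp A := (MulOpposite.opAddEquiv (α := A)).toAddMonoidHom

@[simp] lemma of_out (a : ConjOp A) : of (out a) = a := rfl
lemma of_mul (a b : A) : of (a * b) = of b * of a := rfl
@[simp] lemma out_mul (a b : ConjOp A) : out (a * b) = out b * out a := rfl
@[simp] lemma out_one : out (1 : ConjOp A) = 1 := rfl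
@[simp] lemma out_algebraMap (c : ℂ) :
    out (algebraMap ℂ (ConjOp A) c) = algebraMap ℂ A (star c) := rfl
@[simp] lemma of_algebraMap (c : ℂ) :
    of (algebraMap ℂ A c) = algebraMap ℂ (ConjOp A) (star c) := by
  rw [← of_out (algebraMap ℂ (ConjOp A) (star c)), out_algebraMap, star_star]
lemma out_smul (c : ℂ) (a : ConjOp A) : out (c • a) = star c • out a := by
  rw [Algebra.smul_def, Algebra.smul_def, out_mul, out_algebraMap, Algebra.commutes]

variable {l m n : Type*}

/-- The conjugate transpose of a matrix over the conjugate opposite algebra. -/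
def dag : Matrix m n (ConjOp A) →+ Matrix n m A where
  toFun M := Matrix.of fun j i => out (M i j)
  map_zero' := rfl
  map_add' _ _ := rfl

lemma dag_apply (M : Matrix m n (ConjOp A)) (i : m) (j : n) : dag M j i = out (M i j) := rfl

lemma dag_injective : Function.Injective (dag : Matrix m n (ConjOp A) → Matrix n m A) :=
  fun _ _ h => Matrix.ext fun i j =>
    MulOpposite.unop_injective (congrFun (congrFun h j) i)

variable [Fintype l] [DecidableEq l] [Fintype m] [DecidableEq m] [Fintype n] [DecidableEq n]

lemma dag_mul (M : Matrix l m (ConjOp A)) (N : Matrix m n (ConjOp A)) :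
    dag (M * N) = dag N * dag M := by
  ext i j
  rw [dag_apply, Matrix.mul_apply, Matrix.mul_apply, map_sum]
  rfl

lemma dag_one : dag (1 : Matrix n n (ConjOp A)) = 1 := by
  ext i j
  rw [dag_apply, Matrix.one_apply, Matrix.one_apply]
  by_cases h : i = j <;> simp [h, eq_comm]

lemma dag_cm (M : Matrix m n ℂ) : dag (cm (ConjOp A) M) = cm A Mᴴ := rfl

lemma dag_e1 (M : Matrix m m (ConjOp A)) : dag (e1 _ m n M) = e1 A m n (dag M) := by
  ext p q
  rw [dag_apply, e1_apply, e1_apply, apply_ite out, map_zero, dag_apply]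
  exact if_congr eq_comm rfl rfl

lemma dag_e2 (M : Matrix n n (ConjOp A)) : dag (e2 _ m n M) = e2 A m n (dag M) := by
  ext p q
  rw [dag_apply, e2_apply, e2_apply, apply_ite out, map_zero, dag_apply]
  exact if_congr eq_comm rfl rfl

lemma dag_sc (t : ConjOp A) : dag (sc _ n t) = sc A n (out t) := by
  ext p q
  rw [dag_apply, sc_apply, sc_apply, apply_ite out, map_zero]
  exact if_congr eq_comm rfl rfl

/-- The homomorphism `ξ ↦ h(ξ^*)`. -/
def starHom {G : Type*} [Ring G] [StarRing G] [Algebra ℂ G] [StarModule ℂ G] (h : G →ₐ[ℂ] A) :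
    G →ₐ[ℂ] ConjOp A where
  toFun ξ := of (h (star ξ))
  map_one' := by rw [star_one, map_one]; rfl
  map_mul' ξ η := by rw [star_mul, map_mul, of_mul]
  map_zero' := by rw [star_zero, map_zero, map_zero]
  map_add' ξ η := by rw [star_add, map_add, map_add]
  commutes' c := by
    rw [← algebraMap_star_comm, AlgHom.commutes, of_algebraMap, star_star]

lemma out_starHom {G : Type*} [Ring G] [StarRing G] [Algebra ℂ G] [StarModule ℂ G] (h : G →ₐ[ℂ] A)
    (ξ : G) : out (starHom h ξ) = h (star ξ) := rfl

lemma dag_Phi {G : Type*} [Ring G] [HopfAlgebra ℂ G] [StarRing G] [StarModule ℂ G]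
    (τ : G →ₐ[ℂ] Matrix n n ℂ) (hτ : ∀ ξ, τ (star ξ) = (τ ξ)ᴴ) (h : G →ₐ[ℂ] A) (z : G ⊗[ℂ] G) :
    dag (Phi τ (starHom h) z) = Phi τ h (star z) := by
  induction z using TensorProduct.induction_on with
  | zero => simp
  | add a b ha hb => rw [map_add, map_add, ha, hb, star_add, map_add]
  | tmul a b =>
    rw [Phi_tmul, dag_mul, dag_cm, dag_sc, out_starHom, TensorProduct.star_tmul, Phi_tmul, hτ,
      sc_mul_cm]

end ConjOp

end ConjOp

/-- Covariance at the target of a link in the form of entries, for the inverse matrix. -/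
lemma cov_inverse {T G n : Type*} [Ring T] [Algebra ℂ T] [Ring G] [HopfAlgebra ℂ G] [Fintype n]
    [DecidableEq n] (τ : G →ₐ[ℂ] Matrix n n ℂ) (h : G →ₐ[ℂ] T) {M : Matrix n n T}
    (hM : ∀ ξ, Phi τ h (comulA G ξ) * M = M * sc T n (h ξ)) (ξ : G) (a b : n) :
    h ξ * M a b = ∑ c, M c b * h (slice (ent τ a c ∘ₗ HopfAlgebra.antipode ℂ (A := G))
      (comulA G ξ)) := by
  let f : G ⊗[ℂ] (G ⊗[ℂ] G) →ₗ[ℂ] G ⊗[ℂ] G :=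
    TensorProduct.map (LinearMap.mul' ℂ G ∘ₗ TensorProduct.map (SA G) LinearMap.id) LinearMap.id ∘ₗ
      (TensorProduct.assoc ℂ G G G).symm.toLinearMap
  have hf : ∀ p q r : G, f (p ⊗ₜ (q ⊗ₜ r)) = (SA G p * q) ⊗ₜ r := fun _ _ _ => rfl
  have h0 : ∀ (p : G) (Y : G ⊗[ℂ] G), f (p ⊗ₜ Y) = (SA G p ⊗ₜ 1) * Y := fun p Y => by
    induction Y using TensorProduct.induction_on with
    | zero => simp
    | add a b ha hb => rw [TensorProduct.tmul_add, map_add, ha, hb, mul_add]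
    | tmul q r => rw [hf, Algebra.TensorProduct.tmul_mul_tmul, one_mul]
  have h1 : ∀ z : G ⊗[ℂ] G, (Phi τ h (f (comulRightA G z)) * M) a b =
      ∑ c, M c b * h (slice (ent τ a c ∘ₗ HopfAlgebra.antipode ℂ (A := G)) z) := fun z => by
    induction z using TensorProduct.induction_on with
    | zero => simp
    | add p q hp hq =>
      rw [map_add, map_add, map_add, add_mul, Matrix.add_apply, hp, hq, ← Finset.sum_add_distrib]
      simp only [map_add, mul_add]
    | tmul p q =>
      rw [comulRightA_tmul, h0, map_mul, mul_assoc]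
      erw [hM]
      rw [Phi_tmul, map_one, map_one, mul_one, ← mul_assoc, mul_sc_apply, cm_mul_apply,
        Finset.sum_mul]
      refine Finset.sum_congr rfl fun c _ => ?_
      have : slice (ent τ a c ∘ₗ HopfAlgebra.antipode ℂ (A := G)) (p ⊗ₜ q) =
        τ (SA G p) a c • q := rfl
      rw [this, map_smul, mul_smul_comm, smul_mul_assoc]
  have h2 : ∀ z : G ⊗[ℂ] G, f (comulLeftA G z) = 1 ⊗ₜ counitLeftA G z := fun z => by
    induction z using TensorProduct.induction_on with
    | zero => simp
    | add p q hp hq => rw [map_add, map_add, map_add, hp, hq, TensorProduct.tmul_add]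
    | tmul p q =>
      have e : ∀ Y : G ⊗[ℂ] G, f (TensorProduct.assoc ℂ G G G (Y ⊗ₜ q)) =
          (LinearMap.mul' ℂ G ∘ₗ TensorProduct.map (SA G) LinearMap.id) Y ⊗ₜ q := fun Y => by
        simp [f]
      rw [comulLeftA_tmul, e, LinearMap.comp_apply, mul_antipode_id_comul,
        Algebra.algebraMap_eq_smul_one, TensorProduct.smul_tmul]
      rfl
  have h3 : counitLeftA G (comulA G ξ) = ξ := counitLeftA_comul ξ
  rw [← h1, ← comulLeftA_comul, h2, h3, Phi_tmul, map_one, cm_one, one_mul,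
    sc_mul_apply]

/-! ### Slices of the unitarized `R`-matrix -/

section Slices

variable {G : Type*} [Ring G] [HopfAlgebra ℂ G] {n : Type*} [Fintype n] [DecidableEq n]

lemma slice_ent_one (τ : G →ₐ[ℂ] Matrix n n ℂ) (a b : n) :
    slice (ent τ a b) (1 : G ⊗[ℂ] G) = if a = b then 1 else 0 := by
  rw [Algebra.TensorProduct.one_def, slice_tmul, ent_apply, map_one, Matrix.one_apply]
  split_ifs <;> simp

lemma slice_mul_one_tmul (f : G →ₗ[ℂ] ℂ) (X : G ⊗[ℂ] G) (k : G) :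
    slice f (X * ((1 : G) ⊗ₜ[ℂ] k)) = slice f X * k := by
  induction X using TensorProduct.induction_on with
  | zero => simp
  | add a b ha hb => rw [add_mul, map_add, map_add, ha, hb, add_mul]
  | tmul a b => simp [slice_tmul]

lemma slice_ent_tmul_mul (τ : G →ₐ[ℂ] Matrix n n ℂ) {k l : G} {c : ℂ} (hk : τ k = c • 1)
    (Z : G ⊗[ℂ] G) (a b : n) :
    slice (ent τ a b) ((k ⊗ₜ[ℂ] l) * Z) = c • (l * slice (ent τ a b) Z) := by
  induction Z using TensorProduct.induction_on with
  | zero => simp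
  | add x y hx hy => rw [mul_add, map_add, map_add, hx, hy, mul_add, smul_add]
  | tmul x y => simp [slice_tmul, hk, mul_smul]

lemma slice_ent_star [StarRing G] [StarModule ℂ G] (τ : G →ₐ[ℂ] Matrix n n ℂ)
    (hτ : ∀ ξ, τ (star ξ) = (τ ξ)ᴴ) (X : G ⊗[ℂ] G) (a b : n) :
    star (slice (ent τ a b) X) = slice (ent τ b a) (star X) := by
  induction X using TensorProduct.induction_on with
  | zero => simp
  | add x y hx hy => rw [map_add, star_add, hx, hy, star_add, map_add]
  | tmul x y =>
    rw [TensorProduct.star_tmul, slice_tmul, slice_tmul, ent_apply, ent_apply, hτ, star_smul,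
      Matrix.conjTranspose_apply]

lemma counit_slice {G : Type*} [Ring G] [HopfAlgebra ℂ G] (f : G →ₗ[ℂ] ℂ) (z : G ⊗[ℂ] G) :
    Coalgebra.counit (R := ℂ) (slice f z) = f (counitRightA G z) := by
  induction z using TensorProduct.induction_on with
  | zero => simp
  | add a b ha hb => simp [ha, hb]
  | tmul a b => simp [mul_comm]

lemma counit_slice_comul (f : G →ₗ[ℂ] ℂ) (ξ : G) :
    Coalgebra.counit (R := ℂ) (slice f (comulA G ξ)) = f ξ := by
  rw [counit_slice]
  exact congrArg f (counitRightA_comul ξ)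

/-- Matrices invariant under `ξ ↦ τ(S ξ²) N τ(ξ¹)` intertwine `τ` with `τ ∘ S²`. -/
lemma mul_eq_antipode_sq_mul (τ : G →ₐ[ℂ] Matrix n n ℂ) (N : Matrix n n ℂ)
    (F : G ⊗[ℂ] G →ₗ[ℂ] Matrix n n ℂ) (hF : ∀ p q, F (p ⊗ₜ q) = τ (SA G q) * N * τ p)
    (hN : ∀ ξ, F (comulA G ξ) = Coalgebra.counit (R := ℂ) ξ • N) (ξ : G) :
    N * τ ξ = τ (SA G (SA G ξ)) * N := by
  let K : (G ⊗[ℂ] G) ⊗[ℂ] G →ₗ[ℂ] Matrix n n ℂ :=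
    LinearMap.mul' ℂ _ ∘ₗ TensorProduct.map (τ.toLinearMap ∘ₗ SA G ∘ₗ SA G) F ∘ₗ
      (TensorProduct.comm ℂ (G ⊗[ℂ] G) G).toLinearMap
  let L : G ⊗[ℂ] (G ⊗[ℂ] G) →ₗ[ℂ] Matrix n n ℂ :=
    K ∘ₗ (TensorProduct.assoc ℂ G G G).symm.toLinearMap
  have hL : ∀ p q r, L (p ⊗ₜ (q ⊗ₜ r)) = τ (SA G (q * SA G r)) * (N * τ p) := fun p q r => by
    change τ (SA G (SA G r)) * F (p ⊗ₜ q) = _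
    rw [hF, antipode_mul', map_mul, mul_assoc, mul_assoc]
  have hK : ∀ (z : G ⊗[ℂ] G) r, L (TensorProduct.assoc ℂ G G G (z ⊗ₜ r)) =
      τ (SA G (SA G r)) * F z := fun z r => by
    change K ((TensorProduct.assoc ℂ G G G).symm (TensorProduct.assoc ℂ G G G (z ⊗ₜ r))) = _
    rw [LinearEquiv.symm_apply_apply]
    rfl
  have h1 : ∀ X : G ⊗[ℂ] G, L (comulRightA G X) = N * τ (counitRightA G X) := fun X => by
    induction X using TensorProduct.induction_on with
    | zero => simp
    | add x y hx hy => simp only [map_add, hx, hy, mul_add]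
    | tmul p z =>
      have : ∀ Z : G ⊗[ℂ] G, L (p ⊗ₜ Z) = τ (SA G (LinearMap.mul' ℂ G
          (TensorProduct.map LinearMap.id (SA G) Z))) * (N * τ p) := fun Z => by
        induction Z using TensorProduct.induction_on with
        | zero => simp
        | add x y hx hy => simp only [TensorProduct.tmul_add, map_add, hx, hy, add_mul]
        | tmul q r => exact hL p q r
      rw [comulRightA_tmul, this, mul_id_antipode_comul, counitRightA_tmul,
        Algebra.algebraMap_eq_smul_one]
      simp [HopfAlgebra.antipode_one]
  have h2 : ∀ X : G ⊗[ℂ] G, L (comulLeftA G X) = τ (SA G (SA G (counitLeftA G X))) * N := fun X => by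
    induction X using TensorProduct.induction_on with
    | zero => simp
    | add x y hx hy => simp only [map_add, hx, hy, add_mul]
    | tmul p z =>
      rw [comulLeftA_tmul, hK, counitLeftA_tmul]
      refine (congrArg _ (hN p)).trans ?_
      simp
  have := (h2 (comulA G ξ)).symm.trans ((congrArg L (comulLeftA_comul ξ)).trans (h1 (comulA G ξ)))
  have e1 : counitRightA G (comulA G ξ) = ξ := counitRightA_comul ξ
  have e2 : counitLeftA G (comulA G ξ) = ξ := counitLeftA_comul ξ
  rw [e1, e2] at this
  exact this.symm

variable [StarRing G] [StarModule ℂ G] [RibbonHopfStarAlgebra G]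

lemma PositiveRoot.rep_ribInv {k : Gˣ} (hk : PositiveRoot G k) (τ : G →ₐ[ℂ] Matrix n n ℂ) {c : ℂ}
    (hc : c ≠ 0) (hτ : τ (k : G) = c • 1) : τ (ribInv G) = (c ^ 2)⁻¹ • 1 := by
  have h : τ (rib G) = c ^ 2 • 1 := by rw [← hk.sq, map_mul, hτ]; simp [smul_smul, _root_.sq]
  have h2 := congrArg τ (ribInv_mul_rib (G := G))
  rw [map_mul, h, map_one, mul_smul_comm, mul_one] at h2
  rw [← h2, smul_smul, inv_mul_cancel₀ (pow_ne_zero 2 hc), one_smul]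

/-- The contraction of `R⁻¹` along the source of a link. -/
lemma PositiveRoot.sum_slice_RmInv {k : Gˣ} (hk : PositiveRoot G k) (τ : G →ₐ[ℂ] Matrix n n ℂ)
    {c : ℂ} (hc : c ≠ 0) (hτ : τ (k : G) = c • 1) {Z : G ⊗[ℂ] G}
    (hZ : Rm G * comulA G (k : G) = ((k : G) ⊗ₜ[ℂ] (k : G)) * Z) (a d : n) :
    ∑ e, ∑ f, τ (uElt G * ribInv G) e f •
      slice (ent (contra τ) e d) (comulA G (slice (ent τ f a) (RmInv G) * k)) =
      c⁻¹ • ((k : G) * slice (ent (contra τ) a d) Z) := by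
  set g := uElt G * ribInv G
  let E : G ⊗[ℂ] G →ₗ[ℂ] G := LinearMap.mul' ℂ G ∘ₗ
    TensorProduct.map (SA G) (LinearMap.mulLeft ℂ g) ∘ₗ flip G
  let L : G ⊗[ℂ] (G ⊗[ℂ] G) →ₗ[ℂ] G :=
    (TensorProduct.lid ℂ G).toLinearMap ∘ₗ LinearMap.rTensor G (ent τ d a ∘ₗ E) ∘ₗ (TensorProduct.assoc ℂ G G G).symm.toLinearMap
  have hL : ∀ (z : G ⊗[ℂ] G) r, L (TensorProduct.assoc ℂ G G G (z ⊗ₜ r)) = (τ (E z)) d a • r :=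
    fun z r => by
      change (TensorProduct.lid ℂ G) (LinearMap.rTensor G (ent τ d a ∘ₗ E)
        ((TensorProduct.assoc ℂ G G G).symm (TensorProduct.assoc ℂ G G G (z ⊗ₜ r)))) = _
      rw [LinearEquiv.symm_apply_apply]
      rfl
  have hE : E (RmInv G) = ribInv G := by
    have : ∀ X : G ⊗[ℂ] G, E X = ribInv G * (LinearMap.mul' ℂ G ∘ₗ
        TensorProduct.map (SA G) (LinearMap.mulLeft ℂ (uElt G)) ∘ₗ flip G) X := fun X => by
      induction X using TensorProduct.induction_on with
      | zero => simp
      | add x y hx hy => rw [map_add, map_add, hx, hy, mul_add]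
      | tmul p q =>
        change SA G q * (uElt G * ribInv G * p) = ribInv G * (SA G q * (uElt G * p))
        rw [ribInv_comm, mul_assoc (SA G q), mul_assoc (uElt G), mul_assoc (uElt G), ribInv_comm]
    rw [this, antipode_conj_uElt, mul_one]
  have h1 : ∀ X : G ⊗[ℂ] G, ∑ e, ∑ f, τ g e f •
      slice (ent (contra τ) e d) (comulA G (slice (ent τ f a) X)) = L (comulRightA G X) := fun X => by
    induction X using TensorProduct.induction_on with
    | zero => simp
    | add x y hx hy => simp only [map_add, smul_add, Finset.sum_add_distrib, hx, hy]
    | tmul p w =>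
      have : ∀ Z : G ⊗[ℂ] G, ∑ e, ∑ f, τ g e f • τ p f a • slice (ent (contra τ) e d) Z =
          L (p ⊗ₜ Z) := fun Z => by
        induction Z using TensorProduct.induction_on with
        | zero => simp
        | add x y hx hy =>
          simp only [map_add, smul_add, Finset.sum_add_distrib, hx, hy, TensorProduct.tmul_add]
        | tmul q r =>
          refine Eq.trans ?_ (hL (p ⊗ₜ q) r).symm
          change _ = τ (SA G q * (g * p)) d a • r
          simp only [map_mul, slice_tmul, ent_apply, contra_apply, Matrix.transpose_apply,
            smul_smul, Matrix.mul_apply, Finset.mul_sum, Finset.sum_smul]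
          refine Finset.sum_congr rfl fun e _ => Finset.sum_congr rfl fun f _ => ?_
          congr 1
          ring
      rw [comulRightA_tmul, ← this]
      simp only [slice_tmul, map_smul, ent_apply]
      rfl
  have h2 : ∀ X : G ⊗[ℂ] G, ∀ p q r : G, L (leg12A G X * (p ⊗ₜ (q ⊗ₜ r))) =
      τ (SA G q * (E X * p)) d a • r := fun X p q r => by
    induction X using TensorProduct.induction_on with
    | zero => simp
    | add x y hx hy => rw [map_add, add_mul, map_add, hx, hy, map_add, add_mul, mul_add, map_add,
        Matrix.add_apply, add_smul]
    | tmul x y =>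
      rw [leg12A_tmul, Algebra.TensorProduct.tmul_mul_tmul, Algebra.TensorProduct.tmul_mul_tmul,
        one_mul]
      refine (hL ((x * p) ⊗ₜ (y * q)) r).trans ?_
      change τ (SA G (y * q) * (g * (x * p))) d a • r = τ (SA G q * (SA G y * (g * x) * p)) d a • r
      simp only [antipode_mul', mul_assoc]
  have h3 : ∀ Y W : G ⊗[ℂ] G, L (leg12A G (RmInv G) *
      (leg13A G (TensorProduct.map (SA G) LinearMap.id Y) * ((1 : G) ⊗ₜ W))) =
      (c ^ 2)⁻¹ • slice (ent (contra τ) a d) (Y * W) := fun Y W => by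
    induction Y using TensorProduct.induction_on with
    | zero => simp
    | add x y hx hy => simp only [map_add, add_mul, mul_add, smul_add, hx, hy]
    | tmul x y =>
      induction W using TensorProduct.induction_on with
      | zero => simp
      | add p q hp hq => simp only [map_add, mul_add, smul_add, TensorProduct.tmul_add, hp, hq]
      | tmul p q =>
        rw [TensorProduct.map_tmul, leg13A_tmul, Algebra.TensorProduct.tmul_mul_tmul,
          Algebra.TensorProduct.tmul_mul_tmul, Algebra.TensorProduct.tmul_mul_tmul, h2, hE,
          slice_tmul, ent_apply, contra_apply, Matrix.transpose_apply, mul_one, one_mul,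
          antipode_mul', map_mul, map_mul, map_mul, hk.rep_ribInv τ hc hτ]
        simp [smul_smul]
  have hτ' : contra τ (k : G) = c • 1 := by
    rw [contra_apply, hk.antipode, hτ, Matrix.transpose_smul, Matrix.transpose_one]
  simp only [← slice_mul_one_tmul]
  have h4 := h3 (Rm G) (comulA G k)
  rw [antipode_left_Rm, hZ, slice_ent_tmul_mul _ hτ', ← mul_assoc] at h4
  rw [h1, map_mul, comulRightA_RmInv, comulRightA_tmul]
  refine h4.trans ?_
  rw [smul_smul]
  congr 1
  field_simp

end Slices

/-! ### Dressing of connections -/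

namespace GaugeData

variable {X : Type*} {Γ : SimpleGraph X} {Gs : Type u}
    [Ring Gs] [HopfAlgebra ℂ Gs] [StarRing Gs] [StarModule ℂ Gs] [RibbonHopfStarAlgebra Gs]
    {𝒢 : X → Type*}
    [∀ x, Ring (𝒢 x)] [∀ x, HopfAlgebra ℂ (𝒢 x)] [∀ x, StarRing (𝒢 x)]
    [∀ x, StarModule ℂ (𝒢 x)] [∀ x, RibbonHopfStarAlgebra (𝒢 x)]
    {Lab : Type*} {D : GaugeData Γ Gs 𝒢 Lab}
    [IsSemisimpleRing Gs] [Fintype Lab]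

section Dressings

variable {T : Type*} [Ring T] [Algebra ℂ T]

/-- Matrices with entries in `T` that multiply like matrices of representations of `𝒢_x`
(`val`) together with their inverses (`inv`). -/
structure Dressing (D : GaugeData Γ Gs 𝒢 Lab) (T : Type*) [Ring T] [Algebra ℂ T] (x : X) where
  val : ∀ I, Matrix (D.Idx I) (D.Idx I) T
  inv : ∀ I, Matrix (D.Idx I) (D.Idx I) T
  val_mul_inv : ∀ I, val I * inv I = 1
  inv_mul_val : ∀ I, inv I * val I = 1
  cg : ∀ I J K m, cm T (D.siteCG x I J K m) * (e1 T _ _ (val I) * e2 T _ _ (val J)) =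
    val K * cm T (D.siteCG x I J K m)
  cg_star : ∀ I J K m, e2 T _ _ (val J) * e1 T _ _ (val I) * cm T (D.siteCG x I J K m)ᴴ =
    cm T (D.siteCG x I J K m)ᴴ * val K
  rtt : ∀ I J, cm T (D.siteTens x I J (Rm _)) * (e1 T _ _ (val I) * e2 T _ _ (val J)) =
    e2 T _ _ (val J) * e1 T _ _ (val I) * cm T (D.siteTens x I J (Rm _))

/-- Elementwise commutation of two matrices. -/
def EntriesCommute {T m n : Type*} [Mul T] (P : Matrix m m T) (Q : Matrix n n T) : Prop :=
  ∀ a b c d, P a b * Q c d = Q c d * P a b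

lemma EntriesCommute.symm {T m n : Type*} [Mul T] {P : Matrix m m T} {Q : Matrix n n T}
    (h : EntriesCommute P Q) : EntriesCommute Q P := fun a b c d => (h c d a b).symm

lemma EntriesCommute.mul_left {T m n : Type*} [Semiring T] [Fintype m] {P P' : Matrix m m T}
    {Q : Matrix n n T} (h : EntriesCommute P Q) (h' : EntriesCommute P' Q) :
    EntriesCommute (P * P') Q := by
  intro a b c d
  rw [Matrix.mul_apply, Finset.sum_mul, Finset.mul_sum]
  refine Finset.sum_congr rfl fun e _ => ?_
  rw [mul_assoc, h', ← mul_assoc, h, mul_assoc]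

lemma EntriesCommute.mul_right {T m n : Type*} [Semiring T] [Fintype n] {P : Matrix m m T}
    {Q Q' : Matrix n n T} (h : EntriesCommute P Q) (h' : EntriesCommute P Q') :
    EntriesCommute P (Q * Q') := (h.symm.mul_left h'.symm).symm

lemma EntriesCommute.one_left {T m n : Type*} [Semiring T] [DecidableEq m] {Q : Matrix n n T} :
    EntriesCommute (1 : Matrix m m T) Q := by
  intro a b c d
  rw [Matrix.one_apply]
  split_ifs <;> simp

lemma EntriesCommute.one_right {T m n : Type*} [Semiring T] [DecidableEq n] {P : Matrix m m T} :
    EntriesCommute P (1 : Matrix n n T) := EntriesCommute.one_left.symm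

lemma EntriesCommute.e1_e2 {m n : Type*} [Fintype m] [DecidableEq m] [Fintype n] [DecidableEq n]
    {P : Matrix m m T} {Q : Matrix n n T} (h : EntriesCommute P Q) :
    e1 T m n P * e2 T m n Q = e2 T m n Q * e1 T m n P := e1_e2_comm h

namespace Dressing

variable {x y : X}

/-- The trivial dressing. -/
def one (x : X) : Dressing D T x where
  val _ := 1
  inv _ := 1
  val_mul_inv _ := one_mul 1
  inv_mul_val _ := one_mul 1
  cg I J K m := by simp
  cg_star I J K m := by simp
  rtt I J := by simp

/-- The product of two commuting dressings. -/
def mul (Λ M : Dressing D T x) (h : ∀ I J, EntriesCommute (Λ.val I) (M.val J)) :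
    Dressing D T x where
  val I := Λ.val I * M.val I
  inv I := M.inv I * Λ.inv I
  val_mul_inv I := by
    rw [mul_assoc, ← mul_assoc (M.val I), M.val_mul_inv, one_mul, Λ.val_mul_inv]
  inv_mul_val I := by
    rw [mul_assoc, ← mul_assoc (Λ.inv I), Λ.inv_mul_val, one_mul, M.inv_mul_val]
  cg I J K m := by
    rw [map_mul, map_mul]
    calc _ = cm T (D.siteCG x I J K m) * (e1 T _ _ (Λ.val I) *
          (e1 T _ _ (M.val I) * e2 T _ _ (Λ.val J)) * e2 T _ _ (M.val J)) := by
          simp only [Matrix.mul_assoc]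
      _ = cm T (D.siteCG x I J K m) * (e1 T _ _ (Λ.val I) * e2 T _ _ (Λ.val J)) *
          (e1 T _ _ (M.val I) * e2 T _ _ (M.val J)) := by
          rw [(h J I).symm.e1_e2]; simp only [Matrix.mul_assoc]
      _ = _ := by
          rw [Λ.cg, Matrix.mul_assoc, M.cg]; simp only [Matrix.mul_assoc]
  cg_star I J K m := by
    rw [map_mul, map_mul]
    calc _ = e2 T _ _ (Λ.val J) * (e2 T _ _ (M.val J) * e1 T _ _ (Λ.val I)) *
          e1 T _ _ (M.val I) * cm T (D.siteCG x I J K m)ᴴ := by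
          simp only [Matrix.mul_assoc]
      _ = e2 T _ _ (Λ.val J) * e1 T _ _ (Λ.val I) *
          (e2 T _ _ (M.val J) * e1 T _ _ (M.val I) * cm T (D.siteCG x I J K m)ᴴ) := by
          rw [← (h I J).e1_e2]; simp only [Matrix.mul_assoc]
      _ = _ := by
          rw [M.cg_star, ← Matrix.mul_assoc, Λ.cg_star]; simp only [Matrix.mul_assoc]
  rtt I J := by
    rw [map_mul, map_mul]
    calc _ = cm T (D.siteTens x I J (Rm _)) * (e1 T _ _ (Λ.val I) *
          (e1 T _ _ (M.val I) * e2 T _ _ (Λ.val J)) * e2 T _ _ (M.val J)) := by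
          simp only [Matrix.mul_assoc]
      _ = cm T (D.siteTens x I J (Rm _)) * (e1 T _ _ (Λ.val I) * e2 T _ _ (Λ.val J)) *
          (e1 T _ _ (M.val I) * e2 T _ _ (M.val J)) := by
          rw [(h J I).symm.e1_e2]; simp only [Matrix.mul_assoc]
      _ = e2 T _ _ (Λ.val J) * (e1 T _ _ (Λ.val I) * e2 T _ _ (M.val J)) *
          e1 T _ _ (M.val I) * cm T (D.siteTens x I J (Rm _)) := by
          rw [Λ.rtt, Matrix.mul_assoc, M.rtt]; simp only [Matrix.mul_assoc]
      _ = _ := by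
          rw [(h I J).e1_e2]; simp only [Matrix.mul_assoc]

lemma inv_cg_star (Λ : Dressing D T x) (I J K : Lab) (m) :
    e1 T _ _ (Λ.inv I) * e2 T _ _ (Λ.inv J) * cm T (D.siteCG x I J K m)ᴴ =
    cm T (D.siteCG x I J K m)ᴴ * Λ.inv K := by
  have h : e1 T _ (D.Idx J) (Λ.inv I) * e2 T (D.Idx I) _ (Λ.inv J) *
      (e2 T _ _ (Λ.val J) * e1 T _ _ (Λ.val I)) = 1 := by
    rw [mul_assoc, ← mul_assoc (e2 T _ _ (Λ.inv J)), ← map_mul, Λ.inv_mul_val, map_one, one_mul,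
      ← map_mul, Λ.inv_mul_val, map_one]
  calc _ = e1 T _ _ (Λ.inv I) * e2 T _ _ (Λ.inv J) * (cm T (D.siteCG x I J K m)ᴴ *
        Λ.val K) * Λ.inv K := by
        simp only [Matrix.mul_assoc, Λ.val_mul_inv, Matrix.mul_one]
    _ = _ := by
        rw [← Λ.cg_star, ← Matrix.mul_assoc _ _ (cm T (D.siteCG x I J K m)ᴴ), h, Matrix.one_mul]

lemma entriesCommute_inv {n : Type*} [Fintype n] [DecidableEq n] (Λ : Dressing D T x) {I : Lab}
    {Q : Matrix n n T} (h : EntriesCommute (Λ.val I) Q) : EntriesCommute (Λ.inv I) Q := by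
  have h1 := h.e1_e2
  have h2 : e1 T _ _ (Λ.inv I) * e2 T _ _ Q = e2 T _ _ Q * e1 T _ _ (Λ.inv I) := by
    calc _ = e1 T _ _ (Λ.inv I) * e2 T _ _ Q * e1 T _ _ (Λ.val I * Λ.inv I) := by
          rw [Λ.val_mul_inv, map_one, mul_one]
      _ = e1 T _ _ (Λ.inv I * Λ.val I) * e2 T _ _ Q * e1 T _ _ (Λ.inv I) := by
          rw [map_mul, map_mul, ← mul_assoc, mul_assoc (e1 T _ _ (Λ.inv I)), ← h1]
          simp only [mul_assoc]
      _ = _ := by rw [Λ.inv_mul_val, map_one, one_mul]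
  intro a b c d
  have := congrFun (congrFun h2 (a, c)) (b, d)
  rwa [e1_mul_e2_apply, e2_mul_e1_apply] at this

/-- The dressing given by the `R`-matrix and a representation of `𝒢_x`. -/
def ofHom (D : GaugeData Γ Gs 𝒢 Lab) (h : 𝒢 x →ₐ[ℂ] T) : Dressing D T x where
  val I := Phi (D.siteRho x I) h (Rm _)
  inv I := Phi (D.siteRho x I) h (RmInv _)
  val_mul_inv I := by rw [← map_mul, Rm_mul_RmInv, map_one]
  inv_mul_val I := by rw [← map_mul, RmInv_mul_Rm, map_one]
  cg I J K m := by
    rw [← Phi3_leg13, ← Phi3_leg23, ← map_mul, ← comulLeftA_Rm]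
    exact cm_mul_Phi3_comulLeft _ _ h (D.siteRho x K) _ (D.siteCG_mul_comul x I J K m) _
  cg_star I J K m := by
    have := Phi3_comulLeft_mul_cm (D.siteRho x I) (D.siteRho x J) h (D.siteRho x K) _
      (D.flip_comul_mul_siteCG x I J K m) (Rm _)
    rwa [comulLeftA_Rm, map_mul, Phi3_leg13, Phi3_leg23, map_mul, sw_e1, sw_e2] at this
  rtt I J := by
    have := congrArg (Phi3 (D.siteRho x I) (D.siteRho x J) h) (yang_baxter (G := 𝒢 x))
    simp only [map_mul, Phi3_leg12, Phi3_leg13, Phi3_leg23] at this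
    rw [← mul_assoc]
    exact this

end Dressing

/-- Dressing at both ends preserves operator product expansions. -/
lemma IsOpe.dress {x y : X} {U : ∀ I, Matrix (D.Idx I) (D.Idx I) T} (hU : D.IsOpe x y U)
    (Λ : Dressing D T x) (M : Dressing D T y)
    (h1 : ∀ I J, EntriesCommute (Λ.val I) (U J)) (h2 : ∀ I J, EntriesCommute (M.val I) (U J))
    (h3 : ∀ I J, EntriesCommute (Λ.val I) (M.val J)) :
    D.IsOpe x y fun I => Λ.inv I * U I * M.val I := by
  intro I J
  have k1 := (Λ.entriesCommute_inv (h1 J I)).symm.e1_e2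
  have k2 := (h2 I J).e1_e2
  have k3 := (Λ.entriesCommute_inv (h3 J I)).symm.e1_e2
  simp only [map_mul]
  calc _ = e1 T _ _ (Λ.inv I) * e1 T _ _ (U I) * (e1 T _ _ (M.val I) * e2 T _ _ (Λ.inv J)) *
        e2 T _ _ (U J) * e2 T _ _ (M.val J) := by simp only [mul_assoc]
    _ = e1 T _ _ (Λ.inv I) * (e1 T _ _ (U I) * e2 T _ _ (Λ.inv J)) * (e1 T _ _ (M.val I) *
        e2 T _ _ (U J)) * e2 T _ _ (M.val J) := by rw [k3]; simp only [mul_assoc]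
    _ = e1 T _ _ (Λ.inv I) * e2 T _ _ (Λ.inv J) * (e1 T _ _ (U I) * e2 T _ _ (U J)) *
        (e1 T _ _ (M.val I) * e2 T _ _ (M.val J)) := by rw [k1, k2]; simp only [mul_assoc]
    _ = _ := by
        rw [hU I J, Finset.mul_sum, Finset.sum_mul]
        refine Finset.sum_congr rfl fun K _ => ?_
        rw [Finset.mul_sum, Finset.sum_mul]
        refine Finset.sum_congr rfl fun m _ => ?_
        calc _ = e1 T _ _ (Λ.inv I) * e2 T _ _ (Λ.inv J) * cm T (D.siteCG x I J K m)ᴴ * U K *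
              (cm T (D.siteCG y I J K m) * (e1 T _ _ (M.val I) * e2 T _ _ (M.val J))) := by
              simp only [Matrix.mul_assoc]
          _ = _ := by rw [Λ.inv_cg_star, M.cg]; simp only [Matrix.mul_assoc]

/-! ### From commuting links to the lattice -/

/-- Connection matrices on mutually commuting links, with the action of the gauge
transformations at the targets of the links. -/
structure BareModel (D : GaugeData Γ Gs 𝒢 Lab) (T : Type*) [Ring T] [Algebra ℂ T] where
  U : ∀ (I : Lab) (_ : Γ.Dart), Matrix (D.Idx I) (D.Idx I) T
  σ : ∀ i : Γ.Dart, 𝒢 i.snd →ₐ[ℂ] T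
  ope : ∀ i : Γ.Dart, D.IsOpe i.fst i.snd fun I => U I i
  inv : ∀ I i, U I i * U I i.symm = 1
  cov : ∀ I i ξ, sc T _ (σ i ξ) * U I i = U I i * Phi (D.siteRho i.snd I) (σ i) (comulA _ ξ)
  comm_U : ∀ I J (i j : Γ.Dart), i.edge ≠ j.edge → EntriesCommute (U I i) (U J j)
  comm_σ_U : ∀ J (i j : Γ.Dart), i.edge ≠ j.edge → ∀ ξ a b, σ i ξ * U J j a b = U J j a b * σ i ξ
  comm_σ : ∀ i j : Γ.Dart, i ≠ j → ∀ ξ η, σ i ξ * σ j η = σ j η * σ i ξ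

namespace BareModel

variable (B : BareModel D T)

/-- The elementary dressing by the end of the link `i`. -/
def elem (i : Γ.Dart) : Dressing D T i.snd := Dressing.ofHom D (B.σ i)

lemma elem_comm_U (I J : Lab) {i j : Γ.Dart} (h : i.edge ≠ j.edge) :
    EntriesCommute ((B.elem i).val I) (B.U J j) := fun a b c d => by
  change Phi _ _ _ a b * _ = _ * Phi _ _ _ a b
  rw [Phi_apply, B.comm_σ_U J i j h]

lemma elem_comm (I J : Lab) {i j : Γ.Dart} (h : i ≠ j) :
    EntriesCommute ((B.elem i).val I) ((B.elem j).val J) := fun a b c d => by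
  change Phi _ _ _ a b * Phi _ _ _ c d = Phi _ _ _ c d * Phi _ _ _ a b
  rw [Phi_apply, Phi_apply, B.comm_σ i j h]

/-- The entries of `Λ` are generated by the gauge transformations at the ends of the links in
`l`. -/
def Generated {x : X} (l : List Γ.Dart) (Λ : Dressing D T x) : Prop :=
  ∀ (S : Subalgebra ℂ T), (∀ i ∈ l, ∀ ξ, B.σ i ξ ∈ S) → ∀ I a b,
    Λ.val I a b ∈ S ∧ Λ.inv I a b ∈ S

variable {B} in
lemma Generated.comm {x : X} {l : List Γ.Dart} {Λ : Dressing D T x} (h : B.Generated l Λ) (t : T)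
    (ht : ∀ i ∈ l, ∀ ξ, B.σ i ξ * t = t * B.σ i ξ) (I : Lab) (a b : D.Idx I) :
    Λ.val I a b * t = t * Λ.val I a b := by
  have := (h (Subalgebra.centralizer ℂ {t}) (fun i hi ξ => by
    rw [Subalgebra.mem_centralizer_iff]
    rintro s rfl
    exact (ht i hi ξ).symm) I a b).1
  rw [Subalgebra.mem_centralizer_iff] at this
  exact (this t rfl).symm

variable {B} in
lemma Generated.comm_U {x : X} {l : List Γ.Dart} {Λ : Dressing D T x} (h : B.Generated l Λ)
    (I J : Lab) (j : Γ.Dart) (hj : ∀ i ∈ l, i.edge ≠ j.edge) :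
    EntriesCommute (Λ.val I) (B.U J j) := fun a b c d =>
  h.comm _ (fun i hi ξ => B.comm_σ_U J i j (hj i hi) ξ c d) I a b

variable {B} in
lemma Generated.comm_generated {x y : X} {l l' : List Γ.Dart} {Λ : Dressing D T x}
    {M : Dressing D T y} (h : B.Generated l Λ) (h' : B.Generated l' M)
    (hd : ∀ i ∈ l, ∀ j ∈ l', i ≠ j) (I J : Lab) :
    EntriesCommute (Λ.val I) (M.val J) := fun a b c d =>
  h.comm _ (fun i hi ξ => (h'.comm _ (fun j hj η => B.comm_σ j i (hd i hi j hj).symm η ξ)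
    J c d).symm) I a b

lemma generated_elem (i : Γ.Dart) : B.Generated [i] (B.elem i) := fun S hS I a b => by
  change Phi _ _ _ a b ∈ S ∧ Phi _ _ _ a b ∈ S
  rw [Phi_apply, Phi_apply]
  exact ⟨hS i (by simp) _, hS i (by simp) _⟩

variable {B} in
lemma Generated.mul {x : X} {l l' : List Γ.Dart} {Λ M : Dressing D T x} (h : B.Generated l Λ)
    (h' : B.Generated l' M) (hc) : B.Generated (l ++ l') (Λ.mul M hc) := fun S hS I a b => by
  have h1 := h S fun i hi => hS i (List.mem_append_left _ hi)
  have h2 := h' S fun i hi => hS i (List.mem_append_right _ hi)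
  change (Λ.val I * M.val I) a b ∈ S ∧ (M.inv I * Λ.inv I) a b ∈ S
  rw [Matrix.mul_apply, Matrix.mul_apply]
  exact ⟨S.sum_mem fun c _ => S.mul_mem (h1 I a c).1 (h2 I c b).1,
    S.sum_mem fun c _ => S.mul_mem (h2 I a c).2 (h1 I c b).2⟩

/-- The ordered product of elementary dressings. -/
lemma exists_list (x : X) (l : List {i : Γ.Dart // i.snd = x}) (hl : l.Nodup) :
    ∃ Λ : Dressing D T x, B.Generated (l.map Subtype.val) Λ ∧
      (∀ I, Λ.val I = (l.map fun i => (B.elem i.1).val I).prod) := by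
  induction l with
  | nil =>
    refine ⟨Dressing.one x, fun S _ I a b => ?_, fun I => rfl⟩
    change (1 : Matrix _ _ T) a b ∈ S ∧ (1 : Matrix _ _ T) a b ∈ S
    rw [Matrix.one_apply]
    split_ifs <;> simp [S.one_mem, S.zero_mem]
  | cons i l ih =>
    obtain ⟨M, hM, hM2⟩ := ih (List.nodup_cons.mp hl).2
    obtain ⟨i, rfl⟩ := i
    have hi : ∀ j ∈ l.map Subtype.val, i ≠ j := by
      intro j h hij
      obtain ⟨⟨k, hk⟩, hjl, hkj⟩ := List.mem_map.mp h
      exact (List.nodup_cons.mp hl).1 ((Subtype.ext (hij.trans hkj.symm) :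
        (⟨i, rfl⟩ : {j : Γ.Dart // j.snd = i.snd}) = ⟨k, hk⟩) ▸ hjl)
    refine ⟨(B.elem i).mul M ((B.generated_elem i).comm_generated hM (by simpa using hi)),
      (B.generated_elem i).mul hM _, fun I => ?_⟩
    rw [List.map_cons, List.prod_cons, ← hM2]
    rfl

section Order

variable [Fintype X]

variable (Γ) in
/-- The list of all links pointing to `x`, in increasing order. -/
def sortedLinks (D : GaugeData Γ Gs 𝒢 Lab) (x : X) : List {i : Γ.Dart // i.snd = x} :=
  letI := D.order x
  letI : Fintype {i : Γ.Dart // i.snd = x} := by classical exact Fintype.ofFinite _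
  Finset.univ.sort (· ≤ ·)

lemma mem_sortedLinks (x : X) (i) : i ∈ sortedLinks Γ D x := by
  let _ := D.order x
  let _ : Fintype {i : Γ.Dart // i.snd = x} := by classical exact Fintype.ofFinite _
  exact (Finset.mem_sort _).mpr (Finset.mem_univ i)

lemma sortedLinks_sorted (x : X) : (sortedLinks Γ D x).Pairwise (D.order x).lt := by
  let _ := D.order x
  let _ : Fintype {i : Γ.Dart // i.snd = x} := by classical exact Fintype.ofFinite _
  exact Finset.sortedLT_sort _ |>.pairwise

open Classical in
/-- The links with the same target as `i` that are larger than `i`, in increasing order. -/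
def above (D : GaugeData Γ Gs 𝒢 Lab) {x : X} (i : {i : Γ.Dart // i.snd = x}) :
    List {i : Γ.Dart // i.snd = x} :=
  (sortedLinks Γ D x).filter fun j => (D.order x).lt i j

lemma mem_above {x : X} {i j : {i : Γ.Dart // i.snd = x}} :
    j ∈ above D i ↔ (D.order x).lt i j := by
  classical
  simp [above, mem_sortedLinks]

lemma above_nodup {x : X} (i : {i : Γ.Dart // i.snd = x}) : (above D i).Nodup := by
  classical
  let _ := D.order x
  exact ((sortedLinks_sorted (D := D) x).imp fun h => (ne_of_lt h)).filter _

lemma above_eq {x : X} {i j : {i : Γ.Dart // i.snd = x}} (h : (D.order x).lt i j) :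
    ∃ l, above D i = l ++ j :: above D j := by
  classical
  let _ := D.order x
  obtain ⟨a, b, hab⟩ := List.append_of_mem (mem_sortedLinks (D := D) x j)
  have hs := sortedLinks_sorted (D := D) x
  rw [hab, List.pairwise_append, List.pairwise_cons] at hs
  obtain ⟨_, ⟨hb, _⟩, ha⟩ := hs
  have e1 : above D j = b := by
    rw [above, hab, List.filter_append, List.filter_cons, if_neg (by simp),
      List.filter_eq_nil_iff.mpr, List.filter_eq_self.mpr, List.nil_append]
    · intro k hk; simpa using hb k hk
    · intro k hk
      simpa using (ha k hk j (by simp)).le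
  refine ⟨a.filter fun k => (D.order x).lt i k, ?_⟩
  rw [e1, above, hab, List.filter_append, List.filter_cons, if_pos (by simpa using h)]
  congr 2
  rw [List.filter_eq_self]
  intro k hk
  simpa using lt_trans (show i < j from h) (hb k hk)

/-- The dressing at the target of `i` by all larger links. -/
def dress (i : Γ.Dart) : Dressing D T i.snd :=
  (B.exists_list i.snd (above D ⟨i, rfl⟩) (above_nodup _)).choose

lemma generated_dress (i : Γ.Dart) :
    B.Generated ((above D (⟨i, rfl⟩ : {j : Γ.Dart // j.snd = i.snd})).map Subtype.val)
      (B.dress i) :=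
  (B.exists_list i.snd (above D ⟨i, rfl⟩) (above_nodup _)).choose_spec.1

lemma dress_val (i : Γ.Dart) (I : Lab) : (B.dress i).val I =
    ((above D (⟨i, rfl⟩ : {j : Γ.Dart // j.snd = i.snd})).map
      fun i => (B.elem i.1).val I).prod :=
  (B.exists_list i.snd (above D ⟨i, rfl⟩) (above_nodup _)).choose_spec.2 I

lemma of_mem_above {i k : Γ.Dart}
    (hk : k ∈ (above D (⟨i, rfl⟩ : {j : Γ.Dart // j.snd = i.snd})).map Subtype.val) :
    k.snd = i.snd ∧ k ≠ i := by
  let _ := D.order i.snd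
  obtain ⟨⟨k', h⟩, hm, rfl⟩ := List.mem_map.mp hk
  refine ⟨h, fun hki => ?_⟩
  have := mem_above.mp hm
  exact (ne_of_lt this) (Subtype.ext hki.symm)

omit [Fintype X] in
lemma edge_ne {i k : Γ.Dart} (h : k.snd = i.snd) (hne : k ≠ i) : k.edge ≠ i.edge := by
  intro he
  rcases (SimpleGraph.dart_edge_eq_iff k i).mp he with rfl | rfl
  · exact hne rfl
  · exact i.adj.ne h

omit [Fintype X] in
lemma ends_eq {i k : Γ.Dart} (he : k.edge = i.edge) : k.snd = i.snd ∨ k.snd = i.fst := by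
  rcases (SimpleGraph.dart_edge_eq_iff k i).mp he with rfl | rfl
  · exact Or.inl rfl
  · exact Or.inr rfl

lemma dress_comm_U (I J : Lab) (i j : Γ.Dart)
    (h : ∀ k, k.snd = i.snd → k ≠ i → k.edge ≠ j.edge) :
    EntriesCommute ((B.dress i).val I) (B.U J j) :=
  (B.generated_dress i).comm_U I J j fun k hk => h k (of_mem_above hk).1 (of_mem_above hk).2

lemma dress_comm_U_of_ne (I J : Lab) (i j : Γ.Dart) (h : i.snd ≠ j.snd) (h' : i.snd ≠ j.fst) :
    EntriesCommute ((B.dress i).val I) (B.U J j) :=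
  B.dress_comm_U I J i j fun k hk _ he => by
    rcases ends_eq he with e | e
    · exact h (hk.symm.trans e)
    · exact h' (hk.symm.trans e)

lemma dress_comm (I J : Lab) (i j : Γ.Dart) (h : i.snd ≠ j.snd) :
    EntriesCommute ((B.dress i).val I) ((B.dress j).val J) :=
  (B.generated_dress i).comm_generated (B.generated_dress j) (fun k hk l hl => by
    rintro rfl
    exact h ((of_mem_above hk).1.symm.trans (of_mem_above hl).1)) I J

/-- The dressed connection matrices. -/
def dressed (I : Lab) (i : Γ.Dart) : Matrix (D.Idx I) (D.Idx I) T :=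
  (B.dress i.symm).inv I * B.U I i * (B.dress i).val I

lemma dress_val_eq (i : Γ.Dart) {x : X} (h : i.snd = x) (I : Lab) : (B.dress i).val I =
    ((above D (⟨i, h⟩ : {j : Γ.Dart // j.snd = x})).map fun i => (B.elem i.1).val I).prod := by
  subst h
  exact B.dress_val i I

omit [Fintype X] in
lemma list_prod_comm {n : Type*} [Fintype n] [DecidableEq n] {x : X} (I : Lab)
    (l : List {i : Γ.Dart // i.snd = x})
    (Q : Matrix n n T) (h : ∀ i ∈ l, EntriesCommute ((B.elem i.1).val I) Q) :
    EntriesCommute ((l.map fun i => (B.elem i.1).val I).prod) Q := by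
  induction l with
  | nil => exact EntriesCommute.one_left
  | cons i l ih =>
    rw [List.map_cons, List.prod_cons]
    exact (h i (by simp)).mul_left (ih fun k hk => h k (by simp [hk]))

omit [Fintype X] in
lemma elem_mul_U (I J : Lab) (j : Γ.Dart) :
    e1 T _ _ ((B.elem j).val I) * e2 T _ _ (B.U J j) =
      e2 T _ _ (B.U J j) * e1 T _ _ ((B.elem j).val I) * cm T (D.siteTens j.snd I J (Rm _)) := by
  have := e1_Phi_mul_e2 (τ₁ := D.siteRho j.snd I) (B.cov J j) (Rm _)
  rw [comulRightA_Rm, map_mul, Phi3_leg13, Phi3_leg12, ← mul_assoc] at this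
  exact this

lemma dress_mul_U (I J : Lab) (i j : Γ.Dart) (h : i.snd = j.snd)
    (hlt : (D.order j.snd).lt ⟨i, h⟩ ⟨j, rfl⟩) :
    e1 T _ _ ((B.dress i).val I) * (e2 T _ _ (B.U J j) * e2 T _ _ ((B.dress j).val J)) =
      e2 T _ _ (B.U J j) * e2 T _ _ ((B.dress j).val J) * e1 T _ _ ((B.dress i).val I) *
        cm T (D.siteTens j.snd I J (Rm _)) := by
  obtain ⟨l, hl⟩ := above_eq hlt
  have hn := above_nodup (D := D) (⟨i, h⟩ : {k : Γ.Dart // k.snd = j.snd})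
  rw [hl, List.nodup_append] at hn
  obtain ⟨_, hn2, hn3⟩ := hn
  set P := (l.map fun i => (B.elem i.1).val I).prod with hP
  have hV : (B.dress i).val I = P * ((B.elem j).val I * (B.dress j).val I) := by
    rw [B.dress_val_eq i h, hl, List.map_append, List.prod_append, List.map_cons, List.prod_cons,
      B.dress_val_eq j rfl]
  have hlj : ∀ k ∈ l, k.1 ≠ j := fun k hk e =>
    hn3 k hk ⟨j, rfl⟩ (by simp) (Subtype.ext e)
  have c1 : EntriesCommute P (B.U J j) := B.list_prod_comm I l _ fun k hk =>
    B.elem_comm_U I J (edge_ne k.2 (hlj k hk))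
  have c2 : EntriesCommute P ((B.dress j).val J) := B.list_prod_comm I l _ fun k hk => by
    rw [B.dress_val_eq j rfl]
    refine (B.list_prod_comm J _ _ fun m hm => B.elem_comm J I fun e => ?_).symm
    exact hn3 k hk m (by simp [hm]) (Subtype.ext e.symm)
  have c3 : EntriesCommute ((B.elem j).val I) ((B.dress j).val J) := by
    rw [B.dress_val_eq j rfl]
    refine (B.list_prod_comm J _ _ fun m hm => B.elem_comm J I fun e => ?_).symm
    exact (List.nodup_cons.mp hn2).1 ((Subtype.ext e : m = ⟨j, rfl⟩) ▸ hm)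
  have c4 : EntriesCommute ((B.dress j).val I) (B.U J j) :=
    B.dress_comm_U I J j j fun k => edge_ne
  rw [hV, map_mul, map_mul]
  calc _ = e1 T _ _ P * (e1 T _ _ ((B.elem j).val I) * (e1 T _ _ ((B.dress j).val I) *
        e2 T _ _ (B.U J j)) * e2 T _ _ ((B.dress j).val J)) := by simp only [mul_assoc]
    _ = e1 T _ _ P * ((e1 T _ _ ((B.elem j).val I) * e2 T _ _ (B.U J j)) *
        (e1 T _ _ ((B.dress j).val I) * e2 T _ _ ((B.dress j).val J))) := by
        rw [c4.e1_e2]; simp only [mul_assoc]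
    _ = (e1 T _ _ P * e2 T _ _ (B.U J j)) * e1 T _ _ ((B.elem j).val I) *
        (cm T (D.siteTens j.snd I J (Rm _)) *
          (e1 T _ _ ((B.dress j).val I) * e2 T _ _ ((B.dress j).val J))) := by
        rw [B.elem_mul_U]; simp only [mul_assoc]
    _ = e2 T _ _ (B.U J j) * (e1 T _ _ P * (e1 T _ _ ((B.elem j).val I) *
          e2 T _ _ ((B.dress j).val J))) * e1 T _ _ ((B.dress j).val I) *
          cm T (D.siteTens j.snd I J (Rm _)) := by
        rw [(B.dress j).rtt, c1.e1_e2]; simp only [mul_assoc]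
    _ = e2 T _ _ (B.U J j) * (e1 T _ _ P * e2 T _ _ ((B.dress j).val J)) *
          e1 T _ _ ((B.elem j).val I) * e1 T _ _ ((B.dress j).val I) *
          cm T (D.siteTens j.snd I J (Rm _)) := by
        rw [c3.e1_e2]; simp only [mul_assoc]
    _ = _ := by rw [c2.e1_e2]; simp only [mul_assoc]

theorem isConnection_dressed : D.IsConnection B.dressed where
  ope i := (B.ope i).dress (x := i.fst) (B.dress i.symm) (B.dress i)
    (fun I J => B.dress_comm_U I J i.symm i fun k h1 h2 => by
      rw [← SimpleGraph.Dart.edge_symm i]; exact edge_ne h1 h2)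
    (fun I J => B.dress_comm_U I J i i fun k => edge_ne)
    (fun I J => B.dress_comm I J i.symm i i.adj.ne)
  inv I i := by
    have h : (B.dress i.symm.symm).inv I = (B.dress i).inv I := rfl
    rw [dressed, dressed, h]
    calc _ = (B.dress i.symm).inv I * B.U I i * ((B.dress i).val I * (B.dress i).inv I) *
          B.U I i.symm * (B.dress i.symm).val I := by simp only [mul_assoc]
      _ = 1 := by
        rw [(B.dress i).val_mul_inv, mul_one, mul_assoc ((B.dress i.symm).inv I), B.inv, mul_one,
          (B.dress i.symm).inv_mul_val]
  braid I J i j h hlt := by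
    have hij : i ≠ j := by
      rintro rfl
      let _ := D.order i.snd
      exact ne_of_lt hlt rfl
    have hf : i.fst ≠ j.fst := fun e => hij (SimpleGraph.Dart.ext _ _ (Prod.ext e h))
    have hs1 : i.fst ≠ j.snd := h ▸ i.adj.ne
    have hs2 : j.fst ≠ i.snd := h.symm ▸ j.adj.ne
    have a1 := ((B.dress i.symm).entriesCommute_inv
      (B.dress_comm_U_of_ne I J i.symm j hs1 hf)).e1_e2
    have a2 := ((B.dress i.symm).entriesCommute_inv (B.dress_comm I J i.symm j hs1)).e1_e2
    have a3 := ((B.dress i.symm).entriesCommute_inv ((B.dress j.symm).entriesCommute_inv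
      (B.dress_comm J I j.symm i.symm hf.symm)).symm).e1_e2
    have a4 := ((B.dress j.symm).entriesCommute_inv
      (B.dress_comm_U_of_ne J I j.symm i hs2 hf.symm)).symm.e1_e2
    have a5 := ((B.dress j.symm).entriesCommute_inv (B.dress_comm J I j.symm i hs2)).symm.e1_e2
    have a6 := ((B.generated_dress j).comm_U J I i fun k hk => by
      refine edge_ne ((of_mem_above hk).1.trans h.symm) fun hki => ?_
      obtain ⟨k', hm, hk'⟩ := List.mem_map.mp hk
      have e : k' = ⟨i, h⟩ := Subtype.ext (hk'.trans hki)
      let _ := D.order j.snd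
      exact lt_asymm (mem_above.mp hm) (e ▸ hlt)).symm.e1_e2
    have a7 := (B.comm_U I J i j (edge_ne h hij)).e1_e2
    have a8 := B.dress_mul_U I J i j h hlt
    simp only [dressed, map_mul]
    set A₁ := e1 T _ (D.Idx J) ((B.dress i.symm).inv I)
    set A₂ := e2 T (D.Idx I) _ ((B.dress j.symm).inv J)
    set U₁ := e1 T _ (D.Idx J) (B.U I i)
    set U₂ := e2 T (D.Idx I) _ (B.U J j)
    set V₁ := e1 T _ (D.Idx J) ((B.dress i).val I)
    set V₂ := e2 T (D.Idx I) _ ((B.dress j).val J)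
    set R := cm T (D.siteTens j.snd I J (Rm _))
    calc A₁ * U₁ * V₁ * (A₂ * U₂ * V₂) = A₁ * U₁ * (V₁ * A₂) * U₂ * V₂ := by simp only [mul_assoc]
      _ = A₁ * (U₁ * A₂) * V₁ * U₂ * V₂ := by rw [a5]; simp only [mul_assoc]
      _ = A₁ * A₂ * U₁ * (V₁ * (U₂ * V₂)) := by rw [a4]; simp only [mul_assoc]
      _ = A₁ * A₂ * (U₁ * U₂) * V₂ * V₁ * R := by rw [a8]; simp only [mul_assoc]
      _ = A₁ * A₂ * U₂ * (U₁ * V₂) * V₁ * R := by rw [a7]; simp only [mul_assoc]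
      _ = A₂ * (A₁ * U₂) * V₂ * U₁ * V₁ * R := by rw [a6, a3]; simp only [mul_assoc]
      _ = A₂ * U₂ * (A₁ * V₂) * U₁ * V₁ * R := by rw [a1]; simp only [mul_assoc]
      _ = _ := by rw [a2]; simp only [mul_assoc]
  comm I J i j h₁ h₂ h₃ h₄ := by
    have he : i.edge ≠ j.edge := fun e => by
      rcases ends_eq e with e | e
      · exact h₄ e
      · exact h₃ e
    refine EntriesCommute.e1_e2 ?_
    have c1 := (B.dress i.symm).entriesCommute_inv (B.dress_comm_U_of_ne I J i.symm j h₂ h₁)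
    have c2 := (B.dress i.symm).entriesCommute_inv (B.dress_comm I J i.symm j h₂)
    have c3 := (B.dress i.symm).entriesCommute_inv ((B.dress j.symm).entriesCommute_inv
      (B.dress_comm J I j.symm i.symm h₁.symm)).symm
    have c4 := ((B.dress j.symm).entriesCommute_inv
      (B.dress_comm_U_of_ne J I j.symm i h₃.symm h₁.symm)).symm
    have c5 := ((B.dress j.symm).entriesCommute_inv (B.dress_comm J I j.symm i h₃.symm)).symm
    have c6 := (B.dress_comm_U_of_ne J I j i h₄.symm h₂.symm).symm
    have c7 := B.comm_U I J i j he
    have c8 := B.dress_comm_U_of_ne I J i j h₄ h₃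
    have c9 := B.dress_comm I J i j h₄
    exact ((((c3.mul_right c1).mul_right c2)).mul_left ((c4.mul_right c7).mul_right c6)).mul_left
      ((c5.mul_right c8).mul_right c9)

end Order

end BareModel

end Dressings

/-! ### Connection matrices on a single link -/

section Link

lemma IsOpe.map {T T' : Type*} [Ring T] [Algebra ℂ T] [Ring T'] [Algebra ℂ T'] {x y : X}
    {U : ∀ I, Matrix (D.Idx I) (D.Idx I) T} (hU : D.IsOpe x y U) (φ : T →ₐ[ℂ] T') :
    D.IsOpe x y fun I => (U I).map φ := by
  intro I J
  ext p q
  have := congrArg φ (congrFun (congrFun (hU I J) p) q)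
  rw [e1_mul_e2_apply, map_mul] at this
  rw [e1_mul_e2_apply]
  refine this.trans ?_
  simp only [Matrix.sum_apply, mul_cm_apply, cm_mul_apply, map_sum, map_smul, Matrix.map_apply]

lemma Phi_map {G n T T' : Type*} [Ring G] [HopfAlgebra ℂ G] [Fintype n] [DecidableEq n]
    [Ring T] [Algebra ℂ T] [Ring T'] [Algebra ℂ T']
    (τ : G →ₐ[ℂ] Matrix n n ℂ) (h : G →ₐ[ℂ] T) (φ : T →ₐ[ℂ] T') (z : G ⊗[ℂ] G) :
    (Phi τ h z).map φ = Phi τ (φ.comp h) z := by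
  ext a b
  rw [Matrix.map_apply, Phi_apply, Phi_apply]
  rfl

lemma Phi_site {T : Type*} [Ring T] [Algebra ℂ T] (x : X) (I : Lab) (h : Gs →ₐ[ℂ] T)
    (z : 𝒢 x ⊗[ℂ] 𝒢 x) :
    Phi (D.siteRho x I) (h.comp (D.twist x).iso.toAlgEquiv.toAlgHom) z =
      Phi (D.V.rho I) h (D.iso₂ x z) := by
  induction z using TensorProduct.induction_on with
  | zero => simp
  | add a b ha hb => simp only [map_add, ha, hb]
  | tmul a b => rw [Phi_tmul, iso₂_tmul, Phi_tmul]; rfl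

variable (D) in
/-- The connection matrix on a single link from `x` to `y`. -/
def linkU (κ : Lab → ℂ) (x y : X) (I : Lab) : Matrix (D.Idx I) (D.Idx I) (Module.End ℂ Gs)ᵐᵒᵖ :=
  κ I • lopMat (D.F y) (D.cotwist x) (D.V.rho I)

variable (D) in
/-- The inverse of `linkU`. -/
def linkV (κ : Lab → ℂ) (x y : X) (I : Lab) : Matrix (D.Idx I) (D.Idx I) (Module.End ℂ Gs)ᵐᵒᵖ :=
  (κ I)⁻¹ • lopInv (D.F y) (D.Finv y) (D.cotwistInv x) (D.cotwist x) (D.V.rho I)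

lemma linkU_apply (κ : Lab → ℂ) (x y : X) (I : Lab) (a b : D.Idx I) : D.linkU κ x y I a b =
    lop (D.F y) (D.cotwist x) (κ I • ent (D.V.rho I) a b) := by
  rw [map_smul]; rfl

variable {κ : Lab → ℂ} {κs : Gsˣ} (H : D.HasRoots κ κs) (x y : X) (I : Lab)

include H

lemma linkU_mul_linkV : D.linkU κ x y I * D.linkV κ x y I = 1 := by
  rw [linkU, linkV, smul_mul_smul_comm, mul_inv_cancel₀ (H.ne_zero I), one_smul,
    lopMat_mul_lopInv _ (D.isTwist_F y) (D.isTwist_cotwist x)]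

lemma linkV_mul_linkU : D.linkV κ x y I * D.linkU κ x y I = 1 := by
  rw [linkU, linkV, smul_mul_smul_comm, inv_mul_cancel₀ (H.ne_zero I), one_smul,
    lopInv_mul_lopMat _ (D.isTwist_F y) (D.isTwist_cotwist x)]

lemma linkU_isOpe : D.IsOpe x y (D.linkU κ x y) := by
  rw [isOpe_iff H]
  intro I J
  have hU : (fun K => (κ K)⁻¹ • D.linkU κ x y K) =
      fun K => lopMat (D.F y) (D.cotwist x) (D.V.rho K) := by
    funext K
    rw [linkU, smul_smul, inv_mul_cancel₀ (H.ne_zero K), one_smul]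
  rw [hU, linkU, linkU, map_smul, map_smul, smul_mul_smul_comm]
  congr 1
  ext p q
  rw [e1_mul_e2_apply]
  change lop _ _ _ * lop _ _ _ = _
  rw [lop_mul (D.isTwist_F y) (D.isTwist_cotwist x)]
  have h1 : conv (D.F y) (D.cotwist x) (ent (D.V.rho I) p.1 q.1) (ent (D.V.rho J) p.2 q.2) =
      ∑ K, ∑ a, ∑ b, (D.gsTens I J (D.cotwist x) * D.gsTens I J (comulA Gs (D.V.E K a b)) *
        D.gsTens I J (D.F y)) p q • ent (D.V.rho K) a b := by
    ext ξ
    rw [conv_apply, ← tens2_apply]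
    conv_lhs => rw [D.V.sum_E ξ]
    simp only [map_sum, map_smul, Finset.sum_mul, Finset.mul_sum, smul_mul_assoc, mul_smul_comm,
      Matrix.sum_apply, Matrix.smul_apply, LinearMap.sum_apply, LinearMap.smul_apply, smul_eq_mul]
    refine Finset.sum_congr rfl fun K _ => Finset.sum_congr rfl fun a _ =>
      Finset.sum_congr rfl fun b _ => ?_
    rw [map_mul, map_mul, mul_comm, mul_assoc]
    rfl
  rw [h1]
  simp only [map_sum, map_smul, dup, Finset.sum_mul, Finset.mul_sum, Matrix.sum_apply]
  refine Finset.sum_congr rfl fun K _ => Finset.sum_congr rfl fun a _ =>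
    Finset.sum_congr rfl fun b _ => ?_
  rw [← mul_assoc, mul_assoc (_ * _) (sc _ _ _) (cm _ _), sc_mul_cm, ← mul_assoc, ← cm_mul,
    ← cm_mul, mul_sc_apply, cm_apply, ← Algebra.smul_def]
  rfl

omit H in
lemma linkU_cov_target (ξ : 𝒢 y) :
    sc _ _ (rop Gs ((D.twist y).iso ξ)) * D.linkU κ x y I = D.linkU κ x y I *
      Phi (D.siteRho y I) ((rop Gs).comp (D.twist y).iso.toAlgEquiv.toAlgHom) (comulA _ ξ) := by
  rw [Phi_site, iso₂_comul, linkU, mul_smul_comm, smul_mul_assoc,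
    rop_mul_lop _ (D.isTwist_F y)]

lemma linkV_cov_source (ξ : 𝒢 x) :
    sc _ _ (slop Gs ((D.twist x).iso ξ)) * D.linkV κ x y I = D.linkV κ x y I *
      Phi (D.siteRho x I) ((slop Gs).comp (D.twist x).iso.toAlgEquiv.toAlgHom) (comulA _ ξ) := by
  rw [Phi_site]
  have h := Phi_slop_mul_lop (F := D.F y) (D.V.rho I) (D.isTwist_cotwist x) _ _
    (D.galois_iso₂_comul x ξ)
  have h' : Phi (D.V.rho I) (slop Gs) (D.iso₂ x (comulA _ ξ)) * D.linkU κ x y I =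
      D.linkU κ x y I * sc _ _ (slop Gs ((D.twist x).iso ξ)) := by
    rw [linkU, mul_smul_comm, smul_mul_assoc, h]
  calc _ = D.linkV κ x y I * (D.linkU κ x y I * sc _ _ (slop Gs ((D.twist x).iso ξ))) *
        D.linkV κ x y I := by rw [← mul_assoc, linkV_mul_linkU H, one_mul]
    _ = _ := by
        rw [← h', mul_assoc, mul_assoc, linkU_mul_linkV H, mul_one]

end Link

/-! ### Multilinear functionals with one slot for every link -/

section Slots

variable [DecidableEq X]

variable (X Gs) in
/-- Multilinear functionals with one argument in `G_*` for every pair of vertices. -/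
abbrev SlotSpace : Type _ := MultilinearMap ℂ (fun _ : Sym2 X => Gs) ℂ

/-- Operators acting in the slot `e`. -/
def slot (e : Sym2 X) : (Module.End ℂ Gs)ᵐᵒᵖ →ₐ[ℂ] Module.End ℂ (SlotSpace X Gs) :=
  have happ : ∀ (t : Module.End ℂ Gs) (m : SlotSpace X Gs) (ξ : Sym2 X → Gs),
      MultilinearMap.compLinearMapₗ (Function.update (fun _ => LinearMap.id) e t) m ξ =
        m (Function.update ξ e (t (ξ e))) := fun t m ξ => by
    rw [MultilinearMap.compLinearMapₗ_apply, MultilinearMap.compLinearMap_apply]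
    congr 1
    funext f
    by_cases h : f = e
    · subst h; simp
    · simp [h]
  AlgHom.ofLinearMap
    { toFun := fun t => MultilinearMap.compLinearMapₗ
        (Function.update (fun _ => LinearMap.id) e t.unop)
      map_add' := fun s t => by
        ext m ξ
        rw [LinearMap.add_apply, add_apply, happ, happ, happ, MulOpposite.unop_add,
          LinearMap.add_apply, m.map_update_add]
      map_smul' := fun c t => by
        ext m ξ
        rw [RingHom.id_apply, LinearMap.smul_apply, smul_apply, happ, happ,
          MulOpposite.unop_smul, LinearMap.smul_apply, m.map_update_smul] }
    (by
      ext m ξ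
      refine (happ _ _ _).trans ?_
      simp)
    (fun s t => by
      ext m ξ
      rw [Module.End.mul_apply]
      refine (happ _ _ _).trans (Eq.trans ?_ (happ _ _ _).symm)
      refine Eq.trans ?_ (happ _ _ _).symm
      simp)

lemma slot_apply (e : Sym2 X) (t : (Module.End ℂ Gs)ᵐᵒᵖ) (m : SlotSpace X Gs) (ξ : Sym2 X → Gs) :
    slot e t m ξ = m (Function.update ξ e (t.unop (ξ e))) := by
  change m (fun f => Function.update (fun _ => LinearMap.id) e t.unop f (ξ f)) = _
  congr 1
  funext f
  by_cases h : f = e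
  · subst h; simp
  · simp [h]

lemma slot_comm {e f : Sym2 X} (h : e ≠ f) (s t : (Module.End ℂ Gs)ᵐᵒᵖ) :
    slot e s * slot f t = slot f t * slot e s := by
  ext m ξ
  rw [Module.End.mul_apply, Module.End.mul_apply, slot_apply, slot_apply, slot_apply, slot_apply,
    Function.update_of_ne h.symm, Function.update_of_ne h, Function.update_comm h]

end Slots

/-! ### A model of the algebra of functions on connections -/

section Model

variable [DecidableEq X]

/-- A choice of an orientation of every link. -/
def IsPos (i : Γ.Dart) : Prop := i.fst = (Quot.out i.edge).1

omit [DecidableEq X] in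
lemma isPos_symm (i : Γ.Dart) : IsPos i.symm ↔ ¬ IsPos i := by
  rw [IsPos, IsPos, SimpleGraph.Dart.edge_symm]
  have h : (Quot.out i.edge).1 ∈ i.edge := Sym2.out_fst_mem _
  have h' : (Quot.out i.edge).1 = i.fst ∨ (Quot.out i.edge).1 = i.snd := Sym2.mem_iff.mp h
  change i.snd = _ ↔ _
  have := i.adj.ne
  rcases h' with e | e <;> rw [e] <;> simp [this, this.symm]

open Classical in
/-- The connection matrices on the links before dressing. -/
def slotU (D : GaugeData Γ Gs 𝒢 Lab) (κ : Lab → ℂ) (I : Lab) (i : Γ.Dart) :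
    Matrix (D.Idx I) (D.Idx I) (Module.End ℂ (SlotSpace X Gs)) :=
  (if IsPos i then D.linkU κ i.fst i.snd I else D.linkV κ i.snd i.fst I).map (slot i.edge)

open Classical in
/-- The action of gauge transformations at the end of a link. -/
def linkσ (D : GaugeData Γ Gs 𝒢 Lab) (i : Γ.Dart) : 𝒢 i.snd →ₐ[ℂ] (Module.End ℂ Gs)ᵐᵒᵖ :=
  (if IsPos i then rop Gs else slop Gs).comp (D.twist i.snd).iso.toAlgEquiv.toAlgHom

variable {κ : Lab → ℂ} {κs : Gsˣ}

open Classical in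
/-- The model before dressing. -/
def bareModel (H : D.HasRoots κ κs) : BareModel D (Module.End ℂ (SlotSpace X Gs)) where
  U := D.slotU κ
  σ i := (slot i.edge).comp (D.linkσ i)
  ope i := by
    refine IsOpe.map (U := fun I => if IsPos i then D.linkU κ i.fst i.snd I
      else D.linkV κ i.snd i.fst I) ?_ (slot i.edge)
    by_cases h : IsPos i
    · simp only [if_pos h]; exact linkU_isOpe H _ _
    · simp only [if_neg h]
      exact (linkU_isOpe H i.snd i.fst).inv H (linkV_mul_linkU H _ _) (linkU_mul_linkV H _ _)
  inv I i := by
    rw [slotU, slotU, SimpleGraph.Dart.edge_symm, ← Matrix.map_mul]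
    by_cases h : IsPos i
    · rw [if_pos h, if_neg (by rw [isPos_symm]; simpa using h)]
      refine (congrArg (fun M => Matrix.map M (slot i.edge)) (linkU_mul_linkV H _ _ I)).trans ?_
      exact Matrix.map_one _ (map_zero _) (map_one _)
    · rw [if_neg h, if_pos (by rw [isPos_symm]; exact h)]
      refine (congrArg (fun M => Matrix.map M (slot i.edge)) (linkV_mul_linkU H _ _ I)).trans ?_
      exact Matrix.map_one _ (map_zero _) (map_one _)
  cov I i ξ := by
    have h : sc _ _ (D.linkσ i ξ) * (if IsPos i then D.linkU κ i.fst i.snd I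
        else D.linkV κ i.snd i.fst I) = (if IsPos i then D.linkU κ i.fst i.snd I
        else D.linkV κ i.snd i.fst I) * Phi (D.siteRho i.snd I) (D.linkσ i) (comulA _ ξ) := by
      rw [linkσ]
      by_cases h : IsPos i
      · simp only [if_pos h]; exact linkU_cov_target _ _ I ξ
      · simp only [if_neg h]; exact linkV_cov_source H _ _ I ξ
    have h2 := congrArg (fun M => Matrix.map M (slot i.edge)) h
    simp only [Matrix.map_mul] at h2
    rw [Phi_map] at h2
    refine Eq.trans ?_ h2
    congr 1
    ext a b
    rw [sc_apply, Matrix.map_apply, sc_apply]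
    split_ifs <;> simp
  comm_U I J i j h a b c d := slot_comm h _ _
  comm_σ_U J i j h ξ a b := slot_comm h _ _
  comm_σ i j h ξ η := by
    by_cases he : i.edge = j.edge
    · obtain rfl : i = j.symm := ((SimpleGraph.dart_edge_eq_iff i j).mp he).resolve_left h
      change slot j.symm.edge _ * slot j.edge _ = slot j.edge _ * slot j.symm.edge _
      rw [SimpleGraph.Dart.edge_symm, ← map_mul, ← map_mul]
      congr 1
      have hc : ∀ a b : Gs, rop Gs a * slop Gs b = slop Gs b * rop Gs a := fun a b => by
        apply MulOpposite.unop_injective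
        ext ζ
        change SA Gs b * (ζ * a) = SA Gs b * ζ * a
        rw [mul_assoc]
      rw [linkσ, linkσ]
      by_cases hp : IsPos j
      · rw [if_pos hp, if_neg (by rw [isPos_symm]; simpa using hp)]
        exact (hc _ _).symm
      · rw [if_neg hp, if_pos (by rw [isPos_symm]; exact hp)]
        exact hc _ _
    · exact slot_comm he _ _

end Model

/-! ### The universal property of the algebra of functions -/

section Lift

variable {T : Type*} [Ring T] [Algebra ℂ T]
  {U : ∀ (I : Lab) (_ : Γ.Dart), Matrix (D.Idx I) (D.Idx I) T}

/-- The homomorphism from the algebra of functions defined by connection matrices. -/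
def funLift (hU : D.IsConnection U) : D.FunAlg →ₐ[ℂ] T :=
  RingQuot.liftAlgHom ℂ ⟨FreeAlgebra.lift ℂ fun p : D.Coord => U p.I p.i p.a p.b,
    fun _ _ h => IsConnection.map_eq _ _ (by simp only [FreeAlgebra.lift_ι_apply]; exact hU) h⟩

@[simp] lemma funLift_coord (hU : D.IsConnection U) (I : Lab) (i : Γ.Dart) (a b : D.Idx I) :
    funLift hU (D.coord I i a b) = U I i a b := by
  rw [funLift, coord, RingQuot.liftAlgHom_mkAlgHom_apply, FreeAlgebra.lift_ι_apply]

lemma funAlg_hom_ext {φ ψ : D.FunAlg →ₐ[ℂ] T}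
    (h : ∀ I i a b, φ (D.coord I i a b) = ψ (D.coord I i a b)) : φ = ψ := by
  apply RingQuot.ringQuot_ext'
  apply FreeAlgebra.hom_ext
  funext p
  exact h p.I p.i p.a p.b

variable (D) in
/-- The matrix of coordinate functions. -/
def coordMat (I : Lab) (i : Γ.Dart) : Matrix (D.Idx I) (D.Idx I) D.FunAlg :=
  Matrix.of fun a b => D.coord I i a b

lemma isConnection_coordMat : D.IsConnection D.coordMat :=
  isConnection_of (RingQuot.mkAlgHom ℂ _) _ fun h => RingQuot.mkAlgHom_rel ℂ h

lemma IsConnection.triv_eq_one {κ : Lab → ℂ} {κs : Gsˣ} (H : D.HasRoots κ κs)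
    (hU : D.IsConnection U) (i : Γ.Dart) : U D.V.triv i = 1 :=
  (hU.ope i).triv_eq_one H (V := fun I => U I i.symm) (by
    simpa using hU.inv D.V.triv i.symm)

end Lift

/-! ### The Haar functional on the algebra of functions -/

section Haar

/-- The operators preserving a submodule. -/
def stab {M : Type*} [AddCommGroup M] [Module ℂ M] (p : Submodule ℂ M) :
    Subalgebra ℂ (Module.End ℂ M) where
  carrier := {t | ∀ m ∈ p, t m ∈ p}
  mul_mem' hs ht m hm := hs _ (ht _ hm)
  add_mem' hs ht m hm := p.add_mem (hs _ hm) (ht _ hm)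
  algebraMap_mem' c m hm := by
    rw [Module.algebraMap_end_apply]; exact p.smul_mem c hm

variable [DecidableEq X] {κ : Lab → ℂ} {κs : Gsˣ} (H : D.HasRoots κ κs)

variable (X Gs) in
/-- The functionals depending trivially on the argument in the slot `e`. -/
def constIn (e : Sym2 X) : Submodule ℂ (SlotSpace X Gs) where
  carrier := {m | ∀ ξ, m ξ = Coalgebra.counit (R := ℂ) (ξ e) • m (Function.update ξ e 1)}
  zero_mem' ξ := by simp
  add_mem' hm hm' ξ := by rw [add_apply, add_apply, hm, hm', smul_add]
  smul_mem' c m hm ξ := by rw [smul_apply, smul_apply, hm, smul_comm]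

variable (D) in
/-- The functionals vanishing when the argument in the slot `e` is the Haar integral. -/
def vanishIn (e : Sym2 X) : Submodule ℂ (SlotSpace X Gs) where
  carrier := {m | ∀ ξ, m (Function.update ξ e D.V.haar) = 0}
  zero_mem' ξ := by simp
  add_mem' hm hm' ξ := by rw [add_apply, hm, hm', add_zero]
  smul_mem' c m hm ξ := by rw [smul_apply, hm, smul_zero]

lemma mem_constIn {e : Sym2 X} {m : SlotSpace X Gs} : m ∈ constIn X Gs e ↔
    ∀ ξ, m ξ = Coalgebra.counit (R := ℂ) (ξ e) • m (Function.update ξ e 1) := Iff.rfl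

lemma mem_vanishIn {e : Sym2 X} {m : SlotSpace X Gs} : m ∈ D.vanishIn e ↔
    ∀ ξ, m (Function.update ξ e D.V.haar) = 0 := Iff.rfl

lemma slot_mem_stab_constIn {e f : Sym2 X} (h : f ≠ e) (t : (Module.End ℂ Gs)ᵐᵒᵖ) :
    slot f t ∈ stab (constIn X Gs e) := fun m hm ξ => by
  rw [slot_apply, slot_apply, mem_constIn.mp hm, Function.update_of_ne h.symm,
    Function.update_of_ne h, Function.update_comm h]

lemma slot_mem_stab_vanishIn {e f : Sym2 X} (h : f ≠ e) (t : (Module.End ℂ Gs)ᵐᵒᵖ) :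
    slot f t ∈ stab (D.vanishIn e) := fun m hm ξ => by
  rw [slot_apply, Function.update_of_ne h, Function.update_comm h.symm, mem_vanishIn.mp hm]

lemma unop_linkσ (i : Γ.Dart) (ξ : 𝒢 i.snd) (ζ : Gs) : ((D.linkσ i ξ).unop ζ =
      ζ * (D.twist i.snd).iso ξ) ∨ ((D.linkσ i ξ).unop ζ = SA Gs ((D.twist i.snd).iso ξ) * ζ) := by
  by_cases h : IsPos i
  · left; rw [linkσ, if_pos h]; rfl
  · right; rw [linkσ, if_neg h]; rfl

lemma counit_unop_linkσ (i : Γ.Dart) (ξ : 𝒢 i.snd) (ζ : Gs) :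
    Coalgebra.counit (R := ℂ) ((D.linkσ i ξ).unop ζ) =
      Coalgebra.counit (R := ℂ) ζ * Coalgebra.counit (R := ℂ) ((D.twist i.snd).iso ξ) := by
  rcases unop_linkσ (D := D) i ξ ζ with h | h <;> rw [h]
  · simp
  · simp [HopfAlgebra.counit_antipode, mul_comm]

lemma unop_linkσ_haar (i : Γ.Dart) (ξ : 𝒢 i.snd) : (D.linkσ i ξ).unop D.V.haar =
      Coalgebra.counit (R := ℂ) ((D.twist i.snd).iso ξ) • D.V.haar := by
  rcases unop_linkσ (D := D) i ξ D.V.haar with h | h <;> rw [h]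
  · rw [D.V.haar_mul]
  · rw [D.V.mul_haar, HopfAlgebra.counit_antipode]

lemma σ_mem_stab_constIn (e : Sym2 X) (i : Γ.Dart) (ξ : 𝒢 i.snd) :
    (bareModel H).σ i ξ ∈ stab (constIn X Gs e) := by
  by_cases h : i.edge = e
  · subst h
    intro m hm ζ
    change slot _ (D.linkσ i ξ) m ζ = _ • slot _ (D.linkσ i ξ) m _
    rw [slot_apply, slot_apply, mem_constIn.mp hm]
    conv_rhs => rw [mem_constIn.mp hm]
    rw [Function.update_self, Function.update_self, Function.update_self, Function.update_idem,
      Function.update_idem, Function.update_idem, counit_unop_linkσ, counit_unop_linkσ,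
      Bialgebra.counit_one, one_mul, smul_smul]
  · exact slot_mem_stab_constIn h _

lemma σ_mem_stab_vanishIn (e : Sym2 X) (i : Γ.Dart) (ξ : 𝒢 i.snd) :
    (bareModel H).σ i ξ ∈ stab (D.vanishIn e) := by
  by_cases h : i.edge = e
  · subst h
    intro m hm ζ
    change slot _ (D.linkσ i ξ) m _ = _
    rw [slot_apply, Function.update_self, unop_linkσ_haar, Function.update_idem,
      m.map_update_smul, mem_vanishIn.mp hm, smul_zero]
  · exact slot_mem_stab_vanishIn h _

lemma U_mem_range_slot (I : Lab) (i : Γ.Dart) (a b : D.Idx I) :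
    ∃ t, (bareModel H).U I i a b = slot i.edge t := ⟨_, rfl⟩

lemma counit_linkU_haar (x y : X) (I : Lab) (hI : I ≠ D.V.triv) (a b : D.Idx I) :
    Coalgebra.counit (R := ℂ) ((D.linkU κ x y I a b).unop D.V.haar) = 0 := by
  rw [linkU_apply, unop_lop_apply, counit_slice, map_mul (counitRightA Gs), map_mul (counitRightA Gs), (D.isTwist_F y).counit_right,
    Bialgebra.comulAlgHom_apply, counitRightA_comul, mul_one, D.V.mul_haar]
  simp [D.V.rep_haar_of_ne hI]

lemma counit_linkV_haar (x y : X) (I : Lab) (hI : I ≠ D.V.triv) (a b : D.Idx I) :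
    Coalgebra.counit (R := ℂ) ((D.linkV κ x y I a b).unop D.V.haar) = 0 := by
  change Coalgebra.counit (R := ℂ) ((κ I)⁻¹ • (lop _ _ _).unop D.V.haar) = 0
  rw [map_smul, unop_lop_apply, counit_slice, map_mul (counitRightA Gs), map_mul (counitRightA Gs), (D.isTwist_F y).counit_right,
    Bialgebra.comulAlgHom_apply, counitRightA_comul, mul_one, D.V.mul_haar]
  simp [D.V.rep_haar_of_ne hI, D.V.antipode_haar, D.V.rep_haar_of_ne hI]

lemma U_constIn_vanishIn {I : Lab} (hI : I ≠ D.V.triv) (i : Γ.Dart) (a b : D.Idx I)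
    {m : SlotSpace X Gs} (hm : m ∈ constIn X Gs i.edge) :
    (bareModel H).U I i a b m ∈ D.vanishIn i.edge := fun ξ => by
  have key : ∀ t : (Module.End ℂ Gs)ᵐᵒᵖ, Coalgebra.counit (R := ℂ) (t.unop D.V.haar) = 0 →
      slot i.edge t m (Function.update ξ i.edge D.V.haar) = 0 := fun t ht => by
    rw [slot_apply, Function.update_self, Function.update_idem, mem_constIn.mp hm,
      Function.update_self, ht, zero_smul]
  refine key _ ?_
  by_cases h : IsPos i
  · rw [if_pos h]; exact counit_linkU_haar _ _ _ hI _ _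
  · rw [if_neg h]; exact counit_linkV_haar _ _ _ hI _ _

variable [Fintype X]

lemma dress_mem (S : Subalgebra ℂ (Module.End ℂ (SlotSpace X Gs)))
    (hS : ∀ (i : Γ.Dart) ξ, (bareModel H).σ i ξ ∈ S) (i : Γ.Dart) (I : Lab) (a b : D.Idx I) :
    ((bareModel H).dress i).val I a b ∈ S ∧ ((bareModel H).dress i).inv I a b ∈ S :=
  (bareModel H).generated_dress i S (fun j _ => hS j) I a b

lemma dressed_mem (S : Subalgebra ℂ (Module.End ℂ (SlotSpace X Gs)))
    (hS : ∀ (i : Γ.Dart) ξ, (bareModel H).σ i ξ ∈ S) (I : Lab) (i : Γ.Dart)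
    (hU : ∀ a b, (bareModel H).U I i a b ∈ S) (a b : D.Idx I) :
    (bareModel H).dressed I i a b ∈ S := by
  rw [BareModel.dressed, Matrix.mul_apply]
  refine S.sum_mem fun c _ => S.mul_mem ?_ (dress_mem H S hS i I c b).1
  rw [Matrix.mul_apply]
  exact S.sum_mem fun d _ => S.mul_mem (dress_mem H S hS i.symm I a d).2 (hU d c)

lemma dressed_constIn_vanishIn {I : Lab} (hI : I ≠ D.V.triv) (i : Γ.Dart) (a b : D.Idx I)
    {m : SlotSpace X Gs} (hm : m ∈ constIn X Gs i.edge) :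
    (bareModel H).dressed I i a b m ∈ D.vanishIn i.edge := by
  rw [BareModel.dressed, Matrix.mul_apply, LinearMap.sum_apply]
  refine Submodule.sum_mem _ fun c _ => ?_
  rw [Matrix.mul_apply, Finset.sum_mul, LinearMap.sum_apply]
  refine Submodule.sum_mem _ fun d _ => ?_
  exact (dress_mem H _ (fun i ξ => σ_mem_stab_vanishIn H _ i ξ) i.symm I a d).2 _
    (U_constIn_vanishIn H hI i d c
      ((dress_mem H _ (fun i ξ => σ_mem_stab_constIn H _ i ξ) i I c b).1 _ hm))

/-- The representation of the algebra of functions on multilinear functionals. -/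
def slotRep : D.FunAlg →ₐ[ℂ] Module.End ℂ (SlotSpace X Gs) :=
  funLift (bareModel H).isConnection_dressed

variable (X Gs) in
/-- The product of the counits. -/
def slotVac : SlotSpace X Gs :=
  (MultilinearMap.mkPiAlgebra ℂ (Sym2 X) ℂ).compLinearMap fun _ => Coalgebra.counit (A := Gs)

lemma slotVac_apply (ξ : Sym2 X → Gs) :
    slotVac X Gs ξ = ∏ e, Coalgebra.counit (R := ℂ) (ξ e) := rfl

lemma slotVac_mem (e : Sym2 X) : slotVac X Gs ∈ constIn X Gs e := fun ξ => by
  rw [slotVac_apply, slotVac_apply, ← Finset.mul_prod_erase _ _ (Finset.mem_univ e),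
    ← Finset.mul_prod_erase _ (fun f => Coalgebra.counit (R := ℂ) (Function.update ξ e 1 f))
      (Finset.mem_univ e), Function.update_self, Bialgebra.counit_one, one_mul, smul_eq_mul]
  congr 1
  refine Finset.prod_congr rfl fun f hf => ?_
  rw [Function.update_of_ne (Finset.ne_of_mem_erase hf)]

/-- The Haar functional on the algebra of functions. -/
def funHaar : D.FunAlg →ₗ[ℂ] ℂ where
  toFun f := slotRep H f (slotVac X Gs) fun _ => D.V.haar
  map_add' f g := by rw [map_add, LinearMap.add_apply, add_apply]
  map_smul' c f := by rw [map_smul, LinearMap.smul_apply, smul_apply]; rfl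

lemma funHaar_apply (f : D.FunAlg) :
    funHaar H f = slotRep H f (slotVac X Gs) fun _ => D.V.haar := rfl

variable (D) in
/-- The product of coordinate functions. -/
def coordProd (l : List D.Coord) : D.FunAlg := (l.map fun p => D.coord p.I p.i p.a p.b).prod

lemma slotRep_coord (I : Lab) (i : Γ.Dart) (a b : D.Idx I) :
    slotRep H (D.coord I i a b) = (bareModel H).dressed I i a b := funLift_coord _ _ _ _ _

lemma coordProd_mem_constIn (e : Sym2 X) (l : List D.Coord) (hl : e ∉ l.map fun p => p.i.edge) :
    slotRep H (D.coordProd l) (slotVac X Gs) ∈ constIn X Gs e := by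
  have hmem : slotRep H (D.coordProd l) ∈ stab (constIn X Gs e) := by
    rw [coordProd, map_list_prod]
    refine Subalgebra.list_prod_mem _ fun t ht => ?_
    simp only [List.map_map, List.mem_map, Function.comp] at ht
    obtain ⟨p, hp, rfl⟩ := ht
    rw [slotRep_coord]
    refine dressed_mem H _ (σ_mem_stab_constIn H e) _ _ (fun a b => ?_) _ _
    obtain ⟨t, ht⟩ := U_mem_range_slot H p.I p.i a b
    rw [ht]
    exact slot_mem_stab_constIn (fun h => hl (List.mem_map.mpr ⟨p, hp, h⟩)) _
  exact hmem _ (slotVac_mem e)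

lemma coordProd_mem_vanishIn (l : List D.Coord) (hl : (l.map fun p => p.i.edge).Nodup)
    (p : D.Coord) (hp : p ∈ l) (hI : p.I ≠ D.V.triv) :
    slotRep H (D.coordProd l) (slotVac X Gs) ∈ D.vanishIn p.i.edge := by
  induction l with
  | nil => simp at hp
  | cons q l ih =>
    rw [List.map_cons, List.nodup_cons] at hl
    rw [coordProd, List.map_cons, List.prod_cons, map_mul, Module.End.mul_apply, slotRep_coord]
    rcases List.mem_cons.mp hp with rfl | hp
    · exact dressed_constIn_vanishIn H hI _ _ _ (coordProd_mem_constIn H _ l hl.1)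
    · refine dressed_mem H _ (σ_mem_stab_vanishIn H p.i.edge) _ _ (fun a b => ?_) _ _ _
        (ih hl.2 hp)
      obtain ⟨t, ht⟩ := U_mem_range_slot H q.I q.i a b
      rw [ht]
      exact slot_mem_stab_vanishIn (fun h => hl.1 (List.mem_map.mpr ⟨p, hp, h.symm⟩)) _

include H in
lemma coordProd_eq_one (l : List D.Coord) (h : ∀ p ∈ l, p.I = D.V.triv) : D.coordProd l = 1 := by
  refine List.prod_eq_one fun t ht => ?_
  obtain ⟨⟨I, i, a, b⟩, hp, rfl⟩ := List.mem_map.mp ht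
  obtain rfl : I = D.V.triv := h _ hp
  have := congrFun (congrFun ((isConnection_coordMat (D := D)).triv_eq_one H i) a) b
  rw [idx_triv_eq b a, Matrix.one_apply_eq] at this
  rw [idx_triv_eq b a]
  exact this

lemma funHaar_one : funHaar H 1 = 1 := by
  rw [funHaar_apply, map_one, Module.End.one_apply, slotVac_apply]
  simp [D.V.counit_haar]

open Classical in
lemma funHaar_coordProd (l : List D.Coord) (hl : (l.map fun p => p.i.edge).Nodup) :
    funHaar H (D.coordProd l) = if ∀ p ∈ l, p.I = D.V.triv then 1 else 0 := by
  split_ifs with h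
  · rw [coordProd_eq_one H l h, funHaar_one]
  · push Not at h
    obtain ⟨p, hp, hI⟩ := h
    have := coordProd_mem_vanishIn H l hl p hp hI fun _ => D.V.haar
    rwa [Function.update_eq_self_iff.mpr rfl] at this

end Haar

/-! ### Dressing of all links -/

section GaugeTransform

variable {T : Type*} [Ring T] [Algebra ℂ T]

/-- A connection dressed at all vertices is a connection. -/
lemma IsConnection.dress {U : ∀ (I : Lab) (_ : Γ.Dart), Matrix (D.Idx I) (D.Idx I) T}
    (hU : D.IsConnection U) (Λ : ∀ x, Dressing D T x)
    (h1 : ∀ x I J i, EntriesCommute ((Λ x).val I) (U J i))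
    (h2 : ∀ x y, x ≠ y → ∀ I J, EntriesCommute ((Λ x).val I) ((Λ y).val J)) :
    D.IsConnection fun I i => (Λ i.fst).inv I * U I i * (Λ i.snd).val I := by
  have k1 : ∀ x I J i, EntriesCommute ((Λ x).inv I) (U J i) := fun x I J i =>
    (Λ x).entriesCommute_inv (h1 x I J i)
  have k2 : ∀ x y, x ≠ y → ∀ I J, EntriesCommute ((Λ x).inv I) ((Λ y).val J) :=
    fun x y h I J => (Λ x).entriesCommute_inv (h2 x y h I J)
  have k3 : ∀ x y, x ≠ y → ∀ I J, EntriesCommute ((Λ x).inv I) ((Λ y).inv J) :=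
    fun x y h I J => ((Λ y).entriesCommute_inv (k2 x y h I J).symm).symm
  refine ⟨fun i => (hU.ope i).dress _ _ (fun I J => h1 _ I J i) (fun I J => h1 _ I J i)
    (h2 _ _ i.adj.ne), fun I i => ?_, fun I J i j h hlt => ?_, fun I J i j h₁ h₂ h₃ h₄ => ?_⟩
  · change (Λ i.fst).inv I * U I i * (Λ i.snd).val I * ((Λ i.snd).inv I * U I i.symm *
      (Λ i.fst).val I) = 1
    calc _ = (Λ i.fst).inv I * (U I i * ((Λ i.snd).val I * (Λ i.snd).inv I) * U I i.symm) *
          (Λ i.fst).val I := by simp only [mul_assoc]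
      _ = 1 := by
        rw [(Λ i.snd).val_mul_inv, mul_one, hU.inv, mul_one, (Λ i.fst).inv_mul_val]
  · have hij : i ≠ j := by
      rintro rfl
      let _ := D.order i.snd
      exact ne_of_lt hlt rfl
    have hf : i.fst ≠ j.fst := fun e => hij (SimpleGraph.Dart.ext _ _ (Prod.ext e h))
    have hs1 : i.fst ≠ j.snd := h ▸ i.adj.ne
    have hs2 : j.fst ≠ i.snd := h.symm ▸ j.adj.ne
    obtain ⟨⟨s, y⟩, hi⟩ := i
    obtain ⟨⟨r, z⟩, hj⟩ := j
    obtain rfl : y = z := h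
    have a1 := (k1 s I J ⟨(r, y), hj⟩).e1_e2
    have a2 := (k2 s y hs1 I J).e1_e2
    have a3 := (k3 s r hf I J).e1_e2
    have a4 := (k1 r J I ⟨(s, y), hi⟩).symm.e1_e2
    have a5 := (k2 r y hs2 J I).symm.e1_e2
    have a6 := (h1 y J I ⟨(s, y), hi⟩).symm.e1_e2
    have a7 := (h1 y I J ⟨(r, y), hj⟩).e1_e2
    have a8 := (Λ y).rtt I J
    have a9 := hU.braid I J ⟨(s, y), hi⟩ ⟨(r, y), hj⟩ rfl hlt
    simp only [map_mul]
    change e1 T _ (D.Idx J) ((Λ s).inv I) * e1 T _ (D.Idx J) (U I ⟨(s, y), hi⟩) *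
      e1 T _ (D.Idx J) ((Λ y).val I) * (e2 T (D.Idx I) _ ((Λ r).inv J) *
      e2 T (D.Idx I) _ (U J ⟨(r, y), hj⟩) * e2 T (D.Idx I) _ ((Λ y).val J)) =
      e2 T (D.Idx I) _ ((Λ r).inv J) *
      e2 T (D.Idx I) _ (U J ⟨(r, y), hj⟩) * e2 T (D.Idx I) _ ((Λ y).val J) *
      (e1 T _ (D.Idx J) ((Λ s).inv I) * e1 T _ (D.Idx J) (U I ⟨(s, y), hi⟩) *
      e1 T _ (D.Idx J) ((Λ y).val I)) * cm T (D.siteTens y I J (Rm _))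
    change e1 T _ (D.Idx J) (U I ⟨(s, y), hi⟩) * e2 T (D.Idx I) _ (U J ⟨(r, y), hj⟩) =
      e2 T (D.Idx I) _ (U J ⟨(r, y), hj⟩) * e1 T _ (D.Idx J) (U I ⟨(s, y), hi⟩) *
      cm T (D.siteTens y I J (Rm _)) at a9
    set A₁ := e1 T _ (D.Idx J) ((Λ s).inv I)
    set A₂ := e2 T (D.Idx I) _ ((Λ r).inv J)
    set U₁ := e1 T _ (D.Idx J) (U I ⟨(s, y), hi⟩)
    set U₂ := e2 T (D.Idx I) _ (U J ⟨(r, y), hj⟩)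
    set V₁ := e1 T _ (D.Idx J) ((Λ y).val I)
    set V₂ := e2 T (D.Idx I) _ ((Λ y).val J)
    set R := cm T (D.siteTens y I J (Rm _))
    calc A₁ * U₁ * V₁ * (A₂ * U₂ * V₂) = A₁ * U₁ * (V₁ * A₂) * U₂ * V₂ := by simp only [mul_assoc]
      _ = A₁ * (U₁ * A₂) * (V₁ * U₂) * V₂ := by rw [a5]; simp only [mul_assoc]
      _ = A₁ * A₂ * (U₁ * U₂) * (V₁ * V₂) := by rw [a4, a7]; simp only [mul_assoc]
      _ = A₁ * A₂ * U₂ * U₁ * (R * (V₁ * V₂)) := by rw [a9]; simp only [mul_assoc]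
      _ = A₂ * (A₁ * U₂) * (U₁ * V₂) * V₁ * R := by rw [a8, a3]; simp only [mul_assoc]
      _ = A₂ * U₂ * (A₁ * V₂) * U₁ * V₁ * R := by rw [a6, a1]; simp only [mul_assoc]
      _ = _ := by rw [a2]; simp only [mul_assoc]
  · have h7 : EntriesCommute (U I i) (U J j) := fun a b c d => by
      have := congrFun (congrFun (hU.comm I J i j h₁ h₂ h₃ h₄) (a, c)) (b, d)
      rwa [e1_mul_e2_apply, e2_mul_e1_apply] at this
    refine EntriesCommute.e1_e2 ?_
    exact ((((k3 _ _ h₁ I J).mul_right (k1 _ I J j)).mul_right (k2 _ _ h₂ I J)).mul_left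
      (((k1 _ J I i).symm.mul_right h7).mul_right (h1 _ J I i).symm)).mul_left
      (((k2 _ _ h₃.symm J I).symm.mul_right (h1 _ I J j)).mul_right (h2 _ _ h₄ I J))

end GaugeTransform

/-! ### Gauge transformations as functions with values in an algebra -/

section Convolution

variable {A : Type*} [Ring A] [Algebra ℂ A] {G : Type*} [Ring G] [HopfAlgebra ℂ G]

variable (A) in
/-- A scalar functional as an element of the convolution algebra. -/
def scal (f : G →ₗ[ℂ] ℂ) : WithConv (G →ₗ[ℂ] A) := WithConv.toConv (f.smulRight (1 : A))

variable (A G) in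
/-- Constant functions. -/
def constHom : A →ₐ[ℂ] WithConv (G →ₗ[ℂ] A) :=
  AlgHom.ofLinearMap
    { toFun := fun a => WithConv.toConv ((Coalgebra.counit (R := ℂ) (A := G)).smulRight a)
      map_add' := fun a b => by apply WithConv.ext; ext; simp
      map_smul' := fun c a => by apply WithConv.ext; ext; simp [smul_comm c] }
    (by
      apply WithConv.ext; ext ξ
      simp [LinearMap.convOne_def, Algebra.algebraMap_eq_smul_one])
    (fun a b => by
      apply WithConv.ext; ext ξ
      rw [LinearMap.convMul_apply]
      have : ∀ z : G ⊗[ℂ] G, Coalgebra.counit (R := ℂ) (counitLeftA G z) • (a * b) =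
          LinearMap.mul' ℂ A (TensorProduct.map
            ((Coalgebra.counit (R := ℂ) (A := G)).smulRight a)
            ((Coalgebra.counit (R := ℂ) (A := G)).smulRight b) z) := fun z => by
        induction z using TensorProduct.induction_on with
        | zero => simp
        | add x y hx hy => simp only [map_add, add_smul, hx, hy]
        | tmul x y => simp [smul_mul_smul_comm, smul_smul, mul_comm]
      refine Eq.trans ?_ (this _)
      simp)

lemma scal_apply (f : G →ₗ[ℂ] ℂ) (ξ : G) : (scal A f).ofConv ξ = f ξ • 1 := rfl
lemma constHom_apply (a : A) (ξ : G) :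
    (constHom A G a).ofConv ξ = Coalgebra.counit (R := ℂ) ξ • a := rfl

lemma scal_mul_apply (f : G →ₗ[ℂ] ℂ) (t : WithConv (G →ₗ[ℂ] A)) (ξ : G) :
    (scal A f * t).ofConv ξ = t.ofConv (slice f (comulA G ξ)) := by
  refine (LinearMap.convMul_apply _ _ _).trans ?_
  rw [Bialgebra.comulAlgHom_apply]
  induction (Coalgebra.comul (R := ℂ) ξ) using TensorProduct.induction_on with
  | zero => simp
  | add x y hx hy => simp only [map_add, hx, hy]
  | tmul x y => simp [scal, slice]

lemma scal_mul_scal_apply (f g : G →ₗ[ℂ] ℂ) (ξ : G) :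
    (scal A f * scal A g).ofConv ξ = pair f g (comulA G ξ) • 1 := by
  rw [scal_mul_apply, scal_apply]
  congr 1
  induction (comulA G ξ) using TensorProduct.induction_on with
  | zero => simp
  | add x y hx hy => simp only [map_add, hx, hy]
  | tmul x y => simp

lemma slice_counit_comul (f : G →ₗ[ℂ] ℂ) (ξ : G) :
    Coalgebra.counit (R := ℂ) (slice f (comulA G ξ)) = f ξ := by
  rw [counit_slice, Bialgebra.comulAlgHom_apply, counitRightA_comul]

lemma scal_mul_constHom (f : G →ₗ[ℂ] ℂ) (a : A) :
    scal A f * constHom A G a = WithConv.toConv (f.smulRight a) := by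
  apply WithConv.ext; ext ξ
  rw [scal_mul_apply, constHom_apply, slice_counit_comul]
  rfl

lemma constHom_mul_scal (f : G →ₗ[ℂ] ℂ) (a : A) :
    constHom A G a * scal A f = WithConv.toConv (f.smulRight a) := by
  apply WithConv.ext; ext ξ
  refine (LinearMap.convMul_apply _ _ _).trans ?_
  have : ∀ z : G ⊗[ℂ] G, LinearMap.mul' ℂ A (TensorProduct.map (constHom A G a).ofConv
      (scal A f).ofConv z) = f (counitLeftA G z) • a := fun z => by
    induction z using TensorProduct.induction_on with
    | zero => simp
    | add x y hx hy => simp only [map_add, add_smul, hx, hy]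
    | tmul x y => simp [scal_apply, constHom_apply, smul_smul, mul_comm]
  rw [this]
  simp

lemma siteTens_flipA_apply (x : X) (I J : Lab) (z : 𝒢 x ⊗[ℂ] 𝒢 x) (p q : D.Idx I × D.Idx J) :
    D.siteTens x I J (flipA _ z) p q = pair (D.rep x J p.2 q.2) (D.rep x I p.1 q.1) z := by
  rw [siteTens, tens2_apply]
  induction z using TensorProduct.induction_on with
  | zero => simp
  | add a b ha hb => simp only [map_add, ha, hb]
  | tmul a b => rw [flipA_tmul, pair_tmul, pair_tmul, mul_comm]; rfl

variable (D A) in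
/-- The universal gauge transformation at `x`. -/
def siteDressing (x : X) : Dressing D (WithConv (𝒢 x →ₗ[ℂ] A)) x where
  val I := Matrix.of fun a b => scal A (D.rep x I a b)
  inv I := Matrix.of fun a b => scal A (D.rep x I a b ∘ₗ SA (𝒢 x))
  val_mul_inv I := by
    ext a b ξ
    have h : ∀ z : 𝒢 x ⊗[ℂ] 𝒢 x, ∑ c, pair (D.rep x I a c) (D.rep x I c b ∘ₗ SA (𝒢 x)) z =
        D.siteRho x I (LinearMap.mul' ℂ _ (TensorProduct.map LinearMap.id (SA _) z)) a b :=
      fun z => by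
        induction z using TensorProduct.induction_on with
        | zero => simp
        | add x y hx hy => simp only [map_add, Finset.sum_add_distrib, hx, hy, Matrix.add_apply]
        | tmul y z =>
          rw [TensorProduct.map_tmul, LinearMap.mul'_apply, map_mul, Matrix.mul_apply]
          rfl
    rw [Matrix.mul_apply, WithConv.ofConv_sum, LinearMap.sum_apply]
    simp only [Matrix.of_apply, scal_mul_scal_apply]
    rw [← Finset.sum_smul, h, Bialgebra.comulAlgHom_apply, mul_id_antipode_comul,
      AlgHom.commutes, Matrix.algebraMap_matrix_apply, Matrix.one_apply]
    split_ifs <;> simp [LinearMap.convOne_def, Algebra.algebraMap_eq_smul_one]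
  inv_mul_val I := by
    ext a b ξ
    have h : ∀ z : 𝒢 x ⊗[ℂ] 𝒢 x, ∑ c, pair (D.rep x I a c ∘ₗ SA (𝒢 x)) (D.rep x I c b) z =
        D.siteRho x I (LinearMap.mul' ℂ _ (TensorProduct.map (SA _) LinearMap.id z)) a b :=
      fun z => by
        induction z using TensorProduct.induction_on with
        | zero => simp
        | add x y hx hy => simp only [map_add, Finset.sum_add_distrib, hx, hy, Matrix.add_apply]
        | tmul y z =>
          rw [TensorProduct.map_tmul, LinearMap.mul'_apply, map_mul, Matrix.mul_apply]
          rfl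
    rw [Matrix.mul_apply, WithConv.ofConv_sum, LinearMap.sum_apply]
    simp only [Matrix.of_apply, scal_mul_scal_apply]
    rw [← Finset.sum_smul, h, Bialgebra.comulAlgHom_apply, mul_antipode_id_comul,
      AlgHom.commutes, Matrix.algebraMap_matrix_apply, Matrix.one_apply]
    split_ifs <;> simp [LinearMap.convOne_def, Algebra.algebraMap_eq_smul_one]
  cg I J K m := by
    ext a q ξ
    rw [cm_mul_apply, mul_cm_apply]
    simp only [e1_mul_e2_apply]
    have h := congrFun (congrFun (D.siteCG_mul_comul x I J K m ξ) a) q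
    rw [Matrix.mul_apply, Matrix.mul_apply] at h
    rw [WithConv.ofConv_sum, WithConv.ofConv_sum, LinearMap.sum_apply, LinearMap.sum_apply]
    have := congrArg (fun c : ℂ => c • (1 : A)) h
    simp only [Finset.sum_smul] at this
    refine Eq.trans (Finset.sum_congr rfl fun r _ => ?_) (this.trans
      (Finset.sum_congr rfl fun r _ => ?_))
    · rw [WithConv.ofConv_smul, LinearMap.smul_apply, Matrix.of_apply, Matrix.of_apply,
        scal_mul_scal_apply, smul_smul, tens2_apply]
      rfl
    · rw [WithConv.ofConv_smul, LinearMap.smul_apply, Matrix.of_apply, scal_apply, smul_smul,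
        mul_comm]
      rfl
  cg_star I J K m := by
    ext a q ξ
    rw [cm_mul_apply, mul_cm_apply]
    simp only [e2_mul_e1_apply]
    have h := congrFun (congrFun (D.flip_comul_mul_siteCG x I J K m ξ) a) q
    rw [Matrix.mul_apply, Matrix.mul_apply] at h
    rw [WithConv.ofConv_sum, WithConv.ofConv_sum, LinearMap.sum_apply, LinearMap.sum_apply]
    have := congrArg (fun c : ℂ => c • (1 : A)) h
    simp only [Finset.sum_smul] at this
    refine Eq.trans (Finset.sum_congr rfl fun r _ => ?_) (this.trans
      (Finset.sum_congr rfl fun r _ => ?_))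
    · rw [WithConv.ofConv_smul, LinearMap.smul_apply, Matrix.of_apply, Matrix.of_apply,
        scal_mul_scal_apply, smul_smul, mul_comm, siteTens_flipA_apply]
    · rw [WithConv.ofConv_smul, LinearMap.smul_apply, Matrix.of_apply, scal_apply, smul_smul]
      rfl
  rtt I J := by
    ext p q ξ
    rw [cm_mul_apply, mul_cm_apply]
    simp only [e1_mul_e2_apply, e2_mul_e1_apply]
    have h := congrFun (congrFun (congrArg (D.siteTens x I J) (Rm_comul ξ)) p) q
    rw [map_mul, map_mul, Matrix.mul_apply, Matrix.mul_apply] at h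
    rw [WithConv.ofConv_sum, WithConv.ofConv_sum, LinearMap.sum_apply, LinearMap.sum_apply]
    have := congrArg (fun c : ℂ => c • (1 : A)) h
    simp only [Finset.sum_smul] at this
    refine Eq.trans (Finset.sum_congr rfl fun r _ => ?_) (this.trans
      (Finset.sum_congr rfl fun r _ => ?_))
    · rw [WithConv.ofConv_smul, LinearMap.smul_apply, Matrix.of_apply, Matrix.of_apply,
        scal_mul_scal_apply, smul_smul, tens2_apply (z := comulA _ ξ)]
      rfl
    · rw [WithConv.ofConv_smul, LinearMap.smul_apply, Matrix.of_apply, Matrix.of_apply,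
        scal_mul_scal_apply, smul_smul, mul_comm, siteTens_flipA_apply]

end Convolution

/-! ### The action of gauge transformations on the algebra of functions -/

section Induction

lemma funAlg_induction {p : D.FunAlg → Prop} (hs : ∀ c : ℂ, p (algebraMap ℂ _ c))
    (hc : ∀ I i a b, p (D.coord I i a b)) (hm : ∀ f g, p f → p g → p (f * g))
    (ha : ∀ f g, p f → p g → p (f + g)) (f : D.FunAlg) : p f := by
  obtain ⟨f, rfl⟩ := RingQuot.mkAlgHom_surjective ℂ _ f
  induction f using FreeAlgebra.induction with
  | grade0 c => rw [AlgHom.commutes]; exact hs c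
  | grade1 q => exact hc q.I q.i q.a q.b
  | mul f g hf hg => rw [map_mul]; exact hm _ _ hf hg
  | add f g hf hg => rw [map_add]; exact ha _ _ hf hg

lemma isConnection_map {T : Type*} [Ring T] [Algebra ℂ T] (φ : D.FunAlg →ₐ[ℂ] T) :
    D.IsConnection fun I i => (D.coordMat I i).map φ :=
  isConnection_of (φ.comp (RingQuot.mkAlgHom ℂ _)) _ fun h =>
    congrArg φ (RingQuot.mkAlgHom_rel ℂ h)

end Induction

lemma Dressing.one_val {T : Type*} [Ring T] [Algebra ℂ T] (x : X) (I : Lab) :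
    (Dressing.one x : Dressing D T x).val I = 1 := rfl

lemma Dressing.one_inv {T : Type*} [Ring T] [Algebra ℂ T] (x : X) (I : Lab) :
    (Dressing.one x : Dressing D T x).inv I = 1 := rfl

section SiteAct

variable [DecidableEq X]

variable (D) in
/-- The universal gauge transformation at `x` as a dressing of all vertices. -/
def vertexDressing (A : Type*) [Ring A] [Algebra ℂ A] (x y : X) :
    Dressing D (WithConv (𝒢 x →ₗ[ℂ] A)) y :=
  if h : x = y then h ▸ siteDressing D A x else Dressing.one y

lemma vertexDressing_self (A : Type*) [Ring A] [Algebra ℂ A] (x : X) :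
    D.vertexDressing A x x = siteDressing D A x := dif_pos rfl

lemma vertexDressing_of_ne (A : Type*) [Ring A] [Algebra ℂ A] {x y : X} (h : x ≠ y) :
    D.vertexDressing A x y = Dressing.one y := dif_neg h

lemma vertexDressing_comm (A : Type*) [Ring A] [Algebra ℂ A] (x y z : X) (h : y ≠ z) (I J : Lab) :
    EntriesCommute ((D.vertexDressing A x y).val I) ((D.vertexDressing A x z).val J) := by
  by_cases hy : x = y
  · rw [vertexDressing_of_ne A (hy ▸ h : x ≠ z)]
    exact EntriesCommute.one_right
  · rw [vertexDressing_of_ne A hy]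
    exact EntriesCommute.one_left

lemma vertexDressing_comm_const (A : Type*) [Ring A] [Algebra ℂ A] {n : Type*} [Fintype n]
    [DecidableEq n] (x y : X) (I : Lab) (M : Matrix n n A) :
    EntriesCommute ((D.vertexDressing A x y).val I) (M.map (constHom A (𝒢 x))) := by
  by_cases hy : x = y
  · subst hy
    rw [vertexDressing_self]
    intro a b c d
    exact (scal_mul_constHom _ _).trans (constHom_mul_scal _ _).symm
  · rw [vertexDressing_of_ne A hy]
    exact EntriesCommute.one_left

variable (D) in
/-- The action of gauge transformations at `x` on functions, as a homomorphism to the convolution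
algebra. -/
def coact (x : X) : D.FunAlg →ₐ[ℂ] WithConv (𝒢 x →ₗ[ℂ] D.FunAlg) :=
  funLift ((isConnection_map (constHom D.FunAlg (𝒢 x))).dress (D.vertexDressing D.FunAlg x)
    (fun y I _ _ => vertexDressing_comm_const _ x y I _) (vertexDressing_comm _ x))

lemma coact_coord (x : X) (I : Lab) (i : Γ.Dart) (a b : D.Idx I) :
    D.coact x (D.coord I i a b) = ((D.vertexDressing D.FunAlg x i.fst).inv I *
      (D.coordMat I i).map (constHom D.FunAlg (𝒢 x)) *
        (D.vertexDressing D.FunAlg x i.snd).val I) a b := funLift_coord _ _ _ _ _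

lemma coact_coord_target (x : X) (I : Lab) (i : Γ.Dart) (h : i.snd = x) (a b : D.Idx I)
    (ξ : 𝒢 x) : (D.coact x (D.coord I i a b)).ofConv ξ =
      ∑ c, D.rep x I c b ξ • D.coord I i a c := by
  subst h
  rw [coact_coord, vertexDressing_of_ne _ i.adj.ne.symm, vertexDressing_self]
  rw [Dressing.one_inv, one_mul, Matrix.mul_apply, WithConv.ofConv_sum, LinearMap.sum_apply]
  exact Finset.sum_congr rfl fun c _ => congrArg (fun t : WithConv (𝒢 i.snd →ₗ[ℂ] D.FunAlg) => t.ofConv ξ)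
    (constHom_mul_scal (D.rep i.snd I c b) (D.coord I i a c))

lemma coact_coord_source (x : X) (I : Lab) (i : Γ.Dart) (h : i.fst = x) (a b : D.Idx I)
    (ξ : 𝒢 x) : (D.coact x (D.coord I i a b)).ofConv ξ =
      ∑ c, D.repBar x I c a ξ • D.coord I i c b := by
  subst h
  rw [coact_coord, vertexDressing_of_ne _ i.adj.ne, vertexDressing_self]
  rw [Dressing.one_val, mul_one, Matrix.mul_apply, WithConv.ofConv_sum, LinearMap.sum_apply]
  exact Finset.sum_congr rfl fun c _ => congrArg (fun t : WithConv (𝒢 i.fst →ₗ[ℂ] D.FunAlg) => t.ofConv ξ)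
    (scal_mul_constHom (D.repBar i.fst I c a) (D.coord I i c b))

lemma coact_coord_other (x : X) (I : Lab) (i : Γ.Dart) (h : x ≠ i.fst) (h' : x ≠ i.snd)
    (a b : D.Idx I) (ξ : 𝒢 x) : (D.coact x (D.coord I i a b)).ofConv ξ =
      Coalgebra.counit (R := ℂ) ξ • D.coord I i a b := by
  rw [coact_coord, vertexDressing_of_ne _ h, vertexDressing_of_ne _ h']
  rw [Dressing.one_inv, Dressing.one_val, one_mul, mul_one]
  rfl

lemma coact_mul (x : X) (f g : D.FunAlg) (ξ : 𝒢 x) : (D.coact x (f * g)).ofConv ξ =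
    LinearMap.mul' ℂ D.FunAlg (TensorProduct.map (D.coact x f).ofConv (D.coact x g).ofConv
      (comulA _ ξ)) := by
  rw [map_mul]
  exact LinearMap.convMul_apply _ _ _

lemma coact_algebraMap (x : X) (c : ℂ) (ξ : 𝒢 x) :
    (D.coact x (algebraMap ℂ _ c)).ofConv ξ =
      Coalgebra.counit (R := ℂ) ξ • algebraMap ℂ D.FunAlg c := by
  rw [AlgHom.commutes, Algebra.algebraMap_eq_smul_one, Algebra.algebraMap_eq_smul_one,
    WithConv.ofConv_smul, LinearMap.smul_apply, smul_comm]
  simp [LinearMap.convOne_def, Algebra.algebraMap_eq_smul_one]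

variable (D) in
/-- The action of gauge transformations at `x` on functions. -/
def siteAct (x : X) : 𝒢 x →ₗ[ℂ] Module.End ℂ D.FunAlg :=
  LinearMap.mk₂ ℂ (fun ξ f => (D.coact x f).ofConv ξ) (fun _ _ _ => map_add _ _ _)
    (fun _ _ _ => map_smul _ _ _) (fun ξ f g => by rw [map_add]; rfl)
    (fun c ξ f => by rw [map_smul]; rfl)

variable (D) in
/-- The action on pairs of functions. -/
def siteAct₂ (x : X) : 𝒢 x ⊗[ℂ] 𝒢 x →ₗ[ℂ] Module.End ℂ (D.FunAlg ⊗[ℂ] D.FunAlg) :=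
  TensorProduct.homTensorHomMap (RingHom.id ℂ) _ _ _ _ ∘ₗ TensorProduct.map (D.siteAct x) (D.siteAct x)

lemma siteAct_apply (x : X) (ξ : 𝒢 x) (f : D.FunAlg) :
    D.siteAct x ξ f = (D.coact x f).ofConv ξ := rfl

lemma siteAct₂_tmul (x : X) (a b : 𝒢 x) (f g : D.FunAlg) :
    D.siteAct₂ x (a ⊗ₜ b) (f ⊗ₜ g) = D.siteAct x a f ⊗ₜ D.siteAct x b g := rfl

lemma siteAct_mul' (x : X) (ξ : 𝒢 x) (t : D.FunAlg ⊗[ℂ] D.FunAlg) :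
    D.siteAct x ξ (LinearMap.mul' ℂ _ t) =
      LinearMap.mul' ℂ _ (D.siteAct₂ x (comulA _ ξ) t) := by
  induction t using TensorProduct.induction_on with
  | zero => simp
  | add s t hs ht => simp only [map_add, hs, ht]
  | tmul f g =>
    rw [LinearMap.mul'_apply, siteAct_apply, coact_mul]
    congr 1
    induction comulA _ ξ using TensorProduct.induction_on with
    | zero => simp
    | add s t hs ht => simp only [map_add, LinearMap.add_apply, hs, ht]
    | tmul a b => rfl

lemma siteAct_algebraMap (x : X) (ξ : 𝒢 x) (c : ℂ) : D.siteAct x ξ (algebraMap ℂ _ c) =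
    Coalgebra.counit (R := ℂ) ξ • algebraMap ℂ D.FunAlg c := coact_algebraMap x c ξ

lemma siteAct_one_right (x : X) (ξ : 𝒢 x) : D.siteAct x ξ 1 =
    Coalgebra.counit (R := ℂ) ξ • (1 : D.FunAlg) := by
  have := siteAct_algebraMap (D := D) x ξ 1
  rwa [map_one] at this

lemma siteAct_mul_apply (x : X) (ξ η : 𝒢 x) (f : D.FunAlg) :
    D.siteAct x (ξ * η) f = D.siteAct x ξ (D.siteAct x η f) := by
  induction f using funAlg_induction generalizing ξ η with
  | hs c => simp only [siteAct_algebraMap, map_smul, smul_smul, Bialgebra.counit_mul, mul_comm]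
  | ha f g hf hg => simp only [map_add, hf, hg]
  | hm f g hf hg =>
    have key : ∀ Z Y : 𝒢 x ⊗[ℂ] 𝒢 x, D.siteAct₂ x (Z * Y) (f ⊗ₜ g) =
        D.siteAct₂ x Z (D.siteAct₂ x Y (f ⊗ₜ g)) := fun Z Y => by
      induction Y using TensorProduct.induction_on with
      | zero => simp
      | add s t hs ht => simp only [mul_add, map_add, LinearMap.add_apply, hs, ht]
      | tmul a b =>
        induction Z using TensorProduct.induction_on with
        | zero => simp
        | add s t hs ht => simp only [add_mul, map_add, LinearMap.add_apply, hs, ht]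
        | tmul c d =>
          rw [Algebra.TensorProduct.tmul_mul_tmul, siteAct₂_tmul, siteAct₂_tmul, siteAct₂_tmul,
            hf, hg]
    rw [← LinearMap.mul'_apply (R := ℂ) (a := f) (b := g), siteAct_mul', siteAct_mul', siteAct_mul', map_mul, key]
  | hc I i a b =>
    simp only [siteAct_apply]
    by_cases h : i.snd = x
    · simp only [coact_coord_target x I i h, map_sum, map_smul, WithConv.ofConv_sum,
        WithConv.ofConv_smul, LinearMap.sum_apply, LinearMap.smul_apply, Finset.smul_sum]
      rw [Finset.sum_comm]
      refine Finset.sum_congr rfl fun c _ => ?_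
      simp only [smul_smul, ← Finset.sum_smul]
      congr 1
      change D.siteRho x I (ξ * η) c b = _
      rw [map_mul, Matrix.mul_apply]
      exact Finset.sum_congr rfl fun d _ => mul_comm _ _
    · by_cases h' : i.fst = x
      · simp only [coact_coord_source x I i h', map_sum, map_smul, WithConv.ofConv_sum,
          WithConv.ofConv_smul, LinearMap.sum_apply, LinearMap.smul_apply, Finset.smul_sum]
        rw [Finset.sum_comm]
        refine Finset.sum_congr rfl fun c _ => ?_
        simp only [smul_smul, ← Finset.sum_smul]
        congr 1
        change D.siteRho x I (SA _ (ξ * η)) a c = _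
        rw [antipode_mul', map_mul, Matrix.mul_apply]
        rfl
      · simp only [coact_coord_other x I i (Ne.symm h') (Ne.symm h), map_smul,
          WithConv.ofConv_smul, LinearMap.smul_apply, smul_smul, Bialgebra.counit_mul, mul_comm]

lemma siteAct_one (x : X) (f : D.FunAlg) : D.siteAct x 1 f = f := by
  induction f using funAlg_induction with
  | hs c => simp [siteAct_algebraMap]
  | ha f g hf hg => simp only [map_add, hf, hg]
  | hm f g hf hg =>
    rw [← LinearMap.mul'_apply (R := ℂ) (a := f) (b := g), siteAct_mul', map_one, Algebra.TensorProduct.one_def,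
      siteAct₂_tmul, hf, hg]
  | hc I i a b =>
    simp only [siteAct_apply]
    by_cases h : i.snd = x
    · simp only [coact_coord_target x I i h]
      have : ∀ c, D.rep x I c b 1 = (1 : Matrix (D.Idx I) (D.Idx I) ℂ) c b := fun c =>
        congrFun (congrFun (map_one (D.siteRho x I)) c) b
      simp [this, Matrix.one_apply]
    · by_cases h' : i.fst = x
      · simp only [coact_coord_source x I i h']
        have : ∀ c, D.repBar x I c a 1 = (1 : Matrix (D.Idx I) (D.Idx I) ℂ) a c := fun c => by
          change D.siteRho x I (SA _ 1) a c = _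
          rw [HopfAlgebra.antipode_one, map_one]
        simp [this, Matrix.one_apply]
      · simp [coact_coord_other x I i (Ne.symm h') (Ne.symm h)]

/-- The action of the end points on a coordinate function, up to the order of the two factors. -/
lemma siteAct_comm_coord {x z : X} (hxz : x ≠ z) (ξ : 𝒢 x) (η : 𝒢 z) (I : Lab) (i : Γ.Dart)
    (a b : D.Idx I) : D.siteAct x ξ (D.siteAct z η (D.coord I i a b)) =
      D.siteAct z η (D.siteAct x ξ (D.coord I i a b)) := by
  simp only [siteAct_apply]
  rcases eq_or_ne x i.snd with h1 | h1 <;> rcases eq_or_ne x i.fst with h2 | h2 <;>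
  rcases eq_or_ne z i.snd with h3 | h3 <;> rcases eq_or_ne z i.fst with h4 | h4 <;>
  first
  | exact absurd (h2.symm.trans h1) i.adj.ne
  | exact absurd (h4.symm.trans h3) i.adj.ne
  | exact absurd (h1.trans h3.symm) hxz
  | exact absurd (h2.trans h4.symm) hxz
  | simp only [coact_coord_target x I i h1.symm, coact_coord_source z I i h4.symm,
      map_sum, map_smul, WithConv.ofConv_sum, WithConv.ofConv_smul, LinearMap.sum_apply,
      LinearMap.smul_apply, Finset.smul_sum]
    rw [Finset.sum_comm]
    refine Finset.sum_congr rfl fun c _ => Finset.sum_congr rfl fun d _ => smul_comm _ _ _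
  | simp only [coact_coord_target z I i h3.symm, coact_coord_source x I i h2.symm,
      map_sum, map_smul, WithConv.ofConv_sum, WithConv.ofConv_smul, LinearMap.sum_apply,
      LinearMap.smul_apply, Finset.smul_sum]
    rw [Finset.sum_comm]
    refine Finset.sum_congr rfl fun c _ => Finset.sum_congr rfl fun d _ => smul_comm _ _ _
  | simp only [coact_coord_target x I i h1.symm, coact_coord_other z I i h4 h3,
      map_sum, map_smul, WithConv.ofConv_sum, WithConv.ofConv_smul, LinearMap.sum_apply,
      LinearMap.smul_apply, Finset.smul_sum]
    exact Finset.sum_congr rfl fun c _ => smul_comm _ _ _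
  | simp only [coact_coord_source x I i h2.symm, coact_coord_other z I i h4 h3,
      map_sum, map_smul, WithConv.ofConv_sum, WithConv.ofConv_smul, LinearMap.sum_apply,
      LinearMap.smul_apply, Finset.smul_sum]
    exact Finset.sum_congr rfl fun c _ => smul_comm _ _ _
  | simp only [coact_coord_target z I i h3.symm, coact_coord_other x I i h2 h1,
      map_sum, map_smul, WithConv.ofConv_sum, WithConv.ofConv_smul, LinearMap.sum_apply,
      LinearMap.smul_apply, Finset.smul_sum]
    exact Finset.sum_congr rfl fun c _ => smul_comm _ _ _
  | simp only [coact_coord_source z I i h4.symm, coact_coord_other x I i h2 h1,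
      map_sum, map_smul, WithConv.ofConv_sum, WithConv.ofConv_smul, LinearMap.sum_apply,
      LinearMap.smul_apply, Finset.smul_sum]
    exact Finset.sum_congr rfl fun c _ => smul_comm _ _ _
  | simp only [coact_coord_other x I i h2 h1, coact_coord_other z I i h4 h3, map_smul,
      WithConv.ofConv_smul, LinearMap.smul_apply]
    exact smul_comm _ _ _

lemma siteAct_comm {x z : X} (hxz : x ≠ z) (ξ : 𝒢 x) (η : 𝒢 z) (f : D.FunAlg) :
    D.siteAct x ξ (D.siteAct z η f) = D.siteAct z η (D.siteAct x ξ f) := by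
  induction f using funAlg_induction generalizing ξ η with
  | hs c => simp only [siteAct_algebraMap, map_smul, smul_smul, mul_comm]
  | ha f g hf hg => simp only [map_add, hf, hg]
  | hc I i a b => exact siteAct_comm_coord hxz ξ η I i a b
  | hm f g hf hg =>
    have key : ∀ (Z : 𝒢 x ⊗[ℂ] 𝒢 x) (Y : 𝒢 z ⊗[ℂ] 𝒢 z),
        D.siteAct₂ x Z (D.siteAct₂ z Y (f ⊗ₜ g)) = D.siteAct₂ z Y (D.siteAct₂ x Z (f ⊗ₜ g)) :=
      fun Z Y => by
        induction Y using TensorProduct.induction_on with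
        | zero => simp
        | add s t hs ht => simp only [map_add, LinearMap.add_apply, hs, ht]
        | tmul a b =>
          induction Z using TensorProduct.induction_on with
          | zero => simp
          | add s t hs ht => simp only [map_add, LinearMap.add_apply, hs, ht]
          | tmul c d => simp only [siteAct₂_tmul, hf, hg]
    rw [← LinearMap.mul'_apply (R := ℂ) (a := f) (b := g), siteAct_mul', siteAct_mul', siteAct_mul', siteAct_mul',
      key]

variable (D) in
/-- The action as an algebra homomorphism. -/
def siteActHom (x : X) : 𝒢 x →ₐ[ℂ] Module.End ℂ D.FunAlg :=
  AlgHom.ofLinearMap (D.siteAct x) (LinearMap.ext fun f => siteAct_one x f)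
    (fun ξ η => LinearMap.ext fun f => siteAct_mul_apply x ξ η f)

end SiteAct

/-! ### Homomorphisms from the gauge symmetry and from the lattice algebra -/

section SymLift

variable [DecidableEq X] [Fintype X] {T : Type*} [Ring T] [Algebra ℂ T]
  (φ : ∀ x, 𝒢 x →ₐ[ℂ] T) (hφ : ∀ x z, x ≠ z → ∀ ξ η, φ x ξ * φ z η = φ z η * φ x ξ)

/-- The homomorphism `𝒢 → T` defined by commuting homomorphisms of the local algebras. -/
def symLift (D : GaugeData Γ Gs 𝒢 Lab) : D.Sym →ₐ[ℂ] T :=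
  have hc : Pairwise fun x z => ∀ ξ η, Commute ((φ x : 𝒢 x →* T) ξ) ((φ z : 𝒢 z →* T) η) :=
    fun x z h ξ η => hφ x z h ξ η
  have key : ∀ [DecidableEq X] (m : ∀ x, 𝒢 x) (x : X) (a : 𝒢 x),
      MonoidHom.noncommPiCoprod (fun x => (φ x : 𝒢 x →* T)) hc (Function.update m x a) =
        φ x a * MonoidHom.noncommPiCoprod (fun x => (φ x : 𝒢 x →* T)) hc
          (Function.update m x 1) := by
    intro _ m x a
    refine Eq.trans ?_ (congrArg (· * _)
      (MonoidHom.noncommPiCoprod_mulSingle (fun x => (φ x : 𝒢 x →* T)) (hcomm := hc) x a))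
    refine Eq.trans ?_ (map_mul _ _ _)
    congr 1
    funext z
    by_cases hz : z = x
    · subst hz; simp
    · simp [hz]
  PiTensorProduct.liftAlgHom
    { toFun := MonoidHom.noncommPiCoprod (fun x => (φ x : 𝒢 x →* T)) hc
      map_update_add' := fun m x a b => by
        rw [key, key m x a, key m x b, map_add, add_mul]
      map_update_smul' := fun m x c a => by
        rw [key, key m x a, map_smul, smul_mul_assoc] }
    (map_one (MonoidHom.noncommPiCoprod (fun x => (φ x : 𝒢 x →* T)) hc))
    (map_mul (MonoidHom.noncommPiCoprod (fun x => (φ x : 𝒢 x →* T)) hc))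

@[simp] lemma symLift_loc (x : X) (ξ : 𝒢 x) : symLift φ hφ D (D.loc x ξ) = φ x ξ := by
  have hc : Pairwise fun x z => ∀ ξ η, Commute ((φ x : 𝒢 x →* T) ξ) ((φ z : 𝒢 z →* T) η) :=
    fun x z h ξ η => hφ x z h ξ η
  refine Eq.trans ?_
    (MonoidHom.noncommPiCoprod_mulSingle (fun x => (φ x : 𝒢 x →* T)) (hcomm := hc) x ξ)
  exact PiTensorProduct.lift.tprod _

lemma symCounit_loc (x : X) (ξ : 𝒢 x) :
    D.symCounit (D.loc x ξ) = Coalgebra.counit (R := ℂ) ξ := by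
  refine (PiTensorProduct.lift.tprod _).trans ?_
  rw [MultilinearMap.compLinearMap_apply, MultilinearMap.mkPiAlgebra_apply,
    ← Finset.mul_prod_erase _ _ (Finset.mem_univ x), Finset.prod_eq_one, mul_one]
  · simp
  · intro z hz
    simp [Pi.mulSingle_eq_of_ne (Finset.ne_of_mem_erase hz)]

lemma loc_comm {x z : X} (h : x ≠ z) (ξ : 𝒢 x) (η : 𝒢 z) :
    D.loc x ξ * D.loc z η = D.loc z η * D.loc x ξ := by
  change PiTensorProduct.tprod ℂ _ * PiTensorProduct.tprod ℂ _ =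
    PiTensorProduct.tprod ℂ _ * PiTensorProduct.tprod ℂ _
  rw [PiTensorProduct.tprod_mul_tprod, PiTensorProduct.tprod_mul_tprod]
  congr 1
  exact Pi.mulSingle_commute h ξ η

variable (D) in
/-- The counit of `𝒢` as a homomorphism. -/
def symCounitHom : D.Sym →ₐ[ℂ] ℂ :=
  symLift (fun x => Bialgebra.counitAlgHom ℂ (𝒢 x)) (fun _ _ _ _ _ => mul_comm _ _) D

lemma symCounit_eq (s : D.Sym) : D.symCounit s = D.symCounitHom s := by
  have : D.symCounit = D.symCounitHom.toLinearMap := by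
    refine PiTensorProduct.ext (MultilinearMap.ext fun m => ?_)
    change D.symCounit (PiTensorProduct.tprod ℂ m) = D.symCounitHom (PiTensorProduct.tprod ℂ m)
    refine (PiTensorProduct.lift.tprod _).trans (Eq.trans ?_ (PiTensorProduct.lift.tprod _).symm)
    exact (Finset.noncommProd_eq_prod _ _).symm
  exact congrArg (fun f => f s) this

end SymLift

section LatticeLift

variable [DecidableEq X] {T : Type*} [Ring T] [Algebra ℂ T]

variable (D) in
/-- The homomorphism `𝒢_x → ℬ`. -/
def gauge (x : X) : 𝒢 x →ₐ[ℂ] D.Lattice := D.sym.comp (D.loc x)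

variable (D) in
/-- The connection matrices of `ℬ`. -/
def latMat (I : Lab) (i : Γ.Dart) : Matrix (D.Idx I) (D.Idx I) D.Lattice :=
  Matrix.of fun a b => D.U I i a b

lemma isConnection_latMat : D.IsConnection D.latMat :=
  isConnection_of (RingQuot.mkAlgHom ℂ _) _ fun h => RingQuot.mkAlgHom_rel ℂ (LatticeRel.link h)

lemma sym_comm_U_target (I : Lab) (i : Γ.Dart) (a b : D.Idx I) (ξ : 𝒢 i.snd) :
    D.gauge i.snd ξ * D.U I i a b =
      ∑ c, D.U I i a c * D.gauge i.snd (slice (D.rep i.snd I c b) (comulA _ ξ)) := by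
  have := RingQuot.mkAlgHom_rel ℂ (LatticeRel.cov_target (D := D) I i a b ξ)
  simp only [map_mul, map_sum] at this
  exact this

lemma sym_comm_U_source (I : Lab) (i : Γ.Dart) (a b : D.Idx I) (ξ : 𝒢 i.fst) :
    D.gauge i.fst ξ * D.U I i a b =
      ∑ c, D.U I i c b * D.gauge i.fst (slice (D.repBar i.fst I c a) (comulA _ ξ)) := by
  have := RingQuot.mkAlgHom_rel ℂ (LatticeRel.cov_source (D := D) I i a b ξ)
  simp only [map_mul, map_sum] at this
  exact this

lemma sym_comm_U_other (I : Lab) (i : Γ.Dart) (a b : D.Idx I) (z : X) (h₁ : z ≠ i.fst)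
    (h₂ : z ≠ i.snd) (ξ : 𝒢 z) :
    D.gauge z ξ * D.U I i a b = D.U I i a b * D.gauge z ξ := by
  have := RingQuot.mkAlgHom_rel ℂ (LatticeRel.cov_other (D := D) I i a b z h₁ h₂ ξ)
  simp only [map_mul] at this
  exact this

/-- Homomorphisms of connection matrices and gauge transformations to an algebra `T`. -/
structure LatticeHom (D : GaugeData Γ Gs 𝒢 Lab) (T : Type*) [Ring T] [Algebra ℂ T] where
  U : ∀ (I : Lab) (_ : Γ.Dart), Matrix (D.Idx I) (D.Idx I) T
  isConnection : D.IsConnection U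
  gauge : D.Sym →ₐ[ℂ] T
  target : ∀ I (i : Γ.Dart) (a b : D.Idx I) (ξ : 𝒢 i.snd), gauge (D.loc i.snd ξ) * U I i a b =
    ∑ c, U I i a c * gauge (D.loc i.snd (slice (D.rep i.snd I c b) (comulA _ ξ)))
  source : ∀ I (i : Γ.Dart) (a b : D.Idx I) (ξ : 𝒢 i.fst), gauge (D.loc i.fst ξ) * U I i a b =
    ∑ c, U I i c b * gauge (D.loc i.fst (slice (D.repBar i.fst I c a) (comulA _ ξ)))
  other : ∀ I (i : Γ.Dart) (a b : D.Idx I) (z : X) (_ : z ≠ i.fst) (_ : z ≠ i.snd) (ξ : 𝒢 z),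
    gauge (D.loc z ξ) * U I i a b = U I i a b * gauge (D.loc z ξ)

namespace LatticeHom

/-- The homomorphism from the free algebra. -/
def free (B : LatticeHom D T) : FreeAlgebra ℂ D.Gen →ₐ[ℂ] T :=
  FreeAlgebra.lift ℂ (Sum.elim (fun p : D.Coord => B.U p.I p.i p.a p.b) B.gauge)

lemma free_genU (B : LatticeHom D T) (I : Lab) (i : Γ.Dart) (a b : D.Idx I) :
    B.free (D.genU I i a b) = B.U I i a b := by
  rw [free, genU, FreeAlgebra.lift_ι_apply]; rfl

lemma free_genG (B : LatticeHom D T) (s : D.Sym) : B.free (D.genG s) = B.gauge s := by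
  rw [free, genG, FreeAlgebra.lift_ι_apply]; rfl

/-- The homomorphism from the lattice algebra. -/
def lift (B : LatticeHom D T) : D.Lattice →ₐ[ℂ] T :=
  RingQuot.liftAlgHom ℂ ⟨B.free, fun f g h => by
    cases h with
    | sym_one => rw [free_genG, map_one, map_one]
    | sym_add ξ η => rw [map_add, free_genG, free_genG, free_genG, map_add]
    | sym_smul c ξ => rw [map_smul, free_genG, free_genG, map_smul]
    | sym_mul ξ η => rw [map_mul, free_genG, free_genG, free_genG, map_mul]
    | cov_target I i a b ξ =>
      simp only [map_mul, map_sum, free_genG, free_genU]; exact B.target I i a b ξ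
    | cov_source I i a b ξ =>
      simp only [map_mul, map_sum, free_genG, free_genU]; exact B.source I i a b ξ
    | cov_other I i a b z h₁ h₂ ξ =>
      simp only [map_mul, free_genG, free_genU]; exact B.other I i a b z h₁ h₂ ξ
    | link h =>
      refine IsConnection.map_eq B.free _ ?_ h
      simp only [free_genU]
      exact B.isConnection⟩

@[simp] lemma lift_U (B : LatticeHom D T) (I : Lab) (i : Γ.Dart) (a b : D.Idx I) :
    B.lift (D.U I i a b) = B.U I i a b := by
  rw [lift, GaugeData.U, RingQuot.liftAlgHom_mkAlgHom_apply, free_genU]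

@[simp] lemma lift_sym (B : LatticeHom D T) (s : D.Sym) : B.lift (D.sym s) = B.gauge s := by
  change B.lift (RingQuot.mkAlgHom ℂ D.LatticeRel (D.genG s)) = _
  rw [lift, RingQuot.liftAlgHom_mkAlgHom_apply, free_genG]

end LatticeHom

variable [Fintype X]

lemma tprod_mem (M : Submonoid D.Sym) (m : ∀ x, 𝒢 x) (h : ∀ x, D.loc x (m x) ∈ M) :
    (PiTensorProduct.tprod ℂ m : D.Sym) ∈ M := by
  have h : ∀ S : Finset X, (PiTensorProduct.tprod ℂ fun x => if x ∈ S then m x else 1 : D.Sym) ∈ M := by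
    intro S
    induction S using Finset.induction_on with
    | empty => exact M.one_mem
    | insert x S hx ih =>
      have : (PiTensorProduct.tprod ℂ fun z => if z ∈ insert x S then m z else 1 : D.Sym) =
          D.loc x (m x) * PiTensorProduct.tprod ℂ fun z => if z ∈ S then m z else 1 := by
        change _ = PiTensorProduct.tprod ℂ _ * _
        rw [PiTensorProduct.tprod_mul_tprod]
        congr 1
        funext z
        by_cases hz : z = x
        · subst hz; simp [hx]
        · simp [hz]
      rw [this]
      exact M.mul_mem (h x) ih
  simpa using h Finset.univ

lemma sym_induction {p : D.Sym → Prop} (hl : ∀ x ξ, p (D.loc x ξ)) (ha : ∀ s t, p s → p t → p (s + t))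
    (hm : ∀ s t, p s → p t → p (s * t)) (h1 : ∀ c : ℂ, p (algebraMap ℂ _ c)) (s : D.Sym) : p s := by
  have key : ∀ m : ∀ x, 𝒢 x, p (PiTensorProduct.tprod ℂ m) := fun m =>
    tprod_mem { carrier := {s | p s}
                one_mem' := by simpa using h1 1
                mul_mem' := fun hs ht => hm _ _ hs ht } m fun x => hl x (m x)
  induction s using PiTensorProduct.induction_on with
  | smul_tprod c m => rw [Algebra.smul_def]; exact hm _ _ (h1 c) (key m)
  | add s t hs ht => exact ha _ _ hs ht

lemma lattice_induction {p : D.Lattice → Prop} (hs : ∀ c : ℂ, p (algebraMap ℂ _ c))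
    (hU : ∀ I i a b, p (D.U I i a b)) (hg : ∀ x ξ, p (D.gauge x ξ))
    (hm : ∀ A B, p A → p B → p (A * B)) (ha : ∀ A B, p A → p B → p (A + B)) (A : D.Lattice) :
    p A := by
  obtain ⟨A, rfl⟩ := RingQuot.mkAlgHom_surjective ℂ _ A
  induction A using FreeAlgebra.induction with
  | grade0 c => rw [AlgHom.commutes]; exact hs c
  | grade1 q =>
    rcases q with q | s
    · exact hU q.I q.i q.a q.b
    · change p (D.sym s)
      induction s using sym_induction with
      | hl x ξ => exact hg x ξ
      | ha s t hs ht => rw [map_add]; exact ha _ _ hs ht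
      | hm s t hs ht => rw [map_mul]; exact hm _ _ hs ht
      | h1 c => rw [AlgHom.commutes]; exact hs c
  | mul A B hA hB => rw [map_mul]; exact hm _ _ hA hB
  | add A B hA hB => rw [map_add]; exact ha _ _ hA hB

lemma lattice_hom_ext {φ ψ : D.Lattice →ₐ[ℂ] T}
    (hU : ∀ I i a b, φ (D.U I i a b) = ψ (D.U I i a b))
    (hg : ∀ x ξ, φ (D.gauge x ξ) = ψ (D.gauge x ξ)) : φ = ψ := by
  refine AlgHom.ext fun A => ?_
  induction A using lattice_induction with
  | hs c => rw [AlgHom.commutes, AlgHom.commutes]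
  | hU I i a b => exact hU I i a b
  | hg x ξ => exact hg x ξ
  | hm A B hA hB => rw [map_mul, map_mul, hA, hB]
  | ha A B hA hB => rw [map_add, map_add, hA, hB]

end LatticeLift

/-! ### The regular representation -/

section RegularRep

variable [DecidableEq X] [Fintype X]

lemma siteActHom_comm (x z : X) (h : x ≠ z) (ξ : 𝒢 x) (η : 𝒢 z) :
    D.siteActHom x ξ * D.siteActHom z η = D.siteActHom z η * D.siteActHom x ξ :=
  LinearMap.ext fun f => siteAct_comm h ξ η f

variable (D) in
/-- The action of `𝒢` on functions. -/
def symAct : D.Sym →ₐ[ℂ] Module.End ℂ D.FunAlg :=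
  symLift (T := Module.End ℂ D.FunAlg) D.siteActHom siteActHom_comm D

lemma symAct_loc (x : X) (ξ : 𝒢 x) (f : D.FunAlg) : D.symAct (D.loc x ξ) f = D.siteAct x ξ f := by
  rw [symAct, symLift_loc]; rfl

lemma mul'_siteAct₂ (x : X) (f g : D.FunAlg) (Z : 𝒢 x ⊗[ℂ] 𝒢 x) {ι : Type*} [Fintype ι]
    (r : ι → 𝒢 x →ₗ[ℂ] ℂ) (u : ι → D.FunAlg)
    (h : ∀ ξ, D.siteAct x ξ f = ∑ c, r c ξ • u c) :
    LinearMap.mul' ℂ _ (D.siteAct₂ x Z (f ⊗ₜ g)) = ∑ c, u c * D.siteAct x (slice (r c) Z) g := by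
  induction Z using TensorProduct.induction_on with
  | zero => simp
  | add s t hs ht => simp only [map_add, LinearMap.add_apply, hs, ht, mul_add,
      Finset.sum_add_distrib]
  | tmul a b =>
    rw [siteAct₂_tmul, LinearMap.mul'_apply, h, Finset.sum_mul]
    refine Finset.sum_congr rfl fun c _ => ?_
    rw [slice_tmul, map_smul, LinearMap.smul_apply, smul_mul_assoc, mul_smul_comm]

variable (D) in
/-- The regular representation on generators. -/
def regularHom : LatticeHom D (Module.End ℂ D.FunAlg) where
  U I i := (D.coordMat I i).map (Algebra.lmul ℂ D.FunAlg)
  isConnection := isConnection_map (T := Module.End ℂ D.FunAlg) (Algebra.lmul ℂ D.FunAlg)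
  gauge := D.symAct
  target I i a b ξ := by
    refine LinearMap.ext fun f => ?_
    rw [Module.End.mul_apply, LinearMap.sum_apply, symAct_loc]
    change D.siteAct i.snd ξ (D.coord I i a b * f) = _
    rw [← LinearMap.mul'_apply (R := ℂ) (a := D.coord I i a b), siteAct_mul',
      mul'_siteAct₂ _ _ _ _ _ _ (fun ξ => coact_coord_target _ I i rfl a b ξ)]
    exact Finset.sum_congr rfl fun c _ => by
      rw [Module.End.mul_apply, symAct_loc]; rfl
  source I i a b ξ := by
    refine LinearMap.ext fun f => ?_
    rw [Module.End.mul_apply, LinearMap.sum_apply, symAct_loc]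
    change D.siteAct i.fst ξ (D.coord I i a b * f) = _
    rw [← LinearMap.mul'_apply (R := ℂ) (a := D.coord I i a b), siteAct_mul',
      mul'_siteAct₂ _ _ _ _ _ _ (fun ξ => coact_coord_source _ I i rfl a b ξ)]
    exact Finset.sum_congr rfl fun c _ => by
      rw [Module.End.mul_apply, symAct_loc]; rfl
  other I i a b z h₁ h₂ ξ := by
    refine LinearMap.ext fun f => ?_
    rw [Module.End.mul_apply, Module.End.mul_apply, symAct_loc, symAct_loc]
    change D.siteAct z ξ (D.coord I i a b * f) = D.coord I i a b * D.siteAct z ξ f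
    rw [← LinearMap.mul'_apply (R := ℂ) (a := D.coord I i a b), siteAct_mul',
      mul'_siteAct₂ _ _ _ _ (fun _ : Unit => Coalgebra.counit (A := 𝒢 z))
        (fun _ => D.coord I i a b) (fun ξ => by
          rw [siteAct_apply, coact_coord_other z I i h₁ h₂]; simp)]
    have : slice (Coalgebra.counit (R := ℂ) (A := 𝒢 z)) (comulA (𝒢 z) ξ) = ξ :=
      counitLeftA_comul ξ
    simp only [Finset.univ_unique, Finset.sum_singleton]
    rw [this]

lemma isRegularRep : D.IsRegularRep D.regularHom.lift where
  map_U I i a b ψ := by rw [LatticeHom.lift_U]; rfl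
  sym_mul x ξ ψ₁ ψ₂ := by
    have h : ∀ ψ, D.act D.regularHom.lift x ψ = (D.coact x ψ).ofConv := fun ψ => by
      ext η
      change D.regularHom.lift (D.sym (D.loc x η)) ψ = _
      rw [LatticeHom.lift_sym]
      exact symAct_loc x η ψ
    rw [LatticeHom.lift_sym, h, h]
    exact (symAct_loc x ξ _).trans (coact_mul x _ _ ξ)
  sym_coord_target I i a b ξ := by
    rw [LatticeHom.lift_sym]
    exact (symAct_loc _ _ _).trans (coact_coord_target _ I i rfl a b ξ)
  sym_coord_source I i a b ξ := by
    rw [LatticeHom.lift_sym]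
    exact (symAct_loc _ _ _).trans (coact_coord_source _ I i rfl a b ξ)
  sym_coord_other I i a b z h₁ h₂ ξ := by
    rw [LatticeHom.lift_sym]
    exact (symAct_loc _ _ _).trans (coact_coord_other _ I i h₁ h₂ a b ξ)
  sym_one s := by
    rw [LatticeHom.lift_sym, symCounit_eq]
    change D.symAct s 1 = _
    induction s using sym_induction with
    | hl x ξ => rw [symAct_loc, siteAct_one_right, ← symCounit_eq, symCounit_loc]
    | ha s t hs ht => rw [map_add, LinearMap.add_apply, hs, ht, map_add, add_smul]
    | hm s t hs ht =>
      rw [map_mul, Module.End.mul_apply, ht, map_smul, hs, map_mul, smul_smul, mul_comm]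
    | h1 c => rw [AlgHom.commutes, AlgHom.commutes]; rfl

lemma IsRegularRep.unique {π π' : D.Lattice →ₐ[ℂ] Module.End ℂ D.FunAlg} (h : D.IsRegularRep π)
    (h' : D.IsRegularRep π') : π = π' := by
  refine lattice_hom_ext (T := Module.End ℂ D.FunAlg) (fun I i a b => LinearMap.ext fun ψ => by rw [h.map_U, h'.map_U])
    fun x ξ => LinearMap.ext fun ψ => ?_
  change π (D.sym (D.loc x ξ)) ψ = π' (D.sym (D.loc x ξ)) ψ
  induction ψ using funAlg_induction generalizing ξ with
  | hs c => rw [Algebra.algebraMap_eq_smul_one, map_smul, map_smul, h.sym_one, h'.sym_one]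
  | ha f g hf hg => rw [map_add, map_add, hf, hg]
  | hm f g hf hg =>
    rw [h.sym_mul, h'.sym_mul, (LinearMap.ext hf : D.act π x f = D.act π' x f),
      (LinearMap.ext hg : D.act π x g = D.act π' x g)]
  | hc I i a b =>
    by_cases h1 : x = i.snd
    · subst h1; rw [h.sym_coord_target, h'.sym_coord_target]
    · by_cases h2 : x = i.fst
      · subst h2; rw [h.sym_coord_source, h'.sym_coord_source]
      · rw [h.sym_coord_other _ _ _ _ _ h2 h1, h'.sym_coord_other _ _ _ _ _ h2 h1]

end RegularRep

/-! ### Spanning sets -/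

section LinkSpan

variable {T : Type*} [Ring T] [Algebra ℂ T]
  {U : ∀ (I : Lab) (_ : Γ.Dart), Matrix (D.Idx I) (D.Idx I) T} {κ : Lab → ℂ} {κs : Gsˣ}

/-- The span of the matrix elements with label `I` on the link `i`. -/
def genSpan (U : ∀ (I : Lab) (_ : Γ.Dart), Matrix (D.Idx I) (D.Idx I) T) (I : Lab) (i : Γ.Dart) :
    Submodule ℂ T :=
  Submodule.span ℂ (Set.range fun p : D.Idx I × D.Idx I => U I i p.1 p.2)

/-- The span of the matrix elements on the link `i`. -/
def linkSpan (U : ∀ (I : Lab) (_ : Γ.Dart), Matrix (D.Idx I) (D.Idx I) T) (i : Γ.Dart) :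
    Submodule ℂ T :=
  Submodule.span ℂ (Set.range fun p : Σ I, D.Idx I × D.Idx I => U p.1 i p.2.1 p.2.2)

lemma mem_genSpan (I : Lab) (i : Γ.Dart) (a b : D.Idx I) : U I i a b ∈ genSpan U I i :=
  Submodule.subset_span ⟨(a, b), rfl⟩

lemma mem_linkSpan (I : Lab) (i : Γ.Dart) (a b : D.Idx I) : U I i a b ∈ linkSpan U i :=
  Submodule.subset_span ⟨⟨I, a, b⟩, rfl⟩

lemma linkSpan_le {i : Γ.Dart} {P : Submodule ℂ T} (h : ∀ I a b, U I i a b ∈ P) :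
    linkSpan U i ≤ P := Submodule.span_le.mpr (by rintro _ ⟨p, rfl⟩; exact h _ _ _)

lemma linkSpan_mul_le {i j : Γ.Dart} {P : Submodule ℂ T}
    (h : ∀ I J a b c d, U I i a b * U J j c d ∈ P) : linkSpan U i * linkSpan U j ≤ P := by
  rw [linkSpan, linkSpan, Submodule.span_mul_span]
  refine Submodule.span_le.mpr ?_
  rintro _ ⟨_, ⟨p, rfl⟩, _, ⟨q, rfl⟩, rfl⟩
  exact h _ _ _ _ _ _

lemma IsConnection.linkSpan_mul_self (hU : D.IsConnection U) (i : Γ.Dart) :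
    linkSpan U i * linkSpan U i ≤ linkSpan U i := by
  refine linkSpan_mul_le fun I J a b c d => ?_
  have := congrFun (congrFun (hU.ope i I J) (a, c)) (b, d)
  rw [e1_mul_e2_apply, ope_entry] at this
  rw [this]
  exact Submodule.sum_mem _ fun K _ => Submodule.sum_mem _ fun m _ => Submodule.sum_mem _ fun e _ =>
    Submodule.sum_mem _ fun f _ => Submodule.smul_mem _ _ (mem_linkSpan _ _ _ _)

lemma IsConnection.one_mem_linkSpan (hU : D.IsConnection U) (H : D.HasRoots κ κs) (i : Γ.Dart) :
    1 ∈ linkSpan U i := by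
  have h := congrFun (congrFun (hU.triv_eq_one H i) ⟨0, D.V.dim_pos _⟩) ⟨0, D.V.dim_pos _⟩
  rw [Matrix.one_apply_eq] at h
  rw [← h]
  exact mem_linkSpan _ _ _ _

lemma IsConnection.linkSpan_symm_le (hU : D.IsConnection U) (H : D.HasRoots κ κs) (i : Γ.Dart) :
    linkSpan U i.symm ≤ linkSpan U i := by
  refine linkSpan_le fun I a b => ?_
  let S : Subalgebra ℂ T := (linkSpan U i).toSubalgebra (hU.one_mem_linkSpan H i)
    fun x y hx hy => hU.linkSpan_mul_self i (Submodule.mul_mem_mul hx hy)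
  have hfin : FiniteDimensional ℂ (linkSpan U i) := FiniteDimensional.span_of_finite ℂ
    (Set.finite_range _)
  have : FiniteDimensional ℂ S := hfin
  let M : Matrix (D.Idx I) (D.Idx I) S := Matrix.of fun a b => ⟨U I i a b, mem_linkSpan _ _ _ _⟩
  have hM : M.map S.val = U I i := rfl
  have hVU : U I i.symm * U I i = 1 := by simpa using hU.inv I i.symm
  have hinj : Function.Injective (LinearMap.mulLeft ℂ M) := by
    rw [injective_iff_map_eq_zero]
    intro N hN
    have h1 : U I i * N.map S.val = 0 := by
      rw [← hM, ← Matrix.map_mul]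
      have := congrArg (fun Q => Matrix.map Q S.val) hN
      refine this.trans ?_
      ext; simp
    have h2 : N.map S.val = 0 := by
      rw [← one_mul (N.map S.val), ← hVU, mul_assoc, h1, mul_zero]
    ext c d
    exact congrFun (congrFun h2 c) d
  obtain ⟨N, hN⟩ := LinearMap.injective_iff_surjective.mp hinj 1
  have h1 : U I i * N.map S.val = 1 := by
    rw [← hM, ← Matrix.map_mul]
    refine (congrArg (fun Q => Matrix.map Q S.val) hN).trans ?_
    exact Matrix.map_one _ (map_zero _) (map_one _)
  have h2 : U I i.symm = N.map S.val := by
    rw [← one_mul (N.map S.val), ← hVU, mul_assoc, h1, mul_one]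
  rw [h2]
  exact (N a b).2

lemma IsConnection.linkSpan_symm (hU : D.IsConnection U) (H : D.HasRoots κ κs) (i : Γ.Dart) :
    linkSpan U i.symm = linkSpan U i :=
  le_antisymm (hU.linkSpan_symm_le H i) (by simpa using hU.linkSpan_symm_le H i.symm)

lemma IsConnection.linkSpan_comm_of_lt (hU : D.IsConnection U) {i j : Γ.Dart} (h : i.snd = j.snd)
    (hlt : (D.order j.snd).lt ⟨i, h⟩ ⟨j, rfl⟩) :
    linkSpan U i * linkSpan U j = linkSpan U j * linkSpan U i := by
  refine le_antisymm (linkSpan_mul_le fun I J a b c d => ?_)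
    (linkSpan_mul_le fun J I c d a b => ?_)
  · have := congrFun (congrFun (hU.braid I J i j h hlt) (a, c)) (b, d)
    rw [e1_mul_e2_apply, braid_entry] at this
    rw [this]
    exact Submodule.sum_mem _ fun _ _ => Submodule.sum_mem _ fun _ _ => Submodule.smul_mem _ _
      (Submodule.mul_mem_mul (mem_linkSpan _ _ _ _) (mem_linkSpan _ _ _ _))
  · have := congrArg (· * cm T (D.siteTens j.snd I J (RmInv _))) (hU.braid I J i j h hlt)
    beta_reduce at this
    rw [mul_assoc (_ * _) (cm T _), ← cm_mul, ← map_mul, Rm_mul_RmInv, map_one, cm_one,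
      mul_one] at this
    have := congrFun (congrFun this (a, c)) (b, d)
    rw [e2_mul_e1_apply, mul_cm_apply] at this
    rw [← this]
    refine Submodule.sum_mem _ fun p _ => Submodule.smul_mem _ _ ?_
    rw [e1_mul_e2_apply]
    exact Submodule.mul_mem_mul (mem_linkSpan _ _ _ _) (mem_linkSpan _ _ _ _)

lemma IsConnection.linkSpan_comm_of_target (hU : D.IsConnection U) {i j : Γ.Dart}
    (h : i.snd = j.snd) : linkSpan U i * linkSpan U j = linkSpan U j * linkSpan U i := by
  by_cases hij : i = j
  · rw [hij]
  let _ := D.order j.snd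
  rcases lt_trichotomy (⟨i, h⟩ : {k : Γ.Dart // k.snd = j.snd}) ⟨j, rfl⟩ with hlt | he | hlt
  · exact hU.linkSpan_comm_of_lt h hlt
  · exact absurd (congrArg Subtype.val he) hij
  · obtain ⟨⟨s, y⟩, hi⟩ := i
    obtain ⟨⟨r, z⟩, hj⟩ := j
    obtain rfl : y = z := h
    exact (hU.linkSpan_comm_of_lt (i := ⟨(r, y), hj⟩) (j := ⟨(s, y), hi⟩) rfl hlt).symm

/-- Matrix elements on different links can be exchanged. -/
lemma IsConnection.linkSpan_comm (hU : D.IsConnection U) (H : D.HasRoots κ κs) (i j : Γ.Dart) :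
    linkSpan U i * linkSpan U j = linkSpan U j * linkSpan U i := by
  by_cases h1 : i.snd = j.snd
  · exact hU.linkSpan_comm_of_target h1
  by_cases h2 : i.snd = j.fst
  · rw [← hU.linkSpan_symm H j]; exact hU.linkSpan_comm_of_target h2
  by_cases h3 : i.fst = j.snd
  · rw [← hU.linkSpan_symm H i]; exact hU.linkSpan_comm_of_target h3
  by_cases h4 : i.fst = j.fst
  · rw [← hU.linkSpan_symm H i, ← hU.linkSpan_symm H j]; exact hU.linkSpan_comm_of_target h4
  have hc : ∀ I J a b c d, U I i a b * U J j c d = U J j c d * U I i a b := fun I J a b c d => by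
    have := congrFun (congrFun (hU.comm I J i j h4 h3 h2 h1) (a, c)) (b, d)
    rwa [e1_mul_e2_apply, e2_mul_e1_apply] at this
  refine le_antisymm (linkSpan_mul_le fun I J a b c d => ?_)
    (linkSpan_mul_le fun J I c d a b => ?_)
  · rw [hc]; exact Submodule.mul_mem_mul (mem_linkSpan _ _ _ _) (mem_linkSpan _ _ _ _)
  · rw [← hc]; exact Submodule.mul_mem_mul (mem_linkSpan _ _ _ _) (mem_linkSpan _ _ _ _)

/-- The ordered product of the spans of matrix elements on the links of a list. -/
def listSpan (U : ∀ (I : Lab) (_ : Γ.Dart), Matrix (D.Idx I) (D.Idx I) T) (L : List Γ.Dart) :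
    Submodule ℂ T := (L.map (linkSpan U)).prod

lemma listSpan_cons (i : Γ.Dart) (L : List Γ.Dart) :
    listSpan U (i :: L) = linkSpan U i * listSpan U L := by
  rw [listSpan, List.map_cons, List.prod_cons, listSpan]

lemma IsConnection.listSpan_comm (hU : D.IsConnection U) (H : D.HasRoots κ κs) (i : Γ.Dart)
    (L : List Γ.Dart) : listSpan U L * linkSpan U i = linkSpan U i * listSpan U L := by
  induction L with
  | nil => rw [listSpan, List.map_nil, List.prod_nil, one_mul, mul_one]
  | cons j L ih => rw [listSpan_cons, mul_assoc, ih, ← mul_assoc, hU.linkSpan_comm H j i, mul_assoc]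

lemma IsConnection.listSpan_mul_le (hU : D.IsConnection U) (H : D.HasRoots κ κs) {i : Γ.Dart}
    {L : List Γ.Dart} (hi : i ∈ L) : listSpan U L * linkSpan U i ≤ listSpan U L := by
  induction L with
  | nil => simp at hi
  | cons j L ih =>
    rcases List.mem_cons.mp hi with rfl | hi
    · rw [listSpan_cons, mul_assoc, hU.listSpan_comm H, ← mul_assoc]
      exact mul_le_mul_left (hU.linkSpan_mul_self _) _
    · rw [listSpan_cons, mul_assoc]
      exact mul_le_mul_right (ih hi) _

lemma IsConnection.one_mem_listSpan (hU : D.IsConnection U) (H : D.HasRoots κ κs)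
    (L : List Γ.Dart) : 1 ∈ listSpan U L := by
  induction L with
  | nil => exact Submodule.one_le.mp le_rfl
  | cons i L ih =>
    rw [listSpan_cons, ← one_mul (1 : T)]
    exact Submodule.mul_mem_mul (hU.one_mem_linkSpan H i) ih

lemma genSpan_list_le (t : List (Lab × Γ.Dart)) :
    (t.map fun q => genSpan U q.1 q.2).prod ≤ Submodule.span ℂ
      {z | ∃ l : List D.Coord, (l.map fun p => (p.I, p.i)) = t ∧
        z = (l.map fun p => U p.I p.i p.a p.b).prod} := by
  induction t with
  | nil =>
    rw [List.map_nil, List.prod_nil, Submodule.one_le]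
    exact Submodule.subset_span ⟨[], rfl, rfl⟩
  | cons q t ih =>
    rw [List.map_cons, List.prod_cons]
    refine (mul_le_mul_right ih _).trans ?_
    rw [genSpan, Submodule.span_mul_span]
    refine Submodule.span_mono ?_
    rintro _ ⟨_, ⟨p, rfl⟩, _, ⟨l, hl, rfl⟩, rfl⟩
    refine ⟨⟨q.1, q.2, p.1, p.2⟩ :: l, ?_, ?_⟩
    · rw [List.map_cons, hl]
    · simp

lemma listSpan_le (L : List Γ.Dart) :
    listSpan U L ≤ Submodule.span ℂ
      {z | ∃ l : List D.Coord, (l.map fun p => p.i) = L ∧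
        z = (l.map fun p => U p.I p.i p.a p.b).prod} := by
  induction L with
  | nil =>
    rw [listSpan, List.map_nil, List.prod_nil, Submodule.one_le]
    exact Submodule.subset_span ⟨[], rfl, rfl⟩
  | cons i L ih =>
    rw [listSpan_cons]
    refine (mul_le_mul_right ih _).trans ?_
    rw [linkSpan, Submodule.span_mul_span]
    refine Submodule.span_mono ?_
    rintro _ ⟨_, ⟨p, rfl⟩, _, ⟨l, hl, rfl⟩, rfl⟩
    refine ⟨⟨p.1, i, p.2.1, p.2.2⟩ :: l, ?_, ?_⟩
    · rw [List.map_cons, hl]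
    · simp

end LinkSpan

section AllLinks

variable [Fintype X] [DecidableEq X] {κ : Lab → ℂ} {κs : Gsˣ}

open Classical in
variable (Γ) in
/-- A list of all links, each in one orientation. -/
def allLinks : List Γ.Dart :=
  letI : Fintype Γ.Dart := Fintype.ofFinite _
  (Finset.univ.filter fun i : Γ.Dart => IsPos i).toList

lemma mem_allLinks_iff (j : Γ.Dart) : j ∈ allLinks Γ ↔ IsPos j := by
  classical
  let _ : Fintype Γ.Dart := Fintype.ofFinite _
  rw [allLinks, Finset.mem_toList, Finset.mem_filter]
  exact and_iff_right (Finset.mem_univ j)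

lemma mem_allLinks (i : Γ.Dart) : i ∈ allLinks Γ ∨ i.symm ∈ allLinks Γ := by
  rw [mem_allLinks_iff, mem_allLinks_iff, isPos_symm]
  exact em _

lemma allLinks_nodup : ((allLinks Γ).map fun i => i.edge).Nodup := by
  refine List.Nodup.map_on ?_ (Finset.nodup_toList _)
  intro i hi j hj he
  replace hi := (mem_allLinks_iff i).mp hi
  replace hj := (mem_allLinks_iff j).mp hj
  rcases (SimpleGraph.dart_edge_eq_iff i j).mp he with h | h
  · exact h
  · rw [h, isPos_symm] at hi
    exact absurd hj hi

lemma listSpan_allLinks (H : D.HasRoots κ κs) : listSpan D.coordMat (allLinks Γ) = ⊤ := by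
  have hC := isConnection_coordMat (D := D)
  have key : ∀ f : D.FunAlg, ∀ z ∈ listSpan D.coordMat (allLinks Γ),
      z * f ∈ listSpan D.coordMat (allLinks Γ) := fun f => by
    induction f using funAlg_induction with
    | hs c =>
      intro z hz
      rw [← Algebra.commutes, ← Algebra.smul_def]
      exact Submodule.smul_mem _ _ hz
    | hc I i a b =>
      intro z hz
      rcases mem_allLinks i with hi | hi
      · exact hC.listSpan_mul_le H hi (Submodule.mul_mem_mul hz
          (mem_linkSpan (U := D.coordMat) I i a b))
      · refine hC.listSpan_mul_le H hi (Submodule.mul_mem_mul hz ?_)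
        rw [hC.linkSpan_symm H]
        exact mem_linkSpan (U := D.coordMat) I i a b
    | hm f g hf hg => intro z hz; rw [← mul_assoc]; exact hg _ (hf _ hz)
    | ha f g hf hg => intro z hz; rw [mul_add]; exact Submodule.add_mem _ (hf _ hz) (hg _ hz)
  refine eq_top_iff.mpr fun f _ => ?_
  have := key f 1 (hC.one_mem_listSpan H _)
  rwa [one_mul] at this

end AllLinks

section LatticeSpan

variable [DecidableEq X] [Fintype X] {κ : Lab → ℂ} {κs : Gsˣ}

variable (D) in
/-- The subspace of gauge transformations. -/
def symSpan : Submodule ℂ D.Lattice := LinearMap.range D.sym.toLinearMap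

omit [Fintype X] in
lemma mem_symSpan (s : D.Sym) : D.sym s ∈ D.symSpan := ⟨s, rfl⟩

omit [Fintype X] in
lemma symSpan_mul_self : D.symSpan * D.symSpan ≤ D.symSpan := by
  rw [Submodule.mul_le]
  rintro _ ⟨s, rfl⟩ _ ⟨t, rfl⟩
  exact ⟨s * t, map_mul D.sym s t⟩

lemma symSpan_mul_genSpan (I : Lab) (i : Γ.Dart) :
    D.symSpan * genSpan D.latMat I i ≤ genSpan D.latMat I i * D.symSpan := by
  have hG : genSpan D.latMat I i * D.symSpan * D.symSpan ≤ genSpan D.latMat I i * D.symSpan := by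
    rw [mul_assoc]; exact mul_le_mul_right symSpan_mul_self _
  have key : ∀ s : D.Sym, ∀ z ∈ genSpan D.latMat I i * D.symSpan,
      D.sym s * z ∈ genSpan D.latMat I i * D.symSpan := fun s => by
    induction s using sym_induction with
    | ha s t hs ht =>
      intro z hz; rw [map_add, add_mul]; exact Submodule.add_mem _ (hs z hz) (ht z hz)
    | hm s t hs ht => intro z hz; rw [map_mul, mul_assoc]; exact hs _ (ht z hz)
    | h1 c =>
      intro z hz
      rw [AlgHom.commutes, ← Algebra.smul_def]
      exact Submodule.smul_mem _ _ hz
    | hl x ξ =>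
      intro z hz
      induction hz using Submodule.mul_induction_on' with
      | add y _ z _ hy hz => rw [mul_add]; exact Submodule.add_mem _ hy hz
      | mem_mul_mem u hu g hg =>
        rw [← mul_assoc]
        refine hG (Submodule.mul_mem_mul ?_ hg)
        induction hu using Submodule.span_induction with
        | zero => rw [mul_zero]; exact Submodule.zero_mem _
        | add u v _ _ hu hv => rw [mul_add]; exact Submodule.add_mem _ hu hv
        | smul c u _ hu => rw [mul_smul_comm]; exact Submodule.smul_mem _ _ hu
        | mem u hu =>
          obtain ⟨⟨a, b⟩, rfl⟩ := hu
          change D.gauge x ξ * D.U I i a b ∈ _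
          have hm : ∀ a b y η, D.U I i a b * D.gauge y η ∈ genSpan D.latMat I i * D.symSpan :=
            fun a b y η => Submodule.mul_mem_mul (mem_genSpan (U := D.latMat) I i a b)
              (mem_symSpan _)
          by_cases h1 : x = i.snd
          · subst h1
            rw [sym_comm_U_target]
            exact Submodule.sum_mem _ fun c _ => hm _ _ _ _
          · by_cases h2 : x = i.fst
            · subst h2
              rw [sym_comm_U_source]
              exact Submodule.sum_mem _ fun c _ => hm _ _ _ _
            · rw [sym_comm_U_other _ _ _ _ _ h2 h1]
              exact hm _ _ _ _
  rw [Submodule.mul_le]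
  rintro _ ⟨s, rfl⟩ u hu
  refine key s u ?_
  rw [← mul_one u]
  exact Submodule.mul_mem_mul hu ⟨1, map_one D.sym⟩

variable (D) in
/-- The embedding of the algebra of functions into the lattice algebra. -/
def funEmb : D.FunAlg →ₐ[ℂ] D.Lattice := funLift isConnection_latMat

omit [Fintype X] in
@[simp] lemma funEmb_coord (I : Lab) (i : Γ.Dart) (a b : D.Idx I) :
    D.funEmb (D.coord I i a b) = D.U I i a b := funLift_coord _ _ _ _ _

omit [Fintype X] in
lemma funEmb_coordProd (l : List D.Coord) :
    D.funEmb (D.coordProd l) = (l.map fun p => D.U p.I p.i p.a p.b).prod := by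
  rw [coordProd, map_list_prod, List.map_map]
  congr 1
  exact List.map_congr_left fun p _ => funEmb_coord _ _ _ _

variable (D) in
/-- Products of functions and gauge transformations. -/
def normalSpan : Submodule ℂ D.Lattice := LinearMap.range D.funEmb.toLinearMap * D.symSpan

lemma normalSpan_eq_top : D.normalSpan = ⊤ := by
  have hJJ : LinearMap.range D.funEmb.toLinearMap * LinearMap.range D.funEmb.toLinearMap ≤
      LinearMap.range D.funEmb.toLinearMap := by
    rw [Submodule.mul_le]
    rintro _ ⟨s, rfl⟩ _ ⟨t, rfl⟩
    exact ⟨s * t, map_mul D.funEmb s t⟩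
  have hg : ∀ I i, genSpan D.latMat I i ≤ LinearMap.range D.funEmb.toLinearMap := fun I i => by
    refine Submodule.span_le.mpr ?_
    rintro _ ⟨p, rfl⟩
    exact ⟨D.coord I i p.1 p.2, funEmb_coord _ _ _ _⟩
  have h1 : ∀ f : D.FunAlg, ∀ s : D.Sym, D.sym s * D.funEmb f ∈ D.normalSpan := fun f => by
    induction f using funAlg_induction with
    | hs c =>
      intro s
      have : D.sym s * D.funEmb (algebraMap ℂ _ c) = D.funEmb 1 * D.sym (c • s) := by
        rw [AlgHom.commutes, ← Algebra.commutes, ← Algebra.smul_def, map_one, one_mul, map_smul]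
      rw [this]
      exact Submodule.mul_mem_mul ⟨_, rfl⟩ ⟨_, rfl⟩
    | ha f g hf hg => intro s; rw [map_add, mul_add]; exact Submodule.add_mem _ (hf s) (hg s)
    | hc I i a b =>
      intro s
      rw [funEmb_coord]
      exact mul_le_mul_left (hg I i) _ (symSpan_mul_genSpan I i (Submodule.mul_mem_mul
        (mem_symSpan s) (mem_genSpan (U := D.latMat) I i a b)))
    | hm f g hf hg =>
      intro s
      rw [map_mul, ← mul_assoc]
      have : ∀ z ∈ D.normalSpan, z * D.funEmb g ∈ D.normalSpan := by
        intro z hz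
        induction hz using Submodule.mul_induction_on' with
        | add y _ z _ hy hz => rw [add_mul]; exact Submodule.add_mem _ hy hz
        | mem_mul_mem u hu t ht =>
          obtain ⟨t, rfl⟩ := ht
          rw [mul_assoc]
          have := Submodule.mul_mem_mul hu (hg t)
          rw [normalSpan, ← mul_assoc] at this
          exact mul_le_mul_left hJJ _ this
      exact this _ (hf s)
  have key : ∀ A : D.Lattice, ∀ z ∈ D.normalSpan, A * z ∈ D.normalSpan := fun A => by
    induction A using lattice_induction with
    | hs c => intro z hz; rw [← Algebra.smul_def]; exact Submodule.smul_mem _ _ hz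
    | hU I i a b =>
      intro z hz
      have := Submodule.mul_mem_mul (hg I i (mem_genSpan (U := D.latMat) I i a b)) hz
      rw [normalSpan, ← mul_assoc] at this
      exact mul_le_mul_left hJJ _ this
    | hg x ξ =>
      intro z hz
      induction hz using Submodule.mul_induction_on' with
      | add y _ z _ hy hz => rw [mul_add]; exact Submodule.add_mem _ hy hz
      | mem_mul_mem u hu t ht =>
        obtain ⟨f, rfl⟩ := hu
        rw [← mul_assoc]
        have := Submodule.mul_mem_mul (h1 f (D.loc x ξ)) ht
        rw [normalSpan, mul_assoc] at this
        exact mul_le_mul_right symSpan_mul_self _ this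
    | hm A B hA hB => intro z hz; rw [mul_assoc]; exact hA _ (hB z hz)
    | ha A B hA hB => intro z hz; rw [add_mul]; exact Submodule.add_mem _ (hA z hz) (hB z hz)
  refine eq_top_iff.mpr fun A _ => ?_
  have := key A (D.funEmb 1 * D.sym 1) (Submodule.mul_mem_mul ⟨1, rfl⟩ ⟨1, rfl⟩)
  rwa [map_one, map_one, mul_one, mul_one] at this

/-! ### The multidimensional Haar functional -/

variable (H : D.HasRoots κ κs)

/-- The Haar functional on the lattice algebra. -/
def latHaar : D.Lattice →ₗ[ℂ] ℂ :=
  funHaar H ∘ₗ LinearMap.applyₗ (1 : D.FunAlg) ∘ₗ D.regularHom.lift.toLinearMap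

lemma latHaar_apply (A : D.Lattice) : latHaar H A = funHaar H (D.regularHom.lift A 1) := rfl

lemma IsRegularRep.funEmb_apply {π : D.Lattice →ₐ[ℂ] Module.End ℂ D.FunAlg}
    (h : D.IsRegularRep π) (f g : D.FunAlg) : π (D.funEmb f) g = f * g := by
  have : π.comp D.funEmb = Algebra.lmul ℂ D.FunAlg :=
    funAlg_hom_ext (T := Module.End ℂ D.FunAlg) fun I i a b => LinearMap.ext fun ψ => by
      change π (D.funEmb _) ψ = _
      rw [funEmb_coord, h.map_U]
      rfl
  exact congrArg (fun φ => φ f g) this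

lemma IsRegularRep.normal_apply {π : D.Lattice →ₐ[ℂ] Module.End ℂ D.FunAlg}
    (h : D.IsRegularRep π) (f : D.FunAlg) (s : D.Sym) :
    π (D.funEmb f * D.sym s) 1 = D.symCounit s • f := by
  rw [map_mul, Module.End.mul_apply, h.sym_one, map_smul, h.funEmb_apply, mul_one]

lemma isHaar_latHaar : D.IsHaar (latHaar H) := fun l s hl => by
  classical
  rw [← funEmb_coordProd, latHaar_apply, isRegularRep.normal_apply, map_smul,
    funHaar_coordProd H l hl, smul_eq_mul]

include H in
lemma IsHaar.unique {ω ω' : D.Lattice →ₗ[ℂ] ℂ} (h : D.IsHaar ω) (h' : D.IsHaar ω') : ω = ω' := by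
  ext A
  have hA : A ∈ D.normalSpan := by rw [normalSpan_eq_top]; trivial
  induction hA using Submodule.mul_induction_on' with
  | add y _ z _ hy hz => rw [map_add, map_add, hy, hz]
  | mem_mul_mem u hu t ht =>
    obtain ⟨f, rfl⟩ := hu
    obtain ⟨s, rfl⟩ := ht
    have hf : f ∈ listSpan D.coordMat (allLinks Γ) := listSpan_allLinks H ▸ Submodule.mem_top
    replace hf := listSpan_le _ hf
    change ω (D.funEmb f * D.sym s) = ω' (D.funEmb f * D.sym s)
    induction hf using Submodule.span_induction with
    | zero => simp
    | add f g _ _ hf hg => rw [map_add, add_mul, map_add, map_add, hf, hg]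
    | smul c f _ hf => rw [map_smul, smul_mul_assoc, map_smul, map_smul, hf]
    | mem f hf =>
      obtain ⟨l, hl, rfl⟩ := hf
      have e : D.funEmb (List.map (fun p : D.Coord => D.coordMat p.I p.i p.a p.b) l).prod =
        (l.map fun p => D.U p.I p.i p.a p.b).prod := funEmb_coordProd l
      have hn : (l.map fun p => p.i.edge).Nodup := by
        have := allLinks_nodup (Γ := Γ)
        rwa [← hl, List.map_map] at this
      rw [e, h l s hn, h' l s hn]

variable (D) in
/-- Products of matrix elements with given labels and links, and gauge transformations. -/
def labelSpan (t : List (Lab × Γ.Dart)) : Submodule ℂ D.Lattice :=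
  (t.map fun q => genSpan D.latMat q.1 q.2).prod * D.symSpan

lemma symSpan_mul_labelSpan (t : List (Lab × Γ.Dart)) :
    D.symSpan * D.labelSpan t ≤ D.labelSpan t := by
  induction t with
  | nil =>
    rw [labelSpan, List.map_nil, List.prod_nil, one_mul]
    exact symSpan_mul_self
  | cons q t ih =>
    rw [labelSpan, List.map_cons, List.prod_cons, mul_assoc, ← mul_assoc D.symSpan]
    refine (mul_le_mul_left (symSpan_mul_genSpan q.1 q.2) _).trans ?_
    rw [mul_assoc]
    exact mul_le_mul_right ih _

/-- The Haar functional vanishes on products with a nontrivial label. -/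
lemma IsHaar.eq_zero {ω : D.Lattice →ₗ[ℂ] ℂ} (h : D.IsHaar ω) {t : List (Lab × Γ.Dart)}
    (ht : (t.map fun q => q.2.edge).Nodup) (q : Lab × Γ.Dart) (hq : q ∈ t) (hI : q.1 ≠ D.V.triv)
    {A : D.Lattice} (hA : A ∈ D.labelSpan t) : ω A = 0 := by
  induction hA using Submodule.mul_induction_on' with
  | add y _ z _ hy hz => rw [map_add, hy, hz, add_zero]
  | mem_mul_mem u hu t ht =>
    obtain ⟨s, rfl⟩ := ht
    replace hu := genSpan_list_le _ hu
    induction hu using Submodule.span_induction with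
    | zero => simp
    | add f g _ _ hf hg => rw [add_mul, map_add, hf, hg, add_zero]
    | smul c f _ hf => rw [smul_mul_assoc, map_smul, hf, smul_zero]
    | mem f hf =>
      obtain ⟨l, hl, rfl⟩ := hf
      have := h l s (by rwa [← hl, List.map_map] at ht)
      refine this.trans ?_
      rw [if_neg, mul_zero]
      intro hall
      rw [← hl] at hq
      obtain ⟨p, hp, rfl⟩ := List.mem_map.mp hq
      exact hI (hall p hp)

/-- Left invariance of the Haar functional. -/
lemma IsHaar.sym_mul (H : D.HasRoots κ κs) {ω : D.Lattice →ₗ[ℂ] ℂ} (h : D.IsHaar ω) (s : D.Sym)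
    (A : D.Lattice) : ω (D.sym s * A) = D.symCounit s * ω A := by
  have hA : A ∈ D.normalSpan := by rw [normalSpan_eq_top]; trivial
  induction hA using Submodule.mul_induction_on' with
  | add y _ z _ hy hz => rw [mul_add, map_add, map_add, hy, hz, mul_add]
  | mem_mul_mem u hu t ht =>
    obtain ⟨f, rfl⟩ := hu
    obtain ⟨r, rfl⟩ := ht
    have hf : f ∈ listSpan D.coordMat (allLinks Γ) := listSpan_allLinks H ▸ Submodule.mem_top
    replace hf := listSpan_le _ hf
    change ω (D.sym s * (D.funEmb f * D.sym r)) = _ * ω (D.funEmb f * D.sym r)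
    induction hf using Submodule.span_induction with
    | zero => simp
    | add f g _ _ hf hg => rw [map_add, add_mul, mul_add, map_add, map_add, hf, hg, mul_add]
    | smul c f _ hf =>
      rw [map_smul, smul_mul_assoc, mul_smul_comm, map_smul, map_smul, hf, smul_eq_mul,
        smul_eq_mul, mul_left_comm]
    | mem f hf =>
      obtain ⟨l, hl, rfl⟩ := hf
      change ω (D.sym s * (D.funEmb (D.coordProd l) * D.sym r)) =
        _ * ω (D.funEmb (D.coordProd l) * D.sym r)
      have hn : (l.map fun p => p.i.edge).Nodup := by
        have := allLinks_nodup (Γ := Γ)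
        rwa [← hl, List.map_map] at this
      by_cases hI : ∀ p ∈ l, p.I = D.V.triv
      · rw [coordProd_eq_one H l hI, map_one, one_mul, ← map_mul]
        have h0 : ∀ s, ω (D.sym s) = D.symCounit s := fun s => by
          have := h [] s List.nodup_nil
          simpa using this
        rw [h0, h0, symCounit_eq, map_mul, symCounit_eq, symCounit_eq]
      · push Not at hI
        obtain ⟨p, hp, hI⟩ := hI
        have hn' : ((l.map fun p => (p.I, p.i)).map fun q => q.2.edge).Nodup := by
          rwa [List.map_map]
        have hmem : D.funEmb (D.coordProd l) * D.sym r ∈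
            D.labelSpan (l.map fun p => (p.I, p.i)) := by
          refine Submodule.mul_mem_mul ?_ (mem_symSpan r)
          rw [funEmb_coordProd, List.map_map]
          clear hI hp hn hn' hl
          induction l with
          | nil => exact Submodule.one_le.mp le_rfl
          | cons p l ih =>
            rw [List.map_cons, List.prod_cons, List.map_cons, List.prod_cons]
            exact Submodule.mul_mem_mul (mem_genSpan (U := D.latMat) _ _ _ _) ih
        rw [h.eq_zero hn' _ (List.mem_map_of_mem hp) hI hmem, mul_zero]
        exact h.eq_zero hn' _ (List.mem_map_of_mem hp) hI
          (symSpan_mul_labelSpan _ (Submodule.mul_mem_mul (mem_symSpan s) hmem))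

end LatticeSpan

/-! ### The antilinear anti-homomorphism of the lattice algebra -/

section Conj

variable [Fintype X] [DecidableEq X] {κ : Lab → ℂ} {κs : Gsˣ}

lemma gauge_comm {x z : X} (h : x ≠ z) (ξ : 𝒢 x) (η : 𝒢 z) :
    D.gauge x ξ * D.gauge z η = D.gauge z η * D.gauge x ξ := by
  exact (map_mul D.sym _ _).symm.trans ((congrArg D.sym (loc_comm h ξ η)).trans (map_mul D.sym _ _))

variable (D) in
/-- The dressing by `(τ^I_x ⊗ id)(R_x)`. -/
def gaugeDressing (x : X) : Dressing D D.Lattice x := Dressing.ofHom D (D.gauge x)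

lemma gauge_mul_latMat (I : Lab) (i : Γ.Dart) (ξ : 𝒢 i.snd) :
    sc _ _ (D.gauge i.snd ξ) * D.latMat I i =
      D.latMat I i * Phi (D.siteRho i.snd I) (D.gauge i.snd) (comulA _ ξ) := by
  ext a b
  rw [sc_mul_apply, Matrix.mul_apply]
  refine (sym_comm_U_target I i a b ξ).trans (Finset.sum_congr rfl fun c _ => ?_)
  rw [Phi_apply]
  rfl

lemma latMat_symm_mul (I : Lab) (i : Γ.Dart) : D.latMat I i.symm * D.latMat I i = 1 := by
  simpa using isConnection_latMat.inv I i.symm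

lemma Phi_mul_latMat_symm (I : Lab) (i : Γ.Dart) (ξ : 𝒢 i.snd) :
    Phi (D.siteRho i.snd I) (D.gauge i.snd) (comulA _ ξ) * D.latMat I i.symm =
      D.latMat I i.symm * sc _ _ (D.gauge i.snd ξ) := by
  have h1 := latMat_symm_mul (D := D) I i
  have h2 : D.latMat I i * D.latMat I i.symm = 1 := isConnection_latMat.inv I i
  calc _ = D.latMat I i.symm * (D.latMat I i * Phi (D.siteRho i.snd I) (D.gauge i.snd) (comulA _ ξ))
        * D.latMat I i.symm := by rw [← mul_assoc, h1, one_mul]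
    _ = _ := by rw [← gauge_mul_latMat, mul_assoc, mul_assoc, h2, mul_one]

lemma gaugeDressing_mul_latMat (I J : Lab) (i : Γ.Dart) :
    e1 _ _ _ ((D.gaugeDressing i.snd).val I) * e2 _ _ _ (D.latMat J i) =
      e2 _ _ _ (D.latMat J i) * (e1 _ _ _ ((D.gaugeDressing i.snd).val I) *
        cm _ (D.siteTens i.snd I J (Rm _))) := by
  refine (e1_Phi_mul_e2 (τ₁ := D.siteRho i.snd I) (gauge_mul_latMat J i) _).trans ?_
  rw [comulRightA_Rm, map_mul, Phi3_leg13, Phi3_leg12]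
  rfl

lemma gaugeDressing_mul_latMat_symm (I J : Lab) (i : Γ.Dart) :
    e1 _ _ _ ((D.gaugeDressing i.snd).val I) * cm _ (D.siteTens i.snd I J (Rm _)) *
      e2 _ _ _ (D.latMat J i.symm) =
      e2 _ _ _ (D.latMat J i.symm) * e1 _ _ _ ((D.gaugeDressing i.snd).val I) := by
  refine Eq.trans ?_
    (Phi3_comulRight_mul_e2 (τ₁ := D.siteRho i.snd I) (Phi_mul_latMat_symm J i) (Rm _))
  rw [comulRightA_Rm, map_mul, Phi3_leg13, Phi3_leg12]
  rfl

variable (D) in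
/-- The matrices of elements `θ(U^I_α(i))`, transposed. -/
def conjMat (I : Lab) (i : Γ.Dart) : Matrix (D.Idx I) (D.Idx I) D.Lattice :=
  (D.gaugeDressing i.snd).val I * D.latMat I i.symm * (D.gaugeDressing i.fst).inv I

lemma gaugeDressing_entriesCommute {x z : X} (h : x ≠ z) (I J : Lab) :
    EntriesCommute ((D.gaugeDressing x).val I) ((D.gaugeDressing z).val J) := fun a b c d => by
  change Phi _ _ _ a b * Phi _ _ _ c d = Phi _ _ _ c d * Phi _ _ _ a b
  rw [Phi_apply, Phi_apply, gauge_comm h]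

lemma gaugeDressing_entriesCommute_latMat {x : X} (I J : Lab) {i : Γ.Dart} (h₁ : x ≠ i.fst)
    (h₂ : x ≠ i.snd) :
    EntriesCommute ((D.gaugeDressing x).val I) (D.latMat J i) := fun a b c d => by
  change Phi _ _ _ a b * D.U _ _ _ _ = D.U _ _ _ _ * Phi _ _ _ a b
  rw [Phi_apply, sym_comm_U_other _ _ _ _ _ h₁ h₂]

lemma sw_gaugeDressing_mul_latMat (I J : Lab) (i : Γ.Dart) :
    e2 _ _ _ ((D.gaugeDressing i.snd).val J) * e1 _ _ _ (D.latMat I i) =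
      e1 _ _ _ (D.latMat I i) * (e2 _ _ _ ((D.gaugeDressing i.snd).val J) *
        cm _ (D.siteTens i.snd I J (flipA _ (Rm _)))) := by
  have := congrArg (sw _ _ _) (gaugeDressing_mul_latMat (D := D) J I i)
  rwa [map_mul, map_mul, map_mul, sw_e1, sw_e2, sw_cm, sw_tens2] at this

lemma Dressing.cg_inv {T : Type*} [Ring T] [Algebra ℂ T] {x : X} (Λ : Dressing D T x)
    (I J K : Lab) (m) : cm T (D.siteCG x I J K m) * (e2 T _ _ (Λ.inv J) * e1 T _ _ (Λ.inv I)) =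
      Λ.inv K * cm T (D.siteCG x I J K m) := by
  have h : e1 T _ (D.Idx J) (Λ.val I) * e2 T (D.Idx I) _ (Λ.val J) *
      (e2 T _ _ (Λ.inv J) * e1 T _ _ (Λ.inv I)) = 1 := by
    rw [mul_assoc, ← mul_assoc (e2 T _ _ (Λ.val J)), ← map_mul, Λ.val_mul_inv, map_one, one_mul,
      ← map_mul, Λ.val_mul_inv, map_one]
  calc _ = Λ.inv K * (Λ.val K * cm T (D.siteCG x I J K m)) *
        (e2 T _ _ (Λ.inv J) * e1 T _ _ (Λ.inv I)) := by
        rw [← Matrix.mul_assoc (Λ.inv K), Λ.inv_mul_val, Matrix.one_mul]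
    _ = _ := by rw [← Λ.cg, Matrix.mul_assoc, Matrix.mul_assoc, h, Matrix.mul_one]

lemma conjMat_ope (H : D.HasRoots κ κs) (i : Γ.Dart) (I J : Lab) :
    e2 _ _ _ (D.conjMat J i) * e1 _ _ _ (D.conjMat I i) =
      ∑ K, ∑ m, cm D.Lattice (D.siteCG i.snd I J K m)ᴴ * D.conjMat K i *
        cm D.Lattice (D.siteCG i.fst I J K m) := by
  have hne : i.snd ≠ i.fst := i.adj.ne.symm
  have hope : e1 _ _ _ (D.latMat I i.symm) * e2 _ _ _ (D.latMat J i.symm) = _ :=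
    isConnection_latMat.ope i.symm I J
  have hex := congrArg (sw _ _ _) ((isConnection_latMat.ope i.symm).exchange H J I)
  rw [map_mul, map_mul, map_mul, map_mul, sw_e1, sw_e2, sw_cm, sw_cm, sw_tens2, sw_tens2,
    flipA_flipA] at hex
  have hs := gaugeDressing_mul_latMat_symm (D := D) I J i
  have ht := sw_gaugeDressing_mul_latMat (D := D) I J i.symm
  have hc := (Dressing.entriesCommute_inv _ (gaugeDressing_entriesCommute (D := D) hne.symm J I)).symm.e1_e2
  have hR : cm D.Lattice (D.siteTens i.fst I J (flipA _ (Rm _))) *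
      cm _ (D.siteTens i.fst I J (flipA _ (RmInv _))) = 1 := by
    rw [← cm_mul, ← map_mul, ← map_mul, Rm_mul_RmInv, map_one, map_one, cm_one]
  have hz : e2 _ (D.Idx I) _ ((D.gaugeDressing i.fst).inv J) *
      e2 _ _ _ ((D.gaugeDressing i.fst).val J) = 1 := by
    rw [← map_mul, Dressing.inv_mul_val, map_one]
  have hz' : e2 _ (D.Idx I) _ ((D.gaugeDressing i.fst).val J) *
      e2 _ _ _ ((D.gaugeDressing i.fst).inv J) = 1 := by
    rw [← map_mul, Dressing.val_mul_inv, map_one]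
  have k1 := (D.gaugeDressing i.snd).cg_star I J
  have k2 := (D.gaugeDressing i.fst).cg_inv I J
  simp only [conjMat, map_mul]
  change cm _ (D.siteTens i.snd I J (Rm _)) * (e2 _ _ _ (D.latMat J i.symm) *
    e1 _ _ _ (D.latMat I i.symm)) = e1 _ _ _ (D.latMat I i.symm) * e2 _ _ _ (D.latMat J i.symm) *
    cm _ (D.siteTens i.fst I J (flipA _ (Rm _))) at hex
  change e2 _ _ _ ((D.gaugeDressing i.fst).val J) * e1 _ _ _ (D.latMat I i.symm) =
      e1 _ _ _ (D.latMat I i.symm) * (e2 _ _ _ ((D.gaugeDressing i.fst).val J) *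
        cm _ (D.siteTens i.fst I J (flipA _ (Rm _)))) at ht
  set A₁ := e1 _ _ (D.Idx J) ((D.gaugeDressing i.snd).val I)
  set A₂ := e2 _ (D.Idx I) _ ((D.gaugeDressing i.snd).val J)
  set m₁ := e1 _ _ (D.Idx J) (D.latMat I i.symm)
  set m₂ := e2 _ (D.Idx I) _ (D.latMat J i.symm)
  set z₁ := e1 _ _ (D.Idx J) ((D.gaugeDressing i.fst).inv I)
  set z₂ := e2 _ (D.Idx I) _ ((D.gaugeDressing i.fst).inv J)
  set Z₂ := e2 _ (D.Idx I) _ ((D.gaugeDressing i.fst).val J)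
  set P := cm D.Lattice (D.siteTens i.fst I J (flipA _ (Rm _)))
  set Q := cm D.Lattice (D.siteTens i.fst I J (flipA _ (RmInv _)))
  set R := cm D.Lattice (D.siteTens i.snd I J (Rm _))
  calc A₂ * m₂ * z₂ * (A₁ * m₁ * z₁) = A₂ * m₂ * (z₂ * A₁) * m₁ * z₁ := by simp only [mul_assoc]
    _ = A₂ * (m₂ * A₁) * z₂ * (m₁ * (Z₂ * (P * Q) * z₂)) * z₁ := by
      rw [← hc, hR, mul_one, hz', mul_one]; simp only [mul_assoc]
    _ = A₂ * A₁ * R * m₂ * (z₂ * (m₁ * (Z₂ * P))) * Q * z₂ * z₁ := by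
      rw [← hs]; simp only [mul_assoc]
    _ = A₂ * A₁ * (R * (m₂ * ((z₂ * Z₂) * m₁))) * Q * z₂ * z₁ := by
      rw [← ht]; simp only [mul_assoc]
    _ = A₂ * A₁ * (m₁ * m₂) * (P * Q) * z₂ * z₁ := by rw [hz, one_mul, hex]; simp only [mul_assoc]
    _ = A₂ * A₁ * (m₁ * m₂) * (z₂ * z₁) := by rw [hR, mul_one, mul_assoc _ z₂]
    _ = _ := by
      rw [hope]
      simp only [Matrix.mul_sum, Matrix.sum_mul]
      refine Finset.sum_congr rfl fun K _ => Finset.sum_congr rfl fun m _ => ?_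
      calc _ = (A₂ * A₁ * cm D.Lattice (D.siteCG i.snd I J K m)ᴴ) * D.latMat K i.symm *
            (cm D.Lattice (D.siteCG i.fst I J K m) * (z₂ * z₁)) := by
            simp only [Matrix.mul_assoc, mul_assoc]; rfl
        _ = _ := by rw [k1, k2]; simp only [Matrix.mul_assoc]

lemma conjMat_inv (I : Lab) (i : Γ.Dart) : D.conjMat I i.symm * D.conjMat I i = 1 := by
  calc _ = (D.gaugeDressing i.fst).val I * (D.latMat I i * (((D.gaugeDressing i.snd).inv I) *
        ((D.gaugeDressing i.snd).val I)) * D.latMat I i.symm) * (D.gaugeDressing i.fst).inv I := by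
        rw [conjMat, conjMat, SimpleGraph.Dart.symm_symm]; simp only [mul_assoc]; rfl
    _ = 1 := by
      rw [Dressing.inv_mul_val, mul_one, isConnection_latMat.inv, mul_one, Dressing.val_mul_inv]

lemma conjMat_braid (I J : Lab) (i j : Γ.Dart) (h : i.snd = j.snd)
    (hlt : (D.order j.snd).lt ⟨i, h⟩ ⟨j, rfl⟩) :
    e2 _ _ _ (D.conjMat J j) * e1 _ _ _ (D.conjMat I i) =
      cm _ (D.siteTens j.snd I J (flipA _ (RmInv _))) *
        (e1 _ _ _ (D.conjMat I i) * e2 _ _ _ (D.conjMat J j)) := by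
  have hij : i ≠ j := by
    rintro rfl
    let _ := D.order i.snd
    exact ne_of_lt hlt rfl
  have hf : i.fst ≠ j.fst := fun e => hij (SimpleGraph.Dart.ext _ _ (Prod.ext e h))
  have hs1 : i.fst ≠ j.snd := h ▸ i.adj.ne
  have hs2 : j.fst ≠ i.snd := h.symm ▸ j.adj.ne
  have b := isConnection_latMat.braid (D := D) I J i j h hlt
  obtain ⟨⟨s, y⟩, hi⟩ := i
  obtain ⟨⟨r, z⟩, hj⟩ := j
  obtain rfl : y = z := h
  have w1 := gaugeDressing_mul_latMat_symm (D := D) I J ⟨(r, y), hj⟩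
  have w2 := congrArg (sw _ _ _) (gaugeDressing_mul_latMat_symm (D := D) J I ⟨(s, y), hi⟩)
  rw [map_mul, map_mul, map_mul, sw_e1, sw_e2, sw_cm, sw_tens2] at w2
  have w3 := congrArg (sw _ _ _) ((D.gaugeDressing y).rtt J I)
  rw [map_mul, map_mul, map_mul, map_mul, sw_e1, sw_e2, sw_cm, sw_tens2] at w3
  have hu₁ := congrArg (e1 _ _ (D.Idx J)) (latMat_symm_mul (D := D) I ⟨(s, y), hi⟩)
  have hu₂ := congrArg (e2 _ (D.Idx I) _) (latMat_symm_mul (D := D) J ⟨(r, y), hj⟩)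
  have hv₁ := congrArg (e1 _ _ (D.Idx J)) (isConnection_latMat.inv (D := D) I ⟨(s, y), hi⟩)
  have hv₂ := congrArg (e2 _ (D.Idx I) _) (isConnection_latMat.inv (D := D) J ⟨(r, y), hj⟩)
  rw [map_mul, map_one] at hu₁ hu₂ hv₁ hv₂
  have c1 := (Dressing.entriesCommute_inv _ (gaugeDressing_entriesCommute (D := D) hs2 J I)).symm.e1_e2
  have c2 := (Dressing.entriesCommute_inv _ (gaugeDressing_entriesCommute_latMat (D := D)
    (i := (⟨(s, y), hi⟩ : Γ.Dart).symm) J I hs2 hf.symm)).symm.e1_e2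
  have c3 := (Dressing.entriesCommute_inv _ (gaugeDressing_entriesCommute (D := D) hs1 I J)).e1_e2
  have c4 := (Dressing.entriesCommute_inv _ (gaugeDressing_entriesCommute_latMat (D := D)
    (i := (⟨(r, y), hj⟩ : Γ.Dart).symm) I J hs1 hf)).e1_e2
  have c5 := (Dressing.entriesCommute_inv _ (Dressing.entriesCommute_inv _
    (gaugeDressing_entriesCommute (D := D) hf I J)).symm).symm.e1_e2
  have hR : cm D.Lattice (D.siteTens y I J (flipA _ (RmInv _))) *
      cm _ (D.siteTens y I J (flipA _ (Rm _))) = 1 := by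
    rw [← cm_mul, ← map_mul, ← map_mul, RmInv_mul_Rm, map_one, map_one, cm_one]
  simp only [conjMat, map_mul]
  dsimp only at *
  set A₁ := e1 _ _ (D.Idx J) ((D.gaugeDressing y).val I)
  set A₂ := e2 _ (D.Idx I) _ ((D.gaugeDressing y).val J)
  set m₁ := e1 _ _ (D.Idx J) (D.latMat I (SimpleGraph.Dart.symm ⟨(s, y), hi⟩))
  set m₂ := e2 _ (D.Idx I) _ (D.latMat J (SimpleGraph.Dart.symm ⟨(r, y), hj⟩))
  set u₁ := e1 _ _ (D.Idx J) (D.latMat I ⟨(s, y), hi⟩)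
  set u₂ := e2 _ (D.Idx I) _ (D.latMat J ⟨(r, y), hj⟩)
  set s₁ := e1 _ _ (D.Idx J) ((D.gaugeDressing s).inv I)
  set r₂ := e2 _ (D.Idx I) _ ((D.gaugeDressing r).inv J)
  set P := cm D.Lattice (D.siteTens y I J (flipA _ (Rm _)))
  set Q := cm D.Lattice (D.siteTens y I J (flipA _ (RmInv _)))
  set R := cm D.Lattice (D.siteTens y I J (Rm _))
  have hb : R * (m₂ * m₁) = m₁ * m₂ := by
    calc _ = m₁ * (m₂ * u₂) * u₁ * R * (m₂ * m₁) := by rw [hu₂, mul_one, hu₁, one_mul]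
      _ = m₁ * m₂ * (u₂ * u₁ * R) * (m₂ * m₁) := by simp only [mul_assoc]
      _ = m₁ * m₂ * (u₁ * (u₂ * m₂) * m₁) := by rw [← b]; simp only [mul_assoc]
      _ = _ := by rw [hv₂, mul_one, hv₁, mul_one]
  calc A₂ * m₂ * r₂ * (A₁ * m₁ * s₁) = A₂ * m₂ * (r₂ * A₁) * m₁ * s₁ := by simp only [mul_assoc]
    _ = A₂ * (m₂ * A₁) * (r₂ * m₁) * s₁ := by rw [← c1]; simp only [mul_assoc]
    _ = A₂ * A₁ * (R * (m₂ * m₁)) * r₂ * s₁ := by rw [← c2, ← w1]; simp only [mul_assoc]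
    _ = (Q * P) * A₂ * A₁ * m₁ * m₂ * (s₁ * r₂) := by
      rw [hb, hR, one_mul, c5]; simp only [mul_assoc]
    _ = Q * (P * (A₂ * A₁)) * m₁ * m₂ * s₁ * r₂ := by simp only [mul_assoc]
    _ = Q * A₁ * (A₂ * P * m₁) * (m₂ * s₁) * r₂ := by rw [w3]; simp only [mul_assoc]
    _ = Q * A₁ * m₁ * (A₂ * s₁) * m₂ * r₂ := by rw [w2, ← c4]; simp only [mul_assoc]
    _ = _ := by rw [← c3]; simp only [mul_assoc]

lemma conjMat_comm (I J : Lab) (i j : Γ.Dart) (h₁ : i.fst ≠ j.fst) (h₂ : i.fst ≠ j.snd)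
    (h₃ : i.snd ≠ j.fst) (h₄ : i.snd ≠ j.snd) :
    EntriesCommute (D.conjMat I i) (D.conjMat J j) := by
  have c : ∀ {x z : X}, x ≠ z → ∀ I J, EntriesCommute ((D.gaugeDressing x).inv I)
      ((D.gaugeDressing z).val J) := fun h I J =>
    Dressing.entriesCommute_inv _ (gaugeDressing_entriesCommute h I J)
  have c' : ∀ {x z : X}, x ≠ z → ∀ I J, EntriesCommute ((D.gaugeDressing x).inv I)
      ((D.gaugeDressing z).inv J) := fun h I J =>
    (Dressing.entriesCommute_inv _ (c h I J).symm).symm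
  have k : ∀ {x : X} {i : Γ.Dart}, x ≠ i.fst → x ≠ i.snd → ∀ I J,
      EntriesCommute ((D.gaugeDressing x).val I) (D.latMat J i.symm) := fun h h' I J =>
    gaugeDressing_entriesCommute_latMat I J h' h
  have hU : EntriesCommute (D.latMat I i.symm) (D.latMat J j.symm) := fun a b c d => by
    have := congrFun (congrFun (isConnection_latMat.comm I J i.symm j.symm h₄ h₃ h₂ h₁) (a, c)) (b, d)
    rwa [e1_mul_e2_apply, e2_mul_e1_apply] at this
  refine ((EntriesCommute.mul_left ?_ ?_).mul_left ?_)
  · exact ((gaugeDressing_entriesCommute h₄ I J).mul_right (k h₃ h₄ I J)).mul_right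
      (c h₃.symm J I).symm
  · exact ((k h₂.symm h₄.symm J I).symm.mul_right hU).mul_right
      (Dressing.entriesCommute_inv _ (k h₁.symm h₃.symm J I)).symm
  · exact ((c h₂ I J).mul_right (Dressing.entriesCommute_inv _ (k h₁ h₂ I J))).mul_right (c' h₁ I J)

lemma conjMat_mul_gauge (I : Lab) (i : Γ.Dart) (ξ : 𝒢 i.snd) :
    D.conjMat I i * sc _ _ (D.gauge i.snd ξ) =
      Phi (D.siteRho i.snd I) (D.gauge i.snd) (flipA _ (comulA _ ξ)) * D.conjMat I i := by
  have h : (D.gaugeDressing i.fst).inv I * sc _ _ (D.gauge i.snd ξ) =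
      sc _ _ (D.gauge i.snd ξ) * (D.gaugeDressing i.fst).inv I := by
    ext a b
    rw [mul_sc_apply, sc_mul_apply]
    change Phi _ _ _ a b * _ = _ * Phi _ _ _ a b
    rw [Phi_apply, gauge_comm i.adj.ne]
  have h2 : (D.gaugeDressing i.snd).val I * Phi (D.siteRho i.snd I) (D.gauge i.snd) (comulA _ ξ) =
      Phi (D.siteRho i.snd I) (D.gauge i.snd) (flipA _ (comulA _ ξ)) *
      (D.gaugeDressing i.snd).val I := by
    change Phi _ _ (Rm _) * _ = _ * Phi _ _ (Rm _)
    rw [← map_mul, Rm_comul, map_mul]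
  rw [conjMat, mul_assoc, h, ← mul_assoc, mul_assoc _ (D.latMat I i.symm), ← Phi_mul_latMat_symm,
    ← mul_assoc, h2]
  simp only [mul_assoc]

end Conj

section Theta

open ConjOp

variable [Fintype X] [DecidableEq X] {κ : Lab → ℂ} {κs : Gsˣ}

variable (D) in
/-- The images of the connection matrices under the antilinear anti-homomorphism. -/
def conjU (I : Lab) (i : Γ.Dart) : Matrix (D.Idx I) (D.Idx I) (ConjOp D.Lattice) :=
  Matrix.of fun a b => of (D.conjMat I i b a)

lemma dag_conjU (I : Lab) (i : Γ.Dart) : dag (D.conjU I i) = D.conjMat I i := rfl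

lemma isConnection_conjU (H : D.HasRoots κ κs) : D.IsConnection D.conjU where
  ope i I J := dag_injective (by
    rw [dag_mul, dag_e1, dag_e2, dag_conjU, dag_conjU, conjMat_ope H]
    simp only [map_sum]
    refine Finset.sum_congr rfl fun K _ => Finset.sum_congr rfl fun m _ => ?_
    rw [dag_mul, dag_mul, dag_cm, dag_cm, Matrix.conjTranspose_conjTranspose, dag_conjU,
      Matrix.mul_assoc])
  inv I i := dag_injective (by rw [dag_mul, dag_conjU, dag_conjU, conjMat_inv, dag_one])
  braid I J i j h hlt := dag_injective (by
    rw [dag_mul, dag_mul, dag_mul, dag_e1, dag_e2, dag_conjU, dag_conjU, dag_cm,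
      conjMat_braid I J i j h hlt, tens2_conjTranspose _ _ (D.siteRho_star _ I)
      (D.siteRho_star _ J), star_Rm])
  comm I J i j h₁ h₂ h₃ h₄ := dag_injective (by
    rw [dag_mul, dag_mul, dag_e1, dag_e2, dag_conjU, dag_conjU,
      (conjMat_comm I J i j h₁ h₂ h₃ h₄).e1_e2])

lemma gauge_mul_conjU (I : Lab) (i : Γ.Dart) (ξ : 𝒢 i.snd) :
    sc _ _ (starHom (D.gauge i.snd) ξ) * D.conjU I i =
      D.conjU I i * Phi (D.siteRho i.snd I) (starHom (D.gauge i.snd)) (comulA _ ξ) :=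
  dag_injective (by
    rw [dag_mul, dag_mul, dag_sc, dag_Phi _ (D.siteRho_star _ I), dag_conjU, out_starHom,
      conjMat_mul_gauge, star_comulA])

lemma starHom_gauge_comm (x z : X) (h : x ≠ z) (ξ : 𝒢 x) (η : 𝒢 z) :
    starHom (D.gauge x) ξ * starHom (D.gauge z) η =
      starHom (D.gauge z) η * starHom (D.gauge x) ξ :=
  (congrArg of (gauge_comm h (star ξ) (star η))).symm

/-- The relations of the lattice algebra for the images under the antilinear anti-homomorphism. -/
def conjHom (H : D.HasRoots κ κs) : LatticeHom D (ConjOp D.Lattice) where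
  U := D.conjU
  isConnection := isConnection_conjU H
  gauge := symLift (fun x => starHom (D.gauge x)) starHom_gauge_comm D
  target I i a b ξ := by
    have := congrFun (congrFun (gauge_mul_conjU I i ξ) a) b
    rw [sc_mul_apply, Matrix.mul_apply] at this
    simp only [symLift_loc]
    refine this.trans (Finset.sum_congr rfl fun c _ => ?_)
    rw [Phi_apply]
    rfl
  source I i a b ξ := by
    simp only [symLift_loc]
    refine cov_inverse (D.siteRho i.fst I) (starHom (D.gauge i.fst)) (fun ξ => ?_) ξ a b
    have h1 : D.conjU I i * D.conjU I i.symm = 1 := (isConnection_conjU H).inv I i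
    have h2 : D.conjU I i.symm * D.conjU I i = 1 := by
      simpa using (isConnection_conjU H).inv I i.symm
    have h3 := gauge_mul_conjU (D := D) I i.symm ξ
    calc _ = D.conjU I i * (D.conjU I i.symm *
          Phi (D.siteRho i.fst I) (starHom (D.gauge i.fst)) (comulA _ ξ)) * D.conjU I i := by
          rw [← mul_assoc, h1, one_mul]
      _ = D.conjU I i * (sc _ _ (starHom (D.gauge i.fst) ξ) * D.conjU I i.symm) * D.conjU I i :=
          congrArg (fun Y => D.conjU I i * Y * D.conjU I i) h3.symm
      _ = _ := by rw [mul_assoc, mul_assoc, h2, mul_one]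
  other I i a b z h₁ h₂ ξ := by
    simp only [symLift_loc]
    refine congrArg of ?_
    have h1 : ∀ {x : X} (_ : z ≠ x) (Y : 𝒢 x ⊗[ℂ] 𝒢 x), EntriesCommute
        (sc D.Lattice (Fin 1) (D.gauge z (star ξ))) (Phi (D.siteRho x I) (D.gauge x) Y) := by
      intro x hx Y a b c d
      rw [Phi_apply, sc_apply]
      split_ifs
      · exact gauge_comm hx _ _
      · rw [zero_mul, mul_zero]
    have h2 : EntriesCommute (sc D.Lattice (Fin 1) (D.gauge z (star ξ))) (D.latMat I i.symm) := by
      intro a b c d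
      rw [sc_apply]
      split_ifs
      · exact sym_comm_U_other I i.symm c d z h₂ h₁ _
      · rw [zero_mul, mul_zero]
    have := ((h1 h₂ (Rm _)).mul_right h2).mul_right (h1 h₁ (RmInv _)) 0 0 b a
    rw [sc_apply, if_pos rfl] at this
    exact this.symm

/-- The antilinear anti-homomorphism `θ`. -/
def theta (H : D.HasRoots κ κs) : D.Lattice →ₛₗ[starRingEnd ℂ] D.Lattice where
  toFun A := out ((conjHom H).lift A)
  map_add' A B := by rw [map_add, map_add]
  map_smul' c A := by rw [map_smul, out_smul]; rfl

lemma theta_U (H : D.HasRoots κ κs) (I : Lab) (i : Γ.Dart) (a d : D.Idx I) :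
    theta H (D.U I i a d) = D.conjMat I i d a := by
  change out ((conjHom H).lift _) = _
  rw [LatticeHom.lift_U]
  rfl

/-- `(τ ⊗ h)(R) M` for a matrix `M` covariant at the source. -/
lemma Phi_Rm_mul {T G n : Type*} [Ring T] [Algebra ℂ T] [Ring G] [HopfAlgebra ℂ G] [StarRing G]
    [StarModule ℂ G] [RibbonHopfStarAlgebra G] [Fintype n] [DecidableEq n]
    (τ : G →ₐ[ℂ] Matrix n n ℂ) (h : G →ₐ[ℂ] T) {M : Matrix n n T}
    (hM : ∀ ξ, Phi τ h (comulA G ξ) * M = M * sc T n (h ξ)) (d b : n) :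
    (Phi τ h (Rm G) * M) d b = ∑ c, ∑ c', τ (SA G (uElt G)) d c' •
      (M c b * h (slice (ent τ c' c ∘ₗ HopfAlgebra.antipode ℂ (A := G)) (RmInv G))) := by
  let f : G ⊗[ℂ] (G ⊗[ℂ] G) →ₗ[ℂ] G ⊗[ℂ] G :=
    TensorProduct.map (LinearMap.mul' ℂ G ∘ₗ TensorProduct.map LinearMap.id (SA G)) LinearMap.id ∘ₗ
      (TensorProduct.assoc ℂ G G G).symm.toLinearMap
  have hf : ∀ p q r : G, f (p ⊗ₜ (q ⊗ₜ r)) = (p * SA G q) ⊗ₜ r := fun _ _ _ => rfl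
  have h1 : ∀ z, (Phi τ h z * M) d b = ∑ c, M c b * h (slice (ent τ d c) (f (comulRightA G z))) := by
    intro z
    induction z using TensorProduct.induction_on with
    | zero => simp
    | add p q hp hq =>
      rw [map_add, add_mul, Matrix.add_apply, hp, hq, ← Finset.sum_add_distrib]
      simp only [map_add, mul_add]
    | tmul p q =>
      have e : ∀ (c : n) (Y : G ⊗[ℂ] G), slice (ent τ d c) (f (p ⊗ₜ Y)) =
          ∑ e, τ p d e • slice (ent τ e c ∘ₗ HopfAlgebra.antipode ℂ (A := G)) Y := fun c Y => by
        induction Y using TensorProduct.induction_on with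
        | zero => simp
        | add s t hs ht =>
          rw [TensorProduct.tmul_add, map_add, map_add, hs, ht, ← Finset.sum_add_distrib]
          simp only [map_add, smul_add]
        | tmul s t =>
          rw [hf]
          change τ (p * SA G s) d c • t = ∑ e, τ p d e • τ (SA G s) e c • t
          simp only [smul_smul]
          rw [map_mul, Matrix.mul_apply, Finset.sum_smul]
      rw [Phi_tmul, mul_assoc, cm_mul_apply, comulRightA_tmul]
      simp only [sc_mul_apply, cov_inverse τ h hM, e, map_sum, map_smul, Finset.mul_sum,
        Finset.smul_sum, mul_smul_comm]
      exact Finset.sum_comm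
  have h2 : ∀ Y Z : G ⊗[ℂ] G, f (leg13A G Y * leg12A G Z) =
      Y * ((LinearMap.mul' ℂ G (TensorProduct.map LinearMap.id (SA G) Z)) ⊗ₜ 1) := fun Y Z => by
    induction Y using TensorProduct.induction_on with
    | zero => simp
    | add p q hp hq => rw [map_add, add_mul, map_add, hp, hq, add_mul]
    | tmul p q =>
      induction Z using TensorProduct.induction_on with
      | zero => simp
      | add s t hs ht => rw [map_add, mul_add, map_add, hs, ht, map_add, map_add,
          TensorProduct.add_tmul, mul_add]
      | tmul s t =>
        rw [leg13A_tmul, leg12A_tmul, Algebra.TensorProduct.tmul_mul_tmul,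
          Algebra.TensorProduct.tmul_mul_tmul, hf]
        simp [mul_assoc]
  rw [h1, comulRightA_Rm, h2, ← antipode_uElt, Rm_mul_antipode_uElt]
  refine Finset.sum_congr rfl fun c _ => ?_
  have h3 : ∀ (p : G) (Y : G ⊗[ℂ] G), slice (ent τ d c) ((p ⊗ₜ 1) *
      TensorProduct.map (SA G) LinearMap.id Y) =
      ∑ e, τ p d e • slice (ent τ e c ∘ₗ HopfAlgebra.antipode ℂ (A := G)) Y := fun p Y => by
    induction Y using TensorProduct.induction_on with
    | zero => simp
    | add s t hs ht =>
      rw [map_add, mul_add, map_add, hs, ht, ← Finset.sum_add_distrib]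
      simp only [map_add, smul_add]
    | tmul s t =>
      rw [TensorProduct.map_tmul, Algebra.TensorProduct.tmul_mul_tmul, one_mul]
      change τ (p * SA G s) d c • t = ∑ e, τ p d e • τ (SA G s) e c • t
      simp only [smul_smul]
      rw [map_mul, Matrix.mul_apply, Finset.sum_smul]
  rw [h3, map_sum, Finset.mul_sum]
  exact Finset.sum_congr rfl fun e _ => by rw [map_smul, mul_smul_comm]

lemma isTheta (H : D.HasRoots κ κs) : D.IsTheta (theta H) where
  map_one := by
    change out ((conjHom H).lift 1) = 1
    rw [map_one, out_one]
  map_mul A B := by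
    change out ((conjHom H).lift (A * B)) = _
    rw [map_mul, out_mul]
    rfl
  map_sym x ξ := by
    change out ((conjHom H).lift _) = _
    rw [LatticeHom.lift_sym]
    change out (symLift _ _ D (D.loc x ξ)) = _
    rw [symLift_loc]
    rfl
  map_U I i a d := by
    rw [theta_U, conjMat, Matrix.mul_apply]
    refine Finset.sum_congr rfl fun b _ => ?_
    have h : (D.gaugeDressing i.fst).inv I b a =
      D.sym (D.loc i.fst (slice (D.rep i.fst I b a) (RmInv (𝒢 i.fst)))) := Phi_apply _ _ _ _ _
    rw [h]
    change (Phi (D.siteRho i.snd I) (D.gauge i.snd) (Rm _) * D.latMat I i.symm) d b * _ = _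
    rw [Phi_Rm_mul _ _ (Phi_mul_latMat_symm I i), Finset.sum_mul]
    refine Finset.sum_congr rfl fun c _ => ?_
    rw [Finset.sum_mul]
    refine Finset.sum_congr rfl fun c' _ => ?_
    rw [smul_mul_assoc, mul_assoc, mul_assoc]
    congr 2
    exact (gauge_comm i.adj.ne _ _).symm

lemma IsTheta.unique {θ θ' : D.Lattice →ₛₗ[starRingEnd ℂ] D.Lattice} (h : D.IsTheta θ)
    (h' : D.IsTheta θ') : θ = θ' := by
  refine LinearMap.ext fun A => ?_
  induction A using lattice_induction with
  | hs c => rw [Algebra.algebraMap_eq_smul_one, map_smulₛₗ, map_smulₛₗ, h.map_one, h'.map_one]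
  | hU I i a b => rw [h.map_U, h'.map_U]
  | hg x ξ => exact (h.map_sym x ξ).trans (h'.map_sym x ξ).symm
  | hm A B hA hB => rw [h.map_mul, h'.map_mul, hA, hB]
  | ha A B hA hB => rw [map_add, map_add, hA, hB]

end Theta

/-! ### The hermitian form -/

section Form

variable [Fintype X] [DecidableEq X] {κ : Lab → ℂ} {κs : Gsˣ}

variable (D κs) in
/-- The element `κ = ⨂_x κ_x` of the lattice algebra. -/
def latκ : D.Lattice :=
  D.sym (PiTensorProduct.tprod ℂ fun x => ((D.siteκ κs x : (𝒢 x)ˣ) : 𝒢 x))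

lemma latκ_comm (H : D.HasRoots κ κs) (x : X) (ξ : 𝒢 x) :
    D.latκ κs * D.gauge x ξ = D.gauge x ξ * D.latκ κs := by
  refine tprod_mem ((Submonoid.centralizer {D.gauge x ξ}).comap (D.sym : D.Sym →* D.Lattice)) _ ?_
    _ rfl |>.symm
  rintro z _ rfl
  rcases eq_or_ne z x with rfl | hz
  · change D.gauge z _ * D.gauge z _ = D.gauge z _ * D.gauge z _
    rw [← map_mul, ← map_mul, (H.site z).comm]
  · exact gauge_comm hz.symm _ _

lemma latκ_eq {x y : X} (hxy : x ≠ y) : ∃ s : D.Sym,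
    D.latκ κs = D.gauge x (D.siteκ κs x : (𝒢 x)ˣ) * D.gauge y (D.siteκ κs y : (𝒢 y)ˣ) * D.sym s ∧
    ∀ t : D.Lattice, (∀ z, z ≠ x → z ≠ y → ∀ ξ, D.gauge z ξ * t = t * D.gauge z ξ) →
      D.sym s * t = t * D.sym s := by
  let m : ∀ x, 𝒢 x := fun z => if z = x ∨ z = y then 1 else (D.siteκ κs z : (𝒢 z)ˣ)
  refine ⟨PiTensorProduct.tprod ℂ m, ?_, fun t ht => ?_⟩
  · change D.sym _ = D.sym (PiTensorProduct.tprod ℂ _) * D.sym (PiTensorProduct.tprod ℂ _) * _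
    rw [← map_mul, ← map_mul, PiTensorProduct.tprod_mul_tprod, PiTensorProduct.tprod_mul_tprod]
    congr 2
    funext z
    rcases eq_or_ne z x with rfl | hz
    · simp [m, hxy]
    · rcases eq_or_ne z y with rfl | hz'
      · simp [m, hxy.symm]
      · simp [m, hz, hz']
  · refine (tprod_mem ((Submonoid.centralizer {t}).comap (D.sym : D.Sym →* D.Lattice)) m ?_ t rfl).symm
    rintro z _ rfl
    by_cases hz : z = x ∨ z = y
    · simp [m, hz]
    · simp only [m, if_neg hz]
      rw [not_or] at hz
      exact (ht z hz.1 hz.2 _).symm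

lemma symCounit_tprod_eq_one (m : ∀ x, 𝒢 x) (h : ∀ x, Coalgebra.counit (R := ℂ) (m x) = 1) :
    D.symCounit (PiTensorProduct.tprod ℂ m) = 1 := by
  rw [symCounit_eq]
  refine tprod_mem (MonoidHom.mker (D.symCounitHom : D.Sym →* ℂ)) m fun x => ?_
  change D.symCounitHom _ = 1
  rw [← symCounit_eq, symCounit_loc, h]

lemma theta_mul (H : D.HasRoots κ κs) (A B : D.Lattice) :
    theta H (A * B) = theta H B * theta H A := (isTheta H).map_mul A B

lemma theta_gauge (H : D.HasRoots κ κs) (x : X) (ξ : 𝒢 x) :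
    theta H (D.gauge x ξ) = D.gauge x (star ξ) := (isTheta H).map_sym x ξ

lemma theta_sym (H : D.HasRoots κ κs) (s : D.Sym) :
    ∃ t, theta H (D.sym s) = D.sym t ∧ D.symCounit t = star (D.symCounit s) := by
  induction s using sym_induction with
  | hl x ξ => exact ⟨_, theta_gauge H x ξ, (symCounit_loc x (star ξ)).trans
      ((RibbonHopfStarAlgebra.counit_star ξ).trans (congrArg star (symCounit_loc x ξ).symm))⟩
  | ha s t hs ht =>
    obtain ⟨s', h1, h2⟩ := hs
    obtain ⟨t', h3, h4⟩ := ht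
    exact ⟨s' + t', by rw [map_add, map_add, h1, h3, map_add], by
      rw [map_add, map_add, h2, h4, star_add]⟩
  | hm s t hs ht =>
    obtain ⟨s', h1, h2⟩ := hs
    obtain ⟨t', h3, h4⟩ := ht
    refine ⟨t' * s', by rw [map_mul, theta_mul, h1, h3, map_mul], ?_⟩
    rw [symCounit_eq, symCounit_eq, map_mul, map_mul, ← symCounit_eq, ← symCounit_eq,
      ← symCounit_eq, ← symCounit_eq, h2, h4, star_mul]
  | h1 c =>
    refine ⟨algebraMap ℂ _ (star c), ?_, ?_⟩
    · rw [AlgHom.commutes, AlgHom.commutes, Algebra.algebraMap_eq_smul_one, map_smulₛₗ,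
        (isTheta H).map_one, Algebra.algebraMap_eq_smul_one]
      rfl
    · rw [symCounit_eq, symCounit_eq, AlgHom.commutes, AlgHom.commutes]
      rfl

variable (H : D.HasRoots κ κs)

lemma latHaar_one : latHaar H 1 = 1 := by
  rw [latHaar_apply, show D.regularHom.lift 1 = 1 from map_one D.regularHom.lift]
  exact funHaar_one H

lemma latHaar_mul (A B : D.Lattice) :
    latHaar H (A * B) = latHaar H (A * D.funEmb (D.regularHom.lift B 1)) := by
  rw [latHaar_apply, latHaar_apply, map_mul, map_mul, Module.End.mul_apply, Module.End.mul_apply,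
    isRegularRep.funEmb_apply, mul_one]

/-- The form determined by the Haar functional. -/
def stateForm : D.FunAlg →ₗ⋆[ℂ] D.FunAlg →ₗ[ℂ] ℂ :=
  LinearMap.mk₂'ₛₗ (starRingEnd ℂ) (RingHom.id ℂ)
    (fun ψ χ => latHaar H (theta H (D.funEmb ψ) * D.latκ κs * D.funEmb χ))
    (fun _ _ _ => by rw [map_add, map_add, add_mul, add_mul, map_add])
    (fun _ _ _ => by rw [map_smul, map_smulₛₗ, smul_mul_assoc, smul_mul_assoc, map_smul])
    (fun _ _ _ => by rw [map_add, mul_add, map_add])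
    (fun _ _ _ => by rw [map_smul, mul_smul_comm, map_smul]; rfl)

lemma stateForm_apply (ψ χ : D.FunAlg) :
    stateForm H ψ χ = latHaar H (theta H (D.funEmb ψ) * D.latκ κs * D.funEmb χ) := rfl

lemma isStateForm :
    D.IsStateForm κs (theta H) (latHaar H) D.regularHom.lift (fun ψ χ => stateForm H ψ χ) := by
  intro A B
  change stateForm H _ _ = _
  rw [stateForm_apply, ← latHaar_mul, adj, mul_assoc (D.sym _), mul_assoc (D.sym _),
    (isHaar_latHaar H).sym_mul H, symCounit_tprod_eq_one, one_mul, latκ]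
  swap
  · intro x
    have h := (H.site x).counit
    have := congrArg (Coalgebra.counit (R := ℂ)) (D.siteκ κs x).mul_inv
    rwa [Bialgebra.counit_mul, Bialgebra.counit_one, h, one_mul] at this
  set C := D.sym (PiTensorProduct.tprod ℂ fun x => ((D.siteκ κs x : (𝒢 x)ˣ) : 𝒢 x))
  have hA : A ∈ D.normalSpan := by rw [normalSpan_eq_top]; trivial
  induction hA using Submodule.mul_induction_on' with
  | add y _ z _ hy hz =>
    simp only [map_add, LinearMap.add_apply, add_mul] at hy hz ⊢
    rw [hy, hz]
  | mem_mul_mem u hu t ht =>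
    obtain ⟨f, rfl⟩ := hu
    obtain ⟨s, rfl⟩ := ht
    change latHaar H (theta H (D.funEmb (D.regularHom.lift (D.funEmb f * D.sym s) 1)) * C * B) =
      latHaar H (theta H (D.funEmb f * D.sym s) * C * B)
    obtain ⟨t, h1, h2⟩ := theta_sym H s
    rw [isRegularRep.normal_apply, map_smul, map_smulₛₗ, smul_mul_assoc, smul_mul_assoc, map_smul,
      theta_mul, h1, mul_assoc (D.sym t), mul_assoc (D.sym t), (isHaar_latHaar H).sym_mul H, h2]
    rfl

lemma stateForm_siteAct (x : X) (ξ : 𝒢 x) (ψ χ : D.FunAlg) :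
    stateForm H (D.siteAct x ξ ψ) χ = stateForm H ψ (D.siteAct x (star ξ) χ) := by
  have h : ∀ (ξ : 𝒢 x) (ψ : D.FunAlg),
      D.siteAct x ξ ψ = D.regularHom.lift (D.gauge x ξ * D.funEmb ψ) 1 := fun ξ ψ => by
    rw [map_mul, Module.End.mul_apply, isRegularRep.funEmb_apply, mul_one]
    change _ = D.regularHom.lift (D.sym _) ψ
    rw [LatticeHom.lift_sym]
    exact (symAct_loc x ξ ψ).symm
  have h' : ∀ ψ : D.FunAlg, D.regularHom.lift (D.funEmb ψ) 1 = ψ := fun ψ => by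
    rw [isRegularRep.funEmb_apply, mul_one]
  have h₂ : ∀ A B, stateForm H (D.regularHom.lift A 1) (D.regularHom.lift B 1) = _ := isStateForm H
  conv_lhs => rw [h, ← h' χ, h₂]
  conv_rhs => rw [h, ← h' ψ, h₂]
  rw [adj, adj, theta_mul, theta_gauge]
  change latHaar H (_ * (theta H _ * D.gauge x _) * D.latκ κs * _) =
    latHaar H (_ * theta H _ * D.latκ κs * (D.gauge x _ * _))
  congr 1
  simp only [mul_assoc]
  rw [← mul_assoc (D.latκ κs) (D.gauge x _), latκ_comm H, mul_assoc]

end Form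

/-! ### Functions and gauge transformations away from a link -/

section Far

variable [Fintype X] [DecidableEq X] {κ : Lab → ℂ} {κs : Gsˣ}

variable (D) in
/-- The functions of the connections on the other links. -/
def farAlg (e : Sym2 X) : Subalgebra ℂ D.FunAlg :=
  Algebra.adjoin ℂ {f | ∃ I i a b, i.edge ≠ e ∧ f = D.coord I i a b}

variable (D) in
/-- The subalgebra generated by the gauge transformations and the connections on the other links. -/
def farLat (e : Sym2 X) : Subalgebra ℂ D.Lattice :=
  Algebra.adjoin ℂ ({A | ∃ I i a b, i.edge ≠ e ∧ A = D.U I i a b} ∪ {A | ∃ x ξ, A = D.gauge x ξ})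

lemma U_mem_farLat {e : Sym2 X} (I : Lab) {i : Γ.Dart} (h : i.edge ≠ e) (a b : D.Idx I) :
    D.U I i a b ∈ D.farLat e := Algebra.subset_adjoin (Or.inl ⟨I, i, a, b, h, rfl⟩)

lemma gauge_mem_farLat (e : Sym2 X) (x : X) (ξ : 𝒢 x) : D.gauge x ξ ∈ D.farLat e :=
  Algebra.subset_adjoin (Or.inr ⟨x, ξ, rfl⟩)

lemma sym_mem_farLat (e : Sym2 X) (s : D.Sym) : D.sym s ∈ D.farLat e := by
  induction s using sym_induction with
  | hl x ξ => exact gauge_mem_farLat e x ξ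
  | ha s t hs ht => rw [map_add]; exact add_mem hs ht
  | hm s t hs ht => rw [map_mul]; exact mul_mem hs ht
  | h1 c => rw [AlgHom.commutes]; exact Subalgebra.algebraMap_mem _ c

lemma funEmb_mem_farLat {e : Sym2 X} {f : D.FunAlg} (hf : f ∈ D.farAlg e) :
    D.funEmb f ∈ D.farLat e := by
  have : D.farAlg e ≤ (D.farLat e).comap D.funEmb := Algebra.adjoin_le (by
    rintro _ ⟨I, i, a, b, h, rfl⟩
    change D.funEmb _ ∈ D.farLat e
    rw [funEmb_coord]
    exact U_mem_farLat I h a b)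
  exact this hf

lemma theta_mem_farLat (H : D.HasRoots κ κs) {e : Sym2 X} {A : D.Lattice} (hA : A ∈ D.farLat e) :
    theta H A ∈ D.farLat e := by
  induction hA using Algebra.adjoin_induction with
  | mem A hA =>
    rcases hA with ⟨I, i, a, b, h, rfl⟩ | ⟨x, ξ, rfl⟩
    · rw [(isTheta H).map_U]
      have h' : i.symm.edge ≠ e := by rwa [SimpleGraph.Dart.edge_symm]
      exact (D.farLat e).sum_mem fun _ _ => (D.farLat e).sum_mem fun _ _ =>
        (D.farLat e).sum_mem fun _ _ => (D.farLat e).smul_mem ((D.farLat e).mul_mem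
          ((D.farLat e).mul_mem (U_mem_farLat I h' _ _) (sym_mem_farLat e _))
            (sym_mem_farLat e _)) _
    · rw [theta_gauge]; exact gauge_mem_farLat e x _
  | algebraMap c =>
    rw [Algebra.algebraMap_eq_smul_one, map_smulₛₗ, (isTheta H).map_one]
    exact (D.farLat e).smul_mem (D.farLat e).one_mem _
  | add A B _ _ hA hB => rw [map_add]; exact add_mem hA hB
  | mul A B _ _ hA hB => rw [theta_mul]; exact mul_mem hB hA

/-- Invariance of a space of functions under gauge transformations. -/
def GaugeInvariant (P : Submodule ℂ D.FunAlg) : Prop := ∀ x ξ, ∀ f ∈ P, D.siteAct x ξ f ∈ P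

lemma siteAct_mul_mem {P Q : Submodule ℂ D.FunAlg} (x : X) {f g : D.FunAlg}
    (hf : ∀ ξ, D.siteAct x ξ f ∈ P) (hg : ∀ ξ, D.siteAct x ξ g ∈ Q) (ξ : 𝒢 x) :
    D.siteAct x ξ (f * g) ∈ P * Q := by
  have := siteAct_mul' x ξ (f ⊗ₜ g)
  rw [LinearMap.mul'_apply] at this
  rw [this]
  generalize comulA _ ξ = z
  induction z using TensorProduct.induction_on with
  | zero => simp
  | add s t hs ht => rw [map_add, LinearMap.add_apply, map_add]; exact add_mem hs ht
  | tmul s t => rw [siteAct₂_tmul, LinearMap.mul'_apply]; exact Submodule.mul_mem_mul (hf s) (hg t)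

lemma GaugeInvariant.mul {P Q : Submodule ℂ D.FunAlg} (hP : GaugeInvariant P)
    (hQ : GaugeInvariant Q) : GaugeInvariant (P * Q) := fun x ξ f hf => by
  induction hf using Submodule.mul_induction_on' with
  | add y _ z _ hy hz => rw [map_add]; exact add_mem hy hz
  | mem_mul_mem f hf g hg => exact siteAct_mul_mem x (fun ξ => hP x ξ f hf) (fun ξ => hQ x ξ g hg) ξ

lemma siteAct_coord_mem {P : Submodule ℂ D.FunAlg} (x : X) (ξ : 𝒢 x) (I : Lab) (i : Γ.Dart)
    (h : ∀ a b, D.coord I i a b ∈ P) (a b : D.Idx I) : D.siteAct x ξ (D.coord I i a b) ∈ P := by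
  rw [siteAct_apply]
  by_cases h1 : i.snd = x
  · rw [coact_coord_target x I i h1]
    exact sum_mem fun _ _ => P.smul_mem _ (h _ _)
  by_cases h2 : i.fst = x
  · rw [coact_coord_source x I i h2]
    exact sum_mem fun _ _ => P.smul_mem _ (h _ _)
  · rw [coact_coord_other x I i (Ne.symm h2) (Ne.symm h1)]
    exact P.smul_mem _ (h _ _)

lemma gaugeInvariant_span {P : Submodule ℂ D.FunAlg} {S : Set D.FunAlg} (hP : P = Submodule.span ℂ S)
    (h : ∀ x ξ, ∀ f ∈ S, D.siteAct x ξ f ∈ P) : GaugeInvariant P := fun x ξ f hf => by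
  subst hP
  induction hf using Submodule.span_induction with
  | zero => rw [map_zero]; exact zero_mem _
  | add f g _ _ hf hg => rw [map_add]; exact add_mem hf hg
  | smul c f _ hf => rw [map_smul]; exact Submodule.smul_mem _ _ hf
  | mem f hf => exact h x ξ f hf

lemma gaugeInvariant_genSpan (I : Lab) (i : Γ.Dart) : GaugeInvariant (genSpan D.coordMat I i) :=
  gaugeInvariant_span rfl (by
    rintro x ξ _ ⟨p, rfl⟩
    exact siteAct_coord_mem x ξ I i (fun a b => mem_genSpan (U := D.coordMat) I i a b) p.1 p.2)

lemma gaugeInvariant_listSpan (L : List Γ.Dart) : GaugeInvariant (listSpan D.coordMat L) := by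
  induction L with
  | nil =>
    refine gaugeInvariant_span (S := {1}) Submodule.one_eq_span ?_
    rintro x ξ _ rfl
    rw [siteAct_one_right]
    exact Submodule.smul_mem _ _ (Submodule.one_le.mp le_rfl)
  | cons i L ih =>
    rw [listSpan_cons]
    refine GaugeInvariant.mul (gaugeInvariant_span rfl ?_) ih
    rintro x ξ _ ⟨p, rfl⟩
    exact siteAct_coord_mem (P := linkSpan D.coordMat i) x ξ p.1 i (fun a b => mem_linkSpan (U := D.coordMat) p.1 i a b) _ _

lemma gaugeInvariant_farAlg (e : Sym2 X) :
    GaugeInvariant (Subalgebra.toSubmodule (D.farAlg e)) := fun x ξ f hf => by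
  rw [Subalgebra.mem_toSubmodule] at hf
  induction hf using Algebra.adjoin_induction generalizing ξ with
  | mem f hf =>
    obtain ⟨I, i, a, b, h, rfl⟩ := hf
    exact siteAct_coord_mem x ξ I i (fun a b => (Algebra.subset_adjoin ⟨I, i, a, b, h, rfl⟩ : _ ∈ D.farAlg e)) a b
  | algebraMap c => rw [siteAct_algebraMap]; exact Submodule.smul_mem _ _ (Subalgebra.algebraMap_mem _ c)
  | add f g _ _ hf hg => rw [map_add]; exact add_mem (hf ξ) (hg ξ)
  | mul f g _ _ hf hg =>
    have := siteAct_mul_mem x hf hg ξ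
    rwa [(Subalgebra.isIdempotentElem_toSubmodule (D.farAlg e)).eq] at this

lemma listSpan_le_farAlg {e : Sym2 X} {L : List Γ.Dart} (h : ∀ i ∈ L, i.edge ≠ e) :
    listSpan D.coordMat L ≤ Subalgebra.toSubmodule (D.farAlg e) := by
  induction L with
  | nil => exact Submodule.one_le.mpr (one_mem (D.farAlg e))
  | cons i L ih =>
    rw [listSpan_cons, ← (Subalgebra.isIdempotentElem_toSubmodule (D.farAlg e)).eq]
    refine mul_le_mul' (linkSpan_le fun I a b => ?_) (ih fun j hj => h j (List.mem_cons_of_mem _ hj))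
    exact Algebra.subset_adjoin ⟨I, i, a, b, h i List.mem_cons_self, rfl⟩

variable (H : D.HasRoots κ κs)

/-- Functions containing one nontrivial matrix element of a link. -/
lemma funHaar_far {I : Lab} (hI : I ≠ D.V.triv) (i : Γ.Dart) {f : D.FunAlg}
    (hf : f ∈ Subalgebra.toSubmodule (D.farAlg i.edge) * genSpan D.coordMat I i *
      Subalgebra.toSubmodule (D.farAlg i.edge)) : funHaar H f = 0 := by
  have hS : ∀ S : Subalgebra ℂ (Module.End ℂ (SlotSpace X Gs)),
      (∀ (j : Γ.Dart) ξ, (bareModel H).σ j ξ ∈ S) →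
      (∀ f t, f ≠ i.edge → slot f t ∈ S) → D.farAlg i.edge ≤ S.comap (slotRep H) :=
    fun S h1 h2 => Algebra.adjoin_le (by
      rintro _ ⟨J, j, a, b, h, rfl⟩
      change slotRep H _ ∈ S
      rw [slotRep_coord]
      refine dressed_mem H S h1 J j (fun a b => ?_) a b
      obtain ⟨t, ht⟩ := U_mem_range_slot H J j a b
      rw [ht]
      exact h2 _ _ h)
  have hc := hS (stab (constIn X Gs i.edge)) (σ_mem_stab_constIn H _)
    fun f t h => slot_mem_stab_constIn h t
  have hv := hS (stab (D.vanishIn i.edge)) (σ_mem_stab_vanishIn H _)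
    fun f t h => slot_mem_stab_vanishIn h t
  have key : slotRep H f (slotVac X Gs) ∈ D.vanishIn i.edge := by
    rw [mul_assoc] at hf
    induction hf using Submodule.mul_induction_on' with
    | add y _ z _ hy hz => rw [map_add, LinearMap.add_apply]; exact add_mem hy hz
    | mem_mul_mem f hf g hg =>
      rw [map_mul]
      refine hv hf _ ?_
      induction hg using Submodule.mul_induction_on' with
      | add y _ z _ hy hz => rw [map_add, LinearMap.add_apply]; exact add_mem hy hz
      | mem_mul_mem u hu g hg =>
        have hg := hc hg _ (slotVac_mem i.edge)
        rw [map_mul, Module.End.mul_apply]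
        induction hu using Submodule.span_induction with
        | zero => rw [map_zero]; exact zero_mem _
        | add f g _ _ hf hg => rw [map_add, LinearMap.add_apply]; exact add_mem hf hg
        | smul c f _ hf => rw [map_smul]; exact Submodule.smul_mem _ _ hf
        | mem u hu =>
          obtain ⟨p, rfl⟩ := hu
          change slotRep H (D.coord I i p.1 p.2) _ ∈ _
          rw [slotRep_coord]
          exact dressed_constIn_vanishIn H hI i _ _ hg
  have := mem_vanishIn.mp key fun _ => D.V.haar
  rwa [Function.update_eq_self] at this

lemma latHaar_far {i : Γ.Dart} {A B Z : D.Lattice} (hA : A ∈ D.farLat i.edge)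
    (hB : B ∈ D.farLat i.edge) (hZ : Z ∈ linkSpan D.latMat i) :
    latHaar H (A * Z * B) = latHaar H Z * latHaar H (A * B) := by
  set P := Subalgebra.toSubmodule (D.farAlg i.edge)
  have hP : P * P = P := (Subalgebra.isIdempotentElem_toSubmodule (D.farAlg i.edge)).eq
  have hst : ∀ Q : Submodule ℂ D.FunAlg, GaugeInvariant Q → P * Q ≤ Q →
      D.farLat i.edge ≤ (stab Q).comap (D.regularHom.lift) := fun Q hg hQ => Algebra.adjoin_le (by
    rintro _ (⟨J, j, a, b, h, rfl⟩ | ⟨x, ξ, rfl⟩)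
    · intro f hf
      change D.regularHom.lift (D.U J j a b) f ∈ Q
      rw [isRegularRep.map_U]
      exact hQ (Submodule.mul_mem_mul (Algebra.subset_adjoin ⟨J, j, a, b, h, rfl⟩) hf)
    · intro f hf
      change D.regularHom.lift (D.sym _) f ∈ Q
      rw [LatticeHom.lift_sym]
      change D.symAct (D.loc x ξ) f ∈ Q
      rw [symAct_loc]
      exact hg x ξ f hf)
  have hzero : ∀ (I : Lab) (a b : D.Idx I), I ≠ D.V.triv → ∀ A ∈ D.farLat i.edge,
      ∀ B ∈ D.farLat i.edge, latHaar H (A * D.U I i a b * B) = 0 := fun I a b hI A hA B hB => by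
    rw [latHaar_apply, map_mul, map_mul, Module.End.mul_apply, Module.End.mul_apply,
      isRegularRep.map_U]
    have hi := (gaugeInvariant_farAlg (D := D) i.edge)
    refine funHaar_far H hI i (hst _ ((hi.mul (gaugeInvariant_genSpan I i)).mul hi) ?_ hA _ ?_)
    · rw [← mul_assoc, ← mul_assoc, hP]
    · rw [mul_assoc]
      have h1 : (1 : D.FunAlg) ∈ P := one_mem (D.farAlg i.edge)
      have := Submodule.mul_mem_mul h1 (Submodule.mul_mem_mul
        (mem_genSpan (U := D.coordMat) I i a b) (hst P hi hP.le hB 1 h1))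
      rwa [one_mul] at this
  have h1 := latHaar_one H
  induction hZ using Submodule.span_induction with
  | zero => simp
  | add y z _ _ hy hz => rw [mul_add, add_mul, map_add, map_add, hy, hz, add_mul]
  | smul c z _ hz =>
    rw [mul_smul_comm, smul_mul_assoc, map_smul, map_smul, hz, smul_eq_mul, smul_eq_mul, mul_assoc]
  | mem z hz =>
    obtain ⟨⟨I, a, b⟩, rfl⟩ := hz
    by_cases hI : I = D.V.triv
    · subst hI
      have := congrFun (congrFun ((isConnection_latMat (D := D)).triv_eq_one H i) a) b
      rw [idx_triv_eq a b, Matrix.one_apply_eq] at this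
      dsimp only
      rw [idx_triv_eq a b, this, mul_one, h1, one_mul]
    · change latHaar H (A * D.U I i a b * B) = latHaar H (D.U I i a b) * _
      have := hzero I a b hI 1 (one_mem _) 1 (one_mem _)
      rw [one_mul, mul_one] at this
      rw [this, zero_mul, hzero I a b hI A hA B hB]

end Far

/-! ### The pairing of opposite links -/

section Pairing

variable [Fintype X] [DecidableEq X] {κ : Lab → ℂ} {κs : Gsˣ}

lemma siteRho_siteκ (H : D.HasRoots κ κs) (x : X) (I : Lab) :
    D.siteRho x I (D.siteκ κs x : (𝒢 x)ˣ) = κ I • 1 := by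
  rw [siteRho_apply, iso_siteκ]
  exact H.rep I

variable (H : D.HasRoots κ κs)

lemma latHaar_mul_gauge (A : D.Lattice) (x : X) (ξ : 𝒢 x) :
    latHaar H (A * D.gauge x ξ) = Coalgebra.counit (R := ℂ) ξ * latHaar H A := by
  rw [latHaar_apply, map_mul, Module.End.mul_apply]
  change funHaar H (D.regularHom.lift A (D.regularHom.lift (D.sym (D.loc x ξ)) 1)) = _
  rw [isRegularRep.sym_one, map_smul, map_smul, symCounit_loc, smul_eq_mul]
  rfl

lemma latHaar_gauge_mul (A : D.Lattice) (x : X) (ξ : 𝒢 x) :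
    latHaar H (D.gauge x ξ * A) = Coalgebra.counit (R := ℂ) ξ * latHaar H A := by
  have := (isHaar_latHaar H).sym_mul H (D.loc x ξ) A
  rwa [symCounit_loc] at this

/-- The Haar functional on products of matrix elements of a link and its reversal. -/
def linkPair (i : Γ.Dart) {I J : Lab} (a : D.Idx I) (c : D.Idx J) :
    Matrix (D.Idx I) (D.Idx J) ℂ :=
  Matrix.of fun b d => latHaar H (D.U I i.symm b a * D.U J i c d)

lemma linkPair_target (i : Γ.Dart) {I J : Lab} (a : D.Idx I) (c : D.Idx J) (η : 𝒢 i.snd) :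
    D.siteRho i.snd I η * linkPair H i a c = linkPair H i a c * D.siteRho i.snd J η := by
  ext b d
  have h1 := congrFun (congrFun (Phi_mul_latMat_symm (D := D) I i η) b) a
  rw [Matrix.mul_apply, mul_sc_apply] at h1
  simp only [Phi_apply] at h1
  rw [Matrix.mul_apply, Matrix.mul_apply]
  calc ∑ e, D.siteRho i.snd I η b e * linkPair H i a c e d
      = latHaar H ((∑ e, D.gauge i.snd (slice (ent (D.siteRho i.snd I) b e) (comulA _ η)) *
          D.latMat I i.symm e a) * D.U J i c d) := by
        rw [Finset.sum_mul, map_sum]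
        refine Finset.sum_congr rfl fun e _ => ?_
        rw [mul_assoc, latHaar_gauge_mul, counit_slice_comul]
        rfl
    _ = _ := by
        rw [h1, mul_assoc, sym_comm_U_target, Finset.mul_sum, map_sum]
        refine Finset.sum_congr rfl fun e _ => ?_
        rw [← mul_assoc, latHaar_mul_gauge, counit_slice_comul, mul_comm]
        rfl

lemma linkPair_source (i : Γ.Dart) {I : Lab} (b d : D.Idx I) (ξ : 𝒢 i.fst) :
    (Matrix.of fun c a => linkPair H i a c b d) * D.siteRho i.fst I ξ =
      D.siteRho i.fst I (SA _ (SA _ ξ)) * Matrix.of fun c a => linkPair H i a c b d := by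
  set N : Matrix (D.Idx I) (D.Idx I) ℂ := Matrix.of fun c a => linkPair H i a c b d with hN
  set ρ := D.siteRho i.fst I
  let F : 𝒢 i.fst ⊗[ℂ] 𝒢 i.fst →ₗ[ℂ] Matrix (D.Idx I) (D.Idx I) ℂ := LinearMap.mul' ℂ _ ∘ₗ
    TensorProduct.map (LinearMap.mulRight ℂ N ∘ₗ ρ.toLinearMap ∘ₗ SA _) ρ.toLinearMap ∘ₗ flip _
  refine mul_eq_antipode_sq_mul ρ N F (fun _ _ => rfl) (fun ζ => ?_) ξ
  have hF : ∀ Z : 𝒢 i.fst ⊗[ℂ] 𝒢 i.fst, ∀ c a, F Z c a =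
      ∑ a', ∑ c', ρ (SA _ (slice (ent ρ a' a) Z)) c c' * N c' a' := fun Z c a => by
    induction Z using TensorProduct.induction_on with
    | zero => simp
    | add x y hx hy =>
      simp only [map_add, Matrix.add_apply, hx, hy, add_mul, Finset.sum_add_distrib]
    | tmul p q =>
      change (ρ (SA _ q) * N * ρ p) c a = _
      rw [Matrix.mul_apply]
      refine Finset.sum_congr rfl fun a' _ => ?_
      rw [Matrix.mul_apply, Finset.sum_mul]
      refine Finset.sum_congr rfl fun c' _ => ?_
      rw [slice_tmul, map_smul, map_smul, Matrix.smul_apply, smul_eq_mul, ent_apply]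
      ring
  ext c a
  rw [hF, Matrix.smul_apply, smul_eq_mul]
  change _ = _ * latHaar H (D.U I i.symm b a * D.U I i c d)
  rw [← latHaar_gauge_mul H _ i.fst ζ, ← mul_assoc]
  have h1 : D.gauge i.fst ζ * D.U I i.symm b a = _ := sym_comm_U_target I i.symm b a ζ
  rw [h1, Finset.sum_mul, map_sum]
  refine Finset.sum_congr rfl fun a' _ => ?_
  have h2 := sym_comm_U_source (D := D) I i c d (slice (ent ρ a' a) (comulA _ ζ))
  refine Eq.trans ?_ (congrArg (latHaar H) ((congrArg (D.U I i.symm b a' * ·) h2.symm).trans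
    (mul_assoc _ _ _).symm))
  rw [Finset.mul_sum, map_sum]
  refine Finset.sum_congr rfl fun c' _ => ?_
  rw [← mul_assoc, latHaar_mul_gauge, counit_slice_comul]
  rfl

variable (D) in
/-- The trace of `τ^I_x(u v⁻¹)` at the source of a link. -/
def sourceDim (i : Γ.Dart) (I : Lab) : ℂ :=
  (D.siteRho i.fst I (uElt (𝒢 i.fst) * ribInv (𝒢 i.fst))).trace

include H in
lemma sourceDim_pos (i : Γ.Dart) (I : Lab) : 0 < D.sourceDim i I := by
  have : Nonempty (D.Idx I) := Fin.pos_iff_nonempty.mp (D.V.dim_pos I)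
  exact (H.site i.fst).trace_pos' (D.siteRho i.fst I) (siteRho_star D i.fst I)

lemma latHaar_symm_mul_of_ne (i : Γ.Dart) {I J : Lab} (h : I ≠ J) (b a : D.Idx I) (c d : D.Idx J) :
    latHaar H (D.U I i.symm b a * D.U J i c d) = 0 := by
  refine congrFun (congrFun (D.V.intertwiner_eq_zero h (linkPair H i a c) fun ξ => ?_) b) d
  obtain ⟨η, rfl⟩ := (D.twist i.snd).iso.surjective ξ
  exact linkPair_target H i a c η

lemma latHaar_symm_mul (i : Γ.Dart) {I : Lab} (b a c d : D.Idx I) :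
    latHaar H (D.U I i.symm b a * D.U I i c d) = if b = d then
      (D.sourceDim i I)⁻¹ * D.siteRho i.fst I (uElt (𝒢 i.fst) * ribInv (𝒢 i.fst)) c a else 0 := by
  set ρ := D.siteRho i.fst I
  obtain ⟨e⟩ : Nonempty (D.Idx I) := Fin.pos_iff_nonempty.mp (D.V.dim_pos I)
  have h1 : ∀ a c, ∃ m : ℂ, linkPair H i a c = m • (1 : Matrix (D.Idx I) (D.Idx I) ℂ) :=
    fun a c => D.V.intertwiner_eq_smul _ fun ξ => by
      obtain ⟨η, rfl⟩ := (D.twist i.snd).iso.surjective ξ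
      exact linkPair_target H i a c η
  choose m hm using h1
  let N : Matrix (D.Idx I) (D.Idx I) ℂ := Matrix.of fun c a => m a c
  have hN : (Matrix.of fun c a => linkPair H i a c e e) = N := by
    ext c a
    simp [hm, N]
  have h2 := linkPair_source H i e e
  rw [hN] at h2
  set w := SA _ (uElt (𝒢 i.fst)) * (ribInv (𝒢 i.fst) * ribInv (𝒢 i.fst))
  have hu : ρ (uElt _) * ρ w = 1 := by rw [← map_mul, uElt_mul_inv, map_one]
  clear_value w
  have hu' : ρ w * ρ (uElt _) = 1 := mul_eq_one_comm.mp hu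
  obtain ⟨n, hn⟩ : ∃ n : ℂ, ρ w * N = n • 1 := D.V.intertwiner_eq_smul _ fun ξ => by
    obtain ⟨η, rfl⟩ := (D.twist i.fst).iso.surjective ξ
    change ρ η * (ρ w * N) = ρ w * N * ρ η
    have hc : ρ η * ρ w = ρ w * ρ (SA _ (SA _ η)) := by
      calc ρ η * ρ w = ρ w * (ρ (uElt _) * ρ η) * ρ w := by
            rw [← mul_assoc, hu', one_mul]
        _ = ρ w * ρ (SA _ (SA _ η)) := by
            rw [← map_mul, ← antipode_sq_mul_uElt, map_mul, mul_assoc, mul_assoc, hu, mul_one]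
    rw [← mul_assoc, hc, mul_assoc, ← h2, mul_assoc]
  have hk := (H.site i.fst).rep_ribInv ρ (H.ne_zero I) (siteRho_siteκ H i.fst I)
  have hN' : N = (n * κ I ^ 2) • ρ (uElt (𝒢 i.fst) * ribInv (𝒢 i.fst)) := by
    calc N = ρ (uElt _) * (ρ w * N) := by rw [← mul_assoc, hu, one_mul]
      _ = _ := by
        rw [hn, map_mul, hk, mul_smul_comm, mul_smul_comm, mul_one, smul_smul, mul_assoc,
          mul_inv_cancel₀ (pow_ne_zero 2 (H.ne_zero I)), mul_one]
  have htr : N.trace = 1 := by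
    have h3 := congrFun (congrFun (latMat_symm_mul (D := D) I i) e) e
    rw [Matrix.mul_apply, Matrix.one_apply_eq] at h3
    have h4 := congrArg (latHaar H) h3
    rw [map_sum, latHaar_one] at h4
    rw [← h4]
    refine Finset.sum_congr rfl fun a _ => ?_
    have := congrFun (congrFun (hm a a) e) e
    simp only [Matrix.smul_apply, Matrix.one_apply_eq, smul_eq_mul, mul_one] at this
    exact this.symm
  have hn' : n * κ I ^ 2 = (D.sourceDim i I)⁻¹ := by
    rw [hN', Matrix.trace_smul] at htr
    exact eq_inv_of_mul_eq_one_left htr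
  have := congrFun (congrFun (hm a c) b) d
  refine this.trans ?_
  have h5 : m a c = (N : Matrix (D.Idx I) (D.Idx I) ℂ) c a := rfl
  rw [Matrix.smul_apply, h5, hN', hn', Matrix.smul_apply, Matrix.one_apply]
  split_ifs <;> simp

end Pairing

/-! ### The form on functions of a single link -/

section LinkForm

variable [Fintype X] [DecidableEq X] {κ : Lab → ℂ} {κs : Gsˣ}

lemma gauge_gauge_mul_U (J : Lab) (i : Γ.Dart) (p : 𝒢 i.fst) (q : 𝒢 i.snd) (c d : D.Idx J) :
    D.gauge i.fst p * (D.gauge i.snd q * D.U J i c d) = ∑ d', ∑ c', D.U J i c' d' *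
      (D.gauge i.fst (slice (D.repBar i.fst J c' c) (comulA _ p)) *
        D.gauge i.snd (slice (D.rep i.snd J d' d) (comulA _ q))) := by
  rw [sym_comm_U_target, Finset.mul_sum]
  refine Finset.sum_congr rfl fun d' _ => ?_
  rw [← mul_assoc, sym_comm_U_source, Finset.sum_mul]
  exact Finset.sum_congr rfl fun c' _ => mul_assoc _ _ _

variable (H : D.HasRoots κ κs)

lemma symm_mul_mem_linkSpan (H : D.HasRoots κ κs) (i : Γ.Dart) {I J : Lab} (b a : D.Idx I)
    (c d : D.Idx J) : D.U I i.symm b a * D.U J i c d ∈ linkSpan D.latMat i := by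
  refine isConnection_latMat.linkSpan_mul_self i (Submodule.mul_mem_mul ?_
    (mem_linkSpan (U := D.latMat) J i c d))
  rw [← isConnection_latMat.linkSpan_symm H]
  exact mem_linkSpan (U := D.latMat) I i.symm b a

lemma latHaar_conjMat_mul {i : Γ.Dart} {A B : D.Lattice} (hA : A ∈ D.farLat i.edge)
    (hB : B ∈ D.farLat i.edge) {s : D.Sym} (hκ : D.latκ κs =
      D.gauge i.fst (D.siteκ κs i.fst : (𝒢 i.fst)ˣ) *
        D.gauge i.snd (D.siteκ κs i.snd : (𝒢 i.snd)ˣ) * D.sym s)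
    (hs : ∀ t : D.Lattice, (∀ z, z ≠ i.fst → z ≠ i.snd → ∀ ξ, D.gauge z ξ * t = t * D.gauge z ξ) →
      D.sym s * t = t * D.sym s) {I J : Lab} (b a : D.Idx I) (c d : D.Idx J) :
    latHaar H (A * D.conjMat I i b a * D.latκ κs * D.U J i c d * B) =
      ∑ a', ∑ b', ∑ d', ∑ c', latHaar H (D.U I i.symm b' a' * D.U J i c' d') *
        latHaar H (A * (D.gauge i.snd (slice (ent (D.siteRho i.snd I) b b') (Rm _)) *
          (D.gauge i.fst (slice (D.repBar i.fst J c' c) (comulA _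
            (slice (ent (D.siteRho i.fst I) a' a) (RmInv _) * (D.siteκ κs i.fst : (𝒢 i.fst)ˣ)))) *
          D.gauge i.snd (slice (D.rep i.snd J d' d)
            (comulA _ ((D.siteκ κs i.snd : (𝒢 i.snd)ˣ) : 𝒢 i.snd))))) * (D.sym s * B)) := by
  have hsU : D.sym s * D.U J i c d = D.U J i c d * D.sym s :=
    hs _ fun z h1 h2 ξ => sym_comm_U_other J i c d z h1 h2 ξ
  have hc : D.conjMat I i b a = ∑ a', ∑ b',
      D.gauge i.snd (slice (ent (D.siteRho i.snd I) b b') (Rm _)) * D.U I i.symm b' a' *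
        D.gauge i.fst (slice (ent (D.siteRho i.fst I) a' a) (RmInv _)) := by
    rw [conjMat, Matrix.mul_apply]
    refine Finset.sum_congr rfl fun a' _ => ?_
    rw [Matrix.mul_apply, Finset.sum_mul]
    refine Finset.sum_congr rfl fun b' _ => ?_
    change Phi _ _ _ b b' * _ * Phi _ _ _ a' a = _
    rw [Phi_apply, Phi_apply]
    rfl
  rw [hc, Finset.mul_sum, Finset.sum_mul, Finset.sum_mul, Finset.sum_mul, map_sum]
  refine Finset.sum_congr rfl fun a' _ => ?_
  rw [Finset.mul_sum, Finset.sum_mul, Finset.sum_mul, Finset.sum_mul, map_sum]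
  refine Finset.sum_congr rfl fun b' _ => ?_
  set g₁ := D.gauge i.snd (slice (ent (D.siteRho i.snd I) b b') (Rm _))
  set r := slice (ent (D.siteRho i.fst I) a' a) (RmInv (𝒢 i.fst))
  have h1 : A * (g₁ * D.U I i.symm b' a' * D.gauge i.fst r) * D.latκ κs * D.U J i c d * B =
      A * g₁ * D.U I i.symm b' a' * (D.gauge i.fst (r * (D.siteκ κs i.fst : (𝒢 i.fst)ˣ)) *
        (D.gauge i.snd (D.siteκ κs i.snd : (𝒢 i.snd)ˣ) * D.U J i c d)) * (D.sym s * B) := by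
    rw [hκ, map_mul]
    simp only [mul_assoc]
    rw [← mul_assoc (D.sym s), hsU]
    simp only [mul_assoc]
  rw [h1, gauge_gauge_mul_U, Finset.mul_sum, Finset.sum_mul, map_sum]
  refine Finset.sum_congr rfl fun d' _ => ?_
  rw [Finset.mul_sum, Finset.sum_mul, map_sum]
  refine Finset.sum_congr rfl fun c' _ => ?_
  have h2 := latHaar_far H (mul_mem hA (gauge_mem_farLat i.edge i.snd
      (slice (ent (D.siteRho i.snd I) b b') (Rm _))))
    (mul_mem (mul_mem (gauge_mem_farLat i.edge i.fst (slice (D.repBar i.fst J c' c)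
        (comulA _ (r * (D.siteκ κs i.fst : (𝒢 i.fst)ˣ)))))
      (gauge_mem_farLat i.edge i.snd (slice (D.rep i.snd J d' d)
        (comulA _ ((D.siteκ κs i.snd : (𝒢 i.snd)ˣ) : 𝒢 i.snd)))))
      (mul_mem (sym_mem_farLat i.edge s) hB)) (symm_mul_mem_linkSpan H i b' a' c' d')
  refine Eq.trans ?_ (h2.trans ?_)
  · simp only [mul_assoc, g₁]
  · simp only [mul_assoc, g₁]

lemma latHaar_conjMat_mul_of_ne {i : Γ.Dart} {A B : D.Lattice} (hA : A ∈ D.farLat i.edge)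
    (hB : B ∈ D.farLat i.edge) {I J : Lab} (hIJ : I ≠ J) (b a : D.Idx I) (c d : D.Idx J) :
    latHaar H (A * D.conjMat I i b a * D.latκ κs * D.U J i c d * B) = 0 := by
  obtain ⟨s, hκ, hs⟩ := latκ_eq (D := D) (κs := κs) i.adj.ne
  rw [latHaar_conjMat_mul H hA hB hκ hs]
  simp only [latHaar_symm_mul_of_ne H i hIJ, zero_mul, Finset.sum_const_zero]

omit [Fintype X] [DecidableEq X] in
lemma sum_ite_mul_eq {T n : Type*} [Ring T] [Algebra ℂ T] [Fintype n] [DecidableEq n]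
    (ω : T →ₗ[ℂ] ℂ) (A C : T) (y h : n → T) (x : n → n → T) (r : ℂ) (M : Matrix n n ℂ) :
    ∑ a, ∑ b, ∑ d, ∑ c, (if b = d then r * M c a else 0) * ω (A * (y b * (h d * x c a)) * C) =
      r * ω (A * ((∑ e, y e * h e) * ∑ e, ∑ f, M e f • x e f) * C) := by
  have h1 : ∀ a b, ∑ d, ∑ c, (if b = d then r * M c a else 0) *
      ω (A * (y b * (h d * x c a)) * C) = ∑ c, r * M c a * ω (A * (y b * (h b * x c a)) * C) :=
    fun a b => by
      rw [Finset.sum_eq_single b]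
      · simp only [if_true]
      · intro d _ hd
        simp only [if_neg hd.symm, zero_mul, Finset.sum_const_zero]
      · exact fun h => absurd (Finset.mem_univ b) h
  simp only [h1, Finset.sum_mul, Finset.mul_sum, map_sum]
  refine (Finset.sum_congr rfl fun a _ => Finset.sum_comm).trans (Finset.sum_comm.trans ?_)
  refine Finset.sum_congr rfl fun c _ => Finset.sum_congr rfl fun a _ =>
    Finset.sum_congr rfl fun b _ => ?_
  rw [mul_smul_comm, mul_smul_comm, smul_mul_assoc, map_smul, smul_eq_mul, mul_assoc,
    mul_assoc (y b)]

/-- The unitarized `R`-matrix at `x` is `Z`. -/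
def IsUnitarized (D : GaugeData Γ Gs 𝒢 Lab) (κs : Gsˣ) (x : X) (Z : 𝒢 x ⊗[ℂ] 𝒢 x) : Prop :=
  Rm _ * comulA _ (D.siteκ κs x : 𝒢 x) = ((D.siteκ κs x : 𝒢 x) ⊗ₜ[ℂ] (D.siteκ κs x : 𝒢 x)) * Z

/-- Orthogonality relations for a single link. -/
lemma latHaar_conjMat_mul_self {i : Γ.Dart} {A B : D.Lattice} (hA : A ∈ D.farLat i.edge)
    (hB : B ∈ D.farLat i.edge) {Zx : 𝒢 i.fst ⊗[ℂ] 𝒢 i.fst} {Zy : 𝒢 i.snd ⊗[ℂ] 𝒢 i.snd}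
    (hx : D.IsUnitarized κs i.fst Zx) (hy : D.IsUnitarized κs i.snd Zy)
    {I : Lab} (b a c d : D.Idx I) :
    latHaar H (A * D.conjMat I i b a * D.latκ κs * D.U I i c d * B) =
      (D.sourceDim i I)⁻¹ * latHaar H (A * (D.latκ κs *
        (D.gauge i.fst (slice (ent (contra (D.siteRho i.fst I)) a c) Zx) *
          D.gauge i.snd (slice (ent (D.siteRho i.snd I) b d) Zy))) * B) := by
  obtain ⟨s, hκ, hs⟩ := latκ_eq (D := D) (κs := κs) i.adj.ne
  set ρ := D.siteRho i.fst I
  set σ := D.siteRho i.snd I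
  set k := D.siteκ κs i.fst
  set l := D.siteκ κs i.snd
  set C := D.sym s * B with hC
  have h0 := H.ne_zero I
  have h1 : D.gauge i.fst (k * slice (ent (contra ρ) a c) Zx) = κ I • ∑ e, ∑ f,
      ρ (uElt (𝒢 i.fst) * ribInv (𝒢 i.fst)) e f • D.gauge i.fst
        (slice (ent (contra ρ) e c) (comulA _ (slice (ent ρ f a) (RmInv _) * k))) := by
    have := (H.site i.fst).sum_slice_RmInv ρ h0 (siteRho_siteκ H i.fst I) hx a c
    rw [eq_inv_smul_iff₀ h0] at this
    rw [← this]
    simp only [map_sum, map_smul]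
    rfl
  have h2 : D.gauge i.snd (l * slice (ent σ b d) Zy) = (κ I)⁻¹ • ∑ e,
      D.gauge i.snd (slice (ent σ b e) (Rm _)) *
        D.gauge i.snd (slice (ent σ e d) (comulA _ (l : 𝒢 i.snd))) := by
    have := slice_ent_tmul_mul σ (siteRho_siteκ H i.snd I) (l := (l : 𝒢 i.snd)) Zy b d
    rw [← (hy : _ = _), slice_ent_mul] at this
    rw [eq_inv_smul_iff₀ h0, ← map_smul, ← this]
    simp only [map_sum, map_mul]
    rfl
  have h3 : A * (D.latκ κs * (D.gauge i.fst (slice (ent (contra ρ) a c) Zx) *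
      D.gauge i.snd (slice (ent σ b d) Zy))) * B = A * (D.gauge i.snd (l * slice (ent σ b d) Zy) *
        D.gauge i.fst (k * slice (ent (contra ρ) a c) Zx)) * C := by
    have hsg : ∀ p q, D.sym s * (D.gauge i.fst p * D.gauge i.snd q) =
        D.gauge i.fst p * D.gauge i.snd q * D.sym s := fun p q => hs _ fun z h1 h2 ξ => by
      rw [← mul_assoc, gauge_comm h1, mul_assoc, gauge_comm h2, mul_assoc]
    rw [hκ, mul_assoc _ (D.sym s), hsg, ← gauge_comm i.adj.ne, map_mul, map_mul, hC]
    have hg := gauge_comm (D := D) i.adj.ne (slice (ent (contra ρ) a c) Zx) (l : 𝒢 i.snd)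
    simp only [mul_assoc]
    rw [← mul_assoc (D.gauge i.snd _) (D.gauge i.fst _), ← hg]
    simp only [mul_assoc]
  rw [h3, h1, h2, latHaar_conjMat_mul H hA hB hκ hs]
  have h4 : ∀ c' a' d', D.gauge i.fst (slice (D.repBar i.fst I c' c) (comulA _
      (slice (ent (D.siteRho i.fst I) a' a) (RmInv _) * k))) *
        D.gauge i.snd (slice (D.rep i.snd I d' d) (comulA _ (l : 𝒢 i.snd))) =
      D.gauge i.snd (slice (ent σ d' d) (comulA _ (l : 𝒢 i.snd))) *
        D.gauge i.fst (slice (ent (contra ρ) c' c) (comulA _ (slice (ent ρ a' a) (RmInv _) * k))) :=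
    fun c' a' d' => gauge_comm i.adj.ne _ _
  simp only [latHaar_symm_mul]
  rw [smul_mul_smul_comm, inv_mul_cancel₀ h0, one_smul]
  rw [← hC]
  refine Eq.trans ?_ (sum_ite_mul_eq (latHaar H) A C
    (fun e => D.gauge i.snd (slice (ent σ b e) (Rm _)))
    (fun e => D.gauge i.snd (slice (ent σ e d) (comulA _ (l : 𝒢 i.snd))))
    (fun e f => D.gauge i.fst (slice (ent (contra ρ) e c)
      (comulA _ (slice (ent ρ f a) (RmInv _) * k))))
    (D.sourceDim i I)⁻¹ (ρ (uElt (𝒢 i.fst) * ribInv (𝒢 i.fst))))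
  refine Finset.sum_congr rfl fun a _ => Finset.sum_congr rfl fun b _ =>
    Finset.sum_congr rfl fun d _ => Finset.sum_congr rfl fun c _ => ?_
  exact congrArg (fun t => _ * latHaar H (A * (_ * t) * C)) (h4 c a d)

end LinkForm

/-! ### Positivity of the form -/

section Positivity

variable [Fintype X] [DecidableEq X] {κ : Lab → ℂ} {κs : Gsˣ}

/-- The operators by which the form on functions of a link is diagonalized. -/
def linkOp (i : Γ.Dart) (I : Lab) (Xx : 𝒢 i.fst ⊗[ℂ] 𝒢 i.fst) (Xy : 𝒢 i.snd ⊗[ℂ] 𝒢 i.snd)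
    (p q : D.Idx I × D.Idx I) : D.FunAlg →ₗ[ℂ] D.FunAlg :=
  D.siteAct i.fst (slice (ent (contra (D.siteRho i.fst I)) p.1 q.1) Xx) ∘ₗ
    D.siteAct i.snd (slice (ent (D.siteRho i.snd I) p.2 q.2) Xy)

lemma GaugeInvariant.linkOp_mem {P : Submodule ℂ D.FunAlg} (hP : GaugeInvariant P) (i : Γ.Dart)
    (I : Lab) (Xx Xy) (p q) {f : D.FunAlg} (hf : f ∈ P) : linkOp i I Xx Xy p q f ∈ P :=
  hP _ _ _ (hP _ _ _ hf)

lemma sum_linkOp_linkOp (i : Γ.Dart) (I : Lab) (Xx Yx Xy Yy) (p q : D.Idx I × D.Idx I)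
    (f : D.FunAlg) : ∑ r, linkOp i I Xx Xy p r (linkOp i I Yx Yy r q f) =
      linkOp i I (Xx * Yx) (Xy * Yy) p q f := by
  simp only [linkOp, LinearMap.comp_apply, slice_ent_mul, map_sum, LinearMap.sum_apply,
    Fintype.sum_prod_type, siteAct_mul_apply]
  exact Finset.sum_comm.trans (Finset.sum_congr rfl fun h _ => Finset.sum_congr rfl fun g _ =>
    congrArg _ (siteAct_comm i.adj.ne.symm _ _ _))

lemma linkOp_one (i : Γ.Dart) (I : Lab) (p q : D.Idx I × D.Idx I) (f : D.FunAlg) :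
    linkOp i I 1 1 p q f = if p = q then f else 0 := by
  rw [linkOp, LinearMap.comp_apply, slice_ent_one, slice_ent_one]
  by_cases h1 : p.1 = q.1 <;> by_cases h2 : p.2 = q.2 <;>
    simp [Prod.ext_iff, h1, h2, siteAct_one]

variable (H : D.HasRoots κ κs)

lemma stateForm_linkOp (i : Γ.Dart) (I : Lab) (Xx Xy) (p q : D.Idx I × D.Idx I) (φ χ : D.FunAlg) :
    ∑ r, stateForm H (linkOp i I Xx Xy r p φ) (linkOp i I Xx Xy r q χ) =
      stateForm H φ (linkOp i I (star Xx * Xx) (star Xy * Xy) p q χ) := by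
  rw [← sum_linkOp_linkOp, map_sum]
  refine Finset.sum_congr rfl fun r _ => ?_
  have h1 := slice_ent_star (contra (D.siteRho i.fst I))
    (contra_star _ (siteRho_star D i.fst I)) Xx r.1 p.1
  have h2 := slice_ent_star (D.siteRho i.snd I) (siteRho_star D i.snd I) Xy r.2 p.2
  rw [linkOp, LinearMap.comp_apply, stateForm_siteAct, stateForm_siteAct, h1, h2,
    ← siteAct_comm i.adj.ne]
  rfl

lemma stateForm_coord_mul_of_ne {i : Γ.Dart} {φ χ : D.FunAlg} (hφ : φ ∈ D.farAlg i.edge)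
    (hχ : χ ∈ D.farAlg i.edge) {I J : Lab} (hIJ : I ≠ J) (p : D.Idx I × D.Idx I)
    (q : D.Idx J × D.Idx J) :
    stateForm H (D.coord I i p.1 p.2 * φ) (D.coord J i q.1 q.2 * χ) = 0 := by
  have := latHaar_conjMat_mul_of_ne H (theta_mem_farLat H (funEmb_mem_farLat hφ))
    (funEmb_mem_farLat hχ) hIJ p.2 p.1 q.1 q.2
  rw [stateForm_apply, map_mul D.funEmb, map_mul D.funEmb, funEmb_coord, funEmb_coord, theta_mul, theta_U,
    ← mul_assoc]
  exact this

lemma stateForm_coord_mul {i : Γ.Dart} {φ χ : D.FunAlg} (hφ : φ ∈ D.farAlg i.edge)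
    (hχ : χ ∈ D.farAlg i.edge) {Xx : 𝒢 i.fst ⊗[ℂ] 𝒢 i.fst} {Xy : 𝒢 i.snd ⊗[ℂ] 𝒢 i.snd}
    (hx : D.IsUnitarized κs i.fst (star Xx * Xx))
    (hy : D.IsUnitarized κs i.snd (star Xy * Xy))
    {I : Lab} (p q : D.Idx I × D.Idx I) :
    stateForm H (D.coord I i p.1 p.2 * φ) (D.coord I i q.1 q.2 * χ) = (D.sourceDim i I)⁻¹ *
      ∑ r, stateForm H (linkOp i I Xx Xy r p φ) (linkOp i I Xx Xy r q χ) := by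
  have := latHaar_conjMat_mul_self H (theta_mem_farLat H (funEmb_mem_farLat hφ))
    (funEmb_mem_farLat hχ) hx hy p.2 p.1 q.1 q.2
  rw [stateForm_linkOp, stateForm_apply, stateForm_apply, map_mul D.funEmb, map_mul D.funEmb, funEmb_coord,
    funEmb_coord, theta_mul, theta_U, ← mul_assoc]
  refine this.trans (congrArg _ ?_)
  rw [← mul_assoc (theta H _), mul_assoc, latHaar_mul]
  refine congrArg (fun t => latHaar H (_ * D.funEmb t)) ?_
  rw [map_mul, map_mul, Module.End.mul_apply, Module.End.mul_apply, isRegularRep.funEmb_apply,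
    mul_one]
  have hg : ∀ x ξ f, D.regularHom.lift (D.gauge x ξ) f = D.siteAct x ξ f := fun x ξ f => by
    change D.regularHom.lift (D.sym _) f = _
    rw [LatticeHom.lift_sym]
    exact symAct_loc x ξ f
  rw [hg, hg]
  rfl

lemma exists_sum_coord_mul {i : Γ.Dart} {P : Submodule ℂ D.FunAlg} {ψ : D.FunAlg}
    (hψ : ψ ∈ linkSpan D.coordMat i * P) : ∃ f : ∀ I, D.Idx I × D.Idx I → D.FunAlg,
      (∀ I p, f I p ∈ P) ∧ ψ = ∑ I, ∑ p, D.coord I i p.1 p.2 * f I p := by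
  induction hψ using Submodule.mul_induction_on' with
  | add y _ z _ hy hz =>
    obtain ⟨f, hf, rfl⟩ := hy
    obtain ⟨g, hg, rfl⟩ := hz
    refine ⟨fun I p => f I p + g I p, fun I p => add_mem (hf I p) (hg I p), ?_⟩
    simp only [mul_add, Finset.sum_add_distrib]
  | mem_mul_mem m hm n hn =>
    obtain ⟨c, rfl⟩ := (Submodule.mem_span_range_iff_exists_fun ℂ).mp hm
    refine ⟨fun I p => c ⟨I, p⟩ • n, fun I p => Submodule.smul_mem _ _ hn, ?_⟩
    rw [Fintype.sum_sigma, Finset.sum_mul]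
    refine Finset.sum_congr rfl fun I _ => ?_
    rw [Finset.sum_mul]
    exact Finset.sum_congr rfl fun p _ => by rw [mul_smul_comm, smul_mul_assoc]; rfl

lemma stateForm_sum_coord_mul {i : Γ.Dart} {f : ∀ I, D.Idx I × D.Idx I → D.FunAlg}
    (hf : ∀ I p, f I p ∈ D.farAlg i.edge)
    {Xx : 𝒢 i.fst ⊗[ℂ] 𝒢 i.fst} {Xy : 𝒢 i.snd ⊗[ℂ] 𝒢 i.snd}
    (hx : D.IsUnitarized κs i.fst (star Xx * Xx))
    (hy : D.IsUnitarized κs i.snd (star Xy * Xy)) :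
    stateForm H (∑ I, ∑ p, D.coord I i p.1 p.2 * f I p) (∑ I, ∑ p, D.coord I i p.1 p.2 * f I p) =
      ∑ I, (D.sourceDim i I)⁻¹ * ∑ r, stateForm H (∑ p, linkOp i I Xx Xy r p (f I p))
        (∑ p, linkOp i I Xx Xy r p (f I p)) := by
  rw [LinearMap.map_sum₂]
  refine Finset.sum_congr rfl fun I _ => ?_
  rw [map_sum, Finset.sum_eq_single I]
  · simp only [map_sum, LinearMap.sum_apply, stateForm_coord_mul H (hf _ _) (hf _ _) hx hy,
      Finset.mul_sum]
    exact (Finset.sum_congr rfl fun a _ => Finset.sum_comm).trans Finset.sum_comm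
  · intro J _ hJ
    simp only [map_sum, LinearMap.sum_apply]
    exact Finset.sum_eq_zero fun p _ => Finset.sum_eq_zero fun q _ =>
      stateForm_coord_mul_of_ne H (hf _ _) (hf _ _) hJ.symm _ _
  · exact fun h => absurd (Finset.mem_univ I) h

lemma stateForm_one_one : stateForm H 1 1 = 1 := by
  rw [stateForm_apply, map_one, (isTheta H).map_one, one_mul, latκ, (isHaar_latHaar H).sym_mul H,
    symCounit_tprod_eq_one _ fun x => (H.site x).counit, one_mul, latHaar_one]

lemma stateForm_pos_of_mem_listSpan (L : List Γ.Dart) (hL : (L.map fun i => i.edge).Nodup)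
    {ψ : D.FunAlg} (hψ : ψ ∈ listSpan D.coordMat L) :
    0 ≤ stateForm H ψ ψ ∧ (stateForm H ψ ψ = 0 → ψ = 0) := by
  induction L generalizing ψ with
  | nil =>
    obtain ⟨c, rfl⟩ := Submodule.mem_one.mp hψ
    rw [Algebra.algebraMap_eq_smul_one, map_smulₛₗ (stateForm H), LinearMap.smul_apply, map_smul,
      stateForm_one_one, smul_eq_mul, smul_eq_mul, mul_one]
    refine ⟨star_mul_self_nonneg c, fun h => ?_⟩
    rw [show c = 0 by simpa using h, zero_smul]
  | cons i L ih =>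
    rw [List.map_cons, List.nodup_cons] at hL
    rw [listSpan_cons] at hψ
    have hP := gaugeInvariant_listSpan (D := D) L
    have hfar := listSpan_le_farAlg (D := D) (e := i.edge) (L := L) fun j hj hij =>
      hL.1 (List.mem_map.mpr ⟨j, hj, hij⟩)
    obtain ⟨f, hf, rfl⟩ := exists_sum_coord_mul hψ
    obtain ⟨Xx, hx⟩ := (H.site i.fst).factor
    obtain ⟨Xy, hy⟩ := (H.site i.snd).factor
    rw [stateForm_sum_coord_mul H (fun I p => hfar (hf I p)) hx hy]
    have hz : ∀ I r, ∑ p, linkOp i I Xx Xy r p (f I p) ∈ listSpan D.coordMat L := fun I r =>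
      Submodule.sum_mem _ fun p _ => hP.linkOp_mem _ _ _ _ _ _ (hf I p)
    have h1 : ∀ I r, 0 ≤ stateForm H (∑ p, linkOp i I Xx Xy r p (f I p))
        (∑ p, linkOp i I Xx Xy r p (f I p)) := fun I r => (ih hL.2 (hz I r)).1
    have h2 : ∀ I, 0 < (D.sourceDim i I)⁻¹ := fun I => inv_pos.mpr (sourceDim_pos H i I)
    have h3 : ∀ I, 0 ≤ (D.sourceDim i I)⁻¹ * ∑ r, stateForm H
        (∑ p, linkOp i I Xx Xy r p (f I p)) (∑ p, linkOp i I Xx Xy r p (f I p)) := fun I =>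
      mul_nonneg (h2 I).le (Finset.sum_nonneg fun r _ => h1 I r)
    refine ⟨Finset.sum_nonneg fun I _ => h3 I, fun h => ?_⟩
    refine Finset.sum_eq_zero fun I _ => ?_
    have h4 := (Finset.sum_eq_zero_iff_of_nonneg fun I _ => h3 I).mp h I (Finset.mem_univ I)
    have h5 := (Finset.sum_eq_zero_iff_of_nonneg fun r _ => h1 I r).mp
      ((mul_eq_zero.mp h4).resolve_left (h2 I).ne')
    have h6 : ∀ r, ∑ p, linkOp i I Xx Xy r p (f I p) = 0 := fun r =>
      (ih hL.2 (hz I r)).2 (h5 r (Finset.mem_univ r))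
    have h7 : ∀ p, f I p = 0 := fun p => by
      have h8 : ∑ r, linkOp i I ((Xx⁻¹ : (𝒢 i.fst ⊗[ℂ] 𝒢 i.fst)ˣ) : 𝒢 i.fst ⊗[ℂ] 𝒢 i.fst)
          ((Xy⁻¹ : (𝒢 i.snd ⊗[ℂ] 𝒢 i.snd)ˣ) : 𝒢 i.snd ⊗[ℂ] 𝒢 i.snd) p r
          (∑ q, linkOp i I Xx Xy r q (f I q)) = f I p := by
        simp only [map_sum]
        rw [Finset.sum_comm]
        simp only [sum_linkOp_linkOp, Units.inv_mul, linkOp_one]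
        rw [Finset.sum_ite_eq]
        simp
      rw [← h8]
      simp only [h6, map_zero, Finset.sum_const_zero]
    simp only [h7, mul_zero, Finset.sum_const_zero]

lemma stateForm_nonneg (ψ : D.FunAlg) : 0 ≤ stateForm H ψ ψ :=
  (stateForm_pos_of_mem_listSpan H (allLinks Γ) allLinks_nodup
    (by rw [listSpan_allLinks H]; trivial)).1

lemma isScalarProduct_stateForm : IsScalarProduct fun ψ χ => stateForm H ψ χ where
  add_right ψ φ χ := map_add _ _ _
  smul_right c ψ φ := map_smul _ _ _
  conj_symm ψ φ := by
    have hr : ∀ χ, (stateForm H χ χ).im = 0 := fun χ =>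
      ((Complex.nonneg_iff.mp (stateForm_nonneg H χ)).2).symm
    have h1 := hr (ψ + φ)
    have h2 := hr (ψ + Complex.I • φ)
    have h3 : stateForm H (ψ + Complex.I • φ) (ψ + Complex.I • φ) = stateForm H ψ ψ +
        stateForm H φ φ + Complex.I * (stateForm H ψ φ - stateForm H φ ψ) := by
      rw [map_add (stateForm H), LinearMap.add_apply, map_add, map_add, map_smulₛₗ (stateForm H),
        LinearMap.smul_apply, LinearMap.smul_apply, map_smul, map_smul]
      simp only [smul_eq_mul, Complex.conj_I]
      linear_combination -(stateForm H φ φ) * Complex.I_mul_I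
    rw [h3] at h2
    simp only [map_add, LinearMap.add_apply, Complex.add_im, hr, Complex.mul_im, Complex.sub_im,
      Complex.sub_re, Complex.I_re, Complex.I_im] at h1 h2
    apply Complex.ext
    · change (stateForm H ψ φ).re = _
      linarith
    · change -(stateForm H ψ φ).im = _
      linarith
  pos ψ hψ := lt_of_le_of_ne (stateForm_nonneg H ψ) fun h => hψ
    ((stateForm_pos_of_mem_listSpan H (allLinks Γ) allLinks_nodup
      (by rw [listSpan_allLinks H]; trivial)).2 h.symm)

include H in
lemma qdim_pos (I : Lab) : 0 < D.V.qdim I := by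
  have : Nonempty (D.Idx I) := Fin.pos_iff_nonempty.mp (D.V.dim_pos I)
  exact H.positiveRoot.trace_pos (D.V.rho I) (D.V.rho_star I)

end Positivity

end GaugeData

end LatticeGauge

end

theorem mainTheorem3
    {X : Type*} [Fintype X] [DecidableEq X] (Γ : SimpleGraph X)
    {Gs : Type u} [Ring Gs] [HopfAlgebra ℂ Gs] [StarRing Gs] [StarModule ℂ Gs]
    [RibbonHopfStarAlgebra Gs] [IsSemisimpleRing Gs]
    {𝒢 : X → Type*} [∀ x, Ring (𝒢 x)] [∀ x, HopfAlgebra ℂ (𝒢 x)] [∀ x, StarRing (𝒢 x)]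
    [∀ x, StarModule ℂ (𝒢 x)] [∀ x, RibbonHopfStarAlgebra (𝒢 x)]
    {Lab : Type*} [Fintype Lab]
    (D : GaugeData Γ Gs 𝒢 Lab)
    -- square roots `κ_I` of `v^I`, combined into a central element `κ_*` with `S(κ_*) = κ_*`
    (κ : Lab → ℂ) (κs : Gsˣ)
    (hκ_sq : ∀ I, D.V.τ I (rib Gs) = (κ I ^ 2) • (1 : Matrix _ _ ℂ))
    (hκs : ∀ I, D.V.τ I (κs : Gs) = κ I • (1 : Matrix _ _ ℂ))
    (hκ_conj : HopfAlgebra.antipode ℂ (κs : Gs) = κs)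
    (hpos : D.cg.IsNormalized κ) :
    (∃! θ, D.IsTheta θ) ∧ (∃! ω, D.IsHaar ω) ∧ (∃! π, D.IsRegularRep π) ∧
    ∀ θ ω π, D.IsTheta θ → D.IsHaar ω → D.IsRegularRep π →
      (∃! form, D.IsStateForm κs θ ω π form) ∧
      (∀ form, D.IsStateForm κs θ ω π form →
        (IsScalarProduct form ↔ ∀ I, 0 < D.V.qdim I)) ∧
      ((∀ I, 0 < D.V.qdim I) →
        ∀ A ∈ D.observables, 0 ≤ ω (D.adj κs θ A * A)) := by
  classical
  have H : D.HasRoots κ κs := ⟨hκ_sq, hκs, hκ_conj, hpos⟩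
  have hq := GaugeData.qdim_pos H
  refine ⟨⟨_, GaugeData.isTheta H, fun θ h => h.unique (GaugeData.isTheta H)⟩,
    ⟨_, GaugeData.isHaar_latHaar H, fun ω h => h.unique H (GaugeData.isHaar_latHaar H)⟩,
    ⟨_, GaugeData.isRegularRep, fun π h => h.unique GaugeData.isRegularRep⟩,
    fun θ ω π hθ hω hπ => ?_⟩
  obtain rfl := hθ.unique (GaugeData.isTheta H)
  obtain rfl := hω.unique H (GaugeData.isHaar_latHaar H)
  obtain rfl := hπ.unique GaugeData.isRegularRep
  have hform := GaugeData.isStateForm H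
  have huniq : ∀ form, D.IsStateForm κs (GaugeData.theta H) (GaugeData.latHaar H)
      D.regularHom.lift form → form = fun ψ χ => GaugeData.stateForm H ψ χ := fun form h => by
    funext ψ χ
    have h1 : ∀ f, D.regularHom.lift (D.funEmb f) 1 = f := fun f => by
      rw [GaugeData.isRegularRep.funEmb_apply, mul_one]
    have h2 := (h (D.funEmb ψ) (D.funEmb χ)).trans (hform (D.funEmb ψ) (D.funEmb χ)).symm
    rwa [h1, h1] at h2
  refine ⟨⟨_, hform, huniq⟩, fun form h => ⟨fun _ => hq, fun _ => ?_⟩, fun _ A _ => ?_⟩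
  · rw [huniq form h]
    exact GaugeData.isScalarProduct_stateForm H
  · rw [← hform A A]
    exact GaugeData.stateForm_nonneg H _
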